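/- **Setting.** Let $(M,J,\omega)$ be a compact Hermitian manifold of complex dimension $n\ge 2$ with boundary $\partial M$ of class $C^4$, $\bar M=M\cup\partial M$, $\omega=\sqrt{-1}g_{i\bar j}dz_i\wedge d\bar z_j$, and let $\chi$ be a smooth real $(1,1)$-form on $\bar M$. For a function $v$ put $\mathfrak g[v]=\chi+\sqrt{-1}\partial\bar\partial v$, and let $\lambda(\mathfrak g[v])$ be its eigenvalues with respect to $\omega$. Let $\Gamma\subset\mathbb R^n$ be an open symmetric convex cone with vertex at the origin, containing the positive cone $\Gamma_n$, with $\partial\Gamma\neq\emptyset$, and of type 1 (every positive coordinate axis lies in $\partial\Gamma$); let $\Gamma_\infty=\{(\lambda_1,\dots,\lambda_{n-1}):(\lambda_1,\dots,\lambda_n)\in\Gamma \text{ for some }\lambda_n\}$. Let $f$ be a smooth symmetric function on $\Gamma$ such that 1. $f_i=\partial f/\partial\lambda_i>0$ in $\Gamma$ for all $i$, and $f$ is concave in $\Gamma$; 2. $\lim_{t\to+\infty}f(t\lambda)>s$ for all $\lambda\in\Gamma$ and all $s<\sup_\Gamma f$; 3. $\lim_{t\to+\infty}f(\lambda_1,\dots,\lambda_{n-1},\lambda_n+t)=\sup_\Gamma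 f$ for all $\lambda\in\Gamma$. Let $\varphi\in C^4(\bar M)$ and $\psi\in C^0(\bar M)$ satisfy $$\delta_{\psi,f}:=\inf_M\psi-\sup_{\partial\Gamma}f>0,\qquad \sup_{\partial\Gamma}f=\sup_{\lambda_0\in\partial\Gamma}\limsup_{\lambda\to\lambda_0}f(\lambda)$$ (if $\sup_{\partial\Gamma}f=-\infty$, then $\delta_{\psi,f}=+\infty$ and $(\delta_{\psi,f})^{-1}=0$). Let $u\in C^2(\bar M)$ satisfy $\lambda(\mathfrak g[u])\in\Gamma$ and $f(\lambda(\mathfrak g[u]))=\psi$ in $M$, $u=\varphi$ on $\partial M$, and let $\underline u\in C^2(\bar M)$ satisfy $\lambda(\mathfrak g[\underline u])\in\Gamma$ and $f(\lambda(\mathfrak g[\underline u]))\ge\psi$ in $\bar M$, $\underline u=\varphi$ on $\partial M$. Let $p_0\in\partial M$, let $\nu$ be the unit inner normal vector of $\partial M$ at $p_0$, let $\eta=\nu(u-\underline u)(p_0)$, let $\sigma$ be the distance to $\partial M$ with respect to $\omega$, let $\omega'$ be the restriction of $\omega$ to $T^{1,0}_{\partial M}$ at $p_0$, and for $t\in\mathbb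 R$ let $A_t$ be the Hermitian form $$(A_t)_{\alpha\bar\beta}=t\,(\underline u_{\alpha\bar\beta}+\chi_{\alpha\bar\beta})+\eta\,\sigma_{\alpha\bar\beta}\qquad (1\le\alpha,\beta\le n-1)$$ on $T^{1,0}_{\partial M,p_0}$, in holomorphic coordinates centered at $p_0$ in which this space is spanned by $\partial/\partial z_1,\dots,\partial/\partial z_{n-1}$. (Distances and unit vectors refer to the Riemannian metric $\mathrm{Re}\,(g_{i\bar j}v_i\bar w_j)$.) **Lemma 3.1.** There is a first $t$, as $t$ decreases from $1$, with $\lambda_{\omega'}(A_t)\in\partial\Gamma_\infty$. Call it $t_0$. Then $t_0<1$ and $$(1-t_0)^{-1}\le C,$$ where the constant $C>0$ depends only on $(M,J,\omega)$ (including $\partial M$), $\chi$, $\Gamma$, $f$ and on upper bounds for $|u|_{C^0(M)}$, $|\nabla u|_{C^0(\partial M)}$, $|\underline u|_{C^2(\bar M)}$, $(\delta_{\psi,f})^{-1}$, $|\psi|_{C^0(M)}$ and $|\varphi|_{C^4(\bar M)}$; in particular it does not depend on $p_0$, nor on $\sup_M|\nabla u|$. -/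

import Mathlib

open scoped ContDiff Topology
open Filter Set MeasureTheory

noncomputable section

/-! Sesquilinear algebra on `ℂⁿ` and complex Hessians. -/

/-- Complex Euclidean space `ℂⁿ`. -/
abbrev CSpace (n : ℕ) := EuclideanSpace ℂ (Fin n)

/-- `∑ Θ_{i j̄} ξ_i ζ̄_j`, the value on `(ξ, ζ̄)` of the `(1,1)`-form with coefficients `Θ_{i j̄}`. -/
def sesq {n : ℕ} (Θ : Matrix (Fin n) (Fin n) ℂ) (ξ ζ : CSpace n) : ℂ :=
  ∑ i, ∑ j, Θ i j * ξ i * (starRingEnd ℂ) (ζ j)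

/-- The second real derivative `D²v(z)(ξ, ζ)` relative to the set `V`. -/
def realHessian {n : ℕ} (v : CSpace n → ℝ) (V : Set (CSpace n)) (z ξ ζ : CSpace n) : ℝ :=
  fderivWithin ℝ (fderivWithin ℝ v V) V z ξ ζ

/-- `∂_z ∂_{z̄}`-part of a real bilinear form `B`: since `∂_{z_i} = (∂_{x_i} - √-1 ∂_{y_i})/2` and
`∂_{z̄_j} = (∂_{x_j} + √-1 ∂_{y_j})/2`, for `B = D²v` this is `∑ v_{i j̄} ξ_i ζ̄_j`. -/
def leviPart {n : ℕ} (B : CSpace n → CSpace n → ℝ) (ξ ζ : CSpace n) : ℂ :=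
  (1 / 4 : ℂ) *
    ((B ξ ζ : ℂ) + (B (Complex.I • ξ) (Complex.I • ζ) : ℂ)
      + Complex.I * ((B ξ (Complex.I • ζ) : ℂ) - (B (Complex.I • ξ) ζ : ℂ)))

/-- `lam` lists the eigenvalues of the Hermitian form `Θ` with respect to the Hermitian form `G`
on the `k`-dimensional space `S`: there is a `G`-unitary frame of `S` which diagonalizes `Θ`
with diagonal entries `lam`. Such a list is unique up to the order. -/
def IsEigenTuple {n k : ℕ} (G Θ : CSpace n → CSpace n → ℂ) (S : Set (CSpace n))
    (lam : Fin k → ℝ) : Prop :=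
  ∃ e : Fin k → CSpace n, (∀ α, e α ∈ S) ∧
    (∀ α β, G (e α) (e β) = if α = β then 1 else 0) ∧
    (∀ α β, Θ (e α) (e β) = if α = β then (lam α : ℂ) else 0)

/-- The eigenvalues of `Θ` with respect to `G` on the `k`-dimensional space `S`, in some order
(they are only used through symmetric sets and symmetric functions). -/
def eigenTuple {n : ℕ} (k : ℕ) (G Θ : CSpace n → CSpace n → ℂ) (S : Set (CSpace n)) :
    Fin k → ℝ :=
  Classical.epsilon (IsEigenTuple G Θ S)

/-! Compact complex manifolds with boundary. -/

/-- A compact complex manifold with boundary of complex dimension `n`, given by a finite atlas.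
Each chart maps an open set homeomorphically onto a relatively open piece
`{z ∈ ambient | 0 ≤ rho z}` of a closed domain in `ℂⁿ` with `C⁴` boundary (interior charts are
those for which `rho > 0`), and the transition maps are smooth up to the boundary and
holomorphic. The compact sets `core` cover the manifold; they make it compact and they are used
to measure `C^k` norms. -/
structure ComplexManifoldWithBoundary (n : ℕ) (M : Type*) [TopologicalSpace M] where
  /-- number of charts -/
  N : ℕ
  chart : Fin N → PartialEquiv M (CSpace n)
  ambient : Fin N → Set (CSpace n)
  rho : Fin N → CSpace n → ℝ
  core : Fin N → Set M
  isOpen_source : ∀ a, IsOpen (chart a).source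
  isOpen_ambient : ∀ a, IsOpen (ambient a)
  target_eq : ∀ a, (chart a).target = {z | z ∈ ambient a ∧ 0 ≤ rho a z}
  continuousOn_chart : ∀ a, ContinuousOn (chart a) (chart a).source
  continuousOn_chart_symm : ∀ a, ContinuousOn (chart a).symm (chart a).target
  rho_contDiffOn : ∀ a, ContDiffOn ℝ 4 (rho a) (ambient a)
  rho_regular : ∀ a, ∀ z ∈ ambient a, rho a z = 0 → fderiv ℝ (rho a) z ≠ 0
  isCompact_core : ∀ a, IsCompact (core a)
  core_subset : ∀ a, core a ⊆ (chart a).source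
  core_cover : ∀ p, ∃ a, p ∈ core a
  transition_contDiffOn : ∀ a b,
    ContDiffOn ℝ ∞ (fun z => chart b ((chart a).symm z))
      ((chart a).target ∩ (chart a).symm ⁻¹' (chart b).source)
  transition_holomorphic : ∀ a b,
    ∀ z ∈ (chart a).target ∩ (chart a).symm ⁻¹' (chart b).source, ∀ v : CSpace n,
      fderivWithin ℝ (fun z => chart b ((chart a).symm z))
          ((chart a).target ∩ (chart a).symm ⁻¹' (chart b).source) z (Complex.I • v)
        = Complex.I • fderivWithin ℝ (fun z => chart b ((chart a).symm z))
          ((chart a).target ∩ (chart a).symm ⁻¹' (chart b).source) z v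

namespace ComplexManifoldWithBoundary

variable {n : ℕ} {M : Type*} [TopologicalSpace M] (X : ComplexManifoldWithBoundary n M)

/-- The boundary `∂M`. -/
def boundary : Set M :=
  {p | ∃ a, p ∈ (X.chart a).source ∧ X.rho a (X.chart a p) = 0}

/-- The domain of the coordinate change from chart `a` to chart `b`. -/
def overlap (a b : Fin X.N) : Set (CSpace n) :=
  (X.chart a).target ∩ (X.chart a).symm ⁻¹' (X.chart b).source

/-- The coordinate change from chart `a` to chart `b`. -/
def transition (a b : Fin X.N) (z : CSpace n) : CSpace n :=
  X.chart b ((X.chart a).symm z)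

/-- The coordinate expression in chart `a` of a function on the manifold. -/
def coord (v : M → ℝ) (a : Fin X.N) (z : CSpace n) : ℝ :=
  v ((X.chart a).symm z)

/-- The function is of class `C^k` up to the boundary. -/
def IsCk (k : ℕ) (v : M → ℝ) : Prop :=
  ∀ a, ContDiffOn ℝ k (X.coord v a) (X.chart a).target

/-- The `C^k` norm over the whole manifold with boundary, measured with the fixed finite atlas,
is at most `K`. -/
def CkNormLE (k : ℕ) (v : M → ℝ) (K : ℝ) : Prop :=
  ∀ a, ∀ p ∈ X.core a, ∀ j ≤ k,
    ‖iteratedFDerivWithin ℝ j (X.coord v a) (X.chart a).target (X.chart a p)‖ ≤ K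

/-- An index of a chart around `p`. -/
def idx (p : M) : Fin X.N := Classical.choose (X.core_cover p)

/-- The complex Hessian: `∑ v_{i j̄} ξ_i ζ̄_j` at the point with coordinate `z` in chart `a`. -/
def complexHessian (v : M → ℝ) (a : Fin X.N) (z ξ ζ : CSpace n) : ℂ :=
  leviPart (realHessian (X.coord v a) (X.chart a).target z) ξ ζ

/-- The real tangent space of `∂M` at the boundary point with coordinate `z` in chart `a`. -/
def boundaryTangent (a : Fin X.N) (z : CSpace n) : Set (CSpace n) :=
  {v | fderiv ℝ (X.rho a) z v = 0}

/-- `T^{1,0}_{∂M}` at the boundary point with coordinate `z` in chart `a`, of complex dimension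
`n - 1`; the vector `ξ` stands for `∑ ξ_i ∂/∂z_i`. -/
def holTangent (a : Fin X.N) (z : CSpace n) : Set (CSpace n) :=
  {ξ | ξ ∈ X.boundaryTangent a z ∧ Complex.I • ξ ∈ X.boundaryTangent a z}

/-- The part of `∂M` seen in chart `a`. -/
def coordBoundary (a : Fin X.N) : Set (CSpace n) :=
  {z | z ∈ (X.chart a).target ∧ X.rho a z = 0}

/-- The second derivative `D²s(z)(v, w)` at a boundary point in a direction `v` tangent to `∂M`:
the derivative along `∂M` of the differential `ds` (which is taken within the manifold). -/
def tangentialHessian (s : M → ℝ) (a : Fin X.N) (z v w : CSpace n) : ℝ :=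
  fderivWithin ℝ (fun y => fderivWithin ℝ (X.coord s a) (X.chart a).target y w)
    (X.coordBoundary a) z v

/-- The complex Hessian `∑ s_{α β̄} ξ_α ζ̄_β` at a boundary point, for `ξ, ζ ∈ T^{1,0}_{∂M}`. -/
def tangentialComplexHessian (s : M → ℝ) (a : Fin X.N) (z ξ ζ : CSpace n) : ℂ :=
  leviPart (X.tangentialHessian s a z) ξ ζ

/-- `C¹` paths `[0,1] → M ∪ ∂M`. -/
def IsC1Path (γ : ℝ → M) : Prop :=
  ContinuousOn γ (Icc 0 1) ∧
    ∀ a, ContDiffOn ℝ 1 (fun t => X.chart a (γ t)) (Icc 0 1 ∩ γ ⁻¹' (X.chart a).source)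

end ComplexManifoldWithBoundary

/-- A smooth real `(1,1)`-form `√-1 Θ_{i j̄} dz_i ∧ dz̄_j`, smooth up to the boundary. -/
structure RealForm11 {n : ℕ} {M : Type*} [TopologicalSpace M]
    (X : ComplexManifoldWithBoundary n M) where
  comp : Fin X.N → CSpace n → Matrix (Fin n) (Fin n) ℂ
  isHermitian : ∀ a, ∀ z ∈ (X.chart a).target, (comp a z).IsHermitian
  smooth : ∀ a i j, ContDiffOn ℝ ∞ (fun z => comp a z i j) (X.chart a).target
  compat : ∀ a b, ∀ z ∈ X.overlap a b, ∀ v w : CSpace n,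
    sesq (comp a z) v w
      = sesq (comp b (X.transition a b z))
          (fderivWithin ℝ (X.transition a b) (X.overlap a b) z v)
          (fderivWithin ℝ (X.transition a b) (X.overlap a b) z w)

/-- A Hermitian metric `ω = √-1 g_{i j̄} dz_i ∧ dz̄_j`. -/
structure HermitianMetric {n : ℕ} {M : Type*} [TopologicalSpace M]
    (X : ComplexManifoldWithBoundary n M) extends RealForm11 X where
  pos : ∀ a, ∀ z ∈ (X.chart a).target, ∀ v : CSpace n, v ≠ 0 → 0 < (sesq (comp a z) v v).re

namespace HermitianMetric

variable {n : ℕ} {M : Type*} [TopologicalSpace M] {X : ComplexManifoldWithBoundary n M}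
  (g : HermitianMetric X)

/-- The Riemannian inner product `Re ∑ g_{i j̄} v_i w̄_j`, normalized to be the Euclidean one
where `g_{i j̄} = δ_{i j}`. -/
def riem (a : Fin X.N) (z v w : CSpace n) : ℝ := (sesq (g.comp a z) v w).re

/-- The speed of a path. -/
def speed (γ : ℝ → M) (t : ℝ) : ℝ :=
  Real.sqrt (g.riem (X.idx (γ t)) (X.chart (X.idx (γ t)) (γ t))
    (derivWithin (fun s => X.chart (X.idx (γ t)) (γ s)) (Icc 0 1) t)
    (derivWithin (fun s => X.chart (X.idx (γ t)) (γ s)) (Icc 0 1) t))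

/-- The distance to `∂M` with respect to `ω`: the infimum of the lengths of paths to `∂M`. -/
def boundaryDist (p : M) : ℝ :=
  (⨅ (γ : ℝ → M) (_ : X.IsC1Path γ ∧ γ 0 = p ∧ γ 1 ∈ X.boundary),
    ∫⁻ t in Icc (0 : ℝ) 1, ENNReal.ofReal (g.speed γ t)).toReal

/-- `ν` is the unit inner normal vector of `∂M` at the point with coordinate `z` in chart `a`. -/
def IsUnitInnerNormal (a : Fin X.N) (z ν : CSpace n) : Prop :=
  (∀ v ∈ X.boundaryTangent a z, g.riem a z ν v = 0) ∧ g.riem a z ν ν = 1 ∧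
    0 < fderiv ℝ (X.rho a) z ν

/-- `|∇v| ≤ K` on `∂M`. -/
def BoundaryGradLE (v : M → ℝ) (K : ℝ) : Prop :=
  ∀ a, ∀ z ∈ X.coordBoundary a, ∀ w, g.riem a z w w = 1 →
    |fderivWithin ℝ (X.coord v a) (X.chart a).target z w| ≤ K

/-- `𝔤[v] = χ + √-1 ∂∂̄ v`, as a sesquilinear form at the point with coordinate `z` in
chart `a`. -/
def gForm (χ : RealForm11 X) (v : M → ℝ) (a : Fin X.N) (z ξ ζ : CSpace n) : ℂ :=
  sesq (χ.comp a z) ξ ζ + X.complexHessian v a z ξ ζ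

/-- `λ(𝔤[v])`: the eigenvalues of `𝔤[v]` with respect to `ω`. -/
def lamG (χ : RealForm11 X) (v : M → ℝ) (a : Fin X.N) (z : CSpace n) : Fin n → ℝ :=
  eigenTuple n (sesq (g.comp a z)) (gForm χ v a z) Set.univ

/-- `A_t = t (u̲_{α β̄} + χ_{α β̄}) + η σ_{α β̄}` on `T^{1,0}_{∂M}`, where
`σ` is the distance to `∂M`. -/
def formA (χ : RealForm11 X) (usub : M → ℝ) (η t : ℝ) (a : Fin X.N) (z ξ ζ : CSpace n) : ℂ :=
  (t : ℂ) * gForm χ usub a z ξ ζ + (η : ℂ) * X.tangentialComplexHessian g.boundaryDist a z ξ ζ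

end HermitianMetric

/-- `λ_{ω'}(A_t)`: the eigenvalues of `A_t` with respect to the restriction `ω'` of `ω` to
`T^{1,0}_{∂M}`. -/
def HermitianMetric.lamA {m : ℕ} {M : Type*} [TopologicalSpace M]
    {X : ComplexManifoldWithBoundary (m + 1) M} (g : HermitianMetric X) (χ : RealForm11 X)
    (usub : M → ℝ) (η t : ℝ) (a : Fin X.N) (z : CSpace (m + 1)) : Fin m → ℝ :=
  eigenTuple m (sesq (g.comp a z)) (g.formA χ usub η t a z) (X.holTangent a z)

/-! The cone `Γ` and the function `f`. -/

/-- An open symmetric convex cone with vertex at the origin, with nonempty boundary, which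
contains the positive cone. -/
structure IsSymmetricCone {n : ℕ} (Γ : Set (Fin n → ℝ)) : Prop where
  isOpen : IsOpen Γ
  symmetric : ∀ (τ : Equiv.Perm (Fin n)), ∀ l ∈ Γ, l ∘ τ ∈ Γ
  convex : Convex ℝ Γ
  cone : ∀ c : ℝ, 0 < c → ∀ l ∈ Γ, c • l ∈ Γ
  positive_subset : {l : Fin n → ℝ | ∀ i, 0 < l i} ⊆ Γ
  boundary_nonempty : (frontier Γ).Nonempty

/-- The cone is of type 1: every positive coordinate axis lies in its boundary. -/
def IsTypeOne {n : ℕ} (Γ : Set (Fin n → ℝ)) : Prop :=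
  ∀ i, ∀ c : ℝ, 0 < c → (Pi.single i c : Fin n → ℝ) ∈ frontier Γ

/-- `Γ_∞`, the projection of `Γ` to the first coordinates. -/
def gammaInfty {m : ℕ} (Γ : Set (Fin (m + 1) → ℝ)) : Set (Fin m → ℝ) :=
  {l | ∃ s : ℝ, (Fin.snoc l s : Fin (m + 1) → ℝ) ∈ Γ}

/-- `sup_Γ f`. -/
def supCone {n : ℕ} (Γ : Set (Fin n → ℝ)) (f : (Fin n → ℝ) → ℝ) : EReal :=
  ⨆ l ∈ Γ, (f l : EReal)

/-- `sup_{∂Γ} f = sup_{λ₀ ∈ ∂Γ} limsup_{λ → λ₀} f(λ)`. -/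
def supBoundary {n : ℕ} (Γ : Set (Fin n → ℝ)) (f : (Fin n → ℝ) → ℝ) : EReal :=
  ⨆ l₀ ∈ frontier Γ, limsup (fun l => (f l : EReal)) (𝓝[Γ] l₀)

/-- `δ_{ψ,f} = inf_M ψ - sup_{∂Γ} f`, which is `⊤` if `sup_{∂Γ} f = -∞`. -/
def nondegeneracy {n : ℕ} {M : Type*} (Γ : Set (Fin n → ℝ)) (f : (Fin n → ℝ) → ℝ)
    (ψ : M → ℝ) : EReal :=
  (⨅ p, (ψ p : EReal)) - supBoundary Γ f

/-- The structural conditions on `f`: smooth, symmetric, elliptic, concave, with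
`lim_{t → ∞} f(tλ) > s` for every `s < sup_Γ f`, and with the unbounded condition. -/
structure IsStructuralFunction {m : ℕ} (Γ : Set (Fin (m + 1) → ℝ))
    (f : (Fin (m + 1) → ℝ) → ℝ) : Prop where
  smooth : ContDiffOn ℝ ∞ f Γ
  symmetric : ∀ (τ : Equiv.Perm (Fin (m + 1))), ∀ l ∈ Γ, f (l ∘ τ) = f l
  elliptic : ∀ l ∈ Γ, ∀ i, 0 < fderiv ℝ f l (Pi.single i 1)
  concave : ConcaveOn ℝ Γ f
  radial : ∀ s : ℝ, (s : EReal) < supCone Γ f → ∀ l ∈ Γ, ∃ L : EReal,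
    Tendsto (fun t : ℝ => (f (t • l) : EReal)) atTop (𝓝 L) ∧ (s : EReal) < L
  unbounded : ∀ l ∈ Γ,
    Tendsto (fun t : ℝ => (f (l + t • Pi.single (Fin.last m) 1) : EReal)) atTop
      (𝓝 (supCone Γ f))

/-! The Dirichlet problem. -/

/-- `u ∈ C²(M̄)` is an admissible solution of `f(λ(𝔤[u])) = ψ` in `M`, `u = φ` on `∂M`. -/
structure IsAdmissibleSolution {m : ℕ} {M : Type*} [TopologicalSpace M]
    {X : ComplexManifoldWithBoundary (m + 1) M} (g : HermitianMetric X) (χ : RealForm11 X)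
    (Γ : Set (Fin (m + 1) → ℝ)) (f : (Fin (m + 1) → ℝ) → ℝ) (ψ φ u : M → ℝ) : Prop where
  isC2 : X.IsCk 2 u
  equation : ∀ a, ∀ p ∈ (X.chart a).source, p ∉ X.boundary →
    g.lamG χ u a (X.chart a p) ∈ Γ ∧ f (g.lamG χ u a (X.chart a p)) = ψ p
  boundary_value : ∀ p ∈ X.boundary, u p = φ p

/-- `usub ∈ C²(M̄)` is an admissible subsolution: `f(λ(𝔤[usub])) ≥ ψ` in `M̄`,
`usub = φ` on `∂M`. -/
structure IsAdmissibleSubsolution {m : ℕ} {M : Type*} [TopologicalSpace M]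
    {X : ComplexManifoldWithBoundary (m + 1) M} (g : HermitianMetric X) (χ : RealForm11 X)
    (Γ : Set (Fin (m + 1) → ℝ)) (f : (Fin (m + 1) → ℝ) → ℝ) (ψ φ usub : M → ℝ) : Prop where
  isC2 : X.IsCk 2 usub
  inequality : ∀ a, ∀ p ∈ (X.chart a).source,
    g.lamG χ usub a (X.chart a p) ∈ Γ ∧ ψ p ≤ f (g.lamG χ usub a (X.chart a p))
  boundary_value : ∀ p ∈ X.boundary, usub p = φ p

/-- `t₀` is the first `t`, as `t` decreases from `1`, for which `λ_{ω'}(A_t) ∈ ∂Γ_∞`, at the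
boundary point with coordinate `z` in chart `a`. -/
def IsFirstHit {m : ℕ} {M : Type*} [TopologicalSpace M]
    {X : ComplexManifoldWithBoundary (m + 1) M} (g : HermitianMetric X) (χ : RealForm11 X)
    (Γ : Set (Fin (m + 1) → ℝ)) (usub : M → ℝ) (η : ℝ) (a : Fin X.N) (z : CSpace (m + 1))
    (t₀ : ℝ) : Prop :=
  IsGreatest {t : ℝ | t ≤ 1 ∧ g.lamA χ usub η t a z ∈ frontier (gammaInfty Γ)} t₀

end

/-!
# A lower bound for `1 - t₀` at boundary points

Let `h = u - u̲`, which vanishes on `∂M`. Along the boundary `dh` is a multiple of `dσ`, and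
differentiating this relation in a tangential direction shows that on `T^{1,0}_{∂M}` the form
`η √-1 ∂∂̄σ` is `√-1 ∂∂̄h`. Hence `A_t = 𝔤[u] - (1 - t) 𝔤[u̲]` there (`lamA_eq`, which rests on the
differentiability of the distance at boundary points, `hasFDerivWithinAt_boundaryDist`). At `t = 1`
the eigenvalues lie in `Γ_∞`: interior diagonal entries of `𝔤[u]` stay in a compact part of a
superlevel set of `f` above `sup_{∂Γ} f`, so their limits stay in `Γ` (`eigenTuple_solution_mem`).
Since the eigenvalues of `𝔤[u̲]` on `T^{1,0}_{∂M}` are in `Γ_∞` as well, and `0 ∉ Γ_∞`, there is a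
first exit `t₀ < 1` (`exists_first_hit`). Eigenvalues are never perturbed: they enter only through
Schur's theorem that the diagonal in a unitary frame is in the convex hull of the permutations of
the eigenvalues (`diag_mem_convexHull`).

For the bound, only `t₀ ≥ 1/2` matters. Separate `λ(A_{t₀})` from `Γ_∞` by a weight vector `μ`
(`IsMonoCone.exists_weights`) and let `tr` be the trace with weights `μ` in an eigenframe. If `ρ`
defines the boundary and `dh = β₀ dρ` at `p₀`, then `A_{t₀} = t₀ 𝔤[u̲] + β₀ √-1 ∂∂̄ρ`, and
`tr A_{t₀} ≤ 0` while `tr 𝔤[u̲]` has a positive lower bound. By the comparison principle `β₀ ≥ 0`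
(`fderivWithin_sub_nonneg`, from the strong minimum principle `eventually_eq_of_supersolution`), and
`β₀` is bounded above by the gradient bounds. Therefore `tr (√-1 ∂∂̄ρ) ≤ -c` with a uniform `c > 0`:
the boundary is strictly concave in a weighted sense. This makes
`w = φ + (β₁ - ε + l(x)) ρ + A (ρ + τ |x|²)² + ε |x|²`, where `x = z - p₀`, an upper barrier
(`exists_fderivWithin_le`). Here `β₁` is chosen so that `tr 𝔤[φ + β₁ ρ] = t₀⁻¹ tr A_{t₀} ≤ 0` at
`p₀`, the linear function `l` removes the terms of first order of the trace in a unitary frame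
extending the eigenframe, and the square with the large factor `A` absorbs the terms of second order
and dominates on the boundary of the neighbourhood. So the trace of `𝔤[w]` is `O(ε)`, which is
incompatible with `√-1 ∂∂̄w ≥ √-1 ∂∂̄u` since bounded points of `{f ≥ θ}` stay inside `Γ` by a definite
amount (`exists_sub_mem_of_le`). Comparing normal derivatives at `p₀` gives
`ε t₀ ≤ β₀ (1 - t₀)`, and `ε` depends on the stated bounds only (`exists_local_bound`). Compactness
of `∂M` makes the bound uniform in `p₀` (`exists_bound`).

The coefficients are expanded to second order up to the boundary in a domain which need not be
convex; the predicate `UniformTaylor` keeps track of the uniformity of these expansions.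
-/

noncomputable section

/-! ### Hermitian forms, unitary frames and eigenvalue tuples -/

/-- A Hermitian form on `ℂⁿ`, linear in the first and conjugate linear in the second argument. -/
structure IsHermForm {n : ℕ} (Θ : CSpace n → CSpace n → ℂ) : Prop where
  add_left : ∀ x y z, Θ (x + y) z = Θ x z + Θ y z
  smul_left : ∀ (c : ℂ) x z, Θ (c • x) z = c * Θ x z
  conj_symm : ∀ x y, (starRingEnd ℂ) (Θ x y) = Θ y x

/-- A positive definite Hermitian form. -/
structure IsPosForm {n : ℕ} (G : CSpace n → CSpace n → ℂ) : Prop extends IsHermForm G where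
  pos : ∀ x, x ≠ 0 → 0 < (G x x).re

/-- `e` is a `G`-unitary family. -/
def IsUnitaryFam {n k : ℕ} (G : CSpace n → CSpace n → ℂ) (e : Fin k → CSpace n) : Prop :=
  ∀ α β, G (e α) (e β) = if α = β then 1 else 0

namespace IsHermForm

variable {n : ℕ} {Θ Θ' : CSpace n → CSpace n → ℂ}

theorem add_right (h : IsHermForm Θ) (x y z) : Θ x (y + z) = Θ x y + Θ x z := by
  rw [← h.conj_symm, h.add_left, map_add, h.conj_symm, h.conj_symm]

theorem smul_right (h : IsHermForm Θ) (c : ℂ) (x y) :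
    Θ x (c • y) = (starRingEnd ℂ) c * Θ x y := by
  rw [← h.conj_symm, h.smul_left, map_mul, h.conj_symm]

theorem zero_left (h : IsHermForm Θ) (x) : Θ 0 x = 0 := by
  simpa using h.smul_left 0 0 x

theorem sub_left (h : IsHermForm Θ) (x y z) : Θ (x - y) z = Θ x z - Θ y z := by
  have := h.add_left (x - y) y z
  rw [sub_add_cancel] at this
  rw [this]; ring

theorem sum_left (h : IsHermForm Θ) {ι : Type*} (s : Finset ι) (v : ι → CSpace n) (x) :
    Θ (∑ i ∈ s, v i) x = ∑ i ∈ s, Θ (v i) x := by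
  classical
  induction s using Finset.induction_on with
  | empty => simp [h.zero_left]
  | insert a s ha ih => rw [Finset.sum_insert ha, Finset.sum_insert ha, h.add_left, ih]

theorem sum_right (h : IsHermForm Θ) {ι : Type*} (s : Finset ι) (v : ι → CSpace n) (x) :
    Θ x (∑ i ∈ s, v i) = ∑ i ∈ s, Θ x (v i) := by
  rw [← h.conj_symm, h.sum_left, map_sum]
  simp [h.conj_symm]

theorem self_im (h : IsHermForm Θ) (x) : (Θ x x).im = 0 := by
  have := congrArg Complex.im (h.conj_symm x x)
  simp at this
  linarith

theorem self_eq (h : IsHermForm Θ) (x) : Θ x x = ((Θ x x).re : ℂ) := by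
  apply Complex.ext <;> simp [h.self_im]

theorem add (h : IsHermForm Θ) (h' : IsHermForm Θ') :
    IsHermForm (fun x y => Θ x y + Θ' x y) where
  add_left x y z := by rw [h.add_left, h'.add_left]; ring
  smul_left c x z := by rw [h.smul_left, h'.smul_left]; ring
  conj_symm x y := by rw [map_add, h.conj_symm, h'.conj_symm]

theorem real_mul (h : IsHermForm Θ) (c : ℝ) : IsHermForm (fun x y => (c : ℂ) * Θ x y) where
  add_left x y z := by rw [h.add_left]; ring
  smul_left a x z := by rw [h.smul_left]; ring
  conj_symm x y := by rw [map_mul, h.conj_symm, Complex.conj_ofReal]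

end IsHermForm

/-- A real-bilinear symmetric form has a Hermitian Levi part. -/
theorem isHermForm_leviPart {n : ℕ} {B : CSpace n → CSpace n → ℝ}
    (hadd : ∀ x y z, B (x + y) z = B x z + B y z) (hsmul : ∀ (c : ℝ) x z, B (c • x) z = c * B x z)
    (hsymm : ∀ x y, B x y = B y x) : IsHermForm (leviPart B) := by
  have hI : ∀ x z, B (Complex.I • Complex.I • x) z = - B x z := by
    intro x z
    have : Complex.I • Complex.I • x = (-1 : ℝ) • x := by
      rw [smul_smul, Complex.I_mul_I]; simp
    rw [this, hsmul]; ring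
  have hI' : ∀ x z, B x (Complex.I • Complex.I • z) = - B x z := by
    intro x z; rw [hsymm, hI, hsymm]
  have hadd' : ∀ x y z, B x (y + z) = B x y + B x z := by
    intro x y z; rw [hsymm, hadd, hsymm y, hsymm z]
  have key : ∀ x y z, leviPart B (x + y) z = leviPart B x z + leviPart B y z := by
    intro x y z
    simp only [leviPart, smul_add, hadd]
    push_cast; ring
  have keyI : ∀ x z, leviPart B (Complex.I • x) z = Complex.I * leviPart B x z := by
    intro x z
    simp only [leviPart, hI]
    push_cast
    linear_combination
      (1 / 4 : ℂ) * ((B (Complex.I • x) z : ℂ) - B x (Complex.I • z)) * Complex.I_sq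
  have keyR : ∀ (c : ℝ) x z, leviPart B ((c : ℂ) • x) z = (c : ℂ) * leviPart B x z := by
    intro c x z
    have h1 : ((c : ℂ) • x) = c • x := by
      ext i; simp
    have h2 : Complex.I • (c • x) = c • (Complex.I • x) := by
      ext i; simp; ring
    rw [h1]
    simp only [leviPart, h2, hsmul]
    push_cast; ring
  refine ⟨key, ?_, ?_⟩
  · intro c x z
    have hc : c • x = ((c.re : ℂ) • x) + Complex.I • ((c.im : ℂ) • x) := by
      rw [smul_smul, ← add_smul]
      congr 1
      rw [mul_comm]; exact (Complex.re_add_im c).symm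
    rw [hc, key, keyR, keyI, keyR]
    conv_rhs => rw [← Complex.re_add_im c]
    ring
  · intro x y
    simp only [leviPart, map_mul, map_add, map_sub, Complex.conj_ofReal, Complex.conj_I]
    rw [hsymm y x, hsymm (Complex.I • y) (Complex.I • x), hsymm y (Complex.I • x),
      hsymm (Complex.I • y) x]
    have : (starRingEnd ℂ) (1 / 4 : ℂ) = 1 / 4 := by
      rw [map_div₀, map_one, map_ofNat]
    rw [this]; ring

theorem leviPart_self_re {n : ℕ} (B : CSpace n → CSpace n → ℝ) (x : CSpace n) :
    (leviPart B x x).re = (1 / 4) * (B x x + B (Complex.I • x) (Complex.I • x)) := by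
  simp only [leviPart]
  have : (1 / 4 : ℂ) = ((1 / 4 : ℝ) : ℂ) := by norm_num
  rw [this, Complex.re_ofReal_mul]
  simp

theorem isHermForm_sesq {n : ℕ} {Θ : Matrix (Fin n) (Fin n) ℂ} (h : Θ.IsHermitian) :
    IsHermForm (sesq Θ) where
  add_left x y z := by
    simp only [sesq, ← Finset.sum_add_distrib]
    refine Finset.sum_congr rfl fun i _ => Finset.sum_congr rfl fun j _ => ?_
    simp; ring
  smul_left c x z := by
    simp only [sesq, Finset.mul_sum]
    refine Finset.sum_congr rfl fun i _ => Finset.sum_congr rfl fun j _ => ?_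
    simp; ring
  conj_symm x y := by
    simp only [sesq, map_sum, map_mul, Complex.conj_conj]
    rw [Finset.sum_comm]
    refine Finset.sum_congr rfl fun i _ => Finset.sum_congr rfl fun j _ => ?_
    have := h.apply i j
    rw [← this]
    simp; ring

section frames

variable {n k : ℕ} {G Θ : CSpace n → CSpace n → ℂ} {S : Submodule ℂ (CSpace n)}

/-- A unitary family which is too short to span `S` leaves a nonzero orthogonal vector in `S`. -/
theorem exists_orthogonal (hG : IsHermForm G) (e : Fin k → CSpace n)
    (hk : k < Module.finrank ℂ S) : ∃ v ∈ S, v ≠ 0 ∧ ∀ α, G v (e α) = 0 := by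
  let φ : S →ₗ[ℂ] (Fin k → ℂ) :=
    { toFun := fun v α => G v (e α)
      map_add' := fun x y => by ext α; simp [hG.add_left]
      map_smul' := fun c x => by ext α; simp [hG.smul_left] }
  have hker : LinearMap.ker φ ≠ ⊥ := by
    apply LinearMap.ker_ne_bot_of_finrank_lt
    simpa using hk
  obtain ⟨v, hv, hv0⟩ := (Submodule.ne_bot_iff _).1 hker
  refine ⟨v, v.2, by simpa using hv0, fun α => ?_⟩
  exact congrFun (LinearMap.mem_ker.1 hv) α

theorem IsUnitaryFam.expand (hG : IsHermForm G) {e : Fin k → CSpace n} (he : IsUnitaryFam G e)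
    (heS : ∀ α, e α ∈ S) (hk : Module.finrank ℂ S = k) {x : CSpace n} (hx : x ∈ S) :
    x = ∑ α, G x (e α) • e α := by
  have coef : ∀ (c : Fin k → ℂ) β, G (∑ α, c α • e α) (e β) = c β := by
    intro c β
    rw [hG.sum_left]
    simp [hG.smul_left, he _ β]
  have hli : LinearIndependent ℂ e := by
    rw [Fintype.linearIndependent_iff]
    intro c hc β
    rw [← coef c β, hc, hG.zero_left]
  have hspan : Submodule.span ℂ (Set.range e) = S := by
    apply Submodule.eq_of_le_of_finrank_eq
    · rw [Submodule.span_le]; rintro _ ⟨α, rfl⟩; exact heS α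
    · rw [finrank_span_eq_card hli, hk, Fintype.card_fin]
  rw [← hspan] at hx
  obtain ⟨c, rfl⟩ := (Submodule.mem_span_range_iff_exists_fun ℂ).1 hx
  refine Finset.sum_congr rfl fun α _ => ?_
  rw [coef]

theorem IsPosForm.normalize (hG : IsPosForm G) {v : CSpace n} (hv : v ≠ 0) :
    G ((((Real.sqrt (G v v).re)⁻¹ : ℝ) : ℂ) • v)
      ((((Real.sqrt (G v v).re)⁻¹ : ℝ) : ℂ) • v) = 1 := by
  have h0 := hG.pos v hv
  have hs := Real.mul_self_sqrt h0.le
  have hs0 : Real.sqrt (G v v).re ≠ 0 := (Real.sqrt_pos.2 h0).ne'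
  rw [hG.smul_left, hG.smul_right, Complex.conj_ofReal, hG.self_eq, ← Complex.ofReal_mul,
    ← Complex.ofReal_mul]
  norm_cast
  generalize Real.sqrt (G v v).re = s at *
  rw [← hs]; field_simp

theorem isUnitaryFam_snoc (hG : IsHermForm G) {e : Fin k → CSpace n} (he : IsUnitaryFam G e)
    {v : CSpace n} (hv : G v v = 1) (ho : ∀ α, G v (e α) = 0) :
    IsUnitaryFam G (Fin.snoc e v : Fin (k + 1) → CSpace n) := by
  have ho' : ∀ α, G (e α) v = 0 := fun α => by rw [← hG.conj_symm, ho, map_zero]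
  intro α β
  refine Fin.lastCases ?_ (fun α => ?_) α
  · refine Fin.lastCases ?_ (fun β => ?_) β
    · simp [hv]
    · simp [ho, (Fin.castSucc_lt_last β).ne']
  · refine Fin.lastCases ?_ (fun β => ?_) β
    · simp [ho', (Fin.castSucc_lt_last α).ne]
    · simp [he α β]

theorem exists_unitary_snoc (hG : IsPosForm G) {e : Fin k → CSpace n} (he : IsUnitaryFam G e)
    (hk : k < Module.finrank ℂ S) :
    ∃ v ∈ S, IsUnitaryFam G (Fin.snoc e v : Fin (k + 1) → CSpace n) := by
  obtain ⟨v, hvS, hv0, hv⟩ := exists_orthogonal hG.toIsHermForm e hk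
  refine ⟨_, S.smul_mem _ hvS,
    isUnitaryFam_snoc hG.toIsHermForm he (hG.normalize hv0) fun α => ?_⟩
  rw [hG.smul_left, hv, mul_zero]

theorem exists_unitary_frame (hG : IsPosForm G) (hk : k ≤ Module.finrank ℂ S) :
    ∃ e : Fin k → CSpace n, (∀ α, e α ∈ S) ∧ IsUnitaryFam G e := by
  induction k with
  | zero => exact ⟨fun i => i.elim0, fun i => i.elim0, fun i => i.elim0⟩
  | succ k ih =>
    obtain ⟨e, heS, he⟩ := ih (by omega)
    obtain ⟨v, hv, hu⟩ := exists_unitary_snoc hG he hk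
    refine ⟨_, fun α => ?_, hu⟩
    refine Fin.lastCases ?_ (fun α => ?_) α
    · simpa using hv
    · simpa using heS α

theorem IsUnitaryFam.herm_eq_sum (hΘ : IsHermForm Θ) (c d : Fin k → ℂ) (e : Fin k → CSpace n) :
    Θ (∑ α, c α • e α) (∑ β, d β • e β)
      = ∑ α, ∑ β, c α * (starRingEnd ℂ) (d β) * Θ (e α) (e β) := by
  rw [hΘ.sum_left]
  refine Finset.sum_congr rfl fun α _ => ?_
  rw [hΘ.sum_right]
  refine Finset.sum_congr rfl fun β _ => ?_
  rw [hΘ.smul_left, hΘ.smul_right]; ring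

/-- The spectral theorem for a Hermitian form relative to a positive one. -/
theorem exists_isEigenTuple (hG : IsPosForm G) (hΘ : IsHermForm Θ)
    (hk : Module.finrank ℂ S = k) : ∃ lam, IsEigenTuple (k := k) G Θ (S : Set (CSpace n)) lam := by
  obtain ⟨x, hxS, hx⟩ := exists_unitary_frame (S := S) hG hk.ge
  let H : Matrix (Fin k) (Fin k) ℂ := Matrix.of fun α β => Θ (x β) (x α)
  have hH : H.IsHermitian := by
    ext α β
    simp [H, Matrix.conjTranspose_apply, hΘ.conj_symm]
  let V : Matrix (Fin k) (Fin k) ℂ := hH.eigenvectorUnitary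
  have hV : star V * V = 1 := Unitary.coe_star_mul_self hH.eigenvectorUnitary
  have hD : star V * H * V = Matrix.diagonal (fun i => (hH.eigenvalues i : ℂ)) := by
    have := hH.conjStarAlgAut_star_eigenvectorUnitary
    simp only [Unitary.conjStarAlgAut_apply, Unitary.coe_star, star_star] at this
    exact this
  refine ⟨hH.eigenvalues, fun α => ∑ β, V β α • x β, ?_, ?_, ?_⟩
  · intro α
    exact S.sum_mem fun β _ => S.smul_mem _ (hxS β)
  · intro α β
    rw [IsUnitaryFam.herm_eq_sum hG.toIsHermForm]
    have h1 := congrFun (congrFun hV β) α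
    simp only [Matrix.mul_apply, Matrix.star_apply, Matrix.one_apply] at h1
    simp only [hx _ _, mul_ite, mul_one, mul_zero, Finset.sum_ite_eq, Finset.mem_univ, if_true]
    rw [show (if α = β then (1 : ℂ) else 0) = if β = α then 1 else 0 by simp [eq_comm], ← h1]
    refine Finset.sum_congr rfl fun γ _ => ?_
    simp [mul_comm]
  · intro α β
    rw [IsUnitaryFam.herm_eq_sum hΘ]
    have h1 := congrFun (congrFun hD β) α
    simp only [Matrix.mul_apply, Matrix.star_apply, Matrix.diagonal_apply, Finset.sum_mul] at h1
    rw [show (if α = β then (hH.eigenvalues α : ℂ) else 0)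
      = if β = α then (hH.eigenvalues β : ℂ) else 0 by
        by_cases h : α = β <;> simp [h, eq_comm], ← h1]
    refine Finset.sum_congr rfl fun γ _ => Finset.sum_congr rfl fun δ _ => ?_
    simp [H]; ring

theorem isEigenTuple_eigenTuple (hG : IsPosForm G) (hΘ : IsHermForm Θ)
    (hk : Module.finrank ℂ S = k) :
    IsEigenTuple G Θ (S : Set (CSpace n)) (eigenTuple k G Θ S) :=
  Classical.epsilon_spec (exists_isEigenTuple hG hΘ hk)

/-- Eigenvalue tuples are preserved by a form-preserving bijection. -/
theorem eigenTuple_congr {G' Θ' : CSpace n → CSpace n → ℂ} {S S' : Set (CSpace n)}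
    (P P' : CSpace n → CSpace n) (hP : ∀ x ∈ S, P x ∈ S') (hP' : ∀ x ∈ S', P' x ∈ S)
    (hPP' : ∀ x ∈ S', P (P' x) = x)
    (hG : ∀ x ∈ S, ∀ y ∈ S, G' (P x) (P y) = G x y)
    (hΘ : ∀ x ∈ S, ∀ y ∈ S, Θ' (P x) (P y) = Θ x y) :
    eigenTuple k G Θ S = eigenTuple k G' Θ' S' := by
  have : IsEigenTuple (k := k) G Θ S = IsEigenTuple G' Θ' S' := by
    ext lam
    constructor
    · rintro ⟨e, h1, h2, h3⟩
      refine ⟨fun α => P (e α), fun α => hP _ (h1 α), fun α β => ?_, fun α β => ?_⟩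
      · rw [hG _ (h1 α) _ (h1 β), h2]
      · rw [hΘ _ (h1 α) _ (h1 β), h3]
    · rintro ⟨e, h1, h2, h3⟩
      refine ⟨fun α => P' (e α), fun α => hP' _ (h1 α), fun α β => ?_, fun α β => ?_⟩
      · rw [← hG _ (hP' _ (h1 α)) _ (hP' _ (h1 β)), hPP' _ (h1 α), hPP' _ (h1 β), h2]
      · rw [← hΘ _ (hP' _ (h1 α)) _ (hP' _ (h1 β)), hPP' _ (h1 α), hPP' _ (h1 β), h3]
  rw [eigenTuple, this, eigenTuple]

/-- The matrix `|G(e'_i, e_j)|²` between two unitary frames is doubly stochastic. -/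
theorem normSq_mem_doublyStochastic (hG : IsHermForm G) {e e' : Fin k → CSpace n}
    (he : IsUnitaryFam G e) (heS : ∀ α, e α ∈ S) (he' : IsUnitaryFam G e')
    (heS' : ∀ α, e' α ∈ S) (hk : Module.finrank ℂ S = k) :
    (Matrix.of fun i j => Complex.normSq (G (e' i) (e j))) ∈ doublyStochastic ℝ (Fin k) := by
  have row : ∀ {e e' : Fin k → CSpace n}, IsUnitaryFam G e → (∀ α, e α ∈ S) →
      IsUnitaryFam G e' → (∀ α, e' α ∈ S) → ∀ i, ∑ j, Complex.normSq (G (e' i) (e j)) = 1 := by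
    intro e e' he heS he' heS' i
    have h1 := he' i i
    rw [he.expand hG heS hk (heS' i), IsUnitaryFam.herm_eq_sum hG] at h1
    simp only [he _ _, mul_ite, mul_one, mul_zero, Finset.sum_ite_eq, Finset.mem_univ,
      if_true, Complex.mul_conj] at h1
    exact_mod_cast h1
  rw [mem_doublyStochastic_iff_sum]
  refine ⟨fun i j => Complex.normSq_nonneg _, fun i => row he heS he' heS' i, fun j => ?_⟩
  rw [← row he' heS' he heS j]
  refine Finset.sum_congr rfl fun i _ => ?_
  rw [Matrix.of_apply, ← hG.conj_symm, Complex.normSq_conj]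

/-- Schur: the diagonal of a Hermitian form in a unitary frame lies in the convex hull of the
permutations of its eigenvalues. -/
theorem diag_mem_convexHull (hG : IsHermForm G) (hΘ : IsHermForm Θ) {lam : Fin k → ℝ}
    (hlam : IsEigenTuple G Θ (S : Set (CSpace n)) lam) {e' : Fin k → CSpace n}
    (he' : IsUnitaryFam G e') (heS' : ∀ α, e' α ∈ S) (hk : Module.finrank ℂ S = k) :
    (fun i => (Θ (e' i) (e' i)).re)
      ∈ convexHull ℝ (Set.range fun τ : Equiv.Perm (Fin k) => lam ∘ τ) := by
  obtain ⟨e, heS, he, hd⟩ := hlam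
  have hds := normSq_mem_doublyStochastic hG he heS he' heS' hk
  set D : Matrix (Fin k) (Fin k) ℝ := Matrix.of fun i j => Complex.normSq (G (e' i) (e j))
  have hdiag : (fun i => (Θ (e' i) (e' i)).re) = Matrix.mulVecBilin ℝ ℝ D lam := by
    ext i
    have h1 : Θ (e' i) (e' i) = ∑ j, (Complex.normSq (G (e' i) (e j)) : ℂ) * lam j := by
      conv_lhs => rw [IsUnitaryFam.expand hG he heS hk (heS' i)]
      rw [IsUnitaryFam.herm_eq_sum hΘ]
      simp only [hd, mul_ite, mul_zero, Finset.sum_ite_eq, Finset.mem_univ, if_true,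
        Complex.mul_conj]
    rw [h1]
    simp [Matrix.mulVec, dotProduct, D]
  rw [hdiag]
  have : (D : Matrix (Fin k) (Fin k) ℝ) ∈
      convexHull ℝ {σ.permMatrix ℝ | σ : Equiv.Perm (Fin k)} := by
    rw [← doublyStochastic_eq_convexHull_permMatrix]; exact hds
  let F : Matrix (Fin k) (Fin k) ℝ →ₗ[ℝ] (Fin k → ℝ) := (Matrix.mulVecBilin ℝ ℝ).flip lam
  have h2 : F D ∈ F '' convexHull ℝ {σ.permMatrix ℝ | σ : Equiv.Perm (Fin k)} := ⟨D, this, rfl⟩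
  rw [F.image_convexHull] at h2
  refine convexHull_mono ?_ h2
  rintro _ ⟨_, ⟨σ, rfl⟩, rfl⟩
  refine ⟨σ, ?_⟩
  ext i
  simp [F, Matrix.permMatrix_mulVec]

end frames

/-! ### Symmetric cones and the function `f` -/

/-- The properties shared by `Γ` and `Γ_∞`: an open symmetric convex cone which is stable under
adding vectors with nonnegative entries, and which does not contain the origin. -/
structure IsMonoCone {k : ℕ} (D : Set (Fin k → ℝ)) : Prop where
  isOpen : IsOpen D
  symmetric : ∀ (τ : Equiv.Perm (Fin k)), ∀ l ∈ D, l ∘ τ ∈ D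
  convex : Convex ℝ D
  cone : ∀ c : ℝ, 0 < c → ∀ l ∈ D, c • l ∈ D
  add_nonneg : ∀ l ∈ D, ∀ y : Fin k → ℝ, (∀ i, 0 ≤ y i) → l + y ∈ D
  zero_notMem : (0 : Fin k → ℝ) ∉ D
  nonempty : D.Nonempty

namespace IsMonoCone

variable {k : ℕ} {D : Set (Fin k → ℝ)}

theorem add_mem (hD : IsMonoCone D) {x y : Fin k → ℝ} (hx : x ∈ D) (hy : y ∈ D) : x + y ∈ D := by
  have := hD.cone 2 two_pos _ (hD.convex hx hy (a := 1 / 2) (b := 1 / 2) (by norm_num)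
    (by norm_num) (by norm_num))
  convert this using 1
  ext i; simp; ring

theorem mono (hD : IsMonoCone D) {x y : Fin k → ℝ} (hx : x ∈ D) (hxy : ∀ i, x i ≤ y i) :
    y ∈ D := by
  have := hD.add_nonneg x hx (y - x) fun i => by simpa using hxy i
  simpa using this

theorem exists_sub (hD : IsMonoCone D) {x : Fin k → ℝ} (hx : x ∈ D) :
    ∃ ε > 0, (fun i => x i - ε) ∈ D := by
  obtain ⟨ε, hε, hb⟩ := Metric.isOpen_iff.1 hD.isOpen x hx
  refine ⟨ε / 2, by positivity, hb ?_⟩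
  rw [Metric.mem_ball]
  refine lt_of_le_of_lt ((dist_pi_le_iff (by positivity : (0 : ℝ) ≤ ε / 2)).2 fun i => ?_)
    (half_lt_self hε)
  rw [Real.dist_eq]; simp [abs_of_pos (half_pos hε)]

theorem mem_closure_iff (hD : IsMonoCone D) {x : Fin k → ℝ} :
    x ∈ closure D ↔ ∀ ε > 0, (fun i => x i + ε) ∈ D := by
  constructor
  · intro hx ε hε
    obtain ⟨y, hy, hd⟩ := Metric.mem_closure_iff.1 hx ε hε
    refine hD.mono hy fun i => ?_
    have := (dist_pi_lt_iff hε).1 hd i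
    rw [Real.dist_eq, abs_lt] at this
    linarith
  · intro h
    rw [Metric.mem_closure_iff]
    intro ε hε
    refine ⟨_, h (ε / 2) (by positivity), ?_⟩
    refine lt_of_le_of_lt ((dist_pi_le_iff (by positivity : (0 : ℝ) ≤ ε / 2)).2 fun i => ?_)
      (half_lt_self hε)
    rw [Real.dist_eq]; simp [abs_of_pos (half_pos hε)]

theorem mem_frontier_iff (hD : IsMonoCone D) {x : Fin k → ℝ} :
    x ∈ frontier D ↔ x ∉ D ∧ ∀ ε > 0, (fun i => x i + ε) ∈ D := by
  rw [hD.isOpen.frontier_eq, Set.mem_sdiff, hD.mem_closure_iff, and_comm]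

/-- A point outside the cone is separated from it by a nonnegative weight vector. -/
theorem exists_weights (hD : IsMonoCone D) {x : Fin k → ℝ} (hx : x ∉ D) :
    ∃ μ : Fin k → ℝ, (∀ i, 0 ≤ μ i) ∧ ∑ i, μ i = 1 ∧ ∑ i, μ i * x i ≤ 0 ∧
      ∀ l ∈ D, 0 < ∑ i, μ i * l i := by
  obtain ⟨F, hF⟩ := geometric_hahn_banach_open_point hD.convex hD.isOpen hx
  have hFx : 0 ≤ F x := by
    obtain ⟨a, ha⟩ := hD.nonempty
    by_contra! hneg
    have hc : 0 < (F x / (2 * F a)) := div_pos_of_neg_of_neg hneg (by linarith [hF a ha])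
    have := hF _ (hD.cone _ hc a ha)
    rw [map_smul, smul_eq_mul] at this
    have h0 : F a ≠ 0 := by linarith [hF a ha]
    have h2 : F x / (2 * F a) * F a = F x / 2 := by field_simp
    rw [h2] at this; linarith
  have hFa : ∀ a ∈ D, F a ≤ 0 := by
    intro a ha
    by_contra! hpos
    have := hF _ (hD.cone (F x / F a + 1) (by positivity) a ha)
    rw [map_smul, smul_eq_mul, add_mul, div_mul_cancel₀ _ hpos.ne'] at this
    linarith
  set ν : Fin k → ℝ := fun i => - F (Pi.single i 1) with hν
  have hsum : ∀ l : Fin k → ℝ, ∑ i, ν i * l i = - F l := by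
    intro l
    have : l = ∑ i, l i • (Pi.single i (1 : ℝ) : Fin k → ℝ) := by
      rw [← pi_eq_sum_univ' l]
    conv_rhs => rw [this, map_sum]
    rw [← Finset.sum_neg_distrib]
    refine Finset.sum_congr rfl fun i _ => ?_
    rw [map_smul, smul_eq_mul, hν]; ring
  have hν0 : ∀ i, 0 ≤ ν i := by
    intro i
    obtain ⟨a, ha⟩ := hD.nonempty
    by_contra! hneg
    have h1 : 0 ≤ F a / ν i := by
      exact div_nonneg_of_nonpos (hFa a ha) hneg.le
    have := hFa _ (hD.add_nonneg a ha ((1 - F a / ν i + 2 * (F a / ν i)) • Pi.single i 1)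
      fun j => by
        rw [Pi.smul_apply, smul_eq_mul]
        refine mul_nonneg (by linarith) ?_
        by_cases h : j = i
        · subst h; simp
        · simp [h])
    rw [map_add, map_smul, smul_eq_mul] at this
    have h3 : F (Pi.single i 1) = - ν i := by simp [hν]
    rw [h3] at this
    have h4 : F a / ν i * ν i = F a := div_mul_cancel₀ _ hneg.ne
    nlinarith
  have hpos : 0 < ∑ i, ν i := by
    refine lt_of_le_of_ne (Finset.sum_nonneg fun i _ => hν0 i) fun h0 => ?_
    have hz := (Finset.sum_eq_zero_iff_of_nonneg fun i _ => hν0 i).1 h0.symm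
    have hF0 : ∀ l, F l = 0 := fun l => by
      have := hsum l
      rw [Finset.sum_eq_zero fun i hi => by rw [hz i hi, zero_mul]] at this
      linarith
    obtain ⟨a, ha⟩ := hD.nonempty
    have := hF a ha
    rw [hF0, hF0] at this
    exact lt_irrefl _ this
  have hscale : ∀ l : Fin k → ℝ, ∑ i, (ν i / ∑ j, ν j) * l i = - F l / ∑ j, ν j := by
    intro l
    rw [← hsum, Finset.sum_div]
    exact Finset.sum_congr rfl fun i _ => by ring
  refine ⟨fun i => ν i / ∑ j, ν j, fun i => div_nonneg (hν0 i) hpos.le, ?_, ?_, ?_⟩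
  · rw [← Finset.sum_div, div_self hpos.ne']
  · rw [hscale]
    exact div_nonpos_of_nonpos_of_nonneg (by linarith) hpos.le
  · intro l hl
    obtain ⟨ε, hε, hl'⟩ := hD.exists_sub hl
    have h1 := hFa _ hl'
    have h2 := hscale l
    have h3 := hscale fun i => l i - ε
    have h4 : ∑ i, (ν i / ∑ j, ν j) * (l i - ε) = ∑ i, (ν i / ∑ j, ν j) * l i - ε := by
      simp only [mul_sub, Finset.sum_sub_distrib, ← Finset.sum_mul, ← Finset.sum_div]
      rw [div_self hpos.ne']; ring
    have h5 : 0 ≤ - F (fun i => l i - ε) / ∑ j, ν j := div_nonneg (by linarith) hpos.le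
    linarith

section forms

variable {n : ℕ} {G Θ Θ' : CSpace n → CSpace n → ℂ} {S : Submodule ℂ (CSpace n)}

theorem diag_mem (hD : IsMonoCone D) (hG : IsHermForm G) (hΘ : IsHermForm Θ)
    (hk : Module.finrank ℂ S = k) {lam : Fin k → ℝ}
    (hlam : IsEigenTuple G Θ (S : Set (CSpace n)) lam) (hl : lam ∈ D) {e : Fin k → CSpace n}
    (he : IsUnitaryFam G e) (heS : ∀ α, e α ∈ S) : (fun i => (Θ (e i) (e i)).re) ∈ D := by
  refine convexHull_min ?_ hD.convex (diag_mem_convexHull hG hΘ hlam he heS hk)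
  rintro _ ⟨τ, rfl⟩
  exact hD.symmetric τ _ hl

theorem mem_of_le (hD : IsMonoCone D) (hG : IsHermForm G) (hΘ : IsHermForm Θ)
    (hk : Module.finrank ℂ S = k) {lam lam' : Fin k → ℝ}
    (hlam : IsEigenTuple G Θ (S : Set (CSpace n)) lam) (hl : lam ∈ D)
    (hlam' : IsEigenTuple G Θ' (S : Set (CSpace n)) lam')
    (hle : ∀ x ∈ S, (Θ x x).re ≤ (Θ' x x).re) : lam' ∈ D := by
  obtain ⟨e, heS, he, hd⟩ := hlam'
  refine hD.mono (hD.diag_mem hG hΘ hk hlam hl he heS) fun i => ?_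
  have := hle _ (heS i)
  rw [hd i i] at this
  simpa using this

theorem add_form_mem (hD : IsMonoCone D) (hG : IsHermForm G) (hΘ : IsHermForm Θ)
    (hΘ' : IsHermForm Θ') (hk : Module.finrank ℂ S = k) {lam lam' lam'' : Fin k → ℝ}
    (hlam : IsEigenTuple G Θ (S : Set (CSpace n)) lam) (hl : lam ∈ D)
    (hlam' : IsEigenTuple G Θ' (S : Set (CSpace n)) lam') (hl' : lam' ∈ D)
    (hlam'' : IsEigenTuple G (fun x y => Θ x y + Θ' x y) (S : Set (CSpace n)) lam'') :
    lam'' ∈ D := by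
  obtain ⟨e, heS, he, hd⟩ := hlam''
  convert hD.add_mem (hD.diag_mem hG hΘ hk hlam hl he heS) (hD.diag_mem hG hΘ' hk hlam' hl' he heS)
    using 1
  ext i
  have := congrArg Complex.re (hd i i)
  simp at this
  simp [this]

end forms
end IsMonoCone

section forms

variable {n k : ℕ} {G Θ : CSpace n → CSpace n → ℂ} {S : Submodule ℂ (CSpace n)}

theorem IsEigenTuple.add_scalar {S : Set (CSpace n)} {lam : Fin k → ℝ}
    (h : IsEigenTuple G Θ S lam) (c : ℝ) :
    IsEigenTuple G (fun x y => Θ x y + (c : ℂ) * G x y) S (fun i => lam i + c) := by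
  obtain ⟨e, heS, he, hd⟩ := h
  refine ⟨e, heS, he, fun α β => ?_⟩
  simp only [hd, he]
  by_cases h : α = β <;> simp [h]

theorem IsEigenTuple.real_mul {S : Set (CSpace n)} {lam : Fin k → ℝ}
    (h : IsEigenTuple G Θ S lam) (c : ℝ) :
    IsEigenTuple G (fun x y => (c : ℂ) * Θ x y) S (fun i => c * lam i) := by
  obtain ⟨e, heS, he, hd⟩ := h
  refine ⟨e, heS, he, fun α β => ?_⟩
  simp only [hd]
  by_cases h : α = β <;> simp [h]

/-- A Hermitian form is bounded by its largest eigenvalue. -/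
theorem IsEigenTuple.abs_le (hG : IsHermForm G) (hΘ : IsHermForm Θ)
    (hk : Module.finrank ℂ S = k) {lam : Fin k → ℝ}
    (h : IsEigenTuple G Θ (S : Set (CSpace n)) lam) {C : ℝ} (hC : ∀ i, |lam i| ≤ C)
    {x : CSpace n} (hx : x ∈ S) : |(Θ x x).re| ≤ C * (G x x).re := by
  obtain ⟨e, heS, he, hd⟩ := h
  have hexp := IsUnitaryFam.expand hG he heS hk hx
  have h1 : ∀ {Ξ : CSpace n → CSpace n → ℂ}, IsHermForm Ξ → ∀ {d : Fin k → ℝ},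
      (∀ α β, Ξ (e α) (e β) = if α = β then (d α : ℂ) else 0) →
      (Ξ x x).re = ∑ α, Complex.normSq (G x (e α)) * d α := by
    intro Ξ hΞ d hdd
    rw [hexp, IsUnitaryFam.herm_eq_sum hΞ, ← hexp]
    simp only [hdd, mul_ite, mul_zero, Finset.sum_ite_eq, Finset.mem_univ, if_true,
      Complex.mul_conj]
    simp
  rw [h1 hΘ hd, h1 hG (d := fun _ => 1) (by simpa using he), Finset.mul_sum]
  refine (Finset.abs_sum_le_sum_abs _ _).trans (Finset.sum_le_sum fun α _ => ?_)
  rw [abs_mul, abs_of_nonneg (Complex.normSq_nonneg _)]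
  nlinarith [Complex.normSq_nonneg (G x (e α)), hC α]

end forms

section firstHit

variable {n k : ℕ} {D : Set (Fin k → ℝ)} {G U L : CSpace n → CSpace n → ℂ}
  {S : Submodule ℂ (CSpace n)}

/-- Moving from `U` along `-L` inside the cone of forms with eigenvalues in `D`, there is a first
exit. -/
theorem exists_first_hit (hD : IsMonoCone D) (hG : IsPosForm G) (hU : IsHermForm U)
    (hL : IsHermForm L) (hk : Module.finrank ℂ S = k) (hUD : eigenTuple k G U S ∈ D)
    (hLD : eigenTuple k G L S ∈ D) :
    ∃ t₀ : ℝ, IsGreatest {t : ℝ | t ≤ 1 ∧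
        eigenTuple k G (fun x y => U x y + ((-(1 - t) : ℝ) : ℂ) * L x y) S ∈ frontier D} t₀ ∧
      t₀ < 1 ∧ eigenTuple k G (fun x y => U x y + ((-(1 - t₀) : ℝ) : ℂ) * L x y) S ∉ D := by
  set A : ℝ → CSpace n → CSpace n → ℂ := fun t x y => U x y + ((-(1 - t) : ℝ) : ℂ) * L x y with hA
  have hAh : ∀ t, IsHermForm (A t) := fun t => hU.add (hL.real_mul _)
  have hAe : ∀ t, IsEigenTuple G (A t) (S : Set (CSpace n)) (eigenTuple k G (A t) S) :=
    fun t => isEigenTuple_eigenTuple hG (hAh t) hk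
  have hLe := isEigenTuple_eigenTuple hG hL hk
  obtain ⟨C, hC0, hC⟩ : ∃ C : ℝ, 0 < C ∧ ∀ x ∈ S, |(L x x).re| ≤ C * (G x x).re := by
    refine ⟨∑ i, |eigenTuple k G L S i| + 1, by positivity, fun x hx => ?_⟩
    refine hLe.abs_le hG.toIsHermForm hL hk (fun i => ?_) hx
    have := Finset.single_le_sum (f := fun i => |eigenTuple k G L S i|) (fun i _ => abs_nonneg _)
      (Finset.mem_univ i)
    linarith
  have hGn : ∀ x, 0 ≤ (G x x).re := fun x => by
    by_cases hx : x = 0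
    · rw [hx, hG.zero_left]; simp
    · exact (hG.pos x hx).le
  -- Relative to `G`, the forms `A t` are Lipschitz in `t`.
  have hcmp : ∀ t s ε : ℝ, C * |t - s| ≤ ε → ∀ x ∈ S,
      (A t x x).re ≤ (A s x x).re + ε * (G x x).re := by
    intro t s ε hε x hx
    have h1 : (A t x x).re - (A s x x).re = (t - s) * (L x x).re := by
      simp [hA]; ring
    have h2 : (t - s) * (L x x).re ≤ |t - s| * (C * (G x x).re) := by
      refine (le_abs_self _).trans ?_
      rw [abs_mul]
      exact mul_le_mul_of_nonneg_left (hC x hx) (abs_nonneg _)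
    nlinarith [hGn x]
  set B : Set ℝ := {t | t ≤ 1 ∧ eigenTuple k G (A t) S ∉ D} with hB
  have hopen : ∀ t, eigenTuple k G (A t) S ∈ D → ∀ᶠ s in 𝓝 t, eigenTuple k G (A s) S ∈ D := by
    intro t ht
    obtain ⟨ε, hε, hεD⟩ := hD.exists_sub ht
    filter_upwards [Metric.ball_mem_nhds t (show 0 < ε / C by positivity)] with s hs
    have hs' : C * |t - s| ≤ ε := by
      rw [Metric.mem_ball, Real.dist_eq, abs_sub_comm, lt_div_iff₀ hC0] at hs
      linarith
    refine hD.mem_of_le hG.toIsHermForm ((hAh t).add (hG.toIsHermForm.real_mul (-ε))) hk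
      ((hAe t).add_scalar (-ε)) (by simpa [sub_eq_add_neg] using hεD) (hAe s) fun x hx => ?_
    have := hcmp t s ε hs' x hx
    simp
    linarith
  have hclosed : IsClosed B := by
    have : B = Iic 1 ∩ {t | eigenTuple k G (A t) S ∈ D}ᶜ := by ext; simp [hB]
    rw [this]
    exact isClosed_Iic.inter (isOpen_iff_eventually.2 fun t ht => hopen t ht).isClosed_compl
  have hne : B.Nonempty := by
    -- `L - ε G` still has its eigenvalues in `D`. If `U - s L` had so too, then `U - s ε G` would,
    -- but its weighted trace is negative for large `s`.
    obtain ⟨ε, hε, hεD⟩ := hD.exists_sub hLD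
    obtain ⟨μ, hμ0, hμ1, -, hμ⟩ := hD.exists_weights hD.zero_notMem
    set m := ∑ i, μ i * eigenTuple k G U S i with hm
    have hm0 : 0 < m := hμ _ hUD
    refine ⟨1 - 2 * m / ε, by have : 0 < 2 * m / ε := by positivity
                              linarith, fun hmem => ?_⟩
    set s := 2 * m / ε with hs
    have hs0 : 0 < s := by positivity
    have h2 : (fun i => s * (eigenTuple k G L S i + -ε)) ∈ D := by
      have := hD.cone s hs0 _ hεD
      convert this using 1
      ext i
      simp [sub_eq_add_neg]
    have h1 := hD.add_form_mem hG.toIsHermForm (hAh _)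
      ((hL.add (hG.toIsHermForm.real_mul (-ε))).real_mul s) hk (hAe _) hmem
      ((hLe.add_scalar (-ε)).real_mul s) h2
      (lam'' := fun i => eigenTuple k G U S i + (-(s * ε))) (by
        have h3 := (isEigenTuple_eigenTuple hG hU hk).add_scalar (-(s * ε))
        convert h3 using 1
        ext x y
        simp only [hA]
        push_cast
        ring)
    have h4 := hμ _ h1
    simp only [mul_add, Finset.sum_add_distrib, ← Finset.sum_mul, hμ1] at h4
    rw [← hm] at h4
    have : s * ε = 2 * m := by rw [hs]; field_simp
    rw [this] at h4
    linarith
  have hbdd : BddAbove B := ⟨1, fun t ht => ht.1⟩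
  have hmem := hclosed.csSup_mem hne hbdd
  set t₀ := sSup B with ht₀
  have hA1 : eigenTuple k G (A 1) S ∈ D := by
    have : A 1 = U := by ext x y; simp [hA]
    rw [this]; exact hUD
  have hlt : t₀ < 1 := lt_of_le_of_ne hmem.1 fun h => hmem.2 (h ▸ hA1)
  refine ⟨t₀, ⟨⟨hmem.1, ?_⟩, ?_⟩, hlt, hmem.2⟩
  · rw [hD.mem_frontier_iff]
    refine ⟨hmem.2, fun ε hε => ?_⟩
    set t := min 1 (t₀ + ε / C) with ht
    have htt : t₀ < t := lt_min hlt (by have : 0 < ε / C := by positivity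
                                        linarith)
    have htD : eigenTuple k G (A t) S ∈ D := by
      by_contra hcon
      exact absurd (le_csSup hbdd ⟨min_le_left _ _, hcon⟩) (not_le.2 htt)
    refine hD.mem_of_le hG.toIsHermForm (hAh t) hk (hAe t) htD ((hAe t₀).add_scalar ε)
      fun x hx => ?_
    have h1 : C * |t - t₀| ≤ ε := by
      rw [abs_of_pos (by linarith)]
      have : t ≤ t₀ + ε / C := min_le_right _ _
      have h2 : C * (ε / C) = ε := by field_simp
      nlinarith
    have := hcmp t t₀ ε h1 x hx
    simp
    linarith
  · rintro t ⟨ht1, htf⟩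
    exact le_csSup hbdd ⟨ht1, (hD.mem_frontier_iff.1 htf).1⟩

end firstHit

section Gamma

theorem IsSymmetricCone.isMonoCone {n : ℕ} {Γ : Set (Fin n → ℝ)} (h : IsSymmetricCone Γ) :
    IsMonoCone Γ := by
  have hadd : ∀ x ∈ Γ, ∀ y ∈ Γ, x + y ∈ Γ := by
    intro x hx y hy
    have := h.cone 2 two_pos _ (h.convex hx hy (a := 1 / 2) (b := 1 / 2) (by norm_num)
      (by norm_num) (by norm_num))
    convert this using 1
    ext i; simp; ring
  refine ⟨h.isOpen, h.symmetric, h.convex, h.cone, ?_, ?_, ⟨fun _ => 1, h.positive_subset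
    fun _ => one_pos⟩⟩
  · intro l hl y hy
    obtain ⟨ε, hε, hb⟩ := Metric.isOpen_iff.1 h.isOpen l hl
    have h1 : (fun i => l i - ε / 2) ∈ Γ := by
      apply hb
      rw [Metric.mem_ball]
      refine lt_of_le_of_lt ((dist_pi_le_iff (by positivity : (0 : ℝ) ≤ ε / 2)).2 fun i => ?_)
        (half_lt_self hε)
      rw [Real.dist_eq]; simp [abs_of_pos (half_pos hε)]
    have h2 : (fun i => y i + ε / 2) ∈ Γ := h.positive_subset fun i => by
      have := hy i
      show 0 < y i + ε / 2
      linarith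
    convert hadd _ h1 _ h2 using 1
    ext i; simp
  · intro h0
    -- An open cone containing the origin is the whole space and has no boundary.
    obtain ⟨ε, hε, hb⟩ := Metric.isOpen_iff.1 h.isOpen 0 h0
    have huniv : Γ = univ := by
      refine eq_univ_of_forall fun x => ?_
      have hpos : 0 < ε / (2 * (‖x‖ + 1)) := by positivity
      have : (ε / (2 * (‖x‖ + 1))) • x ∈ Γ := by
        apply hb
        rw [mem_ball_zero_iff, norm_smul, Real.norm_of_nonneg hpos.le, div_mul_eq_mul_div,
          div_lt_iff₀ (by positivity)]
        nlinarith [norm_nonneg x]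
      have h2 := h.cone _ (inv_pos.2 hpos) _ this
      rwa [smul_smul, inv_mul_cancel₀ hpos.ne', one_smul] at h2
    obtain ⟨x, hx⟩ := h.boundary_nonempty
    rw [huniv, frontier_univ] at hx
    exact hx

theorem isMonoCone_gammaInfty {m : ℕ} {Γ : Set (Fin (m + 1) → ℝ)} (h : IsSymmetricCone Γ)
    (h1 : IsTypeOne Γ) : IsMonoCone (gammaInfty Γ) := by
  have hΓ := h.isMonoCone
  refine ⟨?_, ?_, ?_, ?_, ?_, ?_, ?_⟩
  · rw [isOpen_iff_mem_nhds]
    rintro l ⟨s, hs⟩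
    have hc : Continuous fun l : Fin m → ℝ => (Fin.snoc l s : Fin (m + 1) → ℝ) :=
      Continuous.finSnoc (A := fun _ => ℝ) continuous_id continuous_const
    filter_upwards [hc.continuousAt.preimage_mem_nhds (h.isOpen.mem_nhds hs)] with l' hl'
    exact ⟨s, hl'⟩
  · rintro τ l ⟨s, hs⟩
    refine ⟨s, ?_⟩
    let τ' : Equiv.Perm (Fin (m + 1)) :=
      finSuccEquivLast.symm.permCongr (Equiv.optionCongr τ)
    convert h.symmetric τ' _ hs using 1
    ext i
    refine Fin.lastCases ?_ (fun i => ?_) i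
    · simp [τ', Equiv.permCongr_apply]
    · simp [τ', Equiv.permCongr_apply]
  · rintro x ⟨s, hs⟩ y ⟨t, ht⟩ a b ha hb hab
    refine ⟨a • s + b • t, ?_⟩
    convert h.convex hs ht ha hb hab using 1
    ext i
    refine Fin.lastCases ?_ (fun i => ?_) i <;> simp
  · rintro c hc x ⟨s, hs⟩
    refine ⟨c • s, ?_⟩
    convert h.cone c hc _ hs using 1
    ext i
    refine Fin.lastCases ?_ (fun i => ?_) i <;> simp
  · rintro x ⟨s, hs⟩ y hy
    refine ⟨s, hΓ.mono hs fun i => ?_⟩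
    refine Fin.lastCases ?_ (fun i => ?_) i <;> simp [hy]
  · rintro ⟨s, hs⟩
    have h2 : (Pi.single (Fin.last m) (|s| + 1) : Fin (m + 1) → ℝ) ∈ Γ := by
      refine hΓ.mono hs fun i => ?_
      refine Fin.lastCases ?_ (fun i => ?_) i
      · simp; linarith [le_abs_self s]
      · simp [(Fin.castSucc_lt_last i).ne]
    have h3 := h1 (Fin.last m) (|s| + 1) (by positivity)
    rw [h.isOpen.frontier_eq] at h3
    exact h3.2 h2
  · refine ⟨fun _ => 1, 1, h.positive_subset fun i => ?_⟩
    refine Fin.lastCases ?_ (fun i => ?_) i <;> simp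

/-- The restriction of an admissible form to a hyperplane has its eigenvalues in `Γ_∞`: the
diagonal in an adapted frame lies in `Γ`. -/
theorem init_mem_gammaInfty {m : ℕ} {Γ : Set (Fin (m + 1) → ℝ)} {d : Fin (m + 1) → ℝ}
    (hd : d ∈ Γ) : (fun i : Fin m => d i.castSucc) ∈ gammaInfty Γ := by
  refine ⟨d (Fin.last m), ?_⟩
  convert hd using 1
  ext i
  refine Fin.lastCases ?_ (fun i => ?_) i <;> simp

variable {m : ℕ} {Γ : Set (Fin (m + 1) → ℝ)} {f : (Fin (m + 1) → ℝ) → ℝ}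

theorem IsStructuralFunction.differentiableAt (hΓ : IsSymmetricCone Γ)
    (hf : IsStructuralFunction Γ f) {l : Fin (m + 1) → ℝ} (hl : l ∈ Γ) :
    DifferentiableAt ℝ f l :=
  (hf.smooth.contDiffAt (hΓ.isOpen.mem_nhds hl)).differentiableAt (by simp)

theorem fderiv_apply_eq_sum (F : (Fin (m + 1) → ℝ) →L[ℝ] ℝ) (y : Fin (m + 1) → ℝ) :
    F y = ∑ i, y i * F (Pi.single i 1) := by
  conv_lhs => rw [pi_eq_sum_univ' y, map_sum]
  exact Finset.sum_congr rfl fun i _ => by rw [map_smul, smul_eq_mul]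

theorem IsStructuralFunction.mono (hΓ : IsSymmetricCone Γ) (hf : IsStructuralFunction Γ f)
    {x y : Fin (m + 1) → ℝ} (hx : x ∈ Γ) (hxy : ∀ i, x i ≤ y i) : f x ≤ f y := by
  have hseg : ∀ t : ℝ, 0 ≤ t → x + t • (y - x) ∈ Γ := fun t ht =>
    hΓ.isMonoCone.add_nonneg x hx _ fun i => mul_nonneg ht (by simpa using hxy i)
  have hder : ∀ t : ℝ, 0 ≤ t → HasDerivAt (fun t : ℝ => f (x + t • (y - x)))
      (fderiv ℝ f (x + t • (y - x)) (y - x)) t := by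
    intro t ht
    have h1 : HasDerivAt (fun t : ℝ => x + t • (y - x)) (y - x) t := by
      simpa using ((hasDerivAt_id t).smul_const (y - x)).const_add x
    exact (hf.differentiableAt hΓ (hseg t ht)).hasFDerivAt.comp_hasDerivAt t h1
  have hmono : MonotoneOn (fun t : ℝ => f (x + t • (y - x))) (Icc 0 1) := by
    refine monotoneOn_of_deriv_nonneg (convex_Icc 0 1)
      (fun t ht => (hder t ht.1).continuousAt.continuousWithinAt)
      (fun t ht => ?_) (fun t ht => ?_)
    · rw [interior_Icc] at ht
      exact (hder t ht.1.le).differentiableAt.differentiableWithinAt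
    · rw [interior_Icc] at ht
      rw [(hder t ht.1.le).deriv, fderiv_apply_eq_sum]
      exact Finset.sum_nonneg fun i _ => mul_nonneg (by simpa using hxy i)
        (hf.elliptic _ (hseg t ht.1.le) i).le
  have := hmono (left_mem_Icc.2 zero_le_one) (right_mem_Icc.2 zero_le_one) zero_le_one
  simpa using this

/-- The value of `f` on the diagonal in a unitary frame dominates its value on the eigenvalues. -/
theorem IsStructuralFunction.le_diag {n : ℕ} {G Θ : CSpace n → CSpace n → ℂ}
    {S : Submodule ℂ (CSpace n)} (hf : IsStructuralFunction Γ f)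
    (hG : IsHermForm G) (hΘ : IsHermForm Θ) (hk : Module.finrank ℂ S = m + 1)
    (hsymm : ∀ (τ : Equiv.Perm (Fin (m + 1))), ∀ l ∈ Γ, l ∘ τ ∈ Γ)
    {lam : Fin (m + 1) → ℝ} (hlam : IsEigenTuple G Θ (S : Set (CSpace n)) lam) (hl : lam ∈ Γ)
    {e : Fin (m + 1) → CSpace n} (he : IsUnitaryFam G e) (heS : ∀ α, e α ∈ S) :
    f lam ≤ f fun i => (Θ (e i) (e i)).re := by
  have := convexHull_min (t := {x | x ∈ Γ ∧ f lam ≤ f x}) ?_ (hf.concave.convex_ge (f lam))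
    (diag_mem_convexHull hG hΘ hlam he heS hk)
  · exact this.2
  · rintro _ ⟨τ, rfl⟩
    exact ⟨hsymm τ _ hl, (hf.symmetric τ _ hl).ge⟩

/-- The part of a superlevel set of `f` above `sup_{∂Γ} f` in a bounded region keeps a positive
distance from `∂Γ`. -/
theorem exists_sub_mem_of_le (hΓ : IsSymmetricCone Γ) {θ : ℝ}
    (hθ : supBoundary Γ f < (θ : EReal)) (R : ℝ) :
    ∃ ε > 0, ∀ l ∈ Γ, (∀ i, |l i| ≤ R) → θ ≤ f l → (fun i => l i - ε) ∈ Γ := by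
  set S : Set (Fin (m + 1) → ℝ) := {l | l ∈ Γ ∧ (∀ i, |l i| ≤ R) ∧ θ ≤ f l} with hS
  have hbd : Bornology.IsBounded S := by
    refine (Metric.isBounded_closedBall (x := (0 : Fin (m + 1) → ℝ)) (r := |R|)).subset
      fun l hl => ?_
    rw [mem_closedBall_zero_iff]
    exact (pi_norm_le_iff_of_nonneg (abs_nonneg R)).2 fun i => (hl.2.1 i).trans (le_abs_self R)
  have hK : IsCompact (closure S) := hbd.isCompact_closure
  have hsub : closure S ⊆ Γ := by
    intro l hl
    by_contra hcon
    have hfr : l ∈ frontier Γ := by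
      rw [hΓ.isOpen.frontier_eq]
      exact ⟨closure_mono (fun x hx => hx.1) hl, hcon⟩
    have hfreq : ∃ᶠ x in 𝓝[Γ] l, ((θ : ℝ) : EReal) ≤ (f x : EReal) := by
      have h1 : ∃ᶠ x in 𝓝 l, x ∈ S := mem_closure_iff_frequently.1 hl
      rw [frequently_nhdsWithin_iff]
      exact h1.mono fun x hx => ⟨EReal.coe_le_coe_iff.2 hx.2.2, hx.1⟩
    have h2 : ((θ : ℝ) : EReal) ≤ limsup (fun x => (f x : EReal)) (𝓝[Γ] l) :=
      le_limsup_of_frequently_le hfreq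
    have h3 : limsup (fun x => (f x : EReal)) (𝓝[Γ] l) ≤ supBoundary Γ f :=
      le_iSup₂ (f := fun l (_ : l ∈ frontier Γ) => limsup (fun x => (f x : EReal)) (𝓝[Γ] l)) l hfr
    exact absurd (h2.trans h3) (not_le.2 hθ)
  obtain ⟨δ, hδ, hδΓ⟩ := hK.exists_cthickening_subset_open hΓ.isOpen hsub
  refine ⟨δ, hδ, fun l hl hR hfl => hδΓ ?_⟩
  refine Metric.mem_cthickening_of_dist_le _ l _ _ (subset_closure ⟨hl, hR, hfl⟩) ?_
  refine (dist_pi_le_iff hδ.le).2 fun i => ?_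
  rw [Real.dist_eq]; simp [abs_of_pos hδ]

/-- The quantitative nondegeneracy hypothesis gives one lower bound, above `sup_{∂Γ} f`, for all
right-hand sides. -/
theorem exists_threshold {M : Type*} (hK : ∃ ψ : M → ℝ, 0 < nondegeneracy Γ f ψ) (K : ℝ)
    [Nonempty M] :
    ∃ θ : ℝ, supBoundary Γ f < (θ : EReal) ∧ ∀ ψ : M → ℝ, (∀ p, |ψ p| ≤ K) →
      0 < nondegeneracy Γ f ψ → (nondegeneracy Γ f ψ)⁻¹ ≤ (K : EReal) → ∀ p, θ ≤ ψ p := by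
  rcases h : supBoundary Γ f with _ | b
  · exact ⟨-K, EReal.bot_lt_coe _, fun ψ hψ _ _ p => (abs_le.1 (hψ p)).1⟩
  rcases b with _ | b
  · exfalso
    obtain ⟨ψ, hψ⟩ := hK
    rw [nondegeneracy, h] at hψ
    change (0 : EReal) < _ - ⊤ at hψ
    rw [EReal.sub_top] at hψ
    exact not_lt_bot hψ
  · change supBoundary Γ f = (b : EReal) at h
    have hM : 0 < max K 1 := lt_max_of_lt_right one_pos
    refine ⟨b + (max K 1)⁻¹, ?_, ?_⟩
    · change (b : EReal) < _
      exact EReal.coe_lt_coe_iff.2 (by have := inv_pos.2 hM; linarith)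
    · intro ψ _ h0 hinv p
      have hle : nondegeneracy Γ f ψ ≤ ((ψ p - b : ℝ) : EReal) := by
        rw [nondegeneracy, h, EReal.coe_sub]
        exact EReal.sub_le_sub (iInf_le _ p) le_rfl
      induction hd : nondegeneracy Γ f ψ using EReal.rec with
      | bot => rw [hd] at h0; exact absurd h0 not_lt_bot
      | top => rw [hd] at hle; exact absurd hle (not_le.2 (EReal.coe_lt_top _))
      | coe d =>
        rw [hd] at hle h0 hinv
        have hd0 : 0 < d := by exact_mod_cast h0
        rw [← EReal.coe_inv] at hinv
        have h1 : d⁻¹ ≤ K := by exact_mod_cast hinv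
        have h2 : d ≤ ψ p - b := by exact_mod_cast hle
        have h3 : (max K 1)⁻¹ ≤ d := inv_le_of_inv_le₀ hd0 (h1.trans (le_max_left _ _))
        linarith

end Gamma

/-! ### Closed domains with regular boundary -/

/-- `{z ∈ Ω | 0 ≤ ρ z}` is a closed domain in `Ω` with boundary of class `C⁴`. -/
structure IsRegularDomain {E : Type*} [NormedAddCommGroup E] [NormedSpace ℝ E]
    (ρ : E → ℝ) (Ω : Set E) : Prop where
  isOpen : IsOpen Ω
  contDiffOn : ContDiffOn ℝ 4 ρ Ω
  regular : ∀ z ∈ Ω, ρ z = 0 → fderiv ℝ ρ z ≠ 0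

namespace IsRegularDomain

variable {E : Type*} [NormedAddCommGroup E] [NormedSpace ℝ E] {ρ : E → ℝ} {Ω : Set E}

/-- The closed domain `{z ∈ Ω | 0 ≤ ρ z}`, boundary included. -/
def dom (ρ : E → ℝ) (Ω : Set E) : Set E := {z | z ∈ Ω ∧ 0 ≤ ρ z}

/-- The boundary `{z ∈ Ω | ρ z = 0}` of the closed domain. -/
def bdry (ρ : E → ℝ) (Ω : Set E) : Set E := {z | z ∈ dom ρ Ω ∧ ρ z = 0}

theorem contDiffAt (h : IsRegularDomain ρ Ω) {z : E} (hz : z ∈ Ω) : ContDiffAt ℝ 4 ρ z :=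
  h.contDiffOn.contDiffAt (h.isOpen.mem_nhds hz)

theorem hasFDerivAt (h : IsRegularDomain ρ Ω) {z : E} (hz : z ∈ Ω) :
    HasFDerivAt ρ (fderiv ℝ ρ z) z :=
  ((h.contDiffAt hz).differentiableAt (by simp)).hasFDerivAt

theorem continuousAt (h : IsRegularDomain ρ Ω) {z : E} (hz : z ∈ Ω) : ContinuousAt ρ z :=
  (h.contDiffAt hz).continuousAt

theorem continuousAt_fderiv (h : IsRegularDomain ρ Ω) {z : E} (hz : z ∈ Ω) :
    ContinuousAt (fderiv ℝ ρ) z :=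
  ((h.contDiffAt hz).fderiv_right (m := 3) (by norm_num)).continuousAt

theorem dom_mem_nhds (h : IsRegularDomain ρ Ω) {z : E} (hz : z ∈ Ω) (hρ : 0 < ρ z) :
    dom ρ Ω ∈ 𝓝 z := by
  filter_upwards [h.isOpen.mem_nhds hz, (h.continuousAt hz).eventually (lt_mem_nhds hρ)]
    with y hy hy'
  exact ⟨hy, hy'.le⟩

theorem exists_inner (h : IsRegularDomain ρ Ω) {z : E} (hz : z ∈ Ω) (hρ : ρ z = 0) :
    ∃ N : E, 0 < fderiv ℝ ρ z N := by
  by_contra! hcon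
  refine h.regular z hz hρ ?_
  ext v
  have h1 := hcon v
  have h2 := hcon (-v)
  rw [map_neg] at h2
  simp; linarith

theorem tendsto_ray (z v : E) : Tendsto (fun t : ℝ => z + t • v) (𝓝[>] 0) (𝓝 z) := by
  have : Continuous fun t : ℝ => z + t • v := by fun_prop
  simpa using (this.tendsto 0).mono_left nhdsWithin_le_nhds

theorem hasDerivAt_ray (h : IsRegularDomain ρ Ω) {z : E} (hz : z ∈ Ω) (v : E) :
    HasDerivAt (fun t : ℝ => ρ (z + t • v)) (fderiv ℝ ρ z v) 0 := by
  have h1 : HasDerivAt (fun t : ℝ => z + t • v) v 0 := by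
    simpa using ((hasDerivAt_id (0 : ℝ)).smul_const v).const_add z
  have h2 : HasFDerivAt ρ (fderiv ℝ ρ z) (z + (0 : ℝ) • v) := by simpa using h.hasFDerivAt hz
  exact h2.comp_hasDerivAt (0 : ℝ) h1

theorem eventually_ray_pos (h : IsRegularDomain ρ Ω) {z : E} (hz : z ∈ Ω) (hρ : ρ z = 0) {v : E}
    (hv : 0 < fderiv ℝ ρ z v) : ∀ᶠ t in 𝓝[>] (0 : ℝ), z + t • v ∈ Ω ∧ 0 < ρ (z + t • v) := by
  have h1 := hasDerivAt_iff_tendsto_slope.1 (h.hasDerivAt_ray hz v)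
  have h2 := (h1.mono_left (nhdsGT_le_nhdsNE 0)).eventually (lt_mem_nhds hv)
  filter_upwards [h2, (tendsto_ray z v).eventually (h.isOpen.mem_nhds hz), self_mem_nhdsWithin]
    with t ht hΩ ht0
  refine ⟨hΩ, ?_⟩
  rw [slope_def_field] at ht
  simp only [zero_smul, add_zero, hρ, sub_zero] at ht
  exact (div_pos_iff_of_pos_right ht0).1 ht

theorem eventually_ray_neg (h : IsRegularDomain ρ Ω) {z : E} (hz : z ∈ Ω) (hρ : ρ z = 0) {v : E}
    (hv : fderiv ℝ ρ z v < 0) : ∀ᶠ t in 𝓝[>] (0 : ℝ), z + t • v ∈ Ω ∧ ρ (z + t • v) < 0 := by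
  have h1 := hasDerivAt_iff_tendsto_slope.1 (h.hasDerivAt_ray hz v)
  have h2 := (h1.mono_left (nhdsGT_le_nhdsNE 0)).eventually (gt_mem_nhds hv)
  filter_upwards [h2, (tendsto_ray z v).eventually (h.isOpen.mem_nhds hz), self_mem_nhdsWithin]
    with t ht hΩ ht0
  refine ⟨hΩ, ?_⟩
  rw [slope_def_field] at ht
  simp only [zero_smul, add_zero, hρ, sub_zero] at ht
  rcases div_neg_iff.1 ht with h | h
  · exact absurd h.2 (not_lt.2 (le_of_lt ht0))
  · exact h.1

theorem mem_tangentCone_dom (h : IsRegularDomain ρ Ω) {z : E} (hz : z ∈ Ω) (hρ : ρ z = 0) {v : E}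
    (hv : 0 < fderiv ℝ ρ z v) : v ∈ tangentConeAt ℝ (dom ρ Ω) z := by
  refine mem_tangentConeAt_of_add_smul_mem (l := 𝓝[>] (0 : ℝ)) (c := id)
    (tendsto_id'.2 (nhdsGT_le_nhdsNE 0)) ?_
  filter_upwards [h.eventually_ray_pos hz hρ hv] with t ht
  exact ⟨ht.1, ht.2.le⟩

theorem uniqueDiffOn (h : IsRegularDomain ρ Ω) : UniqueDiffOn ℝ (dom ρ Ω) := by
  intro z hz
  rcases hz.2.lt_or_eq with hpos | hzero
  · exact uniqueDiffWithinAt_of_mem_nhds (h.dom_mem_nhds hz.1 hpos)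
  · obtain ⟨N, hN⟩ := h.exists_inner hz.1 hzero.symm
    refine ⟨?_, subset_closure hz⟩
    have : Submodule.span ℝ (tangentConeAt ℝ (dom ρ Ω) z) = ⊤ := by
      rw [eq_top_iff]
      rintro w -
      set c : ℝ := (1 + |fderiv ℝ ρ z w|) / fderiv ℝ ρ z N
      have hc : 0 < c := by positivity
      have hcN : fderiv ℝ ρ z (c • N) = 1 + |fderiv ℝ ρ z w| := by
        rw [map_smul, smul_eq_mul]; exact div_mul_cancel₀ _ hN.ne'
      have h1 : w + c • N ∈ tangentConeAt ℝ (dom ρ Ω) z := by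
        apply h.mem_tangentCone_dom hz.1 hzero.symm
        rw [map_add, hcN]
        linarith [neg_abs_le (fderiv ℝ ρ z w)]
      have h2 : c • N ∈ tangentConeAt ℝ (dom ρ Ω) z := by
        apply h.mem_tangentCone_dom hz.1 hzero.symm
        rw [hcN]; positivity
      have := Submodule.sub_mem _ (Submodule.subset_span h1) (Submodule.subset_span (R := ℝ) h2)
      simpa using this
    rw [this]; exact dense_univ

theorem mem_closure_interior (h : IsRegularDomain ρ Ω) {z : E} (hz : z ∈ dom ρ Ω) :
    z ∈ closure (interior (dom ρ Ω)) := by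
  rcases hz.2.lt_or_eq with hpos | hzero
  · exact subset_closure (mem_interior_iff_mem_nhds.2 (h.dom_mem_nhds hz.1 hpos))
  · obtain ⟨N, hN⟩ := h.exists_inner hz.1 hzero.symm
    refine mem_closure_of_tendsto (tendsto_ray z N) ?_
    filter_upwards [h.eventually_ray_pos hz.1 hzero.symm hN] with t ht
    exact mem_interior_iff_mem_nhds.2 (h.dom_mem_nhds ht.1 ht.2)

/-- Vectors in the kernel of `dρ` are tangent to the boundary. -/
theorem mem_tangentCone_bdry (h : IsRegularDomain ρ Ω) {z : E} (hz : z ∈ Ω) (hρ : ρ z = 0) {v : E}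
    (hv : fderiv ℝ ρ z v = 0) : v ∈ tangentConeAt ℝ (bdry ρ Ω) z := by
  obtain ⟨N, hN⟩ := h.exists_inner hz hρ
  obtain ⟨r, hr, hball⟩ := Metric.isOpen_iff.1 h.isOpen z hz
  have key : ∀ ε : ℝ, 0 < ε → ∃ t s : ℝ, 0 < t ∧ t < ε ∧ |s| ≤ ε * t ∧
      z + (t • v + s • N) ∈ bdry ρ Ω := by
    intro ε hε
    have h1 := h.eventually_ray_pos hz hρ (v := v + ε • N) (by
      rw [map_add, hv, map_smul, smul_eq_mul]; simpa using mul_pos hε hN)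
    have h2 := h.eventually_ray_neg hz hρ (v := v - ε • N) (by
      rw [map_sub, hv, map_smul, smul_eq_mul]; simpa using mul_pos hε hN)
    have h3 : ∀ᶠ t in 𝓝[>] (0 : ℝ), t < min ε (r / (‖v‖ + ε * ‖N‖ + 1)) :=
      nhdsWithin_le_nhds (gt_mem_nhds (lt_min hε (by positivity)))
    obtain ⟨t, ⟨ht1, ht2⟩, ht3, ht0⟩ := ((h1.and h2).and (h3.and self_mem_nhdsWithin)).exists
    have ht0 : 0 < t := ht0
    have hin : ∀ s ∈ Icc (-(ε * t)) (ε * t), z + (t • v + s • N) ∈ Ω := by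
      intro s hs
      apply hball
      rw [mem_ball_iff_norm, add_sub_cancel_left]
      have h4 : ‖t • v + s • N‖ ≤ t * ‖v‖ + ε * t * ‖N‖ := by
        refine (norm_add_le _ _).trans (add_le_add ?_ ?_)
        · rw [norm_smul, Real.norm_of_nonneg ht0.le]
        · rw [norm_smul, Real.norm_eq_abs]
          exact mul_le_mul_of_nonneg_right (abs_le.2 hs) (norm_nonneg _)
      have h5 : t * (‖v‖ + ε * ‖N‖ + 1) < r :=
        (lt_div_iff₀ (by positivity)).1 (ht3.trans_le (min_le_right _ _))
      nlinarith
    have hcont : ContinuousOn (fun s : ℝ => ρ (z + (t • v + s • N))) (Icc (-(ε * t)) (ε * t)) := by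
      intro s hs
      have hc : Continuous fun s : ℝ => z + (t • v + s • N) := by fun_prop
      exact (ContinuousAt.comp (f := fun s : ℝ => z + (t • v + s • N))
        (h.continuousAt (hin s hs)) hc.continuousAt).continuousWithinAt
    have hle : -(ε * t) ≤ ε * t := by have := mul_pos hε ht0; linarith
    have hiv := intermediate_value_Icc hle hcont
    have h0 : (0 : ℝ) ∈ Icc (ρ (z + (t • v + (-(ε * t)) • N))) (ρ (z + (t • v + (ε * t) • N))) := by
      constructor
      · convert ht2.2.le using 3
        rw [smul_sub, smul_smul, neg_smul, sub_eq_add_neg, mul_comm]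
      · convert ht1.2.le using 3
        rw [smul_add, smul_smul, mul_comm]
    obtain ⟨s, hs, hs0⟩ := hiv h0
    exact ⟨t, s, ht0, ht3.trans_le (min_le_left _ _), abs_le.2 hs, ⟨hin s hs, hs0.ge⟩, hs0⟩
  choose t s ht0 htε hs hmem using fun n : ℕ => key (1 / ((n : ℝ) + 1)) (by positivity)
  have hε := tendsto_one_div_add_atTop_nhds_zero_nat (𝕜 := ℝ)
  have htt : Tendsto t atTop (𝓝 0) := squeeze_zero (fun n => (ht0 n).le) (fun n => (htε n).le) hε
  have hsd : Tendsto (fun n => s n / t n) atTop (𝓝 0) := by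
    refine squeeze_zero_norm (fun n => ?_) hε
    rw [Real.norm_eq_abs, abs_div, abs_of_pos (ht0 n), div_le_iff₀ (ht0 n)]
    exact hs n
  have hss : Tendsto s atTop (𝓝 0) := by
    have := hsd.mul htt
    rw [zero_mul] at this
    refine this.congr fun n => div_mul_cancel₀ _ (ht0 n).ne'
  refine mem_tangentConeAt_of_seq atTop (fun n => (t n)⁻¹) (fun n => t n • v + s n • N) ?_
    (Eventually.of_forall hmem) ?_
  · simpa using (htt.smul_const v).add (hss.smul_const N)
  · have : Tendsto (fun n => v + (s n / t n) • N) atTop (𝓝 (v + (0 : ℝ) • N)) :=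
      tendsto_const_nhds.add (hsd.smul_const N)
    rw [zero_smul, add_zero] at this
    refine this.congr fun n => ?_
    rw [smul_add, smul_smul, smul_smul, inv_mul_cancel₀ (ht0 n).ne', one_smul, div_eq_inv_mul]

/-- The differential of a function which is constant on the boundary vanishes on tangent vectors. -/
theorem fderivWithin_eq_zero_of_const (h : IsRegularDomain ρ Ω) {F : Type*} [NormedAddCommGroup F]
    [NormedSpace ℝ F] {H : E → F} {L : E →L[ℝ] F} {z : E} (hz : z ∈ Ω) (hρ : ρ z = 0)
    (hH : HasFDerivWithinAt H L (dom ρ Ω) z) (hc : ∀ᶠ y in 𝓝[bdry ρ Ω] z, H y = H z) {v : E}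
    (hv : fderiv ℝ ρ z v = 0) : L v = 0 := by
  have hmem : z ∈ bdry ρ Ω := ⟨⟨hz, hρ.ge⟩, hρ⟩
  have h1 : HasFDerivWithinAt H L (bdry ρ Ω) z := hH.mono fun x hx => hx.1
  have h2 : HasFDerivWithinAt H (0 : E →L[ℝ] F) (bdry ρ Ω) z :=
    (hasFDerivWithinAt_const (H z) z _).congr_of_eventuallyEq hc rfl
  simpa using h1.unique_on h2 (h.mem_tangentCone_bdry hz hρ hv)

theorem eq_mul_of_ker {z N : E} (hN : fderiv ℝ ρ z N ≠ 0) {L : E →L[ℝ] ℝ}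
    (hL : ∀ v, fderiv ℝ ρ z v = 0 → L v = 0) (w : E) :
    L w = L N / fderiv ℝ ρ z N * fderiv ℝ ρ z w := by
  have := hL (w - (fderiv ℝ ρ z w / fderiv ℝ ρ z N) • N) (by
    rw [map_sub, map_smul, smul_eq_mul, div_mul_cancel₀ _ hN, sub_self])
  rw [map_sub, map_smul, smul_eq_mul] at this
  field_simp at this ⊢
  linarith

end IsRegularDomain

/-! ### Charts and coordinate changes -/

theorem two_le_infty : (2 : ℕ∞ω) ≤ ∞ := by
  have h : (2 : ℕ∞) ≤ ⊤ := le_top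
  exact WithTop.coe_le_coe.2 h

/-- The complex linear functional with real part `F`. -/
def cplx {n : ℕ} (F : CSpace n →L[ℝ] ℝ) : CSpace n →ₗ[ℂ] ℂ where
  toFun x := (F x : ℂ) - Complex.I * (F (Complex.I • x) : ℂ)
  map_add' x y := by simp only [smul_add, map_add]; push_cast; ring
  map_smul' c x := by
    have hc : ∀ y : CSpace n, c • y = c.re • y + c.im • (Complex.I • y) := by
      intro y
      ext i
      simp only [PiLp.smul_apply, PiLp.add_apply, smul_eq_mul, Complex.real_smul]
      conv_lhs => rw [← Complex.re_add_im c]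
      ring
    have hI : Complex.I • (Complex.I • x) = -x := by
      rw [smul_smul, Complex.I_mul_I, neg_one_smul]
    have h1 : F (c • x) = c.re * F x + c.im * F (Complex.I • x) := by
      rw [hc, map_add, F.map_smul, F.map_smul, smul_eq_mul, smul_eq_mul]
    have h2 : F (Complex.I • c • x) = c.re * F (Complex.I • x) - c.im * F x := by
      rw [smul_comm, hc, map_add, F.map_smul, F.map_smul, hI, map_neg, smul_eq_mul, smul_eq_mul]
      ring
    rw [h1, h2, RingHom.id_apply, smul_eq_mul]
    conv_rhs => rw [← Complex.re_add_im c]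
    push_cast
    linear_combination ((c.im : ℂ) * (F (Complex.I • x))) * Complex.I_sq

theorem cplx_re {n : ℕ} (F : CSpace n →L[ℝ] ℝ) (x) : (cplx F x).re = F x := by
  simp [cplx]

theorem cplx_eq_zero_iff {n : ℕ} (F : CSpace n →L[ℝ] ℝ) (x) :
    cplx F x = 0 ↔ F x = 0 ∧ F (Complex.I • x) = 0 := by
  rw [Complex.ext_iff]; simp [cplx]

theorem finrank_ker_cplx {m : ℕ} {F : CSpace (m + 1) →L[ℝ] ℝ} (hF : F ≠ 0) :
    Module.finrank ℂ (LinearMap.ker (cplx F)) = m := by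
  have h0 : (cplx F : Module.Dual ℂ (CSpace (m + 1))) ≠ 0 := by
    intro h
    apply hF
    ext x
    rw [← cplx_re, h]; simp
  have := Module.Dual.finrank_ker_add_one_of_ne_zero h0
  rw [finrank_euclideanSpace_fin] at this
  omega

namespace ComplexManifoldWithBoundary

variable {n : ℕ} {M : Type*} [TopologicalSpace M] (X : ComplexManifoldWithBoundary n M)

theorem regular (a : Fin X.N) : IsRegularDomain (X.rho a) (X.ambient a) :=
  ⟨X.isOpen_ambient a, X.rho_contDiffOn a, X.rho_regular a⟩

theorem target_eq_dom (a : Fin X.N) :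
    (X.chart a).target = IsRegularDomain.dom (X.rho a) (X.ambient a) := X.target_eq a

theorem coordBoundary_eq (a : Fin X.N) :
    X.coordBoundary a = IsRegularDomain.bdry (X.rho a) (X.ambient a) := by
  ext z; simp [coordBoundary, IsRegularDomain.bdry, target_eq_dom]

theorem mem_target {a : Fin X.N} {z : CSpace n} :
    z ∈ (X.chart a).target ↔ z ∈ X.ambient a ∧ 0 ≤ X.rho a z := by
  rw [X.target_eq a]; rfl

theorem uniqueDiffOn_target (a : Fin X.N) : UniqueDiffOn ℝ (X.chart a).target := by
  rw [target_eq_dom]; exact (X.regular a).uniqueDiffOn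

theorem target_mem_nhds {a : Fin X.N} {z : CSpace n} (hz : z ∈ (X.chart a).target)
    (h : 0 < X.rho a z) : (X.chart a).target ∈ 𝓝 z := by
  rw [target_eq_dom] at *
  exact (X.regular a).dom_mem_nhds hz.1 h

theorem exists_open_overlap (a b : Fin X.N) :
    ∃ u, IsOpen u ∧ X.overlap a b = (X.chart a).target ∩ u := by
  obtain ⟨u, hu, h⟩ := continuousOn_iff'.1 (X.continuousOn_chart_symm a) _ (X.isOpen_source b)
  exact ⟨u, hu, by rw [overlap, inter_comm, h, inter_comm]⟩

theorem overlap_mem_nhdsWithin {a b : Fin X.N} {z : CSpace n} (hz : z ∈ X.overlap a b) :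
    X.overlap a b ∈ 𝓝[(X.chart a).target] z := by
  obtain ⟨u, hu, h⟩ := X.exists_open_overlap a b
  rw [h] at hz ⊢
  exact inter_mem self_mem_nhdsWithin (mem_nhdsWithin_of_mem_nhds (hu.mem_nhds hz.2))

theorem uniqueDiffOn_overlap (a b : Fin X.N) : UniqueDiffOn ℝ (X.overlap a b) := by
  obtain ⟨u, hu, h⟩ := X.exists_open_overlap a b
  rw [h]
  exact (X.uniqueDiffOn_target a).inter hu

theorem overlap_subset (a b : Fin X.N) : X.overlap a b ⊆ (X.chart a).target :=
  inter_subset_left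

theorem transition_mem {a b : Fin X.N} {z : CSpace n} (hz : z ∈ X.overlap a b) :
    X.transition a b z ∈ X.overlap b a := by
  refine ⟨(X.chart b).map_source hz.2, ?_⟩
  simp only [mem_preimage, transition]
  rw [(X.chart b).left_inv hz.2]
  exact (X.chart a).map_target hz.1

theorem transition_transition {a b : Fin X.N} {z : CSpace n} (hz : z ∈ X.overlap a b) :
    X.transition b a (X.transition a b z) = z := by
  simp only [transition]
  rw [(X.chart b).left_inv hz.2, (X.chart a).right_inv hz.1]

theorem chart_mem_overlap {a b : Fin X.N} {p : M} (ha : p ∈ (X.chart a).source)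
    (hb : p ∈ (X.chart b).source) : X.chart a p ∈ X.overlap a b := by
  refine ⟨(X.chart a).map_source ha, ?_⟩
  simp only [mem_preimage]
  rwa [(X.chart a).left_inv ha]

theorem transition_chart {a b : Fin X.N} {p : M} (ha : p ∈ (X.chart a).source) :
    X.transition a b (X.chart a p) = X.chart b p := by
  simp only [transition]
  rw [(X.chart a).left_inv ha]

theorem contDiffOn_transition (a b : Fin X.N) :
    ContDiffOn ℝ ∞ (X.transition a b) (X.overlap a b) := X.transition_contDiffOn a b

/-- The differential of a coordinate change. -/
def dT (a b : Fin X.N) (z : CSpace n) : CSpace n →L[ℝ] CSpace n :=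
  fderivWithin ℝ (X.transition a b) (X.overlap a b) z

theorem hasFDerivWithinAt_transition {a b : Fin X.N} {z : CSpace n} (hz : z ∈ X.overlap a b) :
    HasFDerivWithinAt (X.transition a b) (X.dT a b z) (X.overlap a b) z :=
  ((X.contDiffOn_transition a b).differentiableOn (by simp) z hz).hasFDerivWithinAt

theorem dT_I {a b : Fin X.N} {z : CSpace n} (hz : z ∈ X.overlap a b) (v : CSpace n) :
    X.dT a b z (Complex.I • v) = Complex.I • X.dT a b z v :=
  X.transition_holomorphic a b z hz v

theorem dT_dT {a b : Fin X.N} {z : CSpace n} (hz : z ∈ X.overlap a b) (v : CSpace n) :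
    X.dT b a (X.transition a b z) (X.dT a b z v) = v := by
  have h1 := (X.hasFDerivWithinAt_transition (X.transition_mem hz)).comp z
    (X.hasFDerivWithinAt_transition hz) fun y hy => X.transition_mem hy
  have h2 : HasFDerivWithinAt (X.transition b a ∘ X.transition a b)
      (ContinuousLinearMap.id ℝ _) (X.overlap a b) z :=
    (hasFDerivWithinAt_id z _).congr (fun y hy => X.transition_transition hy)
      (X.transition_transition hz)
  have := (X.uniqueDiffOn_overlap a b z hz).eq h1 h2
  exact congrArg (fun L : CSpace n →L[ℝ] CSpace n => L v) this

theorem dT_dT' {a b : Fin X.N} {z : CSpace n} (hz : z ∈ X.overlap a b) (v : CSpace n) :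
    X.dT a b z (X.dT b a (X.transition a b z) v) = v := by
  have := X.dT_dT (X.transition_mem hz) v
  rwa [X.transition_transition hz] at this

theorem rho_transition_eq_zero {a b : Fin X.N} {z : CSpace n} (hz : z ∈ X.overlap a b)
    (h : X.rho b (X.transition a b z) = 0) : X.rho a z = 0 := by
  by_contra hne
  have hpos : 0 < X.rho a z := lt_of_le_of_ne (X.mem_target.1 hz.1).2 (Ne.symm hne)
  have hnhds : X.overlap a b ∈ 𝓝 z := by
    have := X.overlap_mem_nhdsWithin hz
    rwa [nhdsWithin_eq_nhds.2 (X.target_mem_nhds hz.1 hpos)] at this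
  have hTz := X.transition_mem hz
  have hamb := (X.mem_target.1 hTz.1).1
  -- The function `ρ_b ∘ T` is nonnegative and vanishes at the interior point `z`.
  have hmin : IsLocalMin (fun y => X.rho b (X.transition a b y)) z := by
    filter_upwards [hnhds] with y hy
    rw [h]
    exact (X.mem_target.1 (X.transition_mem hy).1).2
  have hd : HasFDerivAt (fun y => X.rho b (X.transition a b y))
      ((fderiv ℝ (X.rho b) (X.transition a b z)).comp (X.dT a b z)) z :=
    ((X.regular b).hasFDerivAt hamb).comp z
      ((X.hasFDerivWithinAt_transition hz).hasFDerivAt hnhds)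
  have h0 := hmin.hasFDerivAt_eq_zero hd
  refine X.rho_regular b _ hamb h ?_
  ext v
  have := congrArg (fun L : CSpace n →L[ℝ] ℝ => L (X.dT b a (X.transition a b z) v)) h0
  simpa [X.dT_dT' hz] using this

theorem rho_transition_eq_zero_iff {a b : Fin X.N} {z : CSpace n} (hz : z ∈ X.overlap a b) :
    X.rho b (X.transition a b z) = 0 ↔ X.rho a z = 0 := by
  refine ⟨X.rho_transition_eq_zero hz, fun h => ?_⟩
  apply X.rho_transition_eq_zero (X.transition_mem hz)
  rwa [X.transition_transition hz]

theorem mem_boundary_iff {a : Fin X.N} {p : M} (hp : p ∈ (X.chart a).source) :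
    p ∈ X.boundary ↔ X.rho a (X.chart a p) = 0 := by
  refine ⟨?_, fun h => ⟨a, hp, h⟩⟩
  rintro ⟨b, hb, h⟩
  apply X.rho_transition_eq_zero (X.chart_mem_overlap hp hb)
  rwa [X.transition_chart hp]

theorem symm_mem_boundary_iff {a : Fin X.N} {z : CSpace n} (hz : z ∈ (X.chart a).target) :
    (X.chart a).symm z ∈ X.boundary ↔ X.rho a z = 0 := by
  rw [X.mem_boundary_iff ((X.chart a).map_target hz), (X.chart a).right_inv hz]

theorem dT_tangent {a b : Fin X.N} {z : CSpace n} (hz : z ∈ X.overlap a b)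
    (h : X.rho a z = 0) {v : CSpace n} (hv : v ∈ X.boundaryTangent a z) :
    X.dT a b z v ∈ X.boundaryTangent b (X.transition a b z) := by
  have hTz := X.transition_mem hz
  have hamb := (X.mem_target.1 hTz.1).1
  have h1 : HasFDerivWithinAt (fun y => X.rho b (X.transition a b y))
      ((fderiv ℝ (X.rho b) (X.transition a b z)).comp (X.dT a b z)) (X.overlap a b) z :=
    ((X.regular b).hasFDerivAt hamb).comp_hasFDerivWithinAt z (X.hasFDerivWithinAt_transition hz)
  have h2 := h1.mono_of_mem_nhdsWithin (X.overlap_mem_nhdsWithin hz)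
  rw [target_eq_dom] at h2
  refine (X.regular a).fderivWithin_eq_zero_of_const (X.mem_target.1 hz.1).1 h h2 ?_ hv
  have h3 := X.overlap_mem_nhdsWithin hz
  rw [target_eq_dom] at h3
  have h4 := nhdsWithin_mono z
    (fun y hy => hy.1 : IsRegularDomain.bdry (X.rho a) (X.ambient a) ⊆ _) h3
  filter_upwards [h4, self_mem_nhdsWithin] with y hy hy'
  rw [(X.rho_transition_eq_zero_iff hy).2 hy'.2, (X.rho_transition_eq_zero_iff hz).2 h]

theorem dT_holTangent {a b : Fin X.N} {z : CSpace n} (hz : z ∈ X.overlap a b)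
    (h : X.rho a z = 0) {v : CSpace n} (hv : v ∈ X.holTangent a z) :
    X.dT a b z v ∈ X.holTangent b (X.transition a b z) := by
  refine ⟨X.dT_tangent hz h hv.1, ?_⟩
  rw [← X.dT_I hz]
  exact X.dT_tangent hz h hv.2

/-- `T^{1,0}_{∂M}` as a complex subspace. -/
def holSub (a : Fin X.N) (z : CSpace n) : Submodule ℂ (CSpace n) :=
  LinearMap.ker (cplx (fderiv ℝ (X.rho a) z))

theorem coe_holSub (a : Fin X.N) (z : CSpace n) :
    (X.holSub a z : Set (CSpace n)) = X.holTangent a z := by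
  ext v
  simp [holSub, cplx_eq_zero_iff, holTangent, boundaryTangent]

variable {X}

theorem coord_transition (v : M → ℝ) {a b : Fin X.N} {z : CSpace n} (hz : z ∈ X.overlap a b) :
    X.coord v b (X.transition a b z) = X.coord v a z := by
  simp only [coord, transition]
  rw [(X.chart b).left_inv hz.2]

theorem coord_chart (v : M → ℝ) {a : Fin X.N} {p : M} (hp : p ∈ (X.chart a).source) :
    X.coord v a (X.chart a p) = v p := by
  simp only [coord]
  rw [(X.chart a).left_inv hp]

theorem IsCk.overlap {k : ℕ} {v : M → ℝ} (hv : X.IsCk k v) (a b : Fin X.N) :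
    ContDiffOn ℝ k (X.coord v a) (X.overlap a b) := (hv a).mono (X.overlap_subset a b)

theorem fderivWithin_coord_overlap {v : M → ℝ} (hv : X.IsCk 2 v) {a b : Fin X.N} {z : CSpace n}
    (hz : z ∈ X.overlap a b) :
    fderivWithin ℝ (X.coord v a) (X.overlap a b) z
      = (fderivWithin ℝ (X.coord v b) (X.overlap b a) (X.transition a b z)).comp (X.dT a b z) := by
  have h1 := ((hv.overlap b a).differentiableOn (by simp) _ (X.transition_mem hz)).hasFDerivWithinAt
  have h2 := h1.comp z (X.hasFDerivWithinAt_transition hz) fun y hy => X.transition_mem hy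
  exact (h2.congr (fun y hy => (coord_transition v hy).symm)
    (coord_transition v hz).symm).fderivWithin (X.uniqueDiffOn_overlap a b z hz)

theorem realHessian_eq_overlap {v : M → ℝ} (hv : X.IsCk 2 v) {a b : Fin X.N} {z : CSpace n}
    (hz : z ∈ X.overlap a b) :
    fderivWithin ℝ (fderivWithin ℝ (X.coord v a) (X.chart a).target) (X.chart a).target z
      = fderivWithin ℝ (fderivWithin ℝ (X.coord v a) (X.overlap a b)) (X.overlap a b) z :=
  fderivWithin_fderivWithin_eq_of_mem_nhdsWithin (X.overlap_mem_nhdsWithin hz)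
    (hv.overlap a b z hz) (X.uniqueDiffOn_target a) (X.uniqueDiffOn_overlap a b) hz.1

theorem realHessian_transition {v : M → ℝ} (hv : X.IsCk 2 v) {a b : Fin X.N} {z : CSpace n}
    (hz : z ∈ X.overlap a b) (ξ ζ : CSpace n) :
    realHessian (X.coord v a) (X.chart a).target z ξ ζ
      = realHessian (X.coord v b) (X.chart b).target (X.transition a b z) (X.dT a b z ξ)
          (X.dT a b z ζ)
        + fderivWithin ℝ (X.coord v b) (X.overlap b a) (X.transition a b z)
          (fderivWithin ℝ (X.dT a b) (X.overlap a b) z ξ ζ) := by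
  have hTz := X.transition_mem hz
  rw [realHessian, realHessian, realHessian_eq_overlap hv hz, realHessian_eq_overlap hv hTz]
  have h1 : HasFDerivWithinAt (fderivWithin ℝ (X.coord v b) (X.overlap b a))
      (fderivWithin ℝ (fderivWithin ℝ (X.coord v b) (X.overlap b a)) (X.overlap b a)
        (X.transition a b z)) (X.overlap b a) (X.transition a b z) :=
    (((hv.overlap b a).fderivWithin (m := 1) (X.uniqueDiffOn_overlap b a)
      (by norm_num)).differentiableOn (by simp) _ hTz).hasFDerivWithinAt
  have h2 := h1.comp z (X.hasFDerivWithinAt_transition hz) fun y hy => X.transition_mem hy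
  have h3 : HasFDerivWithinAt (X.dT a b) (fderivWithin ℝ (X.dT a b) (X.overlap a b) z)
      (X.overlap a b) z :=
    (((X.contDiffOn_transition a b).fderivWithin (m := 1) (X.uniqueDiffOn_overlap a b)
      (by norm_num [two_le_infty])).differentiableOn (by simp) _ hz).hasFDerivWithinAt
  have h4 := (h2.clm_comp h3).congr (fun y hy => fderivWithin_coord_overlap hv hy)
    (fderivWithin_coord_overlap hv hz)
  rw [h4.fderivWithin (X.uniqueDiffOn_overlap a b z hz)]
  simp [add_comm]

theorem overlap_mem_closure_interior {a b : Fin X.N} {z : CSpace n} (hz : z ∈ X.overlap a b) :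
    z ∈ closure (interior (X.overlap a b)) := by
  obtain ⟨u, hu, h⟩ := X.exists_open_overlap a b
  rw [h] at hz ⊢
  have h1 : z ∈ closure (interior (X.chart a).target) := by
    rw [target_eq_dom]
    exact (X.regular a).mem_closure_interior (by rw [← target_eq_dom]; exact hz.1)
  rw [interior_inter, hu.interior_eq, inter_comm]
  exact hu.inter_closure ⟨hz.2, h1⟩

theorem complexHessian_transition {v : M → ℝ} (hv : X.IsCk 2 v) {a b : Fin X.N} {z : CSpace n}
    (hz : z ∈ X.overlap a b) (ξ ζ : CSpace n) :
    X.complexHessian v a z ξ ζ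
      = X.complexHessian v b (X.transition a b z) (X.dT a b z ξ) (X.dT a b z ζ) := by
  set D2 := fderivWithin ℝ (X.dT a b) (X.overlap a b) z with hD2
  have hdiff : DifferentiableWithinAt ℝ (X.dT a b) (X.overlap a b) z :=
    ((X.contDiffOn_transition a b).fderivWithin (m := 1) (X.uniqueDiffOn_overlap a b)
      (by norm_num [two_le_infty])).differentiableOn (by simp) _ hz
  have hsymm : ∀ ξ ζ, D2 ξ ζ = D2 ζ ξ :=
    (X.contDiffOn_transition a b z hz).isSymmSndFDerivWithinAt (by simp [two_le_infty])
      (X.uniqueDiffOn_overlap a b) (overlap_mem_closure_interior hz) hz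
  -- The second derivative of a holomorphic map is complex bilinear.
  have hI : ∀ ξ ζ, D2 ξ (Complex.I • ζ) = Complex.I • D2 ξ ζ := by
    intro ξ ζ
    have h1 : HasFDerivWithinAt (fun y => X.dT a b y (Complex.I • ζ))
        (D2.flip (Complex.I • ζ)) (X.overlap a b) z := by
      have := hdiff.hasFDerivWithinAt.clm_apply
        (hasFDerivWithinAt_const (Complex.I • ζ) z (X.overlap a b))
      refine this.congr_fderiv ?_
      ext; simp [hD2]
    have h2 : HasFDerivWithinAt (fun y => Complex.I • X.dT a b y ζ)
        (Complex.I • D2.flip ζ) (X.overlap a b) z := by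
      have := (hdiff.hasFDerivWithinAt.clm_apply
        (hasFDerivWithinAt_const ζ z (X.overlap a b))).const_smul Complex.I
      refine this.congr_fderiv ?_
      ext; simp [hD2]
    have h3 := (X.uniqueDiffOn_overlap a b z hz).eq h1
      (h2.congr (fun y hy => X.dT_I hy ζ) (X.dT_I hz ζ))
    simpa using congrArg (fun L : CSpace n →L[ℝ] CSpace n => L ξ) h3
  have hI' : ∀ ξ ζ, D2 (Complex.I • ξ) ζ = Complex.I • D2 ξ ζ := by
    intro ξ ζ; rw [hsymm, hI, hsymm]
  simp only [complexHessian, leviPart, realHessian_transition hv hz, ← hD2, hI, hI',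
    X.dT_I hz]
  rw [smul_smul, Complex.I_mul_I, neg_one_smul, map_neg]
  push_cast
  ring

end ComplexManifoldWithBoundary

variable {n : ℕ} {M : Type*} [TopologicalSpace M] {X : ComplexManifoldWithBoundary n M}

open ComplexManifoldWithBoundary

theorem gForm_transition (χ : RealForm11 X) {v : M → ℝ} (hv : X.IsCk 2 v) {a b : Fin X.N}
    {z : CSpace n} (hz : z ∈ X.overlap a b) (ξ ζ : CSpace n) :
    HermitianMetric.gForm χ v a z ξ ζ
      = HermitianMetric.gForm χ v b (X.transition a b z) (X.dT a b z ξ) (X.dT a b z ζ) := by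
  simp only [HermitianMetric.gForm]
  rw [complexHessian_transition hv hz, χ.compat a b z hz]
  rfl

theorem realHessian_symm {v : M → ℝ} (hv : X.IsCk 2 v) {a : Fin X.N} {z : CSpace n}
    (hz : z ∈ (X.chart a).target) (ξ ζ : CSpace n) :
    realHessian (X.coord v a) (X.chart a).target z ξ ζ
      = realHessian (X.coord v a) (X.chart a).target z ζ ξ := by
  refine (hv a z hz).isSymmSndFDerivWithinAt (by simp) (X.uniqueDiffOn_target a) ?_ hz ξ ζ
  rw [X.target_eq_dom a] at *
  exact (X.regular a).mem_closure_interior hz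

theorem isHermForm_complexHessian {v : M → ℝ} (hv : X.IsCk 2 v) {a : Fin X.N} {z : CSpace n}
    (hz : z ∈ (X.chart a).target) : IsHermForm (X.complexHessian v a z) :=
  isHermForm_leviPart (fun x y z => by simp [realHessian]) (fun c x z => by simp [realHessian])
    (realHessian_symm hv hz)

theorem isHermForm_gForm (χ : RealForm11 X) {v : M → ℝ} (hv : X.IsCk 2 v) {a : Fin X.N}
    {z : CSpace n} (hz : z ∈ (X.chart a).target) : IsHermForm (HermitianMetric.gForm χ v a z) :=
  (isHermForm_sesq (χ.isHermitian a z hz)).add (isHermForm_complexHessian hv hz)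

theorem HermitianMetric.isPosForm (g : HermitianMetric X) {a : Fin X.N} {z : CSpace n}
    (hz : z ∈ (X.chart a).target) : IsPosForm (sesq (g.comp a z)) :=
  ⟨isHermForm_sesq (g.isHermitian a z hz), fun v hv => g.pos a z hz v hv⟩

/-- The eigenvalues on `T^{1,0}_{∂M}` of a combination of two forms `𝔤[u]` and `𝔤[v]` do not depend
on the chart. -/
theorem eigenTuple_transition (g : HermitianMetric X) (χ : RealForm11 X) {u v : M → ℝ}
    (hu : X.IsCk 2 u) (hv : X.IsCk 2 v) {a b : Fin X.N} {z : CSpace n} (hz : z ∈ X.overlap a b)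
    (h0 : X.rho a z = 0) (k : ℕ) (c : ℂ) :
    eigenTuple k (sesq (g.comp a z))
        (fun x y => HermitianMetric.gForm χ u a z x y + c * HermitianMetric.gForm χ v a z x y)
        (X.holTangent a z)
      = eigenTuple k (sesq (g.comp b (X.transition a b z)))
        (fun x y => HermitianMetric.gForm χ u b (X.transition a b z) x y
          + c * HermitianMetric.gForm χ v b (X.transition a b z) x y)
        (X.holTangent b (X.transition a b z)) := by
  refine eigenTuple_congr (X.dT a b z) (X.dT b a (X.transition a b z))
    (fun x hx => X.dT_holTangent hz h0 hx) (fun x hx => ?_) (fun x _ => X.dT_dT' hz x)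
    (fun x _ y _ => (g.compat a b z hz x y).symm) (fun x _ y _ => ?_)
  · have := X.dT_holTangent (X.transition_mem hz) ((X.rho_transition_eq_zero_iff hz).2 h0) hx
    rwa [X.transition_transition hz] at this
  · rw [gForm_transition χ hu hz, gForm_transition χ hv hz]

/-! ### Unitary frames adapted to the level sets of the defining function -/

open ComplexManifoldWithBoundary

theorem cplx_im {n : ℕ} (F : CSpace n →L[ℝ] ℝ) (x) :
    (cplx F x).im = - F (Complex.I • x) := by
  simp [cplx]

section smooth

variable {n : ℕ} {s : Set (CSpace n)} {q : CSpace n}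

theorem contDiffWithinAt_coe {k : ℕ∞ω} {Y : CSpace n → CSpace n} (hY : ContDiffWithinAt ℝ k Y s q)
    (i : Fin n) : ContDiffWithinAt ℝ k (fun z => Y z i) s q :=
  ((EuclideanSpace.proj (𝕜 := ℂ) i).restrictScalars ℝ).contDiff.contDiffAt.comp_contDiffWithinAt
    (g := (EuclideanSpace.proj (𝕜 := ℂ) i).restrictScalars ℝ) q hY

theorem contDiffWithinAt_conj {k : ℕ∞ω} {c : CSpace n → ℂ} (hc : ContDiffWithinAt ℝ k c s q) :
    ContDiffWithinAt ℝ k (fun z => (starRingEnd ℂ) (c z)) s q :=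
  Complex.conjCLE.toContinuousLinearMap.contDiff.contDiffAt.comp_contDiffWithinAt
    (g := fun w : ℂ => (starRingEnd ℂ) w) q hc

theorem contDiffWithinAt_re {k : ℕ∞ω} {c : CSpace n → ℂ} (hc : ContDiffWithinAt ℝ k c s q) :
    ContDiffWithinAt ℝ k (fun z => (c z).re) s q :=
  Complex.reCLM.contDiff.contDiffAt.comp_contDiffWithinAt (g := fun w : ℂ => w.re) q hc

theorem contDiffWithinAt_ofReal {k : ℕ∞ω} {c : CSpace n → ℝ} (hc : ContDiffWithinAt ℝ k c s q) :
    ContDiffWithinAt ℝ k (fun z => (c z : ℂ)) s q :=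
  Complex.ofRealCLM.contDiff.contDiffAt.comp_contDiffWithinAt (g := fun w : ℝ => (w : ℂ)) q hc

theorem contDiffWithinAt_csmul {k : ℕ∞ω} {c : CSpace n → ℂ} {Y : CSpace n → CSpace n}
    (hc : ContDiffWithinAt ℝ k c s q) (hY : ContDiffWithinAt ℝ k Y s q) :
    ContDiffWithinAt ℝ k (fun z => c z • Y z) s q := hc.smul hY

theorem contDiffWithinAt_sesq {k : ℕ∞ω} {Θ : CSpace n → Matrix (Fin n) (Fin n) ℂ}
    {Y Z : CSpace n → CSpace n} (hΘ : ∀ i j, ContDiffWithinAt ℝ k (fun z => Θ z i j) s q)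
    (hY : ContDiffWithinAt ℝ k Y s q) (hZ : ContDiffWithinAt ℝ k Z s q) :
    ContDiffWithinAt ℝ k (fun z => sesq (Θ z) (Y z) (Z z)) s q := by
  unfold sesq
  refine ContDiffWithinAt.sum fun i _ => ContDiffWithinAt.sum fun j _ => ?_
  exact ((hΘ i j).mul (contDiffWithinAt_coe hY i)).mul
    (contDiffWithinAt_conj (contDiffWithinAt_coe hZ j))

theorem contDiffWithinAt_cplx {k : ℕ∞ω} {F : CSpace n → CSpace n →L[ℝ] ℝ}
    {Y : CSpace n → CSpace n} (hF : ContDiffWithinAt ℝ k F s q)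
    (hY : ContDiffWithinAt ℝ k Y s q) :
    ContDiffWithinAt ℝ k (fun z => cplx (F z) (Y z)) s q := by
  have h1 := contDiffWithinAt_ofReal (hF.clm_apply hY)
  have h2 := contDiffWithinAt_ofReal
    (hF.clm_apply (contDiffWithinAt_csmul (c := fun _ => Complex.I) contDiffWithinAt_const hY))
  exact h1.sub (contDiffWithinAt_const.mul h2)

/-- One Gram–Schmidt step, with smooth dependence on the point. -/
theorem exists_unitary_snoc_field {k : ℕ} {Θ : CSpace n → Matrix (Fin n) (Fin n) ℂ}
    (hΘ : ∀ i j, ContDiffWithinAt ℝ 2 (fun z => Θ z i j) s q)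
    (hpos : ∀ z ∈ s, IsPosForm (sesq (Θ z))) (hq : q ∈ s) {E : Fin k → CSpace n → CSpace n}
    (hE : ∀ i, ContDiffWithinAt ℝ 2 (E i) s q)
    (hEu : ∀ᶠ z in 𝓝[s] q, IsUnitaryFam (sesq (Θ z)) fun i => E i z)
    {Y : CSpace n → CSpace n} (hY : ContDiffWithinAt ℝ 2 Y s q) (hY0 : Y q ≠ 0)
    (hYo : ∀ i, sesq (Θ q) (Y q) (E i q) = 0) :
    ∃ F : CSpace n → CSpace n, ContDiffWithinAt ℝ 2 F s q ∧
      (∀ᶠ z in 𝓝[s] q, IsUnitaryFam (sesq (Θ z))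
        (Fin.snoc (fun i => E i z) (F z) : Fin (k + 1) → CSpace n)) ∧
      ∀ z, ∀ S : Submodule ℂ (CSpace n), Y z ∈ S → (∀ i, E i z ∈ S) → F z ∈ S := by
  set W : CSpace n → CSpace n := fun z => Y z - ∑ i, sesq (Θ z) (Y z) (E i z) • E i z with hW
  have hWs : ContDiffWithinAt ℝ 2 W s q :=
    hY.sub (ContDiffWithinAt.sum fun i _ =>
      contDiffWithinAt_csmul (contDiffWithinAt_sesq hΘ hY (hE i)) (hE i))
  have hWq : W q = Y q := by simp [hW, hYo]
  set N : CSpace n → ℝ := fun z => (sesq (Θ z) (W z) (W z)).re with hN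
  have hNs : ContDiffWithinAt ℝ 2 N s q :=
    contDiffWithinAt_re (contDiffWithinAt_sesq hΘ hWs hWs)
  have hNq : 0 < N q := by
    simp only [hN, hWq]
    exact (hpos q hq).pos _ hY0
  refine ⟨fun z => (((Real.sqrt (N z))⁻¹ : ℝ) : ℂ) • W z, ?_, ?_, ?_⟩
  · exact contDiffWithinAt_csmul (contDiffWithinAt_ofReal
      ((hNs.sqrt hNq.ne').inv (Real.sqrt_pos.2 hNq).ne')) hWs
  · filter_upwards [hEu, hNs.continuousWithinAt.eventually (lt_mem_nhds hNq),
      self_mem_nhdsWithin] with z hz hz' hzs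
    have hG := (hpos z hzs)
    refine isUnitaryFam_snoc hG.toIsHermForm hz (hG.normalize fun h => ?_) fun α => ?_
    · simp only [hN, h] at hz'
      rw [hG.zero_left] at hz'
      simp at hz'
    · rw [hG.smul_left]
      simp only [hW]
      rw [hG.toIsHermForm.sub_left, hG.toIsHermForm.sum_left]
      simp [hG.smul_left, hz _ α]
  · intro z S hYS hES
    exact S.smul_mem _ (S.sub_mem hYS (S.sum_mem fun i _ => S.smul_mem _ (hES i)))

end smooth

variable {m : ℕ} {M : Type*} [TopologicalSpace M] {X : ComplexManifoldWithBoundary (m + 1) M}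

theorem finrank_holSub {a : Fin X.N} {z : CSpace (m + 1)} (hz : fderiv ℝ (X.rho a) z ≠ 0) :
    Module.finrank ℂ (X.holSub a z) = m := finrank_ker_cplx hz

theorem HermitianMetric.contDiffWithinAt_comp (g : HermitianMetric X) {a : Fin X.N}
    {q : CSpace (m + 1)} (hq : q ∈ (X.chart a).target) (i j) :
    ContDiffWithinAt ℝ 2 (fun z => g.comp a z i j) (X.chart a).target q :=
  (g.smooth a i j q hq).of_le two_le_infty

theorem contDiffWithinAt_fderiv_rho {a : Fin X.N} {q : CSpace (m + 1)}
    (hq : q ∈ (X.chart a).target) :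
    ContDiffWithinAt ℝ 3 (fderiv ℝ (X.rho a)) (X.chart a).target q :=
  (((X.regular a).contDiffAt (X.mem_target.1 hq).1).fderiv_right (m := 3)
    (by norm_num)).contDiffWithinAt

/-- Near a boundary point there is a unitary frame of class `C²` whose first `k` vectors are
tangent to the level sets of the defining function. -/
theorem exists_tangent_frame (g : HermitianMetric X) {a : Fin X.N} {q : CSpace (m + 1)}
    (hq : q ∈ X.coordBoundary a) (k : ℕ) (hk : k ≤ m) :
    ∃ E : Fin k → CSpace (m + 1) → CSpace (m + 1),
      (∀ i, ContDiffWithinAt ℝ 2 (E i) (X.chart a).target q) ∧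
      ∀ᶠ z in 𝓝[(X.chart a).target] q, (∀ i, E i z ∈ X.holSub a z) ∧
        IsUnitaryFam (sesq (g.comp a z)) fun i => E i z := by
  induction k with
  | zero => exact ⟨fun i => i.elim0, fun i => i.elim0, Eventually.of_forall fun z =>
      ⟨fun i => i.elim0, fun i => i.elim0⟩⟩
  | succ k ih =>
    obtain ⟨E, hE, hEv⟩ := ih (by omega)
    have hreg := X.rho_regular a q (X.mem_target.1 hq.1).1 hq.2
    obtain ⟨v, hvS, hv0, hvo⟩ := exists_orthogonal (S := X.holSub a q)
      (g.isPosForm hq.1).toIsHermForm (fun i => E i q)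
      (by rw [finrank_holSub hreg]; omega)
    obtain ⟨N, hN⟩ := (X.regular a).exists_inner (X.mem_target.1 hq.1).1 hq.2
    have hℓN : cplx (fderiv ℝ (X.rho a) q) N ≠ 0 := fun h => by
      rw [cplx_eq_zero_iff] at h; exact hN.ne' h.1
    set Y : CSpace (m + 1) → CSpace (m + 1) := fun z =>
      v - (cplx (fderiv ℝ (X.rho a) z) v * (cplx (fderiv ℝ (X.rho a) z) N)⁻¹) • N with hY
    have hDρ := (contDiffWithinAt_fderiv_rho hq.1).of_le (show (2 : ℕ∞ω) ≤ 3 by norm_num)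
    have hℓs : ∀ w : CSpace (m + 1), ContDiffWithinAt ℝ 2
        (fun z => cplx (fderiv ℝ (X.rho a) z) w) (X.chart a).target q := fun w =>
      contDiffWithinAt_cplx hDρ contDiffWithinAt_const
    have hYs : ContDiffWithinAt ℝ 2 Y (X.chart a).target q :=
      contDiffWithinAt_const.sub (contDiffWithinAt_csmul
        ((hℓs v).mul ((hℓs N).inv hℓN)) contDiffWithinAt_const)
    have hYq : Y q = v := by
      have : cplx (fderiv ℝ (X.rho a) q) v = 0 := hvS
      simp [hY, this]
    obtain ⟨F, hF, hFu, hFS⟩ := exists_unitary_snoc_field (g.contDiffWithinAt_comp hq.1)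
      (fun z hz => g.isPosForm hz) hq.1 hE (hEv.mono fun z hz => hz.2) hYs (by rw [hYq]; exact hv0)
      (fun i => by rw [hYq]; exact hvo i)
    refine ⟨Fin.snoc E F, fun i => ?_, ?_⟩
    · refine Fin.lastCases ?_ (fun i => ?_) i
      · simpa using hF
      · simpa using hE i
    · filter_upwards [hEv, hFu, (hℓs N).continuousWithinAt.eventually_ne hℓN] with z hz hzu hzN
      refine ⟨fun i => ?_, ?_⟩
      · refine Fin.lastCases ?_ (fun i => ?_) i
        · rw [Fin.snoc_last]
          refine hFS z _ ?_ hz.1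
          show cplx (fderiv ℝ (X.rho a) z) (Y z) = 0
          simp only [hY]
          rw [map_sub, map_smul, smul_eq_mul, inv_mul_cancel_right₀ hzN, sub_self]
        · rw [Fin.snoc_castSucc]; exact hz.1 i
      · convert hzu using 2 with i
        refine Fin.lastCases ?_ (fun i => ?_) i <;> simp

/-- Near a boundary point there is a unitary frame of class `C²` whose last vector is the unit
normal of the level sets of the defining function. -/
theorem exists_adapted_frame (g : HermitianMetric X) {a : Fin X.N} {q : CSpace (m + 1)}
    (hq : q ∈ X.coordBoundary a) :
    ∃ (E : Fin m → CSpace (m + 1) → CSpace (m + 1)) (ν : CSpace (m + 1) → CSpace (m + 1)),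
      (∀ i, ContDiffWithinAt ℝ 2 (E i) (X.chart a).target q) ∧
      ContDiffWithinAt ℝ 2 ν (X.chart a).target q ∧
      ∀ᶠ z in 𝓝[(X.chart a).target] q, (∀ i, E i z ∈ X.holSub a z) ∧
        IsUnitaryFam (sesq (g.comp a z))
          (Fin.snoc (fun i => E i z) (ν z) : Fin (m + 1) → CSpace (m + 1)) ∧
        fderiv ℝ (X.rho a) z (Complex.I • ν z) = 0 ∧ 0 < fderiv ℝ (X.rho a) z (ν z) := by
  obtain ⟨E, hE, hEv⟩ := exists_tangent_frame g hq m le_rfl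
  have hreg := X.rho_regular a q (X.mem_target.1 hq.1).1 hq.2
  have hGq := g.isPosForm hq.1
  obtain ⟨v, -, hv0, hvo⟩ := exists_orthogonal (S := (⊤ : Submodule ℂ (CSpace (m + 1))))
    hGq.toIsHermForm (fun i => E i q) (by simp)
  obtain ⟨F, hF, hFu, -⟩ := exists_unitary_snoc_field (g.contDiffWithinAt_comp hq.1)
    (fun z hz => g.isPosForm hz) hq.1 hE (hEv.mono fun z hz => hz.2)
    (Y := fun _ => v) contDiffWithinAt_const hv0 hvo
  set ℓ : CSpace (m + 1) → ℂ := fun z => cplx (fderiv ℝ (X.rho a) z) (F z) with hℓ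
  have hDρ := (contDiffWithinAt_fderiv_rho hq.1).of_le (show (2 : ℕ∞ω) ≤ 3 by norm_num)
  have hℓs : ContDiffWithinAt ℝ 2 ℓ (X.chart a).target q := contDiffWithinAt_cplx hDρ hF
  have hFq := hFu.self_of_nhdsWithin hq.1
  have hEq := hEv.self_of_nhdsWithin hq.1
  have hℓq : ℓ q ≠ 0 := by
    intro h0
    have hmem : F q ∈ X.holSub a q := h0
    have hexp := hEq.2.expand hGq.toIsHermForm hEq.1 (finrank_holSub hreg) hmem
    have h1 : ∀ i, sesq (g.comp a q) (F q) (E i q) = 0 := fun i => by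
      have := hFq (Fin.last m) i.castSucc
      simpa [(Fin.castSucc_lt_last i).ne'] using this
    have h2 := hFq (Fin.last m) (Fin.last m)
    rw [Fin.snoc_last, hexp] at h2
    simp [h1, hGq.zero_left] at h2
  have hnorm : ContDiffWithinAt ℝ 2 (fun z => (‖ℓ z‖ : ℝ)) (X.chart a).target q :=
    hℓs.norm ℝ hℓq
  set c : CSpace (m + 1) → ℂ := fun z => (starRingEnd ℂ) (ℓ z) * (((‖ℓ z‖)⁻¹ : ℝ) : ℂ) with hc
  have hcs : ContDiffWithinAt ℝ 2 c (X.chart a).target q :=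
    (contDiffWithinAt_conj hℓs).mul
      (contDiffWithinAt_ofReal (hnorm.inv (norm_ne_zero_iff.2 hℓq)))
  refine ⟨E, fun z => c z • F z, hE, contDiffWithinAt_csmul hcs hF, ?_⟩
  filter_upwards [hEv, hFu, hℓs.continuousWithinAt.eventually_ne hℓq, self_mem_nhdsWithin]
    with z hz hzu hz0 hzs
  have hGz := g.isPosForm hzs
  have hn0 : ‖ℓ z‖ ≠ 0 := norm_ne_zero_iff.2 hz0
  have hn0' : ((‖ℓ z‖ : ℝ) : ℂ) ≠ 0 := by exact_mod_cast hn0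
  have hval : cplx (fderiv ℝ (X.rho a) z) (c z • F z) = ((‖ℓ z‖ : ℝ) : ℂ) := by
    rw [map_smul, smul_eq_mul]
    show (starRingEnd ℂ) (ℓ z) * (((‖ℓ z‖)⁻¹ : ℝ) : ℂ) * ℓ z = _
    have h1 : (starRingEnd ℂ) (ℓ z) * ℓ z = ((‖ℓ z‖ : ℝ) : ℂ) ^ 2 := Complex.conj_mul' _
    push_cast
    field_simp
    linear_combination h1
  refine ⟨hz.1, isUnitaryFam_snoc hGz.toIsHermForm hz.2 ?_ fun α => ?_, ?_, ?_⟩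
  · rw [hGz.smul_left, hGz.smul_right]
    have h2 := hzu (Fin.last m) (Fin.last m)
    simp only [Fin.snoc_last, if_true] at h2
    rw [h2, mul_one]
    simp only [hc, map_mul, Complex.conj_conj, Complex.conj_ofReal]
    have h1 : (starRingEnd ℂ) (ℓ z) * ℓ z = ((‖ℓ z‖ : ℝ) : ℂ) ^ 2 := Complex.conj_mul' _
    push_cast
    field_simp
    linear_combination h1
  · have h2 := hzu (Fin.last m) α.castSucc
    simp only [Fin.snoc_last, Fin.snoc_castSucc, (Fin.castSucc_lt_last α).ne', if_false] at h2
    rw [hGz.smul_left, h2, mul_zero]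
  · have := congrArg Complex.im hval
    rw [cplx_im, Complex.ofReal_im, neg_eq_zero] at this
    exact this
  · have := congrArg Complex.re hval
    rw [cplx_re, Complex.ofReal_re] at this
    rw [this]
    exact norm_pos_iff.2 hz0

/-- The last vector of an adapted frame is the unit inner normal. -/
theorem isUnitInnerNormal_of_frame (g : HermitianMetric X) {a : Fin X.N} {z : CSpace (m + 1)}
    (hz : z ∈ (X.chart a).target) {e : Fin m → CSpace (m + 1)} {ν : CSpace (m + 1)}
    (he : ∀ i, e i ∈ X.holSub a z)
    (hu : IsUnitaryFam (sesq (g.comp a z)) (Fin.snoc e ν : Fin (m + 1) → CSpace (m + 1)))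
    (hI : fderiv ℝ (X.rho a) z (Complex.I • ν) = 0) (hν : 0 < fderiv ℝ (X.rho a) z ν) :
    g.IsUnitInnerNormal a z ν := by
  have hG := g.isPosForm hz
  have h1 := hu (Fin.last m) (Fin.last m)
  simp only [Fin.snoc_last, if_true] at h1
  refine ⟨fun v hv => ?_, by simp [HermitianMetric.riem, h1], hν⟩
  have hexp := hu.expand (S := ⊤) hG.toIsHermForm (fun _ => trivial) (by simp)
    (x := v) trivial
  rw [Fin.sum_univ_castSucc] at hexp
  simp only [Fin.snoc_castSucc, Fin.snoc_last] at hexp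
  have ho : ∀ i, sesq (g.comp a z) ν (e i) = 0 := fun i => by
    have := hu (Fin.last m) i.castSucc
    simpa [(Fin.castSucc_lt_last i).ne'] using this
  set ζ := sesq (g.comp a z) v ν with hζ
  have hℓν : cplx (fderiv ℝ (X.rho a) z) ν = (fderiv ℝ (X.rho a) z ν : ℂ) := by
    simp [cplx, hI]
  have hℓ : cplx (fderiv ℝ (X.rho a) z) v = ζ * (fderiv ℝ (X.rho a) z ν : ℂ) := by
    conv_lhs => rw [hexp]
    rw [map_add, map_sum, map_smul, hℓν, smul_eq_mul, Finset.sum_eq_zero, zero_add]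
    intro i _
    rw [map_smul]
    have : cplx (fderiv ℝ (X.rho a) z) (e i) = 0 := he i
    rw [this, smul_zero]
  have hre : ζ.re = 0 := by
    have h2 := congrArg Complex.re hℓ
    have hv' : fderiv ℝ (X.rho a) z v = 0 := hv
    rw [cplx_re, hv', Complex.re_mul_ofReal] at h2
    rcases mul_eq_zero.1 h2.symm with h | h
    · exact h
    · exact absurd h hν.ne'
  rw [HermitianMetric.riem, ← hG.conj_symm, Complex.conj_re]
  exact hre

theorem HermitianMetric.riem_nonneg (g : HermitianMetric X) {a : Fin X.N} {z : CSpace (m + 1)}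
    (hz : z ∈ (X.chart a).target) (v : CSpace (m + 1)) : 0 ≤ g.riem a z v v := by
  by_cases h : v = 0
  · rw [h, HermitianMetric.riem, (g.isPosForm hz).zero_left]; simp
  · exact ((g.isPosForm hz).pos v h).le

theorem HermitianMetric.IsUnitInnerNormal.abs_fderiv_le {g : HermitianMetric X} {a : Fin X.N}
    {z ν : CSpace (m + 1)} (hz : z ∈ (X.chart a).target) (h : g.IsUnitInnerNormal a z ν)
    (v : CSpace (m + 1)) :
    |fderiv ℝ (X.rho a) z v| ≤ fderiv ℝ (X.rho a) z ν * Real.sqrt (g.riem a z v v) := by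
  have hG := (g.isPosForm hz).toIsHermForm
  set c : ℝ := fderiv ℝ (X.rho a) z v / fderiv ℝ (X.rho a) z ν with hc
  have hker : v - (c : ℂ) • ν ∈ X.boundaryTangent a z := by
    show fderiv ℝ (X.rho a) z (v - (c : ℂ) • ν) = 0
    rw [show ((c : ℂ) • ν) = c • ν by ext i; simp, map_sub, map_smul, smul_eq_mul, hc,
      div_mul_cancel₀ _ h.2.2.ne', sub_self]
  have h1 := h.1 _ hker
  have h2 : g.riem a z v v
      = c ^ 2 + g.riem a z (v - (c : ℂ) • ν) (v - (c : ℂ) • ν) := by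
    have hv : v = (c : ℂ) • ν + (v - (c : ℂ) • ν) := by abel
    set w := v - (c : ℂ) • ν
    have hsym : (sesq (g.comp a z) w ν).re = 0 := by
      rw [← hG.conj_symm, Complex.conj_re]; exact h1
    have hνν : (sesq (g.comp a z) ν ν).re = 1 := h.2.1
    have h1' : (sesq (g.comp a z) ν w).re = 0 := h1
    rw [hv]
    simp only [HermitianMetric.riem, hG.add_left, hG.add_right, hG.smul_left, hG.smul_right,
      Complex.conj_ofReal, Complex.add_re, Complex.re_ofReal_mul, hsym, hνν, h1']
    ring
  have h3 : |c| ≤ Real.sqrt (g.riem a z v v) := by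
    rw [← Real.sqrt_sq_eq_abs]
    apply Real.sqrt_le_sqrt
    rw [h2]
    linarith [g.riem_nonneg hz (v - (c : ℂ) • ν)]
  have h4 : fderiv ℝ (X.rho a) z v = fderiv ℝ (X.rho a) z ν * c := by
    rw [hc, mul_div_cancel₀ _ h.2.2.ne']
  rw [h4, abs_mul, abs_of_pos h.2.2]
  exact mul_le_mul_of_nonneg_left h3 h.2.2.le

theorem HermitianMetric.IsUnitInnerNormal.fderiv_eq {g : HermitianMetric X} {a : Fin X.N}
    {z ν ν' : CSpace (m + 1)} (hz : z ∈ (X.chart a).target) (h : g.IsUnitInnerNormal a z ν)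
    (h' : g.IsUnitInnerNormal a z ν') : fderiv ℝ (X.rho a) z ν = fderiv ℝ (X.rho a) z ν' := by
  have h1 := (le_abs_self _).trans (h.abs_fderiv_le hz ν')
  have h2 := (le_abs_self _).trans (h'.abs_fderiv_le hz ν)
  rw [h'.2.1, Real.sqrt_one, mul_one] at h1
  rw [h.2.1, Real.sqrt_one, mul_one] at h2
  exact le_antisymm h2 h1

/-! ### The distance to the boundary -/

open ComplexManifoldWithBoundary

theorem norm_sesq_le {n : ℕ} (Θ : Matrix (Fin n) (Fin n) ℂ) (ξ ζ : CSpace n) :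
    ‖sesq Θ ξ ζ‖ ≤ (∑ i, ∑ j, ‖Θ i j‖) * ‖ξ‖ * ‖ζ‖ := by
  rw [sesq, Finset.sum_mul, Finset.sum_mul]
  refine (norm_sum_le _ _).trans (Finset.sum_le_sum fun i _ => ?_)
  rw [Finset.sum_mul, Finset.sum_mul]
  refine (norm_sum_le _ _).trans (Finset.sum_le_sum fun j _ => ?_)
  rw [norm_mul, norm_mul, RCLike.norm_conj]
  gcongr
  · exact PiLp.norm_apply_le ξ i
  · exact PiLp.norm_apply_le ζ j

theorem sesq_sub {n : ℕ} (Θ Θ' : Matrix (Fin n) (Fin n) ℂ) (ξ ζ : CSpace n) :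
    sesq (Θ - Θ') ξ ζ = sesq Θ ξ ζ - sesq Θ' ξ ζ := by
  simp only [sesq, Matrix.sub_apply, sub_mul, Finset.sum_sub_distrib]

theorem eventually_norm_sesq_le {n : ℕ} {s : Set (CSpace n)} {q : CSpace n}
    {Θ : CSpace n → Matrix (Fin n) (Fin n) ℂ}
    (hΘ : ∀ i j, ContinuousWithinAt (fun z => Θ z i j) s q) :
    ∃ C : ℝ, 0 < C ∧ ∀ᶠ z in 𝓝[s] q, ∀ ξ ζ, ‖sesq (Θ z) ξ ζ‖ ≤ C * ‖ξ‖ * ‖ζ‖ := by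
  have h : ContinuousWithinAt (fun z => ∑ i, ∑ j, ‖Θ z i j‖) s q :=
    tendsto_finsetSum _ fun i _ =>
      tendsto_finsetSum _ fun j _ => (hΘ i j).norm
  refine ⟨(∑ i, ∑ j, ‖Θ q i j‖) + 1, by positivity, ?_⟩
  filter_upwards [h.eventually (gt_mem_nhds (lt_add_one _))] with z hz ξ ζ
  refine (norm_sesq_le _ _ _).trans ?_
  gcongr

section path

variable {n : ℕ} {M : Type*} [TopologicalSpace M] {X : ComplexManifoldWithBoundary n M}

theorem hasDerivWithinAt_chart_path {γ : ℝ → M} (hγ : X.IsC1Path γ) {a : Fin X.N} {t : ℝ}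
    (ht : t ∈ Icc (0 : ℝ) 1) (ha : γ t ∈ (X.chart a).source) :
    HasDerivWithinAt (fun s => X.chart a (γ s)) (derivWithin (fun s => X.chart a (γ s)) (Icc 0 1) t)
      (Icc 0 1) t := by
  have h1 := (hγ.2 a).differentiableOn one_ne_zero t ⟨ht, ha⟩
  have h2 : DifferentiableWithinAt ℝ (fun s => X.chart a (γ s)) (Icc 0 1) t := by
    refine h1.mono_of_mem_nhdsWithin ?_
    exact inter_mem self_mem_nhdsWithin
      ((hγ.1 t ht).preimage_mem_nhdsWithin ((X.isOpen_source a).mem_nhds ha))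
  exact h2.hasDerivWithinAt

/-- The speed of a path may be computed in any chart. -/
theorem HermitianMetric.speed_eq (g : HermitianMetric X) {γ : ℝ → M} (hγ : X.IsC1Path γ)
    {a : Fin X.N} {t : ℝ} (ht : t ∈ Icc (0 : ℝ) 1) (ha : γ t ∈ (X.chart a).source) :
    g.speed γ t = Real.sqrt (g.riem a (X.chart a (γ t))
      (derivWithin (fun s => X.chart a (γ s)) (Icc 0 1) t)
      (derivWithin (fun s => X.chart a (γ s)) (Icc 0 1) t)) := by
  set b := X.idx (γ t) with hb
  have hbs : γ t ∈ (X.chart b).source := X.core_subset b (Classical.choose_spec (X.core_cover _))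
  have hov := X.chart_mem_overlap ha hbs
  have h1 := hasDerivWithinAt_chart_path hγ ht ha
  have hmaps : ∀ᶠ s in 𝓝[Icc 0 1] t, X.chart a (γ s) ∈ X.overlap a b := by
    filter_upwards [(hγ.1 t ht).preimage_mem_nhdsWithin ((X.isOpen_source a).mem_nhds ha),
      (hγ.1 t ht).preimage_mem_nhdsWithin ((X.isOpen_source b).mem_nhds hbs)] with s hs hs'
    exact X.chart_mem_overlap hs hs'
  have h2 : HasDerivWithinAt (fun s => X.transition a b (X.chart a (γ s)))
      (X.dT a b (X.chart a (γ t)) (derivWithin (fun s => X.chart a (γ s)) (Icc 0 1) t))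
      (Icc 0 1) t := by
    have h3 := (X.hasFDerivWithinAt_transition hov).comp_hasDerivWithinAt_of_eq t
      (h1.mono (inter_subset_left (t := {s | X.chart a (γ s) ∈ X.overlap a b})))
      (fun s hs => hs.2) rfl
    exact h3.mono_of_mem_nhdsWithin (inter_mem self_mem_nhdsWithin hmaps)
  have h3 : HasDerivWithinAt (fun s => X.chart b (γ s))
      (X.dT a b (X.chart a (γ t)) (derivWithin (fun s => X.chart a (γ s)) (Icc 0 1) t))
      (Icc 0 1) t := by
    refine h2.congr_of_eventuallyEq ?_ (X.transition_chart ha).symm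
    filter_upwards [(hγ.1 t ht).preimage_mem_nhdsWithin ((X.isOpen_source a).mem_nhds ha)]
      with s hs
    exact (X.transition_chart hs).symm
  have h4 := h3.derivWithin (uniqueDiffOn_Icc zero_lt_one t ht)
  rw [speed, ← hb, h4, riem, riem, g.compat a b _ hov, X.transition_chart ha]
  rfl

/-- A function whose differential is bounded by the metric is Lipschitz along paths. -/
theorem HermitianMetric.enorm_sub_le_length (g : HermitianMetric X) {γ : ℝ → M}
    (hγ : X.IsC1Path γ) {a : Fin X.N} {W : Type*} [NormedAddCommGroup W] [NormedSpace ℝ W]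
    [CompleteSpace W]
    {F : CSpace n → W} (hF : ContDiffOn ℝ 1 F (X.ambient a)) {T : ℝ} (hT0 : 0 ≤ T) (hT1 : T ≤ 1)
    (hsrc : ∀ t ∈ Icc 0 T, γ t ∈ (X.chart a).source)
    (hb : ∀ t ∈ Icc 0 T, ∀ v, ‖fderiv ℝ F (X.chart a (γ t)) v‖
      ≤ Real.sqrt (g.riem a (X.chart a (γ t)) v v)) :
    ‖F (X.chart a (γ T)) - F (X.chart a (γ 0))‖ₑ
      ≤ ∫⁻ t in Icc (0 : ℝ) 1, ENNReal.ofReal (g.speed γ t) := by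
  have hamb : ∀ t ∈ Icc 0 T, X.chart a (γ t) ∈ X.ambient a := fun t ht =>
    (X.mem_target.1 ((X.chart a).map_source (hsrc t ht))).1
  have hsub : Icc 0 T ⊆ Icc (0 : ℝ) 1 := Icc_subset_Icc_right hT1
  have hc : ContDiffOn ℝ 1 (fun t => F (X.chart a (γ t))) (Icc 0 T) :=
    hF.comp ((hγ.2 a).mono fun t ht => ⟨hsub ht, hsrc t ht⟩) hamb
  refine (enorm_sub_le_lintegral_derivWithin_Icc_of_contDiffOn_Icc hc hT0).trans ?_
  rw [← restrict_Ioo_eq_restrict_Icc]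
  calc ∫⁻ t in Ioo 0 T, ‖derivWithin (fun t => F (X.chart a (γ t))) (Icc 0 T) t‖ₑ
      ≤ ∫⁻ t in Ioo 0 T, ENNReal.ofReal (g.speed γ t) := by
        refine setLIntegral_mono' measurableSet_Ioo fun t ht => ?_
        have ht' : t ∈ Icc 0 T := Ioo_subset_Icc_self ht
        have h1 := (hasDerivWithinAt_chart_path hγ (hsub ht') (hsrc t ht')).mono hsub
        have h2 : HasFDerivAt F (fderiv ℝ F (X.chart a (γ t))) (X.chart a (γ t)) :=
          ((hF.contDiffAt ((X.isOpen_ambient a).mem_nhds (hamb t ht'))).differentiableAt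
            one_ne_zero).hasFDerivAt
        have h3 := h2.comp_hasDerivWithinAt t h1
        have h4 : derivWithin (fun t => F (X.chart a (γ t))) (Icc 0 T) t = _ :=
          h3.derivWithin (uniqueDiffOn_Icc (ht.1.trans ht.2) t ht')
        rw [h4, g.speed_eq hγ (hsub ht') (hsrc t ht'), ← ofReal_norm]
        exact ENNReal.ofReal_le_ofReal (hb t ht' _)
    _ ≤ _ := lintegral_mono_set fun t ht => hsub (Ioo_subset_Icc_self ht)

/-- The metric is locally bounded below. -/
theorem HermitianMetric.eventually_le_riem (g : HermitianMetric X) {a : Fin X.N}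
    {q : CSpace n} (hq : q ∈ (X.chart a).target) :
    ∃ c > 0, ∀ᶠ z in 𝓝[(X.chart a).target] q, ∀ v, c * ‖v‖ ^ 2 ≤ g.riem a z v v := by
  have hcont : Continuous fun v : CSpace n => g.riem a q v v := by
    unfold HermitianMetric.riem sesq
    refine Complex.continuous_re.comp (continuous_finsetSum _ fun i _ =>
      continuous_finsetSum _ fun j _ => ?_)
    have h1 : ∀ i, Continuous fun v : CSpace n => v i := fun i => (EuclideanSpace.proj i).continuous
    exact (continuous_const.mul (h1 i)).mul (Complex.continuous_conj.comp (h1 j))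
  obtain ⟨c, hc, hmin⟩ := (isCompact_sphere (0 : CSpace n) 1).exists_forall_le'
    hcont.continuousOn (a := 0) (fun v hv => g.pos a q hq v (by
      rintro rfl
      simp at hv))
  have hq' : ∀ v, c * ‖v‖ ^ 2 ≤ g.riem a q v v := by
    intro v
    by_cases hv : v = 0
    · simp [hv, HermitianMetric.riem, (g.isPosForm hq).zero_left]
    · have hn : ‖v‖ ≠ 0 := norm_ne_zero_iff.2 hv
      have h1 := hmin ((‖v‖⁻¹ : ℂ) • v) (by simp [norm_smul, hn])
      have h2 : g.riem a q ((‖v‖⁻¹ : ℂ) • v) ((‖v‖⁻¹ : ℂ) • v) = (‖v‖⁻¹) ^ 2 * g.riem a q v v := by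
        rw [HermitianMetric.riem, (g.isPosForm hq).smul_left, (g.isPosForm hq).smul_right,
          ← mul_assoc]
        have : (‖v‖⁻¹ : ℂ) * (starRingEnd ℂ) (‖v‖⁻¹ : ℂ) = (((‖v‖⁻¹) ^ 2 : ℝ) : ℂ) := by
          rw [Complex.mul_conj]
          norm_cast
          rw [Complex.normSq_ofReal, sq]
        rw [this, Complex.re_ofReal_mul]
        rfl
      rw [h2] at h1
      have h3 := mul_le_mul_of_nonneg_right h1 (sq_nonneg ‖v‖)
      have h4 : (‖v‖⁻¹) ^ 2 * g.riem a q v v * ‖v‖ ^ 2 = g.riem a q v v := by field_simp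
      linarith
  refine ⟨c / 2, by positivity, ?_⟩
  have h : ContinuousWithinAt (fun z => ∑ i, ∑ j, ‖(g.comp a z - g.comp a q) i j‖)
      (X.chart a).target q :=
    tendsto_finsetSum _ fun i _ => tendsto_finsetSum _ fun j _ =>
      (((g.smooth a i j).continuousOn q hq).sub continuousWithinAt_const).norm
  filter_upwards [h.eventually (gt_mem_nhds (show _ < c / 2 by simpa using hc))] with z hz v
  have h1 := (Complex.abs_re_le_norm _).trans (norm_sesq_le (g.comp a z - g.comp a q) v v)
  rw [sesq_sub, Complex.sub_re] at h1
  have h2 := mul_le_mul_of_nonneg_right hz.le (sq_nonneg ‖v‖)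
  have h3 := (abs_le.1 h1).1
  have h4 := hq' v
  simp only [HermitianMetric.riem] at h4 ⊢
  nlinarith

end path

section distance

variable {m : ℕ} {M : Type*} [TopologicalSpace M] {X : ComplexManifoldWithBoundary (m + 1) M}

theorem eventually_abs_fderiv_le (g : HermitianMetric X) {a : Fin X.N}
    {y ν : CSpace (m + 1)} (hy : y ∈ X.coordBoundary a) (hν : g.IsUnitInnerNormal a y ν)
    {ε : ℝ} (hε : 0 < ε) : ∀ᶠ x in 𝓝[(X.chart a).target] y, ∀ v,
      |fderiv ℝ (X.rho a) x v| ≤ (fderiv ℝ (X.rho a) y ν + ε) * Real.sqrt (g.riem a x v v) := by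
  obtain ⟨E, N, hE, hN, hev⟩ := exists_adapted_frame g hy
  have h0 := hev.self_of_nhdsWithin hy.1
  have hνN := hν.fderiv_eq hy.1 (isUnitInnerNormal_of_frame g hy.1 h0.1 h0.2.1 h0.2.2.1 h0.2.2.2)
  have hc : ContinuousWithinAt (fun x => fderiv ℝ (X.rho a) x (N x)) (X.chart a).target y :=
    (contDiffWithinAt_fderiv_rho hy.1).continuousWithinAt.clm_apply hN.continuousWithinAt
  have hc' : ∀ᶠ x in 𝓝[(X.chart a).target] y,
      fderiv ℝ (X.rho a) x (N x) < fderiv ℝ (X.rho a) y ν + ε :=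
    hc.eventually (gt_mem_nhds (by rw [hνN]; linarith))
  filter_upwards [hev, hc', self_mem_nhdsWithin] with x hx hx' hxt v
  have h1 := (isUnitInnerNormal_of_frame g hxt hx.1 hx.2.1 hx.2.2.1 hx.2.2.2).abs_fderiv_le hxt v
  exact h1.trans (mul_le_mul_of_nonneg_right hx'.le (Real.sqrt_nonneg _))

/-- Lengths of paths to the boundary are bounded below by multiples of the defining function. -/
theorem eventually_le_length [T2Space M] (g : HermitianMetric X) {a : Fin X.N}
    {y ν : CSpace (m + 1)} (hy : y ∈ X.coordBoundary a) (hν : g.IsUnitInnerNormal a y ν)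
    {ε : ℝ} (hε : 0 < ε) : ∀ᶠ x in 𝓝[(X.chart a).target] y, ∀ γ : ℝ → M,
      X.IsC1Path γ ∧ γ 0 = (X.chart a).symm x ∧ γ 1 ∈ X.boundary →
      ENNReal.ofReal (X.rho a x / (fderiv ℝ (X.rho a) y ν + ε))
        ≤ ∫⁻ t in Icc (0 : ℝ) 1, ENNReal.ofReal (g.speed γ t) := by
  set β := fderiv ℝ (X.rho a) y ν with hβ
  have hβ0 : 0 < β := hν.2.2
  obtain ⟨c, hc, hcev⟩ := g.eventually_le_riem hy.1
  have hyamb := (X.mem_target.1 hy.1).1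
  -- A closed ball on which all local bounds hold.
  obtain ⟨r₁, hr₁, hball₁⟩ := Metric.mem_nhdsWithin_iff.1
    (inter_mem hcev (eventually_abs_fderiv_le g hy hν hε))
  obtain ⟨r₂, hr₂, hball₂⟩ := Metric.isOpen_iff.1 (X.isOpen_ambient a) y hyamb
  set r := min r₁ r₂ / 2 with hr
  have hr0 : 0 < r := by positivity
  have hrb : ∀ x ∈ Metric.closedBall y r, x ∈ Metric.ball y r₁ ∧ x ∈ Metric.ball y r₂ := by
    intro x hx
    have hx' : dist x y ≤ r := hx
    have h1 : r < r₁ := by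
      have := min_le_left r₁ r₂; have := lt_min hr₁ hr₂; rw [hr]; linarith
    have h2 : r < r₂ := by
      have := min_le_right r₁ r₂; have := lt_min hr₁ hr₂; rw [hr]; linarith
    exact ⟨hx'.trans_lt h1, hx'.trans_lt h2⟩
  have hKc : IsCompact ((X.chart a).target ∩ Metric.closedBall y r) := by
    have : (X.chart a).target ∩ Metric.closedBall y r
        = Metric.closedBall y r ∩ X.rho a ⁻¹' (Ici 0) := by
      ext x
      constructor
      · rintro ⟨h1, h2⟩; exact ⟨h2, (X.mem_target.1 h1).2⟩
      · rintro ⟨h1, h2⟩; exact ⟨X.mem_target.2 ⟨hball₂ (hrb x h1).2, h2⟩, h1⟩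
    rw [this]
    refine (isCompact_closedBall y r).of_isClosed_subset ?_ inter_subset_left
    refine ContinuousOn.preimage_isClosed_of_isClosed (fun x hx => ?_) Metric.isClosed_closedBall
      isClosed_Ici
    exact ((X.regular a).continuousAt (hball₂ (hrb x hx).2)).continuousWithinAt
  have hK : IsClosed ((X.chart a).symm '' ((X.chart a).target ∩ Metric.closedBall y r)) :=
    (hKc.image_of_continuousOn ((X.continuousOn_chart_symm a).mono inter_subset_left)).isClosed
  set W : Set M := (X.chart a).source ∩ X.chart a ⁻¹' Metric.ball y r with hW
  have hWo : IsOpen W := (X.continuousOn_chart a).isOpen_inter_preimage (X.isOpen_source a)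
    Metric.isOpen_ball
  have hsmall : ∀ᶠ x in 𝓝[(X.chart a).target] y,
      X.rho a x / (β + ε) < Real.sqrt c * (r / 2) ∧ x ∈ Metric.ball y (r / 2) := by
    refine Eventually.and ?_ (mem_nhdsWithin_of_mem_nhds (Metric.ball_mem_nhds y (by positivity)))
    have h1 : ContinuousWithinAt (fun x => X.rho a x / (β + ε)) (X.chart a).target y :=
      (((X.regular a).continuousAt hyamb).div_const _).continuousWithinAt
    refine h1.eventually (gt_mem_nhds ?_)
    beta_reduce
    rw [hy.2, zero_div]
    positivity
  filter_upwards [hsmall, self_mem_nhdsWithin] with x hx hxt γ hγ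
  obtain ⟨hγ, hγ0, hγ1⟩ := hγ
  have h0src : γ 0 ∈ (X.chart a).source := by rw [hγ0]; exact (X.chart a).map_target hxt
  have h0chart : X.chart a (γ 0) = x := by rw [hγ0, (X.chart a).right_inv hxt]
  have h0W : γ 0 ∈ W := ⟨h0src, by
    show X.chart a (γ 0) ∈ Metric.ball y r
    rw [h0chart]
    exact Metric.ball_subset_ball (by linarith) hx.2⟩
  have hloc : ∀ t, γ t ∈ (X.chart a).source → X.chart a (γ t) ∈ Metric.closedBall y r →
      (∀ v, c * ‖v‖ ^ 2 ≤ g.riem a (X.chart a (γ t)) v v) ∧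
      ∀ v, |fderiv ℝ (X.rho a) (X.chart a (γ t)) v|
        ≤ (β + ε) * Real.sqrt (g.riem a (X.chart a (γ t)) v v) := fun t ht ht' =>
    hball₁ ⟨(hrb _ ht').1, (X.chart a).map_source ht⟩
  set B : Set ℝ := Icc 0 1 ∩ γ ⁻¹' Wᶜ with hB
  have hBc : IsClosed B := hγ.1.preimage_isClosed_of_isClosed isClosed_Icc hWo.isClosed_compl
  rcases B.eq_empty_or_nonempty with hBe | hBn
  · -- The path stays in the coordinate ball.
    have hin : ∀ t ∈ Icc (0 : ℝ) 1, γ t ∈ W := by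
      intro t ht
      by_contra hcon
      have : t ∈ B := ⟨ht, hcon⟩
      rw [hBe] at this
      exact this
    have hkey := g.enorm_sub_le_length hγ (a := a) (F := fun z => (β + ε)⁻¹ * X.rho a z)
      (contDiffOn_const.mul ((X.rho_contDiffOn a).of_le (by norm_num))) zero_le_one le_rfl
      (fun t ht => (hin t ht).1) (fun t ht v => by
        have hamb := (X.mem_target.1 ((X.chart a).map_source (hin t ht).1)).1
        have hd := ((X.regular a).hasFDerivAt hamb).const_mul (β + ε)⁻¹
        rw [hd.fderiv]
        have h1 := (hloc t (hin t ht).1 (Metric.ball_subset_closedBall (hin t ht).2)).2 v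
        rw [smul_apply, smul_eq_mul, Real.norm_eq_abs, abs_mul,
          abs_of_pos (by positivity), inv_mul_le_iff₀ (by positivity)]
        exact h1)
    refine le_trans ?_ hkey
    rw [h0chart, (X.mem_boundary_iff (hin 1 (right_mem_Icc.2 zero_le_one)).1).1 hγ1,
      ← ofReal_norm]
    apply ENNReal.ofReal_le_ofReal
    rw [mul_zero, zero_sub, norm_neg, div_eq_inv_mul]
    exact le_abs_self _
  · -- The path leaves the coordinate ball.
    have hTB := hBc.csInf_mem hBn ⟨0, fun t ht => ht.1.1⟩
    set T := sInf B with hT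
    have hbefore : ∀ t ∈ Ico 0 T, γ t ∈ W := by
      intro t ht
      by_contra hcon
      exact absurd (csInf_le ⟨0, fun t ht => ht.1.1⟩ (show t ∈ B from
        ⟨⟨ht.1, ht.2.le.trans hTB.1.2⟩, hcon⟩)) (not_le.2 ht.2)
    have hT0 : 0 < T := lt_of_le_of_ne hTB.1.1 fun h => hTB.2 (h ▸ h0W)
    have hTK : γ T ∈ (X.chart a).symm '' ((X.chart a).target ∩ Metric.closedBall y r) := by
      rw [← hK.closure_eq]
      refine ContinuousWithinAt.mem_closure (s := Ico 0 T)
        ((hγ.1 T hTB.1).mono fun t ht => ⟨ht.1, ht.2.le.trans hTB.1.2⟩) ?_ fun t ht => ?_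
      · rw [closure_Ico hT0.ne]; exact right_mem_Icc.2 hT0.le
      · have hw := hbefore t ht
        exact ⟨X.chart a (γ t), ⟨(X.chart a).map_source hw.1, Metric.ball_subset_closedBall hw.2⟩,
          (X.chart a).left_inv hw.1⟩
    obtain ⟨w, ⟨hwt, hwb⟩, hwT⟩ := hTK
    have hTsrc : γ T ∈ (X.chart a).source := by rw [← hwT]; exact (X.chart a).map_target hwt
    have hTw : X.chart a (γ T) = w := by rw [← hwT, (X.chart a).right_inv hwt]
    have hin : ∀ t ∈ Icc 0 T, γ t ∈ (X.chart a).source ∧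
        X.chart a (γ t) ∈ Metric.closedBall y r := by
      intro t ht
      rcases ht.2.lt_or_eq with h | h
      · have := hbefore t ⟨ht.1, h⟩
        exact ⟨this.1, Metric.ball_subset_closedBall this.2⟩
      · rw [h, hTw]; exact ⟨hTsrc, hwb⟩
    have hdist : r ≤ dist w y := by
      by_contra hcon
      exact hTB.2 ⟨hTsrc, by
        show X.chart a (γ T) ∈ Metric.ball y r
        rw [hTw]; exact not_le.1 hcon⟩
    have hkey := g.enorm_sub_le_length hγ (a := a) (F := fun z => Real.sqrt c • z)
      (contDiff_id.const_smul _).contDiffOn hT0.le hTB.1.2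
      (fun t ht => (hin t ht).1) (fun t ht v => by
        have hd := (hasFDerivAt_id (𝕜 := ℝ) (X.chart a (γ t))).const_smul (Real.sqrt c)
        have hd' : fderiv ℝ (fun z : CSpace (m + 1) => Real.sqrt c • z) (X.chart a (γ t))
            = Real.sqrt c • ContinuousLinearMap.id ℝ _ := hd.fderiv
        rw [hd', smul_apply, ContinuousLinearMap.id_apply, norm_smul,
          Real.norm_of_nonneg (Real.sqrt_nonneg _)]
        apply Real.le_sqrt_of_sq_le
        rw [mul_pow, Real.sq_sqrt hc.le]
        exact (hloc t (hin t ht).1 (hin t ht).2).1 v)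
    refine le_trans ?_ hkey
    rw [h0chart, hTw, ← ofReal_norm]
    apply ENNReal.ofReal_le_ofReal
    rw [← smul_sub, norm_smul, Real.norm_of_nonneg (Real.sqrt_nonneg _)]
    refine hx.1.le.trans (mul_le_mul_of_nonneg_left ?_ (Real.sqrt_nonneg _))
    have h1 : dist x y < r / 2 := hx.2
    have h2 := dist_triangle w x y
    rw [← dist_eq_norm]
    linarith

/-- The straight path along the normal bounds the distance to the boundary from above. -/
theorem eventually_length_le (g : HermitianMetric X) {a : Fin X.N}
    {y ν : CSpace (m + 1)} (hy : y ∈ X.coordBoundary a) (hν : g.IsUnitInnerNormal a y ν)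
    {ε : ℝ} (hε : 0 < ε) (hεβ : ε < fderiv ℝ (X.rho a) y ν) :
    ∀ᶠ x in 𝓝[(X.chart a).target] y, ∃ γ : ℝ → M,
      (X.IsC1Path γ ∧ γ 0 = (X.chart a).symm x ∧ γ 1 ∈ X.boundary) ∧
      ∫⁻ t in Icc (0 : ℝ) 1, ENNReal.ofReal (g.speed γ t)
        ≤ ENNReal.ofReal ((1 + ε) * (X.rho a x / (fderiv ℝ (X.rho a) y ν - ε))) := by
  set β := fderiv ℝ (X.rho a) y ν with hβ
  have hβε : 0 < β - ε := by linarith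
  have hyamb := (X.mem_target.1 hy.1).1
  have hD : ∀ᶠ x in 𝓝 y, x ∈ X.ambient a ∧ β - ε < fderiv ℝ (X.rho a) x ν := by
    refine Eventually.and ((X.isOpen_ambient a).mem_nhds hyamb) ?_
    have h1 : ContinuousAt (fun x => fderiv ℝ (X.rho a) x ν) y :=
      ((X.regular a).continuousAt_fderiv hyamb).clm_apply continuousAt_const
    exact h1.eventually (lt_mem_nhds (by beta_reduce; rw [← hβ]; linarith))
  have hS : ∀ᶠ x in 𝓝[(X.chart a).target] y, Real.sqrt (g.riem a x ν ν) < 1 + ε := by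
    have h1 : ContinuousWithinAt (fun x => Real.sqrt (g.riem a x ν ν)) (X.chart a).target y :=
      (contDiffWithinAt_re (contDiffWithinAt_sesq (g.contDiffWithinAt_comp hy.1)
        contDiffWithinAt_const contDiffWithinAt_const)).continuousWithinAt.sqrt
    exact h1.eventually (gt_mem_nhds (by beta_reduce; rw [hν.2.1, Real.sqrt_one]; linarith))
  obtain ⟨r₁, hr₁, hball₁⟩ := Metric.mem_nhds_iff.1 hD
  obtain ⟨r₂, hr₂, hball₂⟩ := Metric.mem_nhdsWithin_iff.1 hS
  set r := min r₁ r₂ with hr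
  have hr0 : 0 < r := lt_min hr₁ hr₂
  have hsmall : ∀ᶠ x in 𝓝[(X.chart a).target] y,
      X.rho a x / (β - ε) * ‖ν‖ < r / 2 ∧ x ∈ Metric.ball y (r / 2) := by
    refine Eventually.and ?_ (mem_nhdsWithin_of_mem_nhds (Metric.ball_mem_nhds y (by positivity)))
    have h1 : ContinuousWithinAt (fun x => X.rho a x / (β - ε) * ‖ν‖) (X.chart a).target y :=
      ((((X.regular a).continuousAt hyamb).div_const _).mul
        continuousAt_const).continuousWithinAt
    refine h1.eventually (gt_mem_nhds ?_)
    beta_reduce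
    rw [hy.2, zero_div, zero_mul]
    positivity
  filter_upwards [hsmall, self_mem_nhdsWithin] with x hx hxt
  have hρx : 0 ≤ X.rho a x := (X.mem_target.1 hxt).2
  set s₁ := X.rho a x / (β - ε) with hs₁
  have hs₁0 : 0 ≤ s₁ := div_nonneg hρx hβε.le
  have hin : ∀ s ∈ Icc 0 s₁, x - s • ν ∈ Metric.ball y r := by
    intro s hs
    have h1 : ‖s • ν‖ ≤ s₁ * ‖ν‖ := by
      rw [norm_smul, Real.norm_of_nonneg hs.1]
      exact mul_le_mul_of_nonneg_right hs.2 (norm_nonneg _)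
    have h2 : dist x y < r / 2 := hx.2
    have h3 : dist (x - s • ν) x = ‖s • ν‖ := by simp
    have := dist_triangle (x - s • ν) x y
    rw [Metric.mem_ball]
    linarith [hx.1]
  have hder : ∀ s ∈ Icc 0 s₁, HasDerivAt (fun s : ℝ => X.rho a (x - s • ν) + s * (β - ε))
      (- fderiv ℝ (X.rho a) (x - s • ν) ν + (β - ε)) s := by
    intro s hs
    have h1 : HasDerivAt (fun s : ℝ => x - s • ν) (-ν) s := by
      simpa using ((hasDerivAt_id s).smul_const ν).const_sub x
    have h2 := ((X.regular a).hasFDerivAt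
      (hball₁ (Metric.ball_subset_ball (min_le_left _ _) (hin s hs))).1).comp_hasDerivAt s h1
    rw [map_neg] at h2
    have h3 := h2.fun_add ((hasDerivAt_id s).mul_const (β - ε))
    rw [one_mul] at h3
    exact h3
  have hanti : AntitoneOn (fun s : ℝ => X.rho a (x - s • ν) + s * (β - ε)) (Icc 0 s₁) := by
    refine antitoneOn_of_deriv_nonpos (convex_Icc 0 s₁)
      (fun s hs => (hder s hs).continuousAt.continuousWithinAt) (fun s hs => ?_) fun s hs => ?_
    · exact (hder s (interior_subset hs)).differentiableAt.differentiableWithinAt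
    · rw [(hder s (interior_subset hs)).deriv]
      have := (hball₁ (Metric.ball_subset_ball (min_le_left _ _)
        (hin s (interior_subset hs)))).2
      linarith
  have hcont : ContinuousOn (fun s : ℝ => X.rho a (x - s • ν)) (Icc 0 s₁) := by
    intro s hs
    have h1 := ((hder s hs).continuousAt.sub
      (continuousAt_id.mul_const (β - ε))).continuousWithinAt (s := Icc 0 s₁)
    refine h1.congr (fun t _ => ?_) ?_ <;> simp
  have hend : X.rho a (x - s₁ • ν) ≤ 0 := by
    have h1 := hanti (left_mem_Icc.2 hs₁0) (right_mem_Icc.2 hs₁0) hs₁0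
    simp only [zero_smul, sub_zero, zero_mul, add_zero] at h1
    have h2 : s₁ * (β - ε) = X.rho a x := div_mul_cancel₀ _ hβε.ne'
    linarith
  obtain ⟨s, hs, hs0⟩ := intermediate_value_Icc' hs₁0 hcont
    (show (0 : ℝ) ∈ _ from ⟨hend, by simpa using hρx⟩)
  have hs0 : X.rho a (x - s • ν) = 0 := hs0
  -- The affine path from `x` to the boundary point `x - s ν`.
  set ℓ : ℝ → CSpace (m + 1) := fun t => x - (t * s) • ν with hℓ
  have hts : ∀ t ∈ Icc (0 : ℝ) 1, t * s ∈ Icc 0 s₁ := fun t ht =>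
    ⟨mul_nonneg ht.1 hs.1, (mul_le_of_le_one_left hs.1 ht.2).trans hs.2⟩
  have hℓt : ∀ t ∈ Icc (0 : ℝ) 1, ℓ t ∈ (X.chart a).target := by
    intro t ht
    refine X.mem_target.2 ⟨(hball₁ (Metric.ball_subset_ball (min_le_left _ _)
      (hin _ (hts t ht)))).1, ?_⟩
    have h1 := hanti (hts t ht) hs (mul_le_of_le_one_left hs.1 ht.2)
    simp only [hs0] at h1
    have h2 : t * s ≤ s := mul_le_of_le_one_left hs.1 ht.2
    have h3 : (s - t * s) * (β - ε) ≥ 0 := mul_nonneg (by linarith) hβε.le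
    show 0 ≤ X.rho a (x - (t * s) • ν)
    linarith
  have hℓc : ContDiff ℝ ∞ ℓ := by
    simp only [hℓ]
    fun_prop
  have hC1 : X.IsC1Path fun t => (X.chart a).symm (ℓ t) := by
    refine ⟨(X.continuousOn_chart_symm a).comp hℓc.continuous.continuousOn hℓt, fun b => ?_⟩
    exact (((X.contDiffOn_transition a b).of_le (one_le_two.trans two_le_infty)).comp
      (hℓc.of_le (one_le_two.trans two_le_infty)).contDiffOn
      fun t ht => ⟨hℓt t ht.1, ht.2⟩)
  refine ⟨fun t => (X.chart a).symm (ℓ t), ⟨hC1, by simp [hℓ], ?_⟩, ?_⟩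
  · rw [X.symm_mem_boundary_iff (hℓt 1 (right_mem_Icc.2 zero_le_one))]
    simpa [hℓ] using hs0
  · have hspeed : ∀ t ∈ Icc (0 : ℝ) 1,
        ENNReal.ofReal (g.speed (fun t => (X.chart a).symm (ℓ t)) t)
          ≤ ENNReal.ofReal ((1 + ε) * s₁) := by
      intro t ht
      apply ENNReal.ofReal_le_ofReal
      have hd : HasDerivAt ℓ (-(s • ν)) t := by
        have := (((hasDerivAt_id t).mul_const s).smul_const ν).const_sub x
        simpa using this
      have hder' : derivWithin (fun t => X.chart a ((X.chart a).symm (ℓ t))) (Icc 0 1) t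
          = -(s • ν) := by
        refine HasDerivWithinAt.derivWithin ?_ (uniqueDiffOn_Icc zero_lt_one t ht)
        exact hd.hasDerivWithinAt.congr (fun t ht => (X.chart a).right_inv (hℓt t ht))
          ((X.chart a).right_inv (hℓt t ht))
      rw [g.speed_eq hC1 ht ((X.chart a).map_target (hℓt t ht)), hder',
        (X.chart a).right_inv (hℓt t ht)]
      have hG := (g.isPosForm (hℓt t ht)).toIsHermForm
      have h1 : g.riem a (ℓ t) (-(s • ν)) (-(s • ν)) = s ^ 2 * g.riem a (ℓ t) ν ν := by
        have : (-(s • ν)) = ((-s : ℝ) : ℂ) • ν := by ext i; simp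
        rw [this, HermitianMetric.riem, hG.smul_left, hG.smul_right, Complex.conj_ofReal,
          Complex.re_ofReal_mul, Complex.re_ofReal_mul, HermitianMetric.riem]
        ring
      rw [h1, Real.sqrt_mul (sq_nonneg _), Real.sqrt_sq hs.1, mul_comm]
      have h2 : Real.sqrt (g.riem a (ℓ t) ν ν) < 1 + ε :=
        hball₂ ⟨Metric.ball_subset_ball (min_le_right _ _) (hin _ (hts t ht)), hℓt t ht⟩
      exact mul_le_mul h2.le hs.2 hs.1 (by positivity)
    refine (setLIntegral_mono' measurableSet_Icc hspeed).trans ?_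
    simp

/-- At a boundary point, the differential of the distance to the boundary is the normalized
differential of the defining function. -/
theorem hasFDerivWithinAt_boundaryDist [T2Space M] (g : HermitianMetric X) {a : Fin X.N}
    {y ν : CSpace (m + 1)} (hy : y ∈ X.coordBoundary a) (hν : g.IsUnitInnerNormal a y ν) :
    HasFDerivWithinAt (X.coord g.boundaryDist a)
      ((fderiv ℝ (X.rho a) y ν)⁻¹ • fderiv ℝ (X.rho a) y) (X.chart a).target y := by
  set β := fderiv ℝ (X.rho a) y ν with hβ
  have hβ0 : 0 < β := hν.2.2
  have hyamb := (X.mem_target.1 hy.1).1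
  have hbounds : ∀ ε > 0, ε < β → ∀ᶠ x in 𝓝[(X.chart a).target] y,
      X.rho a x / (β + ε) ≤ X.coord g.boundaryDist a x ∧
      X.coord g.boundaryDist a x ≤ (1 + ε) * (X.rho a x / (β - ε)) := by
    intro ε hε hεβ
    filter_upwards [eventually_le_length g hy hν hε, eventually_length_le g hy hν hε hεβ,
      self_mem_nhdsWithin] with x hx hx' hxt
    have hρx : 0 ≤ X.rho a x := (X.mem_target.1 hxt).2
    obtain ⟨γ, hγ, hγl⟩ := hx'
    have hup := (iInf₂_le (f := fun (γ : ℝ → M) (_ : X.IsC1Path γ ∧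
      γ 0 = (X.chart a).symm x ∧ γ 1 ∈ X.boundary) =>
      ∫⁻ t in Icc (0 : ℝ) 1, ENNReal.ofReal (g.speed γ t)) γ hγ).trans hγl
    have hlow := le_iInf₂ (f := fun (γ : ℝ → M) (_ : X.IsC1Path γ ∧
      γ 0 = (X.chart a).symm x ∧ γ 1 ∈ X.boundary) =>
      ∫⁻ t in Icc (0 : ℝ) 1, ENNReal.ofReal (g.speed γ t)) hx
    constructor
    · exact (ENNReal.ofReal_le_iff_le_toReal (ne_top_of_le_ne_top ENNReal.ofReal_ne_top hup)).1 hlow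
    · exact ENNReal.toReal_le_of_le_ofReal
        (mul_nonneg (by linarith) (div_nonneg hρx (by linarith))) hup
  have hmain : HasFDerivWithinAt (fun x => X.coord g.boundaryDist a x - β⁻¹ * X.rho a x)
      (0 : CSpace (m + 1) →L[ℝ] ℝ) (X.chart a).target y := by
    have hzero : X.coord g.boundaryDist a y - β⁻¹ * X.rho a y = 0 := by
      have := (hbounds (β / 2) (by positivity) (by linarith)).self_of_nhdsWithin hy.1
      rw [hy.2, zero_div, zero_div, mul_zero] at this
      rw [hy.2, mul_zero, sub_zero]
      exact le_antisymm this.2 this.1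
    rw [hasFDerivWithinAt_iff_isLittleO]
    simp only [hzero, sub_zero, zero_apply]
    obtain ⟨L, hL0, hL⟩ := (((X.regular a).hasFDerivAt hyamb).isBigO_sub).exists_pos
    rw [Asymptotics.isLittleO_iff]
    intro c hc
    have hcL : 0 < c / L := by positivity
    have h1 : Tendsto (fun ε : ℝ => (1 + ε) / (β - ε) - β⁻¹) (𝓝[>] 0) (𝓝 0) := by
      have : ContinuousAt (fun ε : ℝ => (1 + ε) / (β - ε) - β⁻¹) 0 := by
        refine ContinuousAt.sub (ContinuousAt.div (by fun_prop) (by fun_prop) ?_)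
          continuousAt_const
        simpa using hβ0.ne'
      have := this.tendsto.mono_left (nhdsWithin_le_nhds (s := Ioi 0))
      simpa using this
    have h2 : Tendsto (fun ε : ℝ => β⁻¹ - 1 / (β + ε)) (𝓝[>] 0) (𝓝 0) := by
      have : ContinuousAt (fun ε : ℝ => β⁻¹ - 1 / (β + ε)) 0 := by
        refine ContinuousAt.sub continuousAt_const (ContinuousAt.div (by fun_prop)
          (by fun_prop) ?_)
        simpa using hβ0.ne'
      have := this.tendsto.mono_left (nhdsWithin_le_nhds (s := Ioi 0))
      simpa using this
    have hlt : ∀ᶠ ε in 𝓝[>] (0 : ℝ), ε < β := nhdsWithin_le_nhds (gt_mem_nhds hβ0)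
    obtain ⟨ε, ⟨hε1, hε2⟩, hε3, hε0⟩ := (((h1.eventually (gt_mem_nhds hcL)).and
      (h2.eventually (gt_mem_nhds hcL))).and (hlt.and self_mem_nhdsWithin)).exists
    filter_upwards [hbounds ε hε0 hε3, nhdsWithin_le_nhds hL.bound, self_mem_nhdsWithin]
      with x hx hxL hxt
    have hρx : 0 ≤ X.rho a x := (X.mem_target.1 hxt).2
    rw [hy.2, sub_zero, Real.norm_eq_abs, abs_of_nonneg hρx] at hxL
    have h3 : |X.coord g.boundaryDist a x - β⁻¹ * X.rho a x| ≤ c / L * X.rho a x := by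
      rw [abs_le]
      constructor
      · have : X.rho a x / (β + ε) = (1 / (β + ε)) * X.rho a x := by ring
        nlinarith [hx.1]
      · have : (1 + ε) * (X.rho a x / (β - ε)) = ((1 + ε) / (β - ε)) * X.rho a x := by ring
        nlinarith [hx.2]
    rw [Real.norm_eq_abs]
    refine h3.trans ((mul_le_mul_of_nonneg_left hxL hcL.le).trans_eq ?_)
    field_simp
  have h4 := hmain.add (((X.regular a).hasFDerivAt hyamb).hasFDerivWithinAt.const_mul β⁻¹
    (s := (X.chart a).target))
  rw [zero_add] at h4
  refine h4.congr_of_eventuallyEq (Eventually.of_forall fun x => ?_) ?_ <;> simp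

end distance

/-! ### The form `A_t` in terms of the complex Hessians of `u` and `u̲` -/

open ComplexManifoldWithBoundary

section formA

variable {m : ℕ} {M : Type*} [TopologicalSpace M] {X : ComplexManifoldWithBoundary (m + 1) M}

theorem ComplexManifoldWithBoundary.IsCk.differentiableWithinAt {v : M → ℝ}
    (hv : X.IsCk 2 v) {a : Fin X.N} {z : CSpace (m + 1)} (hz : z ∈ (X.chart a).target) :
    HasFDerivWithinAt (X.coord v a) (fderivWithin ℝ (X.coord v a) (X.chart a).target z)
      (X.chart a).target z :=
  ((hv a).differentiableOn (by simp) z hz).hasFDerivWithinAt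

theorem ComplexManifoldWithBoundary.IsCk.differentiableWithinAt_fderivWithin {v : M → ℝ}
    (hv : X.IsCk 2 v) {a : Fin X.N} {z : CSpace (m + 1)} (hz : z ∈ (X.chart a).target) :
    HasFDerivWithinAt (fderivWithin ℝ (X.coord v a) (X.chart a).target)
      (fderivWithin ℝ (fderivWithin ℝ (X.coord v a) (X.chart a).target) (X.chart a).target z)
      (X.chart a).target z :=
  (((hv a).fderivWithin (m := 1) (X.uniqueDiffOn_target a) (by norm_num)).differentiableOn
    (by simp) z hz).hasFDerivWithinAt

theorem ComplexManifoldWithBoundary.IsCk.sub {k : ℕ} {u v : M → ℝ} (hu : X.IsCk k u)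
    (hv : X.IsCk k v) :
    X.IsCk k fun p => u p - v p := fun a => (hu a).sub (hv a)

/-- The differential of a function vanishing on the boundary is a multiple of `dρ`. -/
theorem fderivWithin_coord_of_boundary {h : M → ℝ} (hh : X.IsCk 2 h)
    (h0 : ∀ p ∈ X.boundary, h p = 0) {a : Fin X.N} {z N : CSpace (m + 1)}
    (hz : z ∈ X.coordBoundary a) (hN : fderiv ℝ (X.rho a) z N ≠ 0) (w : CSpace (m + 1)) :
    fderivWithin ℝ (X.coord h a) (X.chart a).target z w
      = fderivWithin ℝ (X.coord h a) (X.chart a).target z N / fderiv ℝ (X.rho a) z N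
        * fderiv ℝ (X.rho a) z w := by
  refine IsRegularDomain.eq_mul_of_ker hN (fun v hv => ?_) w
  have h1 := hh.differentiableWithinAt hz.1
  have hval : ∀ y ∈ X.coordBoundary a, X.coord h a y = 0 := fun y hy =>
    h0 _ ((X.symm_mem_boundary_iff hy.1).2 hy.2)
  rw [X.target_eq_dom a] at h1 ⊢
  refine (X.regular a).fderivWithin_eq_zero_of_const (X.mem_target.1 hz.1).1 hz.2 h1 ?_ hv
  rw [← X.coordBoundary_eq]
  filter_upwards [self_mem_nhdsWithin] with y hy
  rw [hval y hy, hval z hz]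

/-- In tangential directions, the Hessian of a function vanishing on the boundary is its normal
derivative times the Hessian of the distance to the boundary. -/
theorem mul_tangentialHessian [T2Space M] (g : HermitianMetric X) {h : M → ℝ} (hh : X.IsCk 2 h)
    (h0 : ∀ p ∈ X.boundary, h p = 0) {a : Fin X.N} {z ν : CSpace (m + 1)}
    (hz : z ∈ X.coordBoundary a) (hν : g.IsUnitInnerNormal a z ν) {v w : CSpace (m + 1)}
    (hv : v ∈ X.boundaryTangent a z) (hw : w ∈ X.boundaryTangent a z) :
    fderivWithin ℝ (X.coord h a) (X.chart a).target z ν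
        * X.tangentialHessian g.boundaryDist a z v w
      = realHessian (X.coord h a) (X.chart a).target z v w := by
  obtain ⟨E, N, -, hN, hev⟩ := exists_adapted_frame g hz
  have hsub : X.coordBoundary a ⊆ (X.chart a).target := fun y hy => hy.1
  have hzc : v ∈ tangentConeAt ℝ (X.coordBoundary a) z := by
    rw [X.coordBoundary_eq]
    exact (X.regular a).mem_tangentCone_bdry (X.mem_target.1 hz.1).1 hz.2 hv
  have hNd : HasFDerivWithinAt N (fderivWithin ℝ N (X.chart a).target z) (X.chart a).target z :=
    (hN.differentiableWithinAt (by simp)).hasFDerivWithinAt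
  have hDρ := ((contDiffWithinAt_fderiv_rho hz.1).differentiableWithinAt
    (by simp)).hasFDerivWithinAt
  have hNz := hev.self_of_nhdsWithin hz.1
  have hNunit := isUnitInnerNormal_of_frame g hz.1 hNz.1 hNz.2.1 hNz.2.2.1 hNz.2.2.2
  -- `S` is the value of the differential of the distance on `w`, at boundary points.
  set S : CSpace (m + 1) → ℝ := fun y => (fderiv ℝ (X.rho a) y (N y))⁻¹ * fderiv ℝ (X.rho a) y w
    with hS
  have hSz : S z = 0 := by
    have hw' : fderiv ℝ (X.rho a) z w = 0 := hw
    simp [hS, hw']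
  have hSd : DifferentiableWithinAt ℝ S (X.chart a).target z :=
    ((hDρ.clm_apply hNd).differentiableWithinAt.inv hNz.2.2.2.ne').mul
      (hDρ.clm_apply (hasFDerivWithinAt_const w z _)).differentiableWithinAt
  set S' := fderivWithin ℝ S (X.chart a).target z with hS'
  have hSd' : HasFDerivWithinAt S S' (X.coordBoundary a) z := hSd.hasFDerivWithinAt.mono hsub
  have hevB := hev.filter_mono (nhdsWithin_mono z hsub)
  have hσ : ∀ y ∈ X.coordBoundary a, ((∀ i, E i y ∈ X.holSub a y) ∧
        IsUnitaryFam (sesq (g.comp a y))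
          (Fin.snoc (fun i => E i y) (N y) : Fin (m + 1) → CSpace (m + 1)) ∧
        fderiv ℝ (X.rho a) y (Complex.I • N y) = 0 ∧ 0 < fderiv ℝ (X.rho a) y (N y)) →
      fderivWithin ℝ (X.coord g.boundaryDist a) (X.chart a).target y w = S y := by
    intro y hy hyf
    rw [(hasFDerivWithinAt_boundaryDist g hy (isUnitInnerNormal_of_frame g hy.1 hyf.1 hyf.2.1
      hyf.2.2.1 hyf.2.2.2)).fderivWithin (X.uniqueDiffOn_target a y hy.1)]
    rfl
  have h1 : X.tangentialHessian g.boundaryDist a z v w = S' v := by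
    have h2 : HasFDerivWithinAt
        (fun y => fderivWithin ℝ (X.coord g.boundaryDist a) (X.chart a).target y w) S'
        (X.coordBoundary a) z := by
      refine hSd'.congr_of_eventuallyEq ?_ (hσ z hz hNz)
      filter_upwards [hevB, self_mem_nhdsWithin] with y hy hyb
      exact hσ y hyb hy
    exact h2.differentiableWithinAt.hasFDerivWithinAt.unique_on h2 hzc
  set H := fderivWithin ℝ (X.coord h a) (X.chart a).target with hH
  have hHd := hh.differentiableWithinAt_fderivWithin hz.1
  have h3 : HasFDerivWithinAt (fun y => H y w)
      ((fderivWithin ℝ H (X.chart a).target z).flip w) (X.coordBoundary a) z := by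
    refine ((hHd.clm_apply (hasFDerivWithinAt_const w z _)).congr_fderiv ?_).mono hsub
    ext; simp [hH]
  have h4 : HasFDerivWithinAt (fun y => H y w) (H z (N z) • S') (X.coordBoundary a) z := by
    have h5 := (((hHd.clm_apply hNd).mono hsub).mul hSd')
    have h6 : HasFDerivWithinAt (fun y => H y (N y) * S y) (H z (N z) • S')
        (X.coordBoundary a) z := by
      refine h5.congr_fderiv ?_
      rw [hSz]; simp [hH]
    have hk : ∀ y ∈ X.coordBoundary a, 0 < fderiv ℝ (X.rho a) y (N y) →
        H y w = H y (N y) * S y := by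
      intro y hy hyN
      rw [hH, fderivWithin_coord_of_boundary hh h0 hy hyN.ne' w]
      simp only [hS]
      field_simp
    refine h6.congr_of_eventuallyEq ?_ (hk z hz hNz.2.2.2)
    filter_upwards [hevB, self_mem_nhdsWithin] with y hy hyb
    exact hk y hyb hy.2.2.2
  have h7 := h3.unique_on h4 hzc
  have h8 : H z ν = H z (N z) := by
    rw [hH, fderivWithin_coord_of_boundary hh h0 hz hNz.2.2.2.ne' ν,
      hν.fderiv_eq hz.1 hNunit, div_mul_cancel₀ _ hNz.2.2.2.ne']
  rw [h1, h8]
  exact h7.symm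

theorem mul_tangentialComplexHessian [T2Space M] (g : HermitianMetric X) {h : M → ℝ}
    (hh : X.IsCk 2 h) (h0 : ∀ p ∈ X.boundary, h p = 0) {a : Fin X.N} {z ν : CSpace (m + 1)}
    (hz : z ∈ X.coordBoundary a) (hν : g.IsUnitInnerNormal a z ν) {ξ ζ : CSpace (m + 1)}
    (hξ : ξ ∈ X.holTangent a z) (hζ : ζ ∈ X.holTangent a z) :
    (fderivWithin ℝ (X.coord h a) (X.chart a).target z ν : ℂ)
        * X.tangentialComplexHessian g.boundaryDist a z ξ ζ = X.complexHessian h a z ξ ζ := by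
  simp only [tangentialComplexHessian, complexHessian, leviPart]
  rw [← mul_tangentialHessian g hh h0 hz hν hξ.1 hζ.1,
    ← mul_tangentialHessian g hh h0 hz hν hξ.2 hζ.2,
    ← mul_tangentialHessian g hh h0 hz hν hξ.1 hζ.2,
    ← mul_tangentialHessian g hh h0 hz hν hξ.2 hζ.1]
  push_cast
  ring

theorem realHessian_sub {u v : M → ℝ} (hu : X.IsCk 2 u) (hv : X.IsCk 2 v) {a : Fin X.N}
    {z : CSpace (m + 1)} (hz : z ∈ (X.chart a).target) (ξ ζ : CSpace (m + 1)) :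
    realHessian (X.coord (fun p => u p - v p) a) (X.chart a).target z ξ ζ
      = realHessian (X.coord u a) (X.chart a).target z ξ ζ
        - realHessian (X.coord v a) (X.chart a).target z ξ ζ := by
  have h1 : ∀ y ∈ (X.chart a).target,
      fderivWithin ℝ (X.coord (fun p => u p - v p) a) (X.chart a).target y
        = fderivWithin ℝ (X.coord u a) (X.chart a).target y
          - fderivWithin ℝ (X.coord v a) (X.chart a).target y := fun y hy =>
    ((hu.differentiableWithinAt hy).sub (hv.differentiableWithinAt hy)).fderivWithin
      (X.uniqueDiffOn_target a y hy)
  have h2 := ((hu.differentiableWithinAt_fderivWithin hz).sub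
    (hv.differentiableWithinAt_fderivWithin hz)).congr h1 (h1 z hz)
  simp only [realHessian]
  rw [h2.fderivWithin (X.uniqueDiffOn_target a z hz)]
  rfl

theorem complexHessian_sub {u v : M → ℝ} (hu : X.IsCk 2 u) (hv : X.IsCk 2 v) {a : Fin X.N}
    {z : CSpace (m + 1)} (hz : z ∈ (X.chart a).target) (ξ ζ : CSpace (m + 1)) :
    X.complexHessian (fun p => u p - v p) a z ξ ζ
      = X.complexHessian u a z ξ ζ - X.complexHessian v a z ξ ζ := by
  simp only [complexHessian, leviPart, realHessian_sub hu hv hz]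
  push_cast
  ring

/-- `A_t = 𝔤[u] - (1 - t) 𝔤[u̲]` on `T^{1,0}_{∂M}`. -/
theorem lamA_eq [T2Space M] (g : HermitianMetric X) (χ : RealForm11 X) {u v : M → ℝ}
    (hu : X.IsCk 2 u) (hv : X.IsCk 2 v) (huv : ∀ p ∈ X.boundary, u p = v p) {a : Fin X.N}
    {z ν : CSpace (m + 1)} (hz : z ∈ X.coordBoundary a) (hν : g.IsUnitInnerNormal a z ν) (t : ℝ) :
    g.lamA χ v (fderivWithin ℝ (X.coord (fun p => u p - v p) a) (X.chart a).target z ν) t a z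
      = eigenTuple m (sesq (g.comp a z))
        (fun x y => HermitianMetric.gForm χ u a z x y
          + ((-(1 - t) : ℝ) : ℂ) * HermitianMetric.gForm χ v a z x y) (X.holTangent a z) := by
  rw [HermitianMetric.lamA]
  refine eigenTuple_congr id id (fun x hx => hx) (fun x hx => hx) (fun x _ => rfl)
    (fun x _ y _ => rfl) fun x hx y hy => ?_
  rw [HermitianMetric.formA, mul_tangentialComplexHessian g (hu.sub hv)
    (fun p hp => by rw [huv p hp, sub_self]) hz hν hx hy, complexHessian_sub hu hv hz.1]
  simp only [HermitianMetric.gForm, id]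
  push_cast
  ring

end formA

section norms

variable {n : ℕ} {M : Type*} [TopologicalSpace M] {X : ComplexManifoldWithBoundary n M}

theorem iteratedFDerivWithin_overlap {W : Type*} [NormedAddCommGroup W] [NormedSpace ℝ W]
    {F : CSpace n → W} {a b : Fin X.N} {z : CSpace n} (hz : z ∈ X.overlap a b) (j : ℕ) :
    iteratedFDerivWithin ℝ j F (X.overlap a b) z
      = iteratedFDerivWithin ℝ j F (X.chart a).target z := by
  obtain ⟨u, hu, h⟩ := X.exists_open_overlap a b
  rw [h] at hz ⊢
  exact iteratedFDerivWithin_inter_open hu hz.2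

/-- A bound of the `C^k` norm, which is measured with the compact sets of the atlas, bounds the
derivatives near any point in any chart. -/
theorem exists_bound_of_CkNormLE [T2Space M] (k : ℕ) (K : ℝ) {b : Fin X.N} {q : CSpace n}
    (hq : q ∈ (X.chart b).target) :
    ∃ C : ℝ, ∀ᶠ z in 𝓝[(X.chart b).target] q, ∀ v : M → ℝ, X.IsCk k v → X.CkNormLE k v K →
      ∀ j ≤ k, ‖iteratedFDerivWithin ℝ j (X.coord v b) (X.chart b).target z‖ ≤ C := by
  have key : ∀ c : Fin X.N, ∃ C : ℝ, 0 ≤ C ∧ ∀ᶠ z in 𝓝[(X.chart b).target] q,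
      (X.chart b).symm z ∈ X.core c → ∀ v : M → ℝ, X.IsCk k v → X.CkNormLE k v K →
      ∀ j ≤ k, ‖iteratedFDerivWithin ℝ j (X.coord v b) (X.chart b).target z‖ ≤ C := by
    intro c
    by_cases hp : (X.chart b).symm q ∈ X.core c
    · have hov : q ∈ X.overlap b c := ⟨hq, X.core_subset c hp⟩
      have hbd : ∀ j : ℕ, ∃ D : ℝ, 1 ≤ D ∧ ∀ᶠ z in 𝓝[(X.chart b).target] q,
          ‖iteratedFDerivWithin ℝ j (X.transition b c) (X.overlap b c) z‖ ≤ D := by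
        intro j
        have h1 := ((X.contDiffOn_transition b c).continuousOn_iteratedFDerivWithin
          (m := j) (by exact_mod_cast le_top) (X.uniqueDiffOn_overlap b c) q hov).norm
        have h2 : ∀ᶠ z in 𝓝[X.overlap b c] q,
            ‖iteratedFDerivWithin ℝ j (X.transition b c) (X.overlap b c) z‖
              < ‖iteratedFDerivWithin ℝ j (X.transition b c) (X.overlap b c) q‖ + 1 :=
          h1.eventually (gt_mem_nhds (by linarith))
        refine ⟨‖iteratedFDerivWithin ℝ j (X.transition b c) (X.overlap b c) q‖ + 1,
          by linarith [norm_nonneg (iteratedFDerivWithin ℝ j (X.transition b c)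
            (X.overlap b c) q)], ?_⟩
        have h3 : 𝓝[(X.chart b).target] q ≤ 𝓝[X.overlap b c] q :=
          nhdsWithin_le_iff.2 (X.overlap_mem_nhdsWithin hov)
        exact (h2.filter_mono h3).mono fun z hz => hz.le
      choose D hD1 hD using hbd
      set D' : ℝ := ∑ j ∈ Finset.range (k + 1), D j with hD'
      have hDle : ∀ j ≤ k, D j ≤ D' := fun j hj =>
        Finset.single_le_sum (f := D) (fun i _ => zero_le_one.trans (hD1 i))
          (Finset.mem_range.2 (by omega))
      have hD'1 : 1 ≤ D' := (hD1 0).trans (hDle 0 (Nat.zero_le _))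
      refine ⟨∑ j ∈ Finset.range (k + 1), (j.factorial : ℝ) * |K| * D' ^ j, by positivity, ?_⟩
      have hall : ∀ᶠ z in 𝓝[(X.chart b).target] q, ∀ j ∈ Finset.range (k + 1),
          ‖iteratedFDerivWithin ℝ j (X.transition b c) (X.overlap b c) z‖ ≤ D j :=
        (Finset.eventually_all _).2 fun j _ => hD j
      filter_upwards [hall, X.overlap_mem_nhdsWithin hov] with z hz hzo hzc v hv hvK j hj
      have hTz : X.chart c ((X.chart b).symm z) = X.transition b c z := rfl
      have h1 : ‖iteratedFDerivWithin ℝ j (X.coord v c ∘ X.transition b c) (X.overlap b c) z‖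
          ≤ (j.factorial : ℝ) * |K| * D' ^ j := by
        refine norm_iteratedFDerivWithin_comp_le (N := j) (t := (X.chart c).target)
          ((hv c).of_le (by exact_mod_cast hj))
          ((X.contDiffOn_transition b c).of_le (by exact_mod_cast le_top)) le_rfl
          (X.uniqueDiffOn_target c) (X.uniqueDiffOn_overlap b c)
          (fun y hy => (X.transition_mem hy).1) hzo (fun i hi => ?_) fun i hi1 hi => ?_
        · have := hvK c _ hzc i (hi.trans hj)
          rw [hTz] at this
          exact this.trans (le_abs_self K)
        · refine (hz i (Finset.mem_range.2 (by omega))).trans ((hDle i (by omega)).trans ?_)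
          exact le_self_pow₀ hD'1 (by omega)
      have h2 : iteratedFDerivWithin ℝ j (X.coord v c ∘ X.transition b c) (X.overlap b c) z
          = iteratedFDerivWithin ℝ j (X.coord v b) (X.overlap b c) z :=
        iteratedFDerivWithin_congr (fun y hy => coord_transition v hy) hzo j
      rw [h2, iteratedFDerivWithin_overlap hzo] at h1
      exact h1.trans (Finset.single_le_sum
        (f := fun j : ℕ => (j.factorial : ℝ) * |K| * D' ^ j) (fun i _ => by positivity)
        (Finset.mem_range.2 (by omega)))
    · refine ⟨0, le_rfl, ?_⟩
      have hcl : IsClosed (X.core c) := (X.isCompact_core c).isClosed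
      have h1 := (X.continuousOn_chart_symm b q hq).preimage_mem_nhdsWithin
        (hcl.isOpen_compl.mem_nhds hp)
      filter_upwards [h1] with z hz hzc
      exact absurd hzc hz
  choose C hC0 hC using key
  refine ⟨∑ c, C c, ?_⟩
  filter_upwards [eventually_all.2 hC] with z hz v hv hvK j hj
  obtain ⟨c, hc⟩ := X.core_cover ((X.chart b).symm z)
  exact (hz c hc v hv hvK j hj).trans
    (Finset.single_le_sum (f := C) (fun i _ => hC0 i) (Finset.mem_univ c))

end norms

/-! ### Second derivatives along lines and the strong minimum principle -/

/-- `φ` is differentiable near `0`, with derivative `a` and second derivative `b` at `0`. -/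
def HasJet2 (φ : ℝ → ℝ) (a b : ℝ) : Prop :=
  ∃ φ' : ℝ → ℝ, (∀ᶠ s in 𝓝 0, HasDerivAt φ (φ' s) s) ∧ φ' 0 = a ∧ HasDerivAt φ' b 0

namespace HasJet2

variable {φ χ : ℝ → ℝ} {a b a' b' : ℝ}

theorem congr_values (h : HasJet2 φ a b) (ha : a = a') (hb : b = b') : HasJet2 φ a' b' :=
  ha ▸ hb ▸ h

theorem add (h : HasJet2 φ a b) (h' : HasJet2 χ a' b') :
    HasJet2 (fun s => φ s + χ s) (a + a') (b + b') := by
  obtain ⟨p, hp, rfl, hb⟩ := h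
  obtain ⟨p', hp', rfl, hb'⟩ := h'
  refine ⟨fun s => p s + p' s, ?_, rfl, hb.add hb'⟩
  filter_upwards [hp, hp'] with s hs hs'
  exact hs.add hs'

theorem const_mul (h : HasJet2 φ a b) (c : ℝ) :
    HasJet2 (fun s => c * φ s) (c * a) (c * b) := by
  obtain ⟨p, hp, rfl, hb⟩ := h
  refine ⟨fun s => c * p s, ?_, rfl, hb.const_mul c⟩
  filter_upwards [hp] with s hs
  exact hs.const_mul c

theorem sub (h : HasJet2 φ a b) (h' : HasJet2 χ a' b') :
    HasJet2 (fun s => φ s - χ s) (a - a') (b - b') := by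
  have := h.add (h'.const_mul (-1))
  simpa [sub_eq_add_neg] using this

theorem mul (h : HasJet2 φ a b) (h' : HasJet2 χ a' b') :
    HasJet2 (fun s => φ s * χ s) (a * χ 0 + φ 0 * a') (b * χ 0 + 2 * (a * a') + φ 0 * b') := by
  obtain ⟨p, hp, rfl, hb⟩ := h
  obtain ⟨p', hp', rfl, hb'⟩ := h'
  refine ⟨fun s => p s * χ s + φ s * p' s, ?_, rfl, ?_⟩
  · filter_upwards [hp, hp'] with s hs hs'
    exact hs.mul hs'
  · exact ((hb.mul hp'.self_of_nhds).add (hp.self_of_nhds.mul hb')).congr_deriv (by ring)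

theorem exp (h : HasJet2 φ a b) :
    HasJet2 (fun s => Real.exp (φ s)) (Real.exp (φ 0) * a) (Real.exp (φ 0) * (a ^ 2 + b)) := by
  obtain ⟨p, hp, rfl, hb⟩ := h
  refine ⟨fun s => Real.exp (φ s) * p s, ?_, rfl, ?_⟩
  · filter_upwards [hp] with s hs
    exact hs.exp
  · exact (hp.self_of_nhds.exp.mul hb).congr_deriv (by ring)

theorem quadratic (p q r : ℝ) : HasJet2 (fun s => p + q * s + r * s ^ 2) q (2 * r) := by
  refine ⟨fun s => q + 2 * r * s, Eventually.of_forall fun s => ?_, by simp, ?_⟩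
  · have := (((hasDerivAt_id s).const_mul q).const_add p).add
      (((hasDerivAt_id s).pow 2).const_mul r)
    exact this.congr_deriv (by simp; ring)
  · simpa using ((hasDerivAt_id (0 : ℝ)).const_mul (2 * r)).const_add q

theorem const (c : ℝ) : HasJet2 (fun _ => c) 0 0 := by
  simpa using quadratic c 0 0

theorem nonneg_of_isLocalMin (h : HasJet2 φ a b) (hm : IsLocalMin φ 0) : 0 ≤ b := by
  obtain ⟨p, hp, ha, hb⟩ := h
  by_contra! hneg
  have h1 : deriv φ =ᶠ[𝓝 0] p := hp.mono fun s hs => hs.deriv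
  have h2 : deriv (deriv φ) 0 = b := by rw [h1.deriv_eq, hb.deriv]
  have hmax := isLocalMax_of_deriv_deriv_neg (by rw [h2]; exact hneg) hm.deriv_eq_zero
    hp.self_of_nhds.continuousAt
  have h3 : φ =ᶠ[𝓝 0] fun _ => φ 0 := by
    filter_upwards [hm, hmax] with s h4 h5
    exact le_antisymm h5 h4
  have h4 : deriv φ =ᶠ[𝓝 0] fun _ => 0 := by
    filter_upwards [h3.eventuallyEq_nhds] with s hs
    rw [hs.deriv_eq, deriv_const]
  rw [h4.deriv_eq, deriv_const] at h2
  exact hneg.ne h2.symm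

end HasJet2

section minimum

variable {n k : ℕ}

theorem norm_sq_line (x ξ : CSpace n) (s : ℝ) :
    ‖x + s • ξ‖ ^ 2 = ‖x‖ ^ 2 + 2 * (inner ℂ ξ x).re * s + ‖ξ‖ ^ 2 * s ^ 2 := by
  rw [@norm_add_sq ℂ, norm_smul, mul_pow, Real.norm_eq_abs, sq_abs, inner_smul_right_eq_smul]
  have : (inner ℂ x ξ).re = (inner ℂ ξ x).re := inner_re_symm (𝕜 := ℂ) x ξ
  simp [this]
  ring

theorem hasJet2_norm_sq (x ξ : CSpace n) :
    HasJet2 (fun s => ‖x + s • ξ‖ ^ 2) (2 * (inner ℂ ξ x).re) (2 * ‖ξ‖ ^ 2) := by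
  simp only [norm_sq_line]
  exact HasJet2.quadratic _ _ _

theorem re_sq_add_re_sq (x ξ : CSpace n) :
    (inner ℂ ξ x).re ^ 2 + (inner ℂ (Complex.I • ξ) x).re ^ 2 = ‖(inner ℂ ξ x : ℂ)‖ ^ 2 := by
  rw [inner_smul_left, ← Complex.normSq_eq_norm_sq, Complex.normSq_apply]
  simp
  ring

/-- Strong minimum principle: a supersolution of a family of uniformly elliptic operators
`∑ w_i (D²h(e_i, e_i) + D²h(√-1 e_i, √-1 e_i)) ≤ 0` with a local minimum is locally constant. The
comparison function is Hopf's `exp (-A |x|²) - exp (-A R²)` near a point where a ball in the set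
`{h > μ}` touches `{h = μ}`. -/
theorem eventually_eq_of_supersolution {h : CSpace n → ℝ} {H : CSpace n → CSpace n → ℝ}
    {z₀ : CSpace n} {μ c C : ℝ} (hc : 0 < c) (hz₀ : h z₀ = μ)
    (hev : ∀ᶠ z in 𝓝 z₀, μ ≤ h z ∧ ContinuousAt h z ∧
      (∀ ξ, ∃ a, HasJet2 (fun s => h (z + s • ξ)) a (H z ξ)) ∧
      ∃ (e : Fin k → CSpace n) (w : Fin k → ℝ), (∀ i, 0 ≤ w i) ∧
        ∑ i, w i * (H z (e i) + H z (Complex.I • e i)) ≤ 0 ∧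
        ∑ i, w i * ‖e i‖ ^ 2 ≤ C ∧
        ∀ x : CSpace n, c * ‖x‖ ^ 2 ≤ ∑ i, w i * ‖(inner ℂ (e i) x : ℂ)‖ ^ 2) :
    ∀ᶠ z in 𝓝 z₀, h z = μ := by
  obtain ⟨R, hR, hball⟩ := Metric.eventually_nhds_iff_ball.1 hev
  set r := R / 4 with hr
  have hr0 : 0 < r := by positivity
  refine Metric.eventually_nhds_iff_ball.2 ⟨r, hr0, fun y hy => ?_⟩
  by_contra hne
  rw [Metric.mem_ball] at hy
  have hin : ∀ z, dist z z₀ ≤ 3 * r → z ∈ Metric.ball z₀ R := fun z hz => by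
    rw [Metric.mem_ball]; linarith
  have hcont : ContinuousOn h (Metric.closedBall z₀ (3 * r)) := fun z hz =>
    (hball z (hin z hz)).2.1.continuousWithinAt
  set F := Metric.closedBall z₀ (3 * r) ∩ h ⁻¹' {μ} with hF
  have hFc : IsCompact F := (isCompact_closedBall z₀ (3 * r)).of_isClosed_subset
    (hcont.preimage_isClosed_of_isClosed Metric.isClosed_closedBall isClosed_singleton)
    inter_subset_left
  have hz₀F : z₀ ∈ F := ⟨Metric.mem_closedBall_self (by positivity), hz₀⟩
  obtain ⟨p, hpF, hp⟩ := hFc.exists_isMinOn ⟨z₀, hz₀F⟩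
    (f := fun z => dist z y) (by fun_prop)
  set δ := dist p y with hδ
  have hδr : δ < r := lt_of_le_of_lt (hp hz₀F) (show dist z₀ y < r by rwa [dist_comm])
  have hδ0 : 0 < δ := by
    rw [hδ, dist_pos]
    rintro rfl
    exact hne hpF.2
  have hout : ∀ z, dist z y < δ → μ < h z := by
    intro z hz
    have hzz : dist z z₀ ≤ 3 * r := by linarith [dist_triangle z y z₀]
    refine lt_of_le_of_ne (hball z (hin z hzz)).1 fun heq => ?_
    exact absurd (hp (show z ∈ F from ⟨hzz, heq.symm⟩)) (not_le.2 hz)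
  -- The smaller ball around `y'` touches `{h = μ}` at `p` only.
  set y' := y + (1 / 2 : ℝ) • (p - y) with hy'
  set δ' := δ / 2 with hδ'
  have hδ'0 : 0 < δ' := by positivity
  have hpy' : p - y' = (1 / 2 : ℝ) • (p - y) := by rw [hy']; module
  have hpn : ‖p - y'‖ = δ' := by
    rw [hpy', norm_smul, hδ', hδ, dist_eq_norm]; norm_num; ring
  have hstrict : ∀ z, ‖z - y'‖ ≤ δ' → z ≠ p → μ < h z := by
    intro z hz hzp
    refine hout z ?_
    have h1 := parallelogram_law_with_norm ℂ (z - y') (p - y')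
    have h2 : z - y' + (p - y') = z - y := by rw [hpy', hy']; module
    have h3 : z - y' - (p - y') = z - p := by abel
    rw [h2, h3, hpn] at h1
    have h4 : 0 < ‖z - p‖ := norm_pos_iff.2 (sub_ne_zero.2 hzp)
    rw [dist_eq_norm]
    by_contra! h5
    have h6 : δ = 2 * δ' := by rw [hδ']; ring
    nlinarith [norm_nonneg (z - y'), mul_self_le_mul_self hδ0.le h5,
      mul_self_le_mul_self (norm_nonneg (z - y')) hz, mul_pos h4 h4]
  set A := 4 * (|C| + 1) / (c * δ' ^ 2) with hA
  have hA0 : 0 < A := by positivity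
  set v : CSpace n → ℝ := fun z => Real.exp (-A * ‖z - y'‖ ^ 2) - Real.exp (-A * δ' ^ 2) with hv
  have hvc : Continuous v := by
    rw [hv]; fun_prop
  have hv1 : ∀ z, v z ≤ 1 := fun z => by
    have h1 : Real.exp (-A * ‖z - y'‖ ^ 2) ≤ 1 := Real.exp_le_one_iff.2 (by
      have := mul_nonneg hA0.le (sq_nonneg ‖z - y'‖); linarith)
    have := Real.exp_pos (-A * δ' ^ 2)
    simp only [hv]; linarith
  have hv0 : ∀ z, δ' ≤ ‖z - y'‖ → v z ≤ 0 := fun z hz => by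
    simp only [hv, sub_nonpos]
    refine Real.exp_le_exp.2 ?_
    have := mul_le_mul_of_nonneg_left (pow_le_pow_left₀ hδ'0.le hz 2) hA0.le
    linarith
  have hvp : v p = 0 := by simp only [hv, hpn, sub_self]
  set B := Metric.closedBall p (δ' / 2) with hB
  have hBin : ∀ z ∈ B, dist z z₀ ≤ 3 * r := by
    intro z hz
    have h1 : dist z p ≤ δ' / 2 := hz
    have := dist_triangle z p z₀
    have := dist_triangle p y z₀
    linarith
  have hBc : ContinuousOn h B := hcont.mono fun z hz => hBin z hz
  have hcomp : IsCompact (Metric.sphere p (δ' / 2) ∩ Metric.closedBall y' δ') :=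
    (isCompact_sphere _ _).inter_right Metric.isClosed_closedBall
  obtain ⟨μ', hμ', hlow⟩ := hcomp.exists_forall_le'
    (hBc.mono fun z hz => Metric.sphere_subset_closedBall hz.1) (a := μ) (fun z hz => by
      refine hstrict z (by rw [← dist_eq_norm]; exact hz.2) ?_
      rintro rfl
      have := hz.1
      rw [Metric.mem_sphere, dist_self] at this
      linarith)
  set ε := μ' - μ with hε
  have hε0 : 0 < ε := by rw [hε]; linarith
  set W : CSpace n → ℝ := fun z => h z - ε * v z with hW
  have hWc : ContinuousOn W B := hBc.sub (by fun_prop)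
  have hWp : W p = μ := by
    have : h p = μ := hpF.2
    simp [hW, hvp, this]
  have hpB : p ∈ B := Metric.mem_closedBall_self (by positivity)
  have hWs : ∀ z ∈ Metric.sphere p (δ' / 2), μ ≤ W z := by
    intro z hz
    by_cases hzy : z ∈ Metric.closedBall y' δ'
    · have h1 := hlow z ⟨hz, hzy⟩
      have h2 := mul_le_mul_of_nonneg_left (hv1 z) hε0.le
      simp only [hW]; linarith
    · rw [Metric.mem_closedBall, not_le, dist_eq_norm] at hzy
      have h1 := (hball z (hin z (hBin z (Metric.sphere_subset_closedBall hz)))).1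
      have h2 := mul_nonpos_of_nonneg_of_nonpos hε0.le (hv0 z hzy.le)
      simp only [hW]; linarith
  obtain ⟨q, hqb, hq⟩ : ∃ q ∈ Metric.ball p (δ' / 2), IsMinOn W B q := by
    obtain ⟨q, hqB, hq⟩ := (isCompact_closedBall p (δ' / 2)).exists_isMinOn ⟨p, hpB⟩ hWc
    rcases lt_or_eq_of_le (show dist q p ≤ δ' / 2 from hqB) with hlt | heq
    · exact ⟨q, hlt, hq⟩
    · refine ⟨p, Metric.mem_ball_self (by positivity), fun z hz => ?_⟩
      have h1 : W q ≤ W z := hq hz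
      have h2 := hWs q heq
      show W p ≤ W z
      linarith
  have hqloc : IsLocalMin W q := hq.isLocalMin
    (mem_of_superset (Metric.isOpen_ball.mem_nhds hqb) Metric.ball_subset_closedBall)
  obtain ⟨-, -, hjet, e, w, hw0, hsum, hwC, hell⟩ :=
    hball q (hin q (hBin q (Metric.ball_subset_closedBall hqb)))
  set x := q - y' with hx
  set E := Real.exp (-A * ‖x‖ ^ 2) with hE
  have hE0 : 0 < E := Real.exp_pos _
  have hxn : δ' / 2 ≤ ‖x‖ := by
    have h1 : ‖p - y'‖ ≤ ‖q - p‖ + ‖x‖ := by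
      rw [hx, ← norm_neg (q - p)]
      refine (norm_add_le _ _).trans_eq' ?_
      congr 1; abel
    rw [Metric.mem_ball, dist_eq_norm] at hqb
    linarith
  have hder : ∀ ξ, ε * (E * ((2 * A * (inner ℂ ξ x).re) ^ 2 - 2 * A * ‖ξ‖ ^ 2)) ≤ H q ξ := by
    intro ξ
    obtain ⟨a, ha⟩ := hjet ξ
    have h1 := ((hasJet2_norm_sq x ξ).const_mul (-A)).exp.sub
      (HasJet2.const (Real.exp (-A * δ' ^ 2)))
    have h2 := ha.sub (h1.const_mul ε)
    have h3 : IsLocalMin (fun s : ℝ => W (q + s • ξ)) 0 := by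
      have hc : ContinuousAt (fun s : ℝ => q + s • ξ) 0 := by fun_prop
      have h4 : Tendsto (fun s : ℝ => q + s • ξ) (𝓝 0) (𝓝 q) := by
        simpa using hc.tendsto
      have := h4.eventually hqloc
      simpa [IsLocalMin, IsMinFilter] using this
    have h4 := h2.nonneg_of_isLocalMin (by
      convert h3 using 2 with s
      simp only [hW, hv]
      rw [show q + s • ξ - y' = x + s • ξ by rw [hx]; abel])
    simp only [zero_smul, add_zero, sub_zero] at h4
    have h5 : (-A * (2 * (inner ℂ ξ x).re)) ^ 2 + -A * (2 * ‖ξ‖ ^ 2)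
      = (2 * A * (inner ℂ ξ x).re) ^ 2 - 2 * A * ‖ξ‖ ^ 2 := by ring
    rw [h5] at h4
    linarith
  have hterm : ∀ i, w i * (ε * (E * (4 * A * (A * ‖(inner ℂ (e i) x : ℂ)‖ ^ 2 - ‖e i‖ ^ 2))))
      ≤ w i * (H q (e i) + H q (Complex.I • e i)) := by
    intro i
    refine mul_le_mul_of_nonneg_left ?_ (hw0 i)
    have h1 := hder (e i)
    have h2 := hder (Complex.I • e i)
    rw [← re_sq_add_re_sq]
    rw [norm_smul, Complex.norm_I, one_mul] at h2
    refine le_trans (le_of_eq ?_) (add_le_add h1 h2)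
    ring
  have htot := (Finset.sum_le_sum fun i (_ : i ∈ Finset.univ) => hterm i).trans hsum
  have hrew : ∑ i, w i * (ε * (E * (4 * A * (A * ‖(inner ℂ (e i) x : ℂ)‖ ^ 2 - ‖e i‖ ^ 2))))
      = ε * E * (4 * A) * (A * ∑ i, w i * ‖(inner ℂ (e i) x : ℂ)‖ ^ 2
        - ∑ i, w i * ‖e i‖ ^ 2) := by
    simp only [Finset.mul_sum, ← Finset.sum_sub_distrib]
    exact Finset.sum_congr rfl fun i _ => by ring
  rw [hrew] at htot
  have hpos : 0 < A * ∑ i, w i * ‖(inner ℂ (e i) x : ℂ)‖ ^ 2 - ∑ i, w i * ‖e i‖ ^ 2 := by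
    have h1 := mul_le_mul_of_nonneg_left (hell x) hA0.le
    have h2 : c * (δ' / 2) ^ 2 ≤ c * ‖x‖ ^ 2 :=
      mul_le_mul_of_nonneg_left (pow_le_pow_left₀ (by positivity) hxn 2) hc.le
    have h3 := mul_le_mul_of_nonneg_left h2 hA0.le
    have h4 : A * (c * (δ' / 2) ^ 2) = |C| + 1 := by
      rw [hA]; field_simp; norm_num
    have := le_abs_self C
    linarith
  have : 0 < ε * E * (4 * A) * (A * ∑ i, w i * ‖(inner ℂ (e i) x : ℂ)‖ ^ 2
        - ∑ i, w i * ‖e i‖ ^ 2) := by positivity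
  linarith

end minimum

/-! ### Comparison of the solution with the subsolution -/

theorem hasJet2_line {n : ℕ} {F : CSpace n → ℝ} {F' : CSpace n → CSpace n →L[ℝ] ℝ}
    {F'' : CSpace n →L[ℝ] CSpace n →L[ℝ] ℝ} {z : CSpace n}
    (hF : ∀ᶠ y in 𝓝 z, HasFDerivAt F (F' y) y) (hF' : HasFDerivAt F' F'' z) (ξ : CSpace n) :
    HasJet2 (fun s : ℝ => F (z + s • ξ)) (F' z ξ) (F'' ξ ξ) := by
  have hline : ∀ s : ℝ, HasDerivAt (fun s : ℝ => z + s • ξ) ξ s := fun s => by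
    simpa using ((hasDerivAt_id s).smul_const ξ).const_add z
  have hz : Tendsto (fun s : ℝ => z + s • ξ) (𝓝 0) (𝓝 z) := by
    simpa using (hline 0).continuousAt.tendsto
  refine ⟨fun s => F' (z + s • ξ) ξ, ?_, by simp, ?_⟩
  · filter_upwards [hz.eventually hF] with s hs
    exact hs.comp_hasDerivAt s (hline s)
  · have h1 : HasDerivAt (fun s : ℝ => F' (z + s • ξ)) (F'' ξ) 0 := by
      have h2 : HasFDerivAt F' F'' (z + (0 : ℝ) • ξ) := by simpa using hF'
      exact h2.comp_hasDerivAt 0 (hline 0)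
    simpa using h1.clm_apply (hasDerivAt_const (0 : ℝ) ξ)

theorem IsUnitaryFam.norm_sq_le_sum_inner {n : ℕ} {G : CSpace n → CSpace n → ℂ}
    (hG : IsHermForm G) {e : Fin n → CSpace n} (he : IsUnitaryFam G e) {C : ℝ}
    {x : CSpace n} (hC : (G x x).re ≤ C * ‖x‖ ^ 2) :
    ‖x‖ ^ 2 ≤ C * ∑ i, ‖(inner ℂ (e i) x : ℂ)‖ ^ 2 := by
  have hexp := he.expand (S := ⊤) hG (fun _ => trivial) (by simp) (x := x) trivial
  have h1 : (G x x).re = ∑ i, ‖G x (e i)‖ ^ 2 := by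
    conv_lhs => rw [hexp, IsUnitaryFam.herm_eq_sum hG]
    simp only [he _ _, mul_ite, mul_one, mul_zero, Finset.sum_ite_eq, Finset.mem_univ, if_true,
      Complex.mul_conj, Complex.re_sum, Complex.ofReal_re, Complex.normSq_eq_norm_sq]
  have h2 : ‖x‖ ^ 2 ≤ ∑ i, ‖G x (e i)‖ * ‖(inner ℂ (e i) x : ℂ)‖ := by
    have h3 : ‖(inner ℂ x x : ℂ)‖ = ‖x‖ ^ 2 := by
      rw [inner_self_eq_norm_sq_to_K]; simp
    rw [← h3]
    conv_lhs => enter [1, 2]; rw [hexp]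
    rw [sum_inner]
    refine (norm_sum_le _ _).trans (Finset.sum_le_sum fun i _ => ?_)
    rw [inner_smul_left, norm_mul, RCLike.norm_conj]
  have h3 := (pow_le_pow_left₀ (sq_nonneg _) h2 2).trans
    (Finset.sum_mul_sq_le_sq_mul_sq Finset.univ (fun i => ‖G x (e i)‖)
      fun i => ‖(inner ℂ (e i) x : ℂ)‖)
  rw [← h1] at h3
  by_cases hx : x = 0
  · simp [hx]
  have hx0 : 0 < ‖x‖ ^ 2 := pow_pos (norm_pos_iff.2 hx) 2
  have h4 := h3.trans (mul_le_mul_of_nonneg_right hC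
    (Finset.sum_nonneg fun i _ => sq_nonneg ‖(inner ℂ (e i) x : ℂ)‖))
  have h5 : ‖x‖ ^ 2 * ‖x‖ ^ 2 ≤ ‖x‖ ^ 2 * (C * ∑ i, ‖(inner ℂ (e i) x : ℂ)‖ ^ 2) := by
    linarith
  exact le_of_mul_le_mul_left h5 hx0

section structural

variable {m : ℕ} {Γ : Set (Fin (m + 1) → ℝ)} {f : (Fin (m + 1) → ℝ) → ℝ}

/-- On a bounded part of a superlevel set above `sup_{∂Γ} f` the operator is uniformly elliptic. -/
theorem exists_fderiv_bounds (hΓ : IsSymmetricCone Γ) (hf : IsStructuralFunction Γ f) {θ : ℝ}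
    (hθ : supBoundary Γ f < (θ : EReal)) (R : ℝ) :
    ∃ c > 0, ∃ C : ℝ, ∀ l ∈ Γ, (∀ i, |l i| ≤ R) → θ ≤ f l →
      ∀ i, c ≤ fderiv ℝ f l (Pi.single i 1) ∧ fderiv ℝ f l (Pi.single i 1) ≤ C := by
  obtain ⟨ε, hε, hsub⟩ := exists_sub_mem_of_le hΓ hθ R
  set S : Set (Fin (m + 1) → ℝ) := {l | (∀ i, |l i| ≤ R) ∧ (fun i => l i - ε) ∈ closure Γ} with hS
  have hSc : IsCompact S := by
    refine (isCompact_closedBall (0 : Fin (m + 1) → ℝ) |R|).of_isClosed_subset ?_ fun l hl => ?_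
    · refine IsClosed.inter ?_ (isClosed_closure.preimage (f := fun l : Fin (m + 1) → ℝ =>
        fun i => l i - ε) (by fun_prop))
      rw [show (fun l : Fin (m + 1) → ℝ => ∀ i, |l i| ≤ R) = {l | ∀ i, |l i| ≤ R} from rfl,
        Set.ofPred_forall]
      exact isClosed_iInter fun i => isClosed_le (by fun_prop) continuous_const
    · rw [mem_closedBall_zero_iff]
      exact (pi_norm_le_iff_of_nonneg (abs_nonneg R)).2 fun i => (hl.1 i).trans (le_abs_self R)
  have hSΓ : S ⊆ Γ := fun l hl => by
    have := (hΓ.isMonoCone.mem_closure_iff.1 hl.2) ε hε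
    simpa using this
  have hcont : ∀ i, ContinuousOn (fun l => fderiv ℝ f l (Pi.single i 1)) S := fun i =>
    ((hf.smooth.continuousOn_fderiv_of_isOpen hΓ.isOpen (by simp)).mono hSΓ).clm_apply
      continuousOn_const
  have hmin : ∀ i : Fin (m + 1), ∃ c : ℝ, 0 < c ∧ ∀ l ∈ S, c ≤ fderiv ℝ f l (Pi.single i 1) :=
    fun i => hSc.exists_forall_le' (hcont i) fun l hl => hf.elliptic l (hSΓ hl) i
  have hmax : ∀ i : Fin (m + 1), ∃ C : ℝ, ∀ l ∈ S, fderiv ℝ f l (Pi.single i 1) ≤ C := by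
    intro i
    obtain ⟨C, hC⟩ := hSc.bddAbove_image (hcont i)
    exact ⟨C, fun l hl => hC (mem_image_of_mem _ hl)⟩
  choose c hc hc' using hmin
  choose C hC using hmax
  obtain ⟨i₀, -, hi₀⟩ := Finset.exists_min_image Finset.univ c ⟨0, Finset.mem_univ _⟩
  obtain ⟨i₁, -, hi₁⟩ := Finset.exists_max_image Finset.univ C ⟨0, Finset.mem_univ _⟩
  refine ⟨c i₀, hc i₀, C i₁, fun l hl hlR hlθ i => ?_⟩
  have hlS : l ∈ S := ⟨hlR, subset_closure (hsub l hl hlR hlθ)⟩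
  exact ⟨(hi₀ i (Finset.mem_univ i)).trans (hc' i l hlS),
    (hC i l hlS).trans (hi₁ i (Finset.mem_univ i))⟩

/-- Concavity: the linearization of the operator at a solution is nonpositive on the difference
of the solution and a subsolution. -/
theorem linearized_sub_nonpos (hΓ : IsSymmetricCone Γ) (hf : IsStructuralFunction Γ f)
    {G U L : CSpace (m + 1) → CSpace (m + 1) → ℂ} (hG : IsHermForm G) (hL : IsHermForm L)
    {lam lam' : Fin (m + 1) → ℝ} {e : Fin (m + 1) → CSpace (m + 1)} (he : IsUnitaryFam G e)
    (hU : ∀ i, (U (e i) (e i)).re = lam i) (hl : lam ∈ Γ)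
    (hlam' : IsEigenTuple G L ((⊤ : Submodule ℂ (CSpace (m + 1))) : Set _) lam') (hl' : lam' ∈ Γ)
    (hle : f lam ≤ f lam') :
    ∑ i, fderiv ℝ f lam (Pi.single i 1) * ((U (e i) (e i)).re - (L (e i) (e i)).re) ≤ 0 := by
  set d : Fin (m + 1) → ℝ := fun i => (L (e i) (e i)).re with hd
  have hdΓ : d ∈ Γ := hΓ.isMonoCone.diag_mem (S := ⊤) hG hL (by simp) hlam' hl' he
    fun _ => trivial
  have hfd : f lam' ≤ f d := hf.le_diag (S := ⊤) hG hL (by simp) hΓ.symmetric hlam' hl' he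
    fun _ => trivial
  have hD := (hf.differentiableAt hΓ hl).hasFDerivAt
  have hline : HasDerivWithinAt (fun t : ℝ => f (lam + t • (d - lam)))
      (fderiv ℝ f lam (d - lam)) (Icc 0 1) 0 := by
    have h1 : HasDerivAt (fun t : ℝ => lam + t • (d - lam)) (d - lam) 0 := by
      simpa using ((hasDerivAt_id (0 : ℝ)).smul_const (d - lam)).const_add lam
    have h2 : HasFDerivAt f (fderiv ℝ f lam) (lam + (0 : ℝ) • (d - lam)) := by simpa using hD
    exact (h2.comp_hasDerivAt 0 h1).hasDerivWithinAt
  have hconc : ConcaveOn ℝ (Icc (0 : ℝ) 1) fun t : ℝ => f (lam + t • (d - lam)) := by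
    have h1 := hf.concave.comp_affineMap (AffineMap.lineMap lam d : ℝ →ᵃ[ℝ] _)
    have h2 := h1.subset (s := Icc (0 : ℝ) 1) (fun t ht => by
      have := hΓ.convex.lineMap_mem hl hdΓ ht
      exact this) (convex_Icc 0 1)
    refine h2.congr fun t _ => ?_
    simp only [Function.comp, AffineMap.lineMap_apply, vsub_eq_sub, vadd_eq_add]
    rw [add_comm]
  have hder := hconc.slope_le_of_hasDerivWithinAt (x := 0) (y := 1) (by simp) (by simp)
    zero_lt_one hline
  simp only [slope, vsub_eq_sub, one_smul, zero_smul, add_zero, sub_zero, inv_one,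
    add_sub_cancel] at hder
  rw [fderiv_apply_eq_sum] at hder
  have hsum : ∑ i, fderiv ℝ f lam (Pi.single i 1) * ((U (e i) (e i)).re - (L (e i) (e i)).re)
      = -∑ i, (d - lam) i * fderiv ℝ f lam (Pi.single i 1) := by
    rw [← Finset.sum_neg_distrib]
    refine Finset.sum_congr rfl fun i _ => ?_
    rw [hU]; simp only [hd, Pi.sub_apply]; ring
  rw [hsum]
  linarith

end structural


open ComplexManifoldWithBoundary

section manifold

variable {m : ℕ} {M : Type*} [TopologicalSpace M] {X : ComplexManifoldWithBoundary (m + 1) M}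
  {g : HermitianMetric X} {χ : RealForm11 X} {Γ : Set (Fin (m + 1) → ℝ)}
  {f : (Fin (m + 1) → ℝ) → ℝ} {ψ φ u usub : M → ℝ}

theorem isEigenTuple_lamG (g : HermitianMetric X) (χ : RealForm11 X) {v : M → ℝ} (hv : X.IsCk 2 v)
    {a : Fin X.N} {z : CSpace (m + 1)} (hz : z ∈ (X.chart a).target) :
    IsEigenTuple (sesq (g.comp a z)) (HermitianMetric.gForm χ v a z)
      ((⊤ : Submodule ℂ (CSpace (m + 1))) : Set _) (g.lamG χ v a z) :=
  isEigenTuple_eigenTuple (S := ⊤) (g.isPosForm hz) (isHermForm_gForm χ hv hz) (by simp)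

theorem IsAdmissibleSolution.equation_coord (h : IsAdmissibleSolution g χ Γ f ψ φ u) {a : Fin X.N}
    {z : CSpace (m + 1)} (hz : z ∈ (X.chart a).target) (hρ : 0 < X.rho a z) :
    g.lamG χ u a z ∈ Γ ∧ f (g.lamG χ u a z) = ψ ((X.chart a).symm z) := by
  have := h.equation a _ ((X.chart a).map_target hz)
    (fun hb => hρ.ne' ((X.symm_mem_boundary_iff hz).1 hb))
  rwa [(X.chart a).right_inv hz] at this

theorem IsAdmissibleSubsolution.inequality_coord (h : IsAdmissibleSubsolution g χ Γ f ψ φ usub)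
    {a : Fin X.N} {z : CSpace (m + 1)} (hz : z ∈ (X.chart a).target) :
    g.lamG χ usub a z ∈ Γ ∧ ψ ((X.chart a).symm z) ≤ f (g.lamG χ usub a z) := by
  have := h.inequality a _ ((X.chart a).map_target hz)
  rwa [(X.chart a).right_inv hz] at this

theorem hasJet2_coord {v : M → ℝ} (hv : X.IsCk 2 v) {a : Fin X.N} {z : CSpace (m + 1)}
    (hz : z ∈ (X.chart a).target) (hρ : 0 < X.rho a z) (ξ : CSpace (m + 1)) :
    HasJet2 (fun s : ℝ => X.coord v a (z + s • ξ))
      (fderivWithin ℝ (X.coord v a) (X.chart a).target z ξ)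
      (realHessian (X.coord v a) (X.chart a).target z ξ ξ) := by
  have hmem := X.target_mem_nhds hz hρ
  refine hasJet2_line ?_ ((hv.differentiableWithinAt_fderivWithin hz).hasFDerivAt hmem) ξ
  filter_upwards [eventually_mem_nhds_iff.2 hmem] with y hy
  exact (hv.differentiableWithinAt (mem_of_mem_nhds hy)).hasFDerivAt hy

theorem abs_realHessian_le (v : CSpace (m + 1) → ℝ) {V : Set (CSpace (m + 1))}
    (hV : UniqueDiffOn ℝ V) {z : CSpace (m + 1)} (hz : z ∈ V) (ξ ζ : CSpace (m + 1)) :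
    |realHessian v V z ξ ζ| ≤ ‖iteratedFDerivWithin ℝ 2 v V z‖ * ‖ξ‖ * ‖ζ‖ := by
  have h := iteratedFDerivWithin_two_apply v hV hz ![ξ, ζ]
  have h2 := (iteratedFDerivWithin ℝ 2 v V z).le_opNorm ![ξ, ζ]
  rw [h, Fin.prod_univ_two] at h2
  simpa [realHessian, mul_assoc] using h2

theorem abs_complexHessian_le (v : M → ℝ) {a : Fin X.N} {z : CSpace (m + 1)}
    (hz : z ∈ (X.chart a).target) (ξ : CSpace (m + 1)) :
    |(X.complexHessian v a z ξ ξ).re|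
      ≤ ‖iteratedFDerivWithin ℝ 2 (X.coord v a) (X.chart a).target z‖ * ‖ξ‖ ^ 2 := by
  rw [complexHessian, leviPart_self_re]
  have h1 := abs_realHessian_le (X.coord v a) (X.uniqueDiffOn_target a) hz ξ ξ
  have h2 := abs_realHessian_le (X.coord v a) (X.uniqueDiffOn_target a) hz (Complex.I • ξ)
    (Complex.I • ξ)
  rw [norm_smul, Complex.norm_I, one_mul] at h2
  rw [abs_mul]
  have h3 := abs_add_le (realHessian (X.coord v a) (X.chart a).target z ξ ξ)
    (realHessian (X.coord v a) (X.chart a).target z (Complex.I • ξ) (Complex.I • ξ))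
  have h4 : 0 ≤ ‖iteratedFDerivWithin ℝ 2 (X.coord v a) (X.chart a).target z‖ * ‖ξ‖ * ‖ξ‖ := by
    positivity
  norm_num [abs_of_pos]
  nlinarith

/-- Near an interior minimum the solution differs from the subsolution by a constant. -/
theorem eventually_sub_eq (hΓ : IsSymmetricCone Γ) (hf : IsStructuralFunction Γ f) {θ : ℝ}
    (hθ : supBoundary Γ f < (θ : EReal)) (hψ : ∀ p, θ ≤ ψ p)
    (hu : IsAdmissibleSolution g χ Γ f ψ φ u) (hs : IsAdmissibleSubsolution g χ Γ f ψ φ usub)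
    {a : Fin X.N} {z₀ : CSpace (m + 1)} (hz₀ : z₀ ∈ (X.chart a).target) (hρ : 0 < X.rho a z₀)
    {μ : ℝ} (hμ : X.coord (fun p => u p - usub p) a z₀ = μ)
    (hmin : ∀ᶠ z in 𝓝 z₀, μ ≤ X.coord (fun p => u p - usub p) a z) :
    ∀ᶠ z in 𝓝 z₀, X.coord (fun p => u p - usub p) a z = μ := by
  have hmem := X.target_mem_nhds hz₀ hρ
  have hh : X.IsCk 2 fun p => u p - usub p := hu.isC2.sub hs.isC2
  obtain ⟨c₁, hc₁, hG₁⟩ := g.eventually_le_riem hz₀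
  obtain ⟨C₂, hC₂, hG₂⟩ := eventually_norm_sesq_le (s := (X.chart a).target) (q := z₀)
    (Θ := g.comp a) fun i j => (g.smooth a i j).continuousOn z₀ hz₀
  obtain ⟨C₃, hC₃, hG₃⟩ := eventually_norm_sesq_le (s := (X.chart a).target) (q := z₀)
    (Θ := χ.comp a) fun i j => (χ.smooth a i j).continuousOn z₀ hz₀
  rw [nhdsWithin_eq_nhds.2 hmem] at hG₁ hG₂ hG₃
  set D := ‖iteratedFDerivWithin ℝ 2 (X.coord u a) (X.chart a).target z₀‖ + 1 with hD
  have hDev : ∀ᶠ z in 𝓝 z₀, ‖iteratedFDerivWithin ℝ 2 (X.coord u a) (X.chart a).target z‖ ≤ D := by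
    have h1 := ((hu.isC2 a).continuousOn_iteratedFDerivWithin (m := 2) (by simp)
      (X.uniqueDiffOn_target a) z₀ hz₀).norm
    rw [ContinuousWithinAt, nhdsWithin_eq_nhds.2 hmem] at h1
    exact (h1.eventually (gt_mem_nhds (lt_add_one _))).mono fun z hz => hz.le
  have hD0 : 0 ≤ D := by positivity
  obtain ⟨c₀, hc₀, C₀, hbd⟩ := exists_fderiv_bounds hΓ hf hθ ((C₃ + D) / c₁)
  have hρev : ∀ᶠ z in 𝓝 z₀, 0 < X.rho a z :=
    ((X.regular a).continuousAt (X.mem_target.1 hz₀).1).eventually (lt_mem_nhds hρ)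
  refine eventually_eq_of_supersolution (k := m + 1) (c := c₀ / C₂)
    (C := ∑ _i : Fin (m + 1), C₀ * (1 / c₁)) (by positivity) hμ (H := fun z ξ =>
      realHessian (X.coord (fun p => u p - usub p) a) (X.chart a).target z ξ ξ) ?_
  filter_upwards [hmin, hρev, eventually_mem_nhds_iff.2 hmem, hG₁, hG₂, hG₃, hDev]
    with z hzmin hzρ hzmem hz₁ hz₂ hz₃ hzD
  have hz : z ∈ (X.chart a).target := mem_of_mem_nhds hzmem
  refine ⟨hzmin, ((hh a).continuousOn z hz).continuousAt hzmem,
    fun ξ => ⟨_, hasJet2_coord hh hz hzρ ξ⟩, ?_⟩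
  have hGz := g.isPosForm hz
  obtain ⟨hlΓ, hlψ⟩ := hu.equation_coord hz hzρ
  obtain ⟨hlΓ', hlψ'⟩ := hs.inequality_coord hz
  obtain ⟨e, -, he, hde⟩ := isEigenTuple_lamG g χ hu.isC2 hz
  set lam := g.lamG χ u a z with hlam
  have hdiag : ∀ i, (HermitianMetric.gForm χ u a z (e i) (e i)).re = lam i := fun i => by
    rw [hde i i]; simp
  have hen : ∀ i, ‖e i‖ ^ 2 ≤ 1 / c₁ := fun i => by
    have h1 := hz₁ (e i)
    rw [HermitianMetric.riem, he i i] at h1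
    simp only [if_true, Complex.one_re] at h1
    rw [le_div_iff₀ hc₁, mul_comm]; exact h1
  have hlR : ∀ i, |lam i| ≤ (C₃ + D) / c₁ := fun i => by
    rw [← hdiag i, HermitianMetric.gForm, Complex.add_re]
    refine (abs_add_le _ _).trans ?_
    have h1 := (Complex.abs_re_le_norm _).trans (hz₃ (e i) (e i))
    have h2 := (abs_complexHessian_le u hz (e i)).trans
      (mul_le_mul_of_nonneg_right hzD (sq_nonneg _))
    have h3 := mul_le_mul_of_nonneg_left (hen i) (add_nonneg hC₃.le hD0)
    rw [← mul_div_assoc, mul_one] at h3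
    linarith
  have hb := hbd lam hlΓ hlR (by rw [hlψ]; exact hψ _)
  refine ⟨e, fun i => fderiv ℝ f lam (Pi.single i 1), fun i => hc₀.le.trans (hb i).1, ?_, ?_, ?_⟩
  · have h1 := linearized_sub_nonpos hΓ hf hGz.toIsHermForm (isHermForm_gForm χ hs.isC2 hz) he
      hdiag hlΓ (isEigenTuple_lamG g χ hs.isC2 hz) hlΓ' (by rw [hlψ]; exact hlψ')
    have h2 : ∀ i, (HermitianMetric.gForm χ u a z (e i) (e i)).re
        - (HermitianMetric.gForm χ usub a z (e i) (e i)).re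
        = 1 / 4 * (realHessian (X.coord (fun p => u p - usub p) a) (X.chart a).target z (e i) (e i)
          + realHessian (X.coord (fun p => u p - usub p) a) (X.chart a).target z
            (Complex.I • e i) (Complex.I • e i)) := fun i => by
      rw [← leviPart_self_re, ← Complex.sub_re]
      congr 1
      have := complexHessian_sub hu.isC2 hs.isC2 hz (e i) (e i)
      simp only [complexHessian] at this
      rw [this]
      simp only [HermitianMetric.gForm, complexHessian]
      ring
    simp only [h2] at h1
    have h3 : ∀ (w t : Fin (m + 1) → ℝ), ∑ i, w i * (1 / 4 * t i) = 1 / 4 * ∑ i, w i * t i :=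
      fun w t => by rw [Finset.mul_sum]; exact Finset.sum_congr rfl fun i _ => by ring
    rw [h3] at h1
    linarith
  · refine Finset.sum_le_sum fun i _ => ?_
    exact mul_le_mul (hb i).2 (hen i) (sq_nonneg _) (hc₀.le.trans ((hb i).1.trans (hb i).2))
  · intro x
    have h1 := IsUnitaryFam.norm_sq_le_sum_inner hGz.toIsHermForm he (C := C₂) (x := x) (by
      have := (Complex.re_le_norm _).trans (hz₂ x x)
      rwa [mul_assoc, ← sq] at this)
    rw [div_mul_eq_mul_div, div_le_iff₀ hC₂]
    have h2 : c₀ * ∑ i, ‖(inner ℂ (e i) x : ℂ)‖ ^ 2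
        ≤ ∑ i, fderiv ℝ f lam (Pi.single i 1) * ‖(inner ℂ (e i) x : ℂ)‖ ^ 2 := by
      rw [Finset.mul_sum]
      exact Finset.sum_le_sum fun i _ => mul_le_mul_of_nonneg_right (hb i).1 (sq_nonneg _)
    calc c₀ * ‖x‖ ^ 2 ≤ c₀ * (C₂ * ∑ i, ‖(inner ℂ (e i) x : ℂ)‖ ^ 2) := by gcongr
      _ = (c₀ * ∑ i, ‖(inner ℂ (e i) x : ℂ)‖ ^ 2) * C₂ := by ring
      _ ≤ _ := by gcongr

theorem ComplexManifoldWithBoundary.compactSpace (X : ComplexManifoldWithBoundary (m + 1) M) :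
    CompactSpace M := by
  refine ⟨?_⟩
  have : (univ : Set M) = ⋃ a, X.core a := by
    ext p; simpa using X.core_cover p
  rw [this]
  exact isCompact_iUnion X.isCompact_core

theorem ComplexManifoldWithBoundary.IsCk.continuous {k : ℕ} {v : M → ℝ} (hv : X.IsCk k v) :
    Continuous v := by
  rw [continuous_iff_continuousAt]
  intro p
  obtain ⟨a, ha⟩ := X.core_cover p
  have hp := X.core_subset a ha
  have h1 : ContinuousOn (fun p => X.coord v a (X.chart a p)) (X.chart a).source :=
    (hv a).continuousOn.comp (X.continuousOn_chart a) fun q hq => (X.chart a).map_source hq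
  refine ((h1.congr fun q hq => ?_) p hp).continuousAt ((X.isOpen_source a).mem_nhds hp)
  rw [coord_chart v hq]

/-- Comparison on a component which meets the boundary. -/
theorem le_of_mem_connectedComponent (hΓ : IsSymmetricCone Γ) (hf : IsStructuralFunction Γ f)
    {θ : ℝ} (hθ : supBoundary Γ f < (θ : EReal)) (hψ : ∀ p, θ ≤ ψ p)
    (hu : IsAdmissibleSolution g χ Γ f ψ φ u) (hs : IsAdmissibleSubsolution g χ Γ f ψ φ usub)
    {p₀ : M} (hp₀ : p₀ ∈ X.boundary) {p : M} (hp : p ∈ connectedComponent p₀) :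
    usub p ≤ u p := by
  have := X.compactSpace
  have hh : X.IsCk 2 fun p => u p - usub p := hu.isC2.sub hs.isC2
  have hhc := hh.continuous
  have h0 : ∀ p ∈ X.boundary, u p - usub p = 0 := fun p hp => by
    rw [hu.boundary_value p hp, hs.boundary_value p hp, sub_self]
  obtain ⟨p₁, hp₁, hmin⟩ := (isClosed_connectedComponent (x := p₀)).isCompact.exists_isMinOn
    ⟨p₀, mem_connectedComponent⟩ hhc.continuousOn
  set μ := u p₁ - usub p₁ with hμ
  rcases le_or_gt 0 μ with hμ0 | hμ0
  · have : μ ≤ u p - usub p := hmin hp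
    linarith
  exfalso
  have hopen : ∀ q ∈ connectedComponent p₀, u q - usub q = μ →
      q ∈ interior {q | u q - usub q = μ} := by
    intro q hq hqμ
    obtain ⟨a, ha⟩ := X.core_cover q
    have hqs := X.core_subset a ha
    set z := X.chart a q with hzq
    have hz : z ∈ (X.chart a).target := (X.chart a).map_source hqs
    have hzs : (X.chart a).symm z = q := (X.chart a).left_inv hqs
    have hρ : 0 < X.rho a z := by
      refine lt_of_le_of_ne (X.mem_target.1 hz).2 fun heq => ?_
      have : q ∈ X.boundary := (X.mem_boundary_iff hqs).2 heq.symm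
      linarith [h0 q this]
    obtain ⟨r, hr, hball⟩ := Metric.mem_nhds_iff.1 (X.target_mem_nhds hz hρ)
    have hev : ∀ᶠ y in 𝓝 z, μ ≤ X.coord (fun p => u p - usub p) a y := by
      filter_upwards [Metric.ball_mem_nhds z hr] with y hy
      have hpre : IsPreconnected ((X.chart a).symm '' Metric.ball z r) :=
        (convex_ball z r).isPreconnected.image _ ((X.continuousOn_chart_symm a).mono hball)
      have hmem := hpre.subset_connectedComponent (mem_image_of_mem _ (Metric.mem_ball_self hr))
        (mem_image_of_mem _ hy)
      rw [hzs, ← connectedComponent_eq hq] at hmem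
      exact hmin hmem
    have heq := eventually_sub_eq hΓ hf hθ hψ hu hs hz hρ
      (by simp only [coord, hzs]; exact hqμ) hev
    rw [mem_interior_iff_mem_nhds]
    have hcont : ContinuousAt (X.chart a) q :=
      (X.continuousOn_chart a q hqs).continuousAt ((X.isOpen_source a).mem_nhds hqs)
    filter_upwards [hcont.eventually heq, (X.isOpen_source a).mem_nhds hqs] with y hy hys
    rw [coord_chart _ hys] at hy
    exact hy
  have hpre := isPreconnected_connectedComponent (x := p₀) (interior {q | u q - usub q = μ})
    {q | u q - usub q ≠ μ} isOpen_interior (isOpen_ne_fun hhc continuous_const)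
    (fun q hq => by
      by_cases h : u q - usub q = μ
      · exact Or.inl (hopen q hq h)
      · exact Or.inr h)
    ⟨p₁, hp₁, hopen p₁ hp₁ rfl⟩ ⟨p₀, mem_connectedComponent, by
      show u p₀ - usub p₀ ≠ μ
      rw [h0 p₀ hp₀]; exact hμ0.ne'⟩
  obtain ⟨q, -, hq₁, hq₂⟩ := hpre
  exact hq₂ (interior_subset (s := {q | u q - usub q = μ}) hq₁)

/-- The inner normal derivative of the solution dominates that of the subsolution. -/
theorem fderivWithin_sub_nonneg (hΓ : IsSymmetricCone Γ) (hf : IsStructuralFunction Γ f)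
    {θ : ℝ} (hθ : supBoundary Γ f < (θ : EReal)) (hψ : ∀ p, θ ≤ ψ p)
    (hu : IsAdmissibleSolution g χ Γ f ψ φ u) (hs : IsAdmissibleSubsolution g χ Γ f ψ φ usub)
    {a : Fin X.N} {z v : CSpace (m + 1)} (hz : z ∈ X.coordBoundary a)
    (hv : 0 < fderiv ℝ (X.rho a) z v) :
    0 ≤ fderivWithin ℝ (X.coord (fun p => u p - usub p) a) (X.chart a).target z v := by
  have hh : X.IsCk 2 fun p => u p - usub p := hu.isC2.sub hs.isC2
  have hzb : (X.chart a).symm z ∈ X.boundary := (X.symm_mem_boundary_iff hz.1).2 hz.2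
  have hray := (X.regular a).eventually_ray_pos (X.mem_target.1 hz.1).1 hz.2 hv
  obtain ⟨δ, hδ, hIoo⟩ := mem_nhdsGT_iff_exists_Ioo_subset.1 hray
  have hδ0 : (0 : ℝ) < δ := hδ
  have hIco : ∀ s ∈ Ico 0 δ, z + s • v ∈ (X.chart a).target := by
    intro s hs
    rcases hs.1.eq_or_lt with rfl | h
    · simpa using hz.1
    · have := hIoo ⟨h, hs.2⟩
      exact X.mem_target.2 ⟨this.1, this.2.le⟩
  have hnonneg : ∀ s ∈ Ico 0 δ, 0 ≤ X.coord (fun p => u p - usub p) a (z + s • v) := by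
    intro s hs'
    have hpre : IsPreconnected ((fun s : ℝ => (X.chart a).symm (z + s • v)) '' Ico 0 δ) :=
      isPreconnected_Ico.image _ ((X.continuousOn_chart_symm a).comp (by fun_prop) hIco)
    have hmem := hpre.subset_connectedComponent (x := (X.chart a).symm z)
      ⟨0, ⟨le_rfl, hδ0⟩, by simp⟩ (mem_image_of_mem _ hs')
    have := le_of_mem_connectedComponent hΓ hf hθ hψ hu hs hzb hmem
    simpa [coord] using this
  have h0 : X.coord (fun p => u p - usub p) a z = 0 := by
    simp only [coord]
    rw [hu.boundary_value _ hzb, hs.boundary_value _ hzb, sub_self]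
  have hder : HasDerivWithinAt (fun s : ℝ => X.coord (fun p => u p - usub p) a (z + s • v))
      (fderivWithin ℝ (X.coord (fun p => u p - usub p) a) (X.chart a).target z v) (Ico 0 δ) 0 := by
    have h1 : HasDerivWithinAt (fun s : ℝ => z + s • v) v (Ico 0 δ) 0 := by
      simpa using (((hasDerivAt_id (0 : ℝ)).smul_const v).const_add z).hasDerivWithinAt
    have h2 : HasFDerivWithinAt (X.coord (fun p => u p - usub p) a)
        (fderivWithin ℝ (X.coord (fun p => u p - usub p) a) (X.chart a).target z)
        (X.chart a).target (z + (0 : ℝ) • v) := by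
      simpa using hh.differentiableWithinAt hz.1
    exact h2.comp_hasDerivWithinAt 0 h1 hIco
  have h3 := (hasDerivWithinAt_iff_tendsto_slope' (by simp)).1
    (hder.mono (Ioo_subset_Ico_self (a := (0 : ℝ)) (b := δ)))
  have : (𝓝[Ioo 0 δ] (0 : ℝ)).NeBot := by
    rw [nhdsWithin_Ioo_eq_nhdsGT hδ0]; infer_instance
  refine ge_of_tendsto h3 ?_
  filter_upwards [self_mem_nhdsWithin] with s hs'
  simp only [slope, vsub_eq_sub, zero_smul, add_zero, sub_zero, h0, smul_eq_mul]
  exact mul_nonneg (inv_nonneg.2 hs'.1.le) (hnonneg s ⟨hs'.1.le, hs'.2⟩)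

end manifold

/-! ### Uniform second order Taylor expansions up to the boundary -/

namespace IsRegularDomain

variable {E : Type*} [NormedAddCommGroup E] [NormedSpace ℝ E] {ρ : E → ℝ} {Ω : Set E}

/-- Near a boundary point, two points of the closed domain are joined by a path of three segments
of comparable length: both are first moved inwards by a multiple of their distance. -/
theorem exists_three_segments (h : IsRegularDomain ρ Ω) {q : E} (hq : q ∈ Ω) (hρ : ρ q = 0) :
    ∃ Λ : ℝ, 0 < Λ ∧ ∃ r > 0, ∀ z ∈ dom ρ Ω, ∀ y ∈ dom ρ Ω, dist z q < r → dist y q < r →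
      ∃ v : E, ‖v‖ ≤ Λ * ‖y - z‖ ∧ segment ℝ z (z + v) ⊆ dom ρ Ω ∧
        segment ℝ (z + v) (y + v) ⊆ dom ρ Ω ∧ segment ℝ y (y + v) ⊆ dom ρ Ω := by
  obtain ⟨N, hN⟩ := h.exists_inner hq hρ
  set c := fderiv ℝ ρ q N / 2 with hc
  have hc0 : 0 < c := by positivity
  set B := ‖fderiv ℝ ρ q‖ + 1 with hB
  have hB0 : 0 < B := by positivity
  have hev : ∀ᶠ y in 𝓝 q, y ∈ Ω ∧ ‖fderiv ℝ ρ y‖ < B ∧ c < fderiv ℝ ρ y N :=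
    Eventually.and (h.isOpen.mem_nhds hq) (((h.continuousAt_fderiv hq).norm.eventually
      (gt_mem_nhds (lt_add_one _))).and (((h.continuousAt_fderiv hq).clm_apply
        continuousAt_const).eventually (lt_mem_nhds (by rw [hc]; linarith))))
  obtain ⟨r₁, hr₁, hball⟩ := Metric.eventually_nhds_iff_ball.1 hev
  have hlip : ∀ x ∈ Metric.ball q r₁, ∀ y ∈ Metric.ball q r₁, |ρ y - ρ x| ≤ B * ‖y - x‖ :=
    fun x hx y hy => (convex_ball q r₁).norm_image_sub_le_of_norm_hasFDerivWithin_le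
      (fun z hz => (h.hasFDerivAt (hball z hz).1).hasFDerivWithinAt)
      (fun z hz => (hball z hz).2.1.le) hx hy
  have hinc : ∀ x ∈ Metric.ball q r₁, ∀ t : ℝ, 0 ≤ t → x + t • N ∈ Metric.ball q r₁ →
      ρ x + c * t ≤ ρ (x + t • N) := by
    intro x hx t ht hxt
    have hseg : ∀ s ∈ Icc 0 t, x + s • N ∈ Metric.ball q r₁ := fun s hs => by
      have := (convex_ball q r₁).add_smul_mem hx hxt (t := s / t)
      rcases ht.eq_or_lt with rfl | ht'
      · have : s = 0 := le_antisymm hs.2 hs.1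
        simpa [this] using hx
      · have := this ⟨div_nonneg hs.1 ht, (div_le_one ht').2 hs.2⟩
        rwa [smul_smul, div_mul_cancel₀ _ ht'.ne'] at this
    have hder : ∀ s ∈ Icc 0 t, HasDerivAt (fun s : ℝ => ρ (x + s • N) - c * s)
        (fderiv ℝ ρ (x + s • N) N - c) s := fun s hs => by
      have h1 : HasDerivAt (fun s : ℝ => x + s • N) N s := by
        simpa using ((hasDerivAt_id s).smul_const N).const_add x
      have h2 := (h.hasFDerivAt (hball _ (hseg s hs)).1).comp_hasDerivAt s h1
      exact (h2.sub ((hasDerivAt_id s).const_mul c)).congr_deriv (by simp)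
    have hmono : MonotoneOn (fun s : ℝ => ρ (x + s • N) - c * s) (Icc 0 t) := by
      refine monotoneOn_of_deriv_nonneg (convex_Icc 0 t)
        (fun s hs => (hder s hs).continuousAt.continuousWithinAt)
        (fun s hs => (hder s (interior_subset hs)).differentiableAt.differentiableWithinAt)
        fun s hs => ?_
      rw [(hder s (interior_subset hs)).deriv]
      linarith [(hball _ (hseg s (interior_subset hs))).2.2]
    have := hmono (left_mem_Icc.2 ht) (right_mem_Icc.2 ht) ht
    simp at this
    linarith
  set Λ := B / c * (‖N‖ + 1) with hΛ
  have hΛ0 : 0 < Λ := by positivity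
  set r := r₁ / (1 + 2 * Λ) with hr
  have hr0 : 0 < r := by positivity
  have hrr : r + Λ * (2 * r) = r₁ := by rw [hr]; field_simp
  refine ⟨Λ, hΛ0, r, hr0, fun z hz y hy hzq hyq => ?_⟩
  set s := B / c * ‖y - z‖ with hs
  have hs0 : 0 ≤ s := by positivity
  have hyz : ‖y - z‖ ≤ 2 * r := by
    rw [← dist_eq_norm]
    linarith [dist_triangle_right y z q]
  have hsN : ‖s • N‖ ≤ Λ * ‖y - z‖ := by
    rw [norm_smul, Real.norm_of_nonneg hs0, hs, hΛ]
    have : 0 ≤ B / c * ‖y - z‖ := by positivity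
    nlinarith
  have hin : ∀ x, dist x q < r → ∀ t ∈ Icc 0 s, x + t • N ∈ Metric.ball q r₁ := by
    intro x hx t ht
    rw [Metric.mem_ball, dist_eq_norm] at *
    have h1 : ‖t • N‖ ≤ ‖s • N‖ := by
      rw [norm_smul, norm_smul, Real.norm_of_nonneg ht.1, Real.norm_of_nonneg hs0]
      exact mul_le_mul_of_nonneg_right ht.2 (norm_nonneg _)
    calc ‖x + t • N - q‖ = ‖(x - q) + t • N‖ := by congr 1; abel
      _ ≤ ‖x - q‖ + ‖t • N‖ := norm_add_le _ _
      _ < r + Λ * (2 * r) := by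
        have := mul_le_mul_of_nonneg_left hyz hΛ0.le
        linarith
      _ = r₁ := hrr
  have hray : ∀ x ∈ dom ρ Ω, dist x q < r → segment ℝ x (x + s • N) ⊆ dom ρ Ω := by
    intro x hx hxq
    rw [segment_eq_image']
    rintro _ ⟨t, ht, rfl⟩
    have hts : t * s ∈ Icc 0 s := ⟨mul_nonneg ht.1 hs0, mul_le_of_le_one_left hs0 ht.2⟩
    have h1 := hin x hxq (t * s) hts
    have h2 := hinc x (by simpa using hin x hxq 0 ⟨le_rfl, hs0⟩) (t * s) hts.1 h1
    simp only [add_sub_cancel_left, smul_smul]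
    exact ⟨(hball _ h1).1, by nlinarith [hx.2, mul_nonneg hc0.le hts.1]⟩
  refine ⟨s • N, hsN, hray z hz hzq, ?_, hray y hy hyq⟩
  rw [segment_eq_image']
  rintro _ ⟨t, ht, rfl⟩
  have h0 : z + s • N + t • (y + s • N - (z + s • N)) = (z + t • (y - z)) + s • N := by module
  simp only [h0]
  have hp : dist (z + t • (y - z)) q < r :=
    (convex_ball q r).add_smul_sub_mem (Metric.mem_ball.2 hzq) (Metric.mem_ball.2 hyq) ht
  have hpb : z + t • (y - z) ∈ Metric.ball q r₁ := by simpa using hin _ hp 0 ⟨le_rfl, hs0⟩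
  have h1 := hin _ hp s ⟨hs0, le_rfl⟩
  have h2 := hinc _ hpb s hs0 h1
  have h3 := (abs_le.1 (hlip z (by simpa using hin z hzq 0 ⟨le_rfl, hs0⟩) _ hpb)).1
  rw [add_sub_cancel_left, norm_smul, Real.norm_of_nonneg ht.1] at h3
  have h4 : t * ‖y - z‖ ≤ ‖y - z‖ := mul_le_of_le_one_left (norm_nonneg _) ht.2
  have h5 : c * s = B * ‖y - z‖ := by rw [hs]; field_simp
  exact ⟨(hball _ h1).1, by nlinarith [hz.2, mul_le_mul_of_nonneg_left h4 hB0.le]⟩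

variable {W : Type*} [NormedAddCommGroup W] [NormedSpace ℝ W]

/-- A mean value inequality on the closed domain, near a boundary point. -/
theorem exists_norm_sub_le (h : IsRegularDomain ρ Ω) {q : E} (hq : q ∈ Ω) (hρ : ρ q = 0)
    (W : Type*) [NormedAddCommGroup W] [NormedSpace ℝ W] :
    ∃ Λ : ℝ, 1 ≤ Λ ∧ ∃ r > 0, ∀ z ∈ dom ρ Ω, ∀ y ∈ dom ρ Ω, dist z q < r → dist y q < r →
      ∀ (F : E → W) (F' : E → E →L[ℝ] W) (B : ℝ),
        (∀ x ∈ dom ρ Ω, dist x z ≤ Λ * ‖y - z‖ →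
          HasFDerivWithinAt F (F' x) (dom ρ Ω) x ∧ ‖F' x‖ ≤ B) →
        ‖F y - F z‖ ≤ B * Λ * ‖y - z‖ := by
  obtain ⟨Λ, hΛ, r, hr, hpath⟩ := h.exists_three_segments hq hρ
  refine ⟨2 * Λ + 1, by linarith, r, hr, fun z hz y hy hzq hyq F F' B hF => ?_⟩
  obtain ⟨v, hv, h1, h2, h3⟩ := hpath z hz y hy hzq hyq
  have hyz := norm_nonneg (y - z)
  have hB : 0 ≤ B := (norm_nonneg _).trans (hF z hz (by
    rw [dist_self]; exact mul_nonneg (by linarith) hyz)).2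
  have hmv : ∀ a b : E, segment ℝ a b ⊆ dom ρ Ω → dist a z ≤ (2 * Λ + 1) * ‖y - z‖ →
      dist b z ≤ (2 * Λ + 1) * ‖y - z‖ → ‖F b - F a‖ ≤ B * ‖b - a‖ := by
    intro a b hab ha hb
    have hd : segment ℝ a b ⊆ Metric.closedBall z ((2 * Λ + 1) * ‖y - z‖) :=
      (convex_closedBall z _).segment_subset ha hb
    exact (convex_segment a b).norm_image_sub_le_of_norm_hasFDerivWithin_le
      (fun x hx => (hF x (hab hx) (hd hx)).1.mono hab) (fun x hx => (hF x (hab hx) (hd hx)).2)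
      (left_mem_segment ℝ a b) (right_mem_segment ℝ a b)
  have hd1 : dist (z + v) z ≤ (2 * Λ + 1) * ‖y - z‖ := by
    rw [dist_eq_norm, add_sub_cancel_left]
    nlinarith
  have hd2 : dist (y + v) z ≤ (2 * Λ + 1) * ‖y - z‖ := by
    rw [dist_eq_norm, show y + v - z = (y - z) + v by abel]
    refine (norm_add_le _ _).trans ?_
    nlinarith
  have hd3 : dist y z ≤ (2 * Λ + 1) * ‖y - z‖ := by
    rw [dist_eq_norm]; nlinarith
  have hd0 : dist z z ≤ (2 * Λ + 1) * ‖y - z‖ := by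
    rw [dist_self]; positivity
  have e1 := hmv _ _ h1 hd0 hd1
  have e2 := hmv _ _ h2 hd1 hd2
  have e3 := hmv _ _ h3 hd3 hd2
  rw [add_sub_cancel_left] at e1 e3
  rw [add_sub_add_right_eq_sub] at e2
  have hsplit : F y - F z = (F (z + v) - F z) + (F (y + v) - F (z + v)) - (F (y + v) - F y) := by
    abel
  rw [hsplit]
  refine (norm_sub_le _ _).trans ?_
  have e4 := norm_add_le (F (z + v) - F z) (F (y + v) - F (z + v))
  nlinarith [mul_le_mul_of_nonneg_left hv hB]

/-- Taylor's formula on the closed domain, near a boundary point. -/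
theorem exists_taylor (h : IsRegularDomain ρ Ω) {q : E} (hq : q ∈ Ω) (hρ : ρ q = 0)
    (W : Type*) [NormedAddCommGroup W] [NormedSpace ℝ W] {R : ℝ} (hR : 0 < R) :
    ∃ Λ : ℝ, 0 ≤ Λ ∧ ∃ r > 0, ∀ (F : E → W) (F' : E → E →L[ℝ] W) (F'' : E → E →L[ℝ] E →L[ℝ] W)
      (C : ℝ), (∀ x ∈ dom ρ Ω, dist x q < R → HasFDerivWithinAt F (F' x) (dom ρ Ω) x ∧
        HasFDerivWithinAt F' (F'' x) (dom ρ Ω) x ∧ ‖F'' x‖ ≤ C) →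
      ∀ z ∈ dom ρ Ω, ∀ y ∈ dom ρ Ω, dist z q < r → dist y q < r →
        ‖F y - F z - F' z (y - z)‖ ≤ C * Λ * ‖y - z‖ ^ 2 := by
  obtain ⟨Λ, hΛ, r, hr, hmv⟩ := h.exists_norm_sub_le hq hρ W
  obtain ⟨Λ', hΛ', r', hr', hmv'⟩ := h.exists_norm_sub_le hq hρ (E →L[ℝ] W)
  set r₀ := min r (min r' R) / (1 + 2 * Λ + 2 * Λ * Λ') with hr₀
  have hden : 0 < 1 + 2 * Λ + 2 * Λ * Λ' := by positivity
  have hm : 0 < min r (min r' R) := lt_min hr (lt_min hr' hR)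
  have hr₀0 : 0 < r₀ := by positivity
  have heq : r₀ + 2 * Λ * r₀ + 2 * Λ * Λ' * r₀ = min r (min r' R) := by
    rw [hr₀]; field_simp
  have hΛr : 0 ≤ 2 * Λ * r₀ := by positivity
  have hΛr' : 0 ≤ 2 * Λ * Λ' * r₀ := by positivity
  have hle : r₀ ≤ r := by linarith [min_le_left r (min r' R)]
  have hle' : r₀ + 2 * Λ * r₀ ≤ r' := by
    linarith [(min_le_right r (min r' R)).trans (min_le_left _ _)]
  have hleR : r₀ + 2 * Λ * Λ' * r₀ ≤ R := by
    linarith [(min_le_right r (min r' R)).trans (min_le_right _ _)]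
  have hleR' : r₀ + 2 * Λ * r₀ ≤ R := by
    linarith [(min_le_right r (min r' R)).trans (min_le_right _ _)]
  refine ⟨Λ' * Λ * Λ, by positivity, r₀, hr₀0, fun F F' F'' C hF z hz y hy hzq hyq => ?_⟩
  have hC : 0 ≤ C := by
    have h1 := (hF z hz (by linarith)).2.2
    exact (norm_nonneg (F'' z)).trans h1
  have hyz : ‖y - z‖ ≤ 2 * r₀ := by
    rw [← dist_eq_norm]
    linarith [dist_triangle_right y z q]
  have hyz0 := norm_nonneg (y - z)
  have key := hmv z hz y hy (by linarith) (by linarith) (fun x => F x - F' z x)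
    (fun x => F' x - F' z) (C * Λ' * (Λ * ‖y - z‖)) fun x hx hxz => ?_
  · calc ‖F y - F z - F' z (y - z)‖ = ‖F y - F' z y - (F z - F' z z)‖ := by
          rw [map_sub]; congr 1; abel
      _ ≤ _ := key
      _ = _ := by ring
  · have hxz2 : dist x z ≤ 2 * Λ * r₀ := by
      have := mul_le_mul_of_nonneg_left hyz (by linarith : (0 : ℝ) ≤ Λ)
      linarith
    have hxq : dist x q < r₀ + 2 * Λ * r₀ := by linarith [dist_triangle x z q]
    refine ⟨(hF x hx (by linarith)).1.sub ((F' z).hasFDerivAt.hasFDerivWithinAt), ?_⟩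
    have h1 := hmv' z hz x hx (by linarith) (by linarith) F' F'' C fun w hw hwz => by
      have hwz2 : dist w z ≤ 2 * Λ * Λ' * r₀ := by
        rw [dist_eq_norm] at hxz2
        have := mul_le_mul_of_nonneg_left hxz2 (by linarith : (0 : ℝ) ≤ Λ')
        linarith
      exact (hF w hw (by linarith [dist_triangle w z q])).2
    refine h1.trans ?_
    rw [← dist_eq_norm]
    exact mul_le_mul_of_nonneg_left hxz (by positivity)

end IsRegularDomain

/-- A family of functions `F i` with a second order Taylor expansion at `z i` relative to `V`, with
constants which are uniform over the indices `i` with `P i` and `z i` close to `q`. -/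
def UniformTaylor {E W ι : Type*} [NormedAddCommGroup E] [NormedSpace ℝ E] [NormedAddCommGroup W]
    [NormedSpace ℝ W] (V : Set E) (q : E) (P : ι → Prop) (z : ι → E) (F : ι → E → W) : Prop :=
  ∃ C : ℝ, 0 ≤ C ∧ ∃ r : ℝ, 0 < r ∧ r ≤ 1 ∧ ∀ i, P i → dist (z i) q < r →
    ∃ L : E →L[ℝ] W, ‖F i (z i)‖ ≤ C ∧ ‖L‖ ≤ C ∧
      ∀ y ∈ V, dist y (z i) ≤ r → ‖F i y - F i (z i) - L (y - z i)‖ ≤ C * ‖y - z i‖ ^ 2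

namespace UniformTaylor

variable {E W W₂ W₃ ι : Type*} [NormedAddCommGroup E] [NormedSpace ℝ E] [NormedAddCommGroup W]
  [NormedSpace ℝ W] [NormedAddCommGroup W₂] [NormedSpace ℝ W₂] [NormedAddCommGroup W₃]
  [NormedSpace ℝ W₃] {V : Set E} {q : E} {P : ι → Prop} {z : ι → E} {F F₁ : ι → E → W}
  {G : ι → E → W₂}

theorem const (c : ι → W) {C : ℝ} (hc : ∀ i, P i → ‖c i‖ ≤ C) :
    UniformTaylor V q P z fun i _ => c i := by
  refine ⟨|C|, abs_nonneg C, 1, one_pos, le_rfl, fun i hi _ => ⟨0, (hc i hi).trans (le_abs_self C),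
    by simp, fun y _ _ => by simp; positivity⟩⟩

theorem add (h : UniformTaylor V q P z F) (h₁ : UniformTaylor V q P z F₁) :
    UniformTaylor V q P z fun i y => F i y + F₁ i y := by
  obtain ⟨C, hC, r, hr, hr1, hF⟩ := h
  obtain ⟨C₁, hC₁, r₁, hr₁, hr₁1, hF₁⟩ := h₁
  refine ⟨C + C₁, by positivity, min r r₁, lt_min hr hr₁, (min_le_left _ _).trans hr1,
    fun i hi hz => ?_⟩
  obtain ⟨L, h1, h2, h3⟩ := hF i hi (hz.trans_le (min_le_left _ _))
  obtain ⟨L₁, h1', h2', h3'⟩ := hF₁ i hi (hz.trans_le (min_le_right _ _))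
  refine ⟨L + L₁, (norm_add_le _ _).trans (by linarith), (norm_add_le _ _).trans (by linarith),
    fun y hy hyz => ?_⟩
  have e1 := h3 y hy (hyz.trans (min_le_left _ _))
  have e2 := h3' y hy (hyz.trans (min_le_right _ _))
  calc ‖F i y + F₁ i y - (F i (z i) + F₁ i (z i)) - (L + L₁) (y - z i)‖
      = ‖(F i y - F i (z i) - L (y - z i)) + (F₁ i y - F₁ i (z i) - L₁ (y - z i))‖ := by
        rw [add_apply]; congr 1; abel
    _ ≤ _ := norm_add_le _ _
    _ ≤ _ := by linarith

theorem clm (h : UniformTaylor V q P z F) (A : W →L[ℝ] W₂) :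
    UniformTaylor V q P z fun i y => A (F i y) := by
  obtain ⟨C, hC, r, hr, hr1, hF⟩ := h
  refine ⟨‖A‖ * C, by positivity, r, hr, hr1, fun i hi hz => ?_⟩
  obtain ⟨L, h1, h2, h3⟩ := hF i hi hz
  refine ⟨A.comp L, (A.le_opNorm _).trans (by gcongr), (A.opNorm_comp_le L).trans (by gcongr),
    fun y hy hyz => ?_⟩
  rw [ContinuousLinearMap.comp_apply, ← map_sub, ← map_sub, mul_assoc]
  exact (A.le_opNorm _).trans (mul_le_mul_of_nonneg_left (h3 y hy hyz) (norm_nonneg A))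

theorem sum {κ : Type*} (s : Finset κ) {F : κ → ι → E → W}
    (h : ∀ k ∈ s, UniformTaylor V q P z (F k)) :
    UniformTaylor V q P z fun i y => ∑ k ∈ s, F k i y := by
  classical
  induction s using Finset.induction_on with
  | empty => simpa using UniformTaylor.const (fun _ => (0 : W)) (C := 0) (by simp)
  | insert k s hk ih =>
    simp only [Finset.sum_insert hk]
    exact (h k (Finset.mem_insert_self k s)).add
      (ih fun j hj => h j (Finset.mem_insert_of_mem hj))

theorem bilin (h : UniformTaylor V q P z F) (h' : UniformTaylor V q P z G)
    (B : W →L[ℝ] W₂ →L[ℝ] W₃) : UniformTaylor V q P z fun i y => B (F i y) (G i y) := by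
  obtain ⟨C, hC, r, hr, hr1, hF⟩ := h
  obtain ⟨C', hC', r', hr', hr1', hG⟩ := h'
  refine ⟨‖B‖ * (6 * C * C'), by positivity, min r r', lt_min hr hr',
    (min_le_left _ _).trans hr1, fun i hi hz => ?_⟩
  obtain ⟨L, h1, h2, h3⟩ := hF i hi (hz.trans_le (min_le_left _ _))
  obtain ⟨L', h1', h2', h3'⟩ := hG i hi (hz.trans_le (min_le_right _ _))
  have hCC : 0 ≤ C * C' := by positivity
  have hB := norm_nonneg B
  have hb : ∀ (x : W) (y : W₂) (a b : ℝ), ‖x‖ ≤ a → ‖y‖ ≤ b → ‖B x y‖ ≤ ‖B‖ * (a * b) := by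
    intro x y a b hx hy
    refine (B.le_opNorm₂ x y).trans ?_
    rw [mul_assoc]
    exact mul_le_mul_of_nonneg_left (mul_le_mul hx hy (norm_nonneg _) ((norm_nonneg _).trans hx)) hB
  refine ⟨(B.flip (G i (z i))).comp L + (B (F i (z i))).comp L', ?_, ?_, fun y hy hyz => ?_⟩
  · refine (hb _ _ C C' h1 h1').trans ?_
    exact mul_le_mul_of_nonneg_left (by linarith) hB
  · refine ContinuousLinearMap.opNorm_le_bound _ (by positivity) fun x => ?_
    rw [add_apply]
    refine (norm_add_le _ _).trans ?_
    have e1 := hb (L x) (G i (z i)) (C * ‖x‖) C' ((L.le_opNorm x).trans (by gcongr)) h1'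
    have e2 := hb (F i (z i)) (L' x) C (C' * ‖x‖) h1 ((L'.le_opNorm x).trans (by gcongr))
    simp only [ContinuousLinearMap.comp_apply, ContinuousLinearMap.flip_apply]
    have : 0 ≤ ‖B‖ * (C * C') * ‖x‖ := by positivity
    nlinarith
  · have e1 := h3 y hy (hyz.trans (min_le_left _ _))
    have e2 := h3' y hy (hyz.trans (min_le_right _ _))
    have hy1 : ‖y - z i‖ ≤ 1 := by
      rw [← dist_eq_norm]; exact hyz.trans ((min_le_left _ _).trans hr1)
    have hy0 := norm_nonneg (y - z i)
    have d1 : ‖F i y - F i (z i)‖ ≤ 2 * C * ‖y - z i‖ := by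
      have : F i y - F i (z i) = (F i y - F i (z i) - L (y - z i)) + L (y - z i) := by abel
      rw [this]
      refine (norm_add_le _ _).trans ?_
      have e3 := (L.le_opNorm (y - z i)).trans (mul_le_mul_of_nonneg_right h2 hy0)
      nlinarith [mul_le_mul_of_nonneg_left hy1 (mul_nonneg hC hy0)]
    have d2 : ‖G i y - G i (z i)‖ ≤ 2 * C' * ‖y - z i‖ := by
      have : G i y - G i (z i) = (G i y - G i (z i) - L' (y - z i)) + L' (y - z i) := by abel
      rw [this]
      refine (norm_add_le _ _).trans ?_
      have e3 := (L'.le_opNorm (y - z i)).trans (mul_le_mul_of_nonneg_right h2' hy0)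
      nlinarith [mul_le_mul_of_nonneg_left hy1 (mul_nonneg hC' hy0)]
    have hsplit : B (F i y) (G i y) - B (F i (z i)) (G i (z i))
        - ((B.flip (G i (z i))).comp L + (B (F i (z i))).comp L') (y - z i)
        = B (F i y - F i (z i) - L (y - z i)) (G i (z i))
          + B (F i (z i)) (G i y - G i (z i) - L' (y - z i))
          + B (F i y - F i (z i)) (G i y - G i (z i)) := by
      simp only [map_sub, sub_apply, add_apply,
        ContinuousLinearMap.comp_apply, ContinuousLinearMap.flip_apply]
      abel
    rw [hsplit]
    refine (norm_add₃_le).trans ?_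
    have f1 := hb _ _ _ _ e1 h1'
    have f2 := hb _ _ _ _ h1 e2
    have f3 := hb _ _ _ _ d1 d2
    refine (add_le_add (add_le_add f1 f2) f3).trans (le_of_eq ?_)
    ring

theorem apply {F : ι → E → E →L[ℝ] W} {X : ι → E → E} (h : UniformTaylor V q P z F)
    (hX : UniformTaylor V q P z X) : UniformTaylor V q P z fun i y => F i y (X i y) :=
  h.bilin hX (ContinuousLinearMap.id ℝ (E →L[ℝ] W))

/-- Bounds of two derivatives give uniform expansions. -/
theorem of_eventually {ρ : E → ℝ} {Ω : Set E} (h : IsRegularDomain ρ Ω) (hq : q ∈ Ω)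
    (hρ : ρ q = 0) (hP : ∀ i, P i → z i ∈ IsRegularDomain.dom ρ Ω) {F' : ι → E → E →L[ℝ] W}
    {F'' : ι → E → E →L[ℝ] E →L[ℝ] W} {C : ℝ}
    (hev : ∀ᶠ y in 𝓝[IsRegularDomain.dom ρ Ω] q, ∀ i, P i →
      HasFDerivWithinAt (F i) (F' i y) (IsRegularDomain.dom ρ Ω) y ∧
      HasFDerivWithinAt (F' i) (F'' i y) (IsRegularDomain.dom ρ Ω) y ∧
      ‖F i y‖ ≤ C ∧ ‖F' i y‖ ≤ C ∧ ‖F'' i y‖ ≤ C) :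
    UniformTaylor (IsRegularDomain.dom ρ Ω) q P z F := by
  obtain ⟨R, hR, hball⟩ := Metric.mem_nhdsWithin_iff.1 hev
  obtain ⟨Λ, hΛ, r, hr, htay⟩ := h.exists_taylor hq hρ W hR
  have hm : 0 < min (min (r / 2) R) 1 := lt_min (lt_min (by positivity) hR) one_pos
  refine ⟨|C| * (1 + Λ), by positivity, min (min (r / 2) R) 1, hm, min_le_right _ _,
    fun i hi hz => ?_⟩
  have hzR : dist (z i) q < R :=
    hz.trans_le ((min_le_left _ _).trans (min_le_right _ _))
  have hzr : dist (z i) q < r / 2 :=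
    hz.trans_le ((min_le_left _ _).trans (min_le_left _ _))
  obtain ⟨-, -, h1, h2, -⟩ := hball ⟨hzR, hP i hi⟩ i hi
  have hCle : C ≤ |C| * (1 + Λ) := by nlinarith [le_abs_self C, abs_nonneg C]
  refine ⟨F' i (z i), h1.trans hCle, h2.trans hCle, fun y hy hyz => ?_⟩
  have hyz' : dist y (z i) ≤ r / 2 := hyz.trans ((min_le_left _ _).trans (min_le_left _ _))
  refine (htay (F i) (F' i) (F'' i) C (fun x hx hxq => ?_) (z i) (hP i hi) y hy (by linarith)
    (by linarith [dist_triangle y (z i) q])).trans ?_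
  · obtain ⟨a1, a2, -, -, a3⟩ := hball ⟨hxq, hx⟩ i hi
    exact ⟨a1, a2, a3⟩
  · refine mul_le_mul_of_nonneg_right ?_ (sq_nonneg _)
    nlinarith [le_abs_self C, abs_nonneg C, mul_le_mul_of_nonneg_right (le_abs_self C) hΛ]

/-- A single function of class `C²`. -/
theorem of_contDiffWithinAt {ρ : E → ℝ} {Ω : Set E} (h : IsRegularDomain ρ Ω) (hq : q ∈ Ω)
    (hρ : ρ q = 0) (hP : ∀ i, P i → z i ∈ IsRegularDomain.dom ρ Ω) {F : E → W}
    (hF : ContDiffWithinAt ℝ 2 F (IsRegularDomain.dom ρ Ω) q) :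
    UniformTaylor (IsRegularDomain.dom ρ Ω) q P z fun _ => F := by
  set V := IsRegularDomain.dom ρ Ω with hV
  have hqV : q ∈ V := ⟨hq, hρ.ge⟩
  obtain ⟨s, hs, hsub, hFs⟩ := hF.contDiffOn (m := 2) le_rfl (by simp)
  rw [insert_eq_of_mem hqV] at hs hsub
  obtain ⟨R, hR, hball⟩ := Metric.mem_nhdsWithin_iff.1 hs
  set U := V ∩ Metric.ball q R with hU
  have hUs : U ⊆ s := fun x hx => hball ⟨hx.2, hx.1⟩
  have hFU : ContDiffOn ℝ 2 F U := hFs.mono hUs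
  have hUu : UniqueDiffOn ℝ U := h.uniqueDiffOn.inter Metric.isOpen_ball
  have hqU : q ∈ U := ⟨hqV, Metric.mem_ball_self hR⟩
  have hF' : ContDiffOn ℝ 1 (fderivWithin ℝ F U) U := hFU.fderivWithin hUu (by norm_num)
  have hF'' : ContDiffOn ℝ 0 (fderivWithin ℝ (fderivWithin ℝ F U) U) U :=
    hF'.fderivWithin hUu (by norm_num)
  have hnhds : 𝓝[U] q = 𝓝[V] q := nhdsWithin_inter_of_mem'
    (mem_nhdsWithin_of_mem_nhds (Metric.ball_mem_nhds q hR))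
  set C := max ‖F q‖ (max ‖fderivWithin ℝ F U q‖ ‖fderivWithin ℝ (fderivWithin ℝ F U) U q‖) + 1
    with hC
  have c1 : ‖F q‖ < C := lt_add_of_le_of_pos (le_max_left _ _) one_pos
  have c2 : ‖fderivWithin ℝ F U q‖ < C :=
    lt_add_of_le_of_pos (le_max_of_le_right (le_max_left _ _)) one_pos
  have c3 : ‖fderivWithin ℝ (fderivWithin ℝ F U) U q‖ < C :=
    lt_add_of_le_of_pos (le_max_of_le_right (le_max_right _ _)) one_pos
  have b1 := (hFU.continuousOn q hqU).norm.eventually (gt_mem_nhds c1)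
  have b2 := (hF'.continuousOn q hqU).norm.eventually (gt_mem_nhds c2)
  have n3 : ContinuousWithinAt (fun y => ‖fderivWithin ℝ (fderivWithin ℝ F U) U y‖) U q :=
    (continuous_norm (E := E →L[ℝ] E →L[ℝ] W)).continuousAt.comp_continuousWithinAt
      (hF''.continuousOn q hqU)
  have b3 : ∀ᶠ y in 𝓝[U] q, ‖fderivWithin ℝ (fderivWithin ℝ F U) U y‖ < C :=
    Tendsto.eventually_lt_const c3 n3
  have bU : ∀ᶠ y in 𝓝[U] q, y ∈ U := self_mem_nhdsWithin
  rw [hnhds] at b1 b2 b3 bU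
  refine of_eventually h hq hρ hP (F' := fun _ => fderivWithin ℝ F U)
    (F'' := fun _ => fderivWithin ℝ (fderivWithin ℝ F U) U) (C := C) ?_
  filter_upwards [b1, b2, b3, bU] with y h1 h2 h3 hy i _
  have hUV : U ∈ 𝓝[V] y := inter_mem self_mem_nhdsWithin
    (mem_nhdsWithin_of_mem_nhds (Metric.isOpen_ball.mem_nhds hy.2))
  exact ⟨((hFU.differentiableOn (by simp) y hy).hasFDerivWithinAt).mono_of_mem_nhdsWithin hUV,
    ((hF'.differentiableOn (by simp) y hy).hasFDerivWithinAt).mono_of_mem_nhdsWithin hUV,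
    h1.le, h2.le, h3.le⟩

end UniformTaylor

/-! ### The upper barrier at a boundary point -/

open ComplexManifoldWithBoundary

section barrier

variable {n : ℕ}

/-- The barrier `φ + (β + l(x)) ρ + A (ρ + τ |x|²)² + ε |x|²`, where `x = z - z₀`. -/
def barrier (φ ρ : CSpace n → ℝ) (z₀ : CSpace n) (β : ℝ) (l : CSpace n →L[ℝ] ℝ) (A τ ε : ℝ)
    (z : CSpace n) : ℝ :=
  φ z + (β + l (z - z₀)) * ρ z
    + A * ((ρ z + τ * ‖z - z₀‖ ^ 2) * (ρ z + τ * ‖z - z₀‖ ^ 2)) + ε * ‖z - z₀‖ ^ 2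

/-- The second derivative of the barrier along `ξ`, in terms of the first derivative `r₁` and of
the second derivatives `p₂` and `r₂` of `φ` and `ρ` along `ξ`. -/
def barrierHess (ρ : ℝ) (x ξ : CSpace n) (β : ℝ) (l : CSpace n →L[ℝ] ℝ) (A τ ε p₂ r₁ r₂ : ℝ) : ℝ :=
  p₂ + (β + l x) * r₂ + 2 * l ξ * r₁
    + A * (2 * (ρ + τ * ‖x‖ ^ 2) * (r₂ + 2 * τ * ‖ξ‖ ^ 2)
      + 2 * (r₁ + 2 * τ * (inner ℂ ξ x).re) ^ 2) + 2 * ε * ‖ξ‖ ^ 2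

theorem hasJet2_barrier {φ ρ : CSpace n → ℝ} {z₀ z ξ : CSpace n} {p₁ p₂ r₁ r₂ : ℝ}
    (hφ : HasJet2 (fun s : ℝ => φ (z + s • ξ)) p₁ p₂)
    (hρ : HasJet2 (fun s : ℝ => ρ (z + s • ξ)) r₁ r₂) (β : ℝ) (l : CSpace n →L[ℝ] ℝ)
    (A τ ε : ℝ) :
    ∃ a, HasJet2 (fun s : ℝ => barrier φ ρ z₀ β l A τ ε (z + s • ξ)) a
      (barrierHess (ρ z) (z - z₀) ξ β l A τ ε p₂ r₁ r₂) := by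
  have hx : ∀ s : ℝ, z + s • ξ - z₀ = (z - z₀) + s • ξ := fun s => by abel
  have hN := hasJet2_norm_sq (z - z₀) ξ
  have hl : HasJet2 (fun s : ℝ => β + l (z - z₀ + s • ξ)) (l ξ) 0 := by
    have := HasJet2.quadratic (β + l (z - z₀)) (l ξ) 0
    convert this using 2 with s
    · simp; ring
    · simp
  have hd := hρ.add (hN.const_mul τ)
  have h := ((hφ.add (hl.mul hρ)).add ((hd.mul hd).const_mul A)).add (hN.const_mul ε)
  simp only [barrier, hx]
  refine ⟨_, h.congr_values rfl ?_⟩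
  simp only [barrierHess, zero_smul, add_zero]
  ring

theorem hasFDerivWithinAt_barrier {φ ρ : CSpace n → ℝ} {z₀ : CSpace n} {V : Set (CSpace n)}
    {φ' ρ' : CSpace n →L[ℝ] ℝ} (hφ : HasFDerivWithinAt φ φ' V z₀)
    (hρ : HasFDerivWithinAt ρ ρ' V z₀) (h0 : ρ z₀ = 0) (β : ℝ) (l : CSpace n →L[ℝ] ℝ)
    (A τ ε : ℝ) : HasFDerivWithinAt (barrier φ ρ z₀ β l A τ ε) (φ' + β • ρ') V z₀ := by
  have hN : HasFDerivWithinAt (fun z : CSpace n => ‖z - z₀‖ ^ 2) (0 : CSpace n →L[ℝ] ℝ) V z₀ := by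
    have h1 : (fun z : CSpace n => ‖z - z₀‖ ^ 2) =o[𝓝 z₀] fun z => z - z₀ := by
      have h2 : Tendsto (fun z : CSpace n => ‖z - z₀‖) (𝓝 z₀) (𝓝 0) := by
        have : Continuous fun z : CSpace n => ‖z - z₀‖ := by fun_prop
        simpa using this.tendsto z₀
      have h3 : (fun z : CSpace n => ‖z - z₀‖) =o[𝓝 z₀] fun _ => (1 : ℝ) :=
        (Asymptotics.isLittleO_one_iff ℝ).2 h2
      have h4 := h3.mul_isBigO (Asymptotics.isBigO_refl (fun z : CSpace n => ‖z - z₀‖) (𝓝 z₀))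
      simp only [one_mul] at h4
      refine (h4.congr_left fun z => (sq _).symm).trans_isBigO ?_
      exact (Asymptotics.isBigO_refl _ _).norm_left
    refine HasFDerivAt.hasFDerivWithinAt (HasFDerivAt.of_isLittleO ?_)
    simpa using h1
  have hl : HasFDerivWithinAt (fun z : CSpace n => β + l (z - z₀)) l V z₀ := by
    have : HasFDerivAt (fun z : CSpace n => l (z - z₀)) l z₀ :=
      (l.hasFDerivAt.comp z₀ ((hasFDerivAt_id z₀).sub_const z₀)).congr_fderiv (by ext; simp)
    exact (this.const_add β).hasFDerivWithinAt
  have hd := hρ.add (hN.const_mul τ)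
  have h := ((hφ.add (hl.mul hρ)).add ((hd.mul hd).const_mul A)).add (hN.const_mul ε)
  refine h.congr_fderiv ?_
  ext v
  simp [h0]

theorem abs_barrierHess_le {ρ : ℝ} {x ξ : CSpace n} {β : ℝ} {l : CSpace n →L[ℝ] ℝ}
    {A τ ε p₂ r₁ r₂ C Λ : ℝ} (hC : 0 ≤ C) (hA : 0 ≤ A) (hτ : 0 ≤ τ) (hε : 0 ≤ ε) (hε1 : ε ≤ 1)
    (hx : ‖x‖ ≤ 1) (hρ : 0 ≤ ρ) (hρC : ρ ≤ C) (hβ : |β| ≤ C + 1) (hl : ‖l‖ ≤ Λ)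
    (hp : |p₂| ≤ C * ‖ξ‖ ^ 2) (hr₁ : |r₁| ≤ C * ‖ξ‖) (hr₂ : |r₂| ≤ C * ‖ξ‖ ^ 2) :
    |barrierHess ρ x ξ β l A τ ε p₂ r₁ r₂|
      ≤ (C + (C + 1 + Λ) * C + 2 * Λ * C
        + A * (2 * (C + τ) * (C + 2 * τ) + 2 * (C + 2 * τ) ^ 2) + 2) * ‖ξ‖ ^ 2 := by
  have hΛ : 0 ≤ Λ := (norm_nonneg l).trans hl
  have hξ := norm_nonneg ξ
  have hx0 := norm_nonneg x
  have e1 : |(β + l x) * r₂| ≤ (C + 1 + Λ) * (C * ‖ξ‖ ^ 2) := by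
    rw [abs_mul]
    refine mul_le_mul ((abs_add_le _ _).trans (add_le_add hβ ?_)) hr₂ (abs_nonneg _) (by positivity)
    calc |l x| ≤ ‖l‖ * ‖x‖ := l.le_opNorm x
      _ ≤ Λ * 1 := by gcongr
      _ = Λ := mul_one Λ
  have e2 : |2 * l ξ * r₁| ≤ 2 * (Λ * ‖ξ‖) * (C * ‖ξ‖) := by
    rw [abs_mul, abs_mul, abs_two]
    have : |l ξ| ≤ Λ * ‖ξ‖ := (l.le_opNorm ξ).trans (by gcongr)
    gcongr
  have hd : |ρ + τ * ‖x‖ ^ 2| ≤ C + τ := by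
    rw [abs_of_nonneg (by positivity)]
    have : ‖x‖ ^ 2 ≤ 1 := pow_le_one₀ hx0 hx
    nlinarith
  have e3 : |2 * (ρ + τ * ‖x‖ ^ 2) * (r₂ + 2 * τ * ‖ξ‖ ^ 2)|
      ≤ 2 * (C + τ) * ((C + 2 * τ) * ‖ξ‖ ^ 2) := by
    rw [abs_mul, abs_mul, abs_two]
    have : |r₂ + 2 * τ * ‖ξ‖ ^ 2| ≤ (C + 2 * τ) * ‖ξ‖ ^ 2 := by
      refine (abs_add_le _ _).trans ?_
      rw [abs_of_nonneg (by positivity : 0 ≤ 2 * τ * ‖ξ‖ ^ 2)]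
      linarith
    gcongr
  have e4 : (r₁ + 2 * τ * (inner ℂ ξ x).re) ^ 2 ≤ ((C + 2 * τ) * ‖ξ‖) ^ 2 := by
    refine sq_le_sq.2 ?_
    rw [abs_of_nonneg (by positivity : 0 ≤ (C + 2 * τ) * ‖ξ‖)]
    refine (abs_add_le _ _).trans ?_
    have : |(inner ℂ ξ x : ℂ).re| ≤ ‖ξ‖ :=
      (Complex.abs_re_le_norm _).trans ((norm_inner_le_norm ξ x).trans
        (mul_le_of_le_one_right hξ hx))
    rw [abs_mul, abs_of_nonneg (by positivity : 0 ≤ 2 * τ)]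
    nlinarith
  rw [barrierHess]
  have e5 : |A * (2 * (ρ + τ * ‖x‖ ^ 2) * (r₂ + 2 * τ * ‖ξ‖ ^ 2)
      + 2 * (r₁ + 2 * τ * (inner ℂ ξ x).re) ^ 2)|
      ≤ A * (2 * (C + τ) * ((C + 2 * τ) * ‖ξ‖ ^ 2) + 2 * ((C + 2 * τ) * ‖ξ‖) ^ 2) := by
    rw [abs_mul, abs_of_nonneg hA]
    refine mul_le_mul_of_nonneg_left ((abs_add_le _ _).trans (add_le_add e3 ?_)) hA
    rw [abs_of_nonneg (by positivity)]
    linarith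
  have e6 : |2 * ε * ‖ξ‖ ^ 2| ≤ 2 * ‖ξ‖ ^ 2 := by
    rw [abs_of_nonneg (by positivity)]
    have : ε * ‖ξ‖ ^ 2 ≤ 1 * ‖ξ‖ ^ 2 := by gcongr
    linarith
  refine (abs_add_le _ _).trans ((add_le_add (abs_add_le _ _) e6).trans ?_)
  have e7 := (abs_add_le (p₂ + (β + l x) * r₂) (2 * l ξ * r₁))
  have e8 := abs_add_le p₂ ((β + l x) * r₂)
  nlinarith

/-- On a complex tangent direction the Levi form of the barrier is the expected combination of the
Levi forms of `φ` and `ρ`. -/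
theorem barrierHess_add_I (ρ : ℝ) (x ξ : CSpace n) (β : ℝ) (l : CSpace n →L[ℝ] ℝ)
    (A τ ε p₂ p₂' r₂ r₂' : ℝ) :
    1 / 4 * (barrierHess ρ x ξ β l A τ ε p₂ 0 r₂
        + barrierHess ρ x (Complex.I • ξ) β l A τ ε p₂' 0 r₂')
      = 1 / 4 * (p₂ + p₂') + (β + l x) * (1 / 4 * (r₂ + r₂'))
        + A * (2 * (ρ + τ * ‖x‖ ^ 2) * (1 / 4 * (r₂ + r₂') + τ * ‖ξ‖ ^ 2)
          + 2 * τ ^ 2 * ‖(inner ℂ ξ x : ℂ)‖ ^ 2) + ε * ‖ξ‖ ^ 2 := by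
  simp only [barrierHess, norm_smul, Complex.norm_I, one_mul, ← re_sq_add_re_sq x ξ]
  ring

/-- The trace estimate for the barrier. The linear function `l` is chosen so that the terms of
first order in `x` cancel. -/
theorem barrier_trace_le {P P₀ R R₀ S Q ρ β₁ C c Λ A τ ε X px rx lx : ℝ} (hc : 0 < c) (hC : 1 ≤ C)
    (hX : 0 ≤ X) (hX1 : X ≤ 1) (hXc : X ≤ c / (8 * C)) (hP : |P - P₀ - px| ≤ C * X ^ 2)
    (hR : |R - R₀ - rx| ≤ C * X ^ 2) (hrx : |rx| ≤ C * X) (hlx : |lx| ≤ Λ * X)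
    (hl : lx * R₀ = -px - β₁ * rx) (hβ₁ : |β₁| ≤ C) (h0 : P₀ + β₁ * R₀ ≤ 0) (hR₀ : R₀ ≤ -c)
    (hRC : |R| ≤ C ^ 2) (hSC : S ≤ C) (hQ : Q ≤ C * X ^ 2) (hρ : 0 ≤ ρ)
    (hτ : τ = c / (4 * C)) (hA : 0 ≤ A) (hAC : C + C * C + 2 * C * Λ ≤ A * (c * τ / 2))
    (hε : 0 ≤ ε) :
    P + (β₁ - ε + lx) * R + A * (2 * (ρ + τ * X ^ 2) * (R + τ * S) + 2 * τ ^ 2 * Q) + ε * S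
      ≤ ε * (C + C ^ 2) := by
  have hC0 : 0 < C := by linarith
  have hτ0 : 0 < τ := by rw [hτ]; positivity
  have hτC : τ * C = c / 4 := by rw [hτ]; field_simp
  have hCX : C * X ≤ c / 8 := by
    rw [le_div_iff₀ (by positivity)] at hXc
    linarith
  have hXX : C * X ^ 2 ≤ C * X :=
    mul_le_mul_of_nonneg_left (pow_le_of_le_one hX hX1 two_ne_zero) hC0.le
  have hRR : |R - R₀| ≤ 2 * (C * X) := by
    have := abs_add_le (R - R₀ - rx) rx
    rw [sub_add_cancel] at this
    linarith
  have hRτ : R + τ * S ≤ -(c / 2) := by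
    have h1 := (abs_le.1 hRR).2
    have h2 : τ * S ≤ τ * C := by gcongr
    linarith
  -- Since `R + τ S ≤ -c / 2`, the terms with `A` contribute at most `-A c τ X² / 2`, which absorbs
  -- every error of second order.
  have hApart : A * (2 * (ρ + τ * X ^ 2) * (R + τ * S) + 2 * τ ^ 2 * Q)
      ≤ -(A * (c * τ / 2) * X ^ 2) := by
    have h1 : 2 * (ρ + τ * X ^ 2) * (R + τ * S) ≤ -(c * τ * X ^ 2) := by
      have h2 : 0 ≤ 2 * (ρ + τ * X ^ 2) := by positivity
      have h3 := mul_le_mul_of_nonneg_left hRτ h2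
      nlinarith [mul_nonneg hc.le hρ]
    have h2 : 2 * τ ^ 2 * Q ≤ c * τ / 2 * X ^ 2 := by
      have h3 : 2 * τ ^ 2 * Q ≤ 2 * τ ^ 2 * (C * X ^ 2) := by gcongr
      have h4 : 2 * τ ^ 2 * (C * X ^ 2) = 2 * τ * X ^ 2 * (τ * C) := by ring
      rw [h4, hτC] at h3
      linarith
    have := mul_le_mul_of_nonneg_left (add_le_add h1 h2) hA
    linarith
  -- By the choice of `lx` and by `P₀ + β₁ R₀ ≤ 0`, the remaining terms are of second order.
  have hΦ : P + (β₁ + lx) * R ≤ (C + C * C + 2 * C * Λ) * X ^ 2 := by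
    have h1 : P + (β₁ + lx) * R = (P - P₀ - px) + β₁ * (R - R₀ - rx) + lx * (R - R₀)
        + (P₀ + β₁ * R₀) + (lx * R₀ + px + β₁ * rx) := by ring
    have h2 : lx * R₀ + px + β₁ * rx = 0 := by rw [hl]; ring
    have h3 : β₁ * (R - R₀ - rx) ≤ C * (C * X ^ 2) := by
      refine (le_abs_self _).trans ?_
      rw [abs_mul]
      gcongr
    have h4 : lx * (R - R₀) ≤ (Λ * X) * (2 * (C * X)) := by
      refine (le_abs_self _).trans ?_
      rw [abs_mul]
      exact mul_le_mul hlx hRR (abs_nonneg _) ((abs_nonneg _).trans hlx)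
    have h5 := (abs_le.1 hP).2
    rw [h1, h2]
    nlinarith
  have hA2 := mul_le_mul_of_nonneg_right hAC (sq_nonneg X)
  have hε1 : ε * (-R) ≤ ε * C ^ 2 := mul_le_mul_of_nonneg_left (by linarith [(abs_le.1 hRC).1]) hε
  have hε2 : ε * S ≤ ε * C := mul_le_mul_of_nonneg_left hSC hε
  nlinarith

end barrier

section comparison

variable {m : ℕ} {M : Type*} [TopologicalSpace M] {X : ComplexManifoldWithBoundary (m + 1) M}
  {g : HermitianMetric X} {χ : RealForm11 X} {Γ : Set (Fin (m + 1) → ℝ)}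
  {f : (Fin (m + 1) → ℝ) → ℝ} {ψ φ u : M → ℝ}

/-- A function whose second derivatives never dominate those of `u` lies above `u` if it does so on
the boundary. -/
theorem le_of_forall_not_hessian_le (hu : X.IsCk 2 u) {a : Fin X.N} {z₀ : CSpace (m + 1)}
    (hz₀ : z₀ ∈ (X.chart a).target) {r : ℝ} (hr : 0 < r)
    (hball : Metric.closedBall z₀ r ⊆ X.ambient a)
    {w : CSpace (m + 1) → ℝ} (hw : ContinuousOn w ((X.chart a).target ∩ Metric.closedBall z₀ r))
    (h1 : ∀ z ∈ (X.chart a).target, dist z z₀ ≤ r → X.rho a z = 0 → X.coord u a z ≤ w z)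
    (h2 : ∀ z ∈ (X.chart a).target, dist z z₀ = r → X.coord u a z ≤ w z)
    (h3 : ∀ z ∈ (X.chart a).target, dist z z₀ < r → 0 < X.rho a z →
      ∃ B : CSpace (m + 1) → ℝ, (∀ ξ, ∃ b, HasJet2 (fun s : ℝ => w (z + s • ξ)) b (B ξ)) ∧
        ¬∀ ξ, realHessian (X.coord u a) (X.chart a).target z ξ ξ ≤ B ξ) :
    ∀ z ∈ (X.chart a).target, dist z z₀ ≤ r → X.coord u a z ≤ w z := by
  set D := (X.chart a).target ∩ Metric.closedBall z₀ r with hD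
  have hDc : IsCompact D := by
    have h4 : D = Metric.closedBall z₀ r ∩ X.rho a ⁻¹' Ici 0 := by
      ext z
      simp only [hD, mem_inter_iff, X.mem_target, mem_preimage, mem_Ici]
      exact ⟨fun h => ⟨h.2, h.1.2⟩, fun h => ⟨⟨hball h.1, h.2⟩, h.1⟩⟩
    rw [h4]
    have hc : ContinuousOn (X.rho a) (Metric.closedBall z₀ r) := fun z hz =>
      ((X.regular a).continuousAt (hball hz)).continuousWithinAt
    exact (isCompact_closedBall z₀ r).of_isClosed_subset
      (hc.preimage_isClosed_of_isClosed Metric.isClosed_closedBall isClosed_Ici) inter_subset_left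
  have huc : ContinuousOn (X.coord u a) D := (hu a).continuousOn.mono inter_subset_left
  obtain ⟨z₁, hz₁, hmin⟩ := hDc.exists_isMinOn ⟨z₀, hz₀, Metric.mem_closedBall_self hr.le⟩
    (hw.sub huc)
  intro z hz hzr
  by_contra! hlt
  have hneg : w z₁ - X.coord u a z₁ < 0 := lt_of_le_of_lt (hmin ⟨hz, hzr⟩) (by
    show w z - X.coord u a z < 0
    linarith)
  have hρ : 0 < X.rho a z₁ := by
    refine lt_of_le_of_ne (X.mem_target.1 hz₁.1).2 fun heq => ?_
    linarith [h1 z₁ hz₁.1 hz₁.2 heq.symm]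
  have hlt₁ : dist z₁ z₀ < r := by
    refine lt_of_le_of_ne hz₁.2 fun heq => ?_
    linarith [h2 z₁ hz₁.1 heq]
  obtain ⟨B, hB, hnot⟩ := h3 z₁ hz₁.1 hlt₁ hρ
  refine hnot fun ξ => ?_
  obtain ⟨b, hb⟩ := hB ξ
  have hjet := hb.sub (hasJet2_coord hu hz₁.1 hρ ξ)
  have hloc : IsLocalMin (fun z => w z - X.coord u a z) z₁ :=
    hmin.isLocalMin (inter_mem (X.target_mem_nhds hz₁.1 hρ)
      (Metric.closedBall_mem_nhds_of_mem (Metric.mem_ball.2 hlt₁)))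
  have hline : Tendsto (fun s : ℝ => z₁ + s • ξ) (𝓝 0) (𝓝 z₁) := by
    have : ContinuousAt (fun s : ℝ => z₁ + s • ξ) 0 := by fun_prop
    simpa using this.tendsto
  have := hjet.nonneg_of_isLocalMin (by
    have h4 := hline.eventually hloc
    simpa [IsLocalMin, IsMinFilter] using h4)
  linarith

/-- If the Hessian of `u` is dominated by `B`, the weighted trace of `χ + B` on the first `m`
vectors of a unitary frame is bounded below. -/
theorem lt_trace_of_hessian_le (hΓ : IsSymmetricCone Γ) (hf : IsStructuralFunction Γ f) {θ : ℝ}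
    (hψ : ∀ p, θ ≤ ψ p) (hu : IsAdmissibleSolution g χ Γ f ψ φ u) {a : Fin X.N}
    {z : CSpace (m + 1)} (hz : z ∈ (X.chart a).target) (hρ : 0 < X.rho a z)
    {B : CSpace (m + 1) → ℝ}
    (hB : ∀ ξ, realHessian (X.coord u a) (X.chart a).target z ξ ξ ≤ B ξ)
    {e : Fin (m + 1) → CSpace (m + 1)} (he : IsUnitaryFam (sesq (g.comp a z)) e) {R ε : ℝ}
    (hε : ∀ l ∈ Γ, (∀ i, |l i| ≤ R) → θ ≤ f l → (fun i => l i - ε) ∈ Γ)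
    (hR : ∀ i, |(sesq (χ.comp a z) (e i) (e i)).re
      + 1 / 4 * (B (e i) + B (Complex.I • e i))| ≤ R)
    {μ : Fin m → ℝ} (hμ1 : ∑ i, μ i = 1) (hμ : ∀ l ∈ gammaInfty Γ, 0 < ∑ i, μ i * l i) :
    ε < ∑ i : Fin m, μ i * ((sesq (χ.comp a z) (e i.castSucc) (e i.castSucc)).re
      + 1 / 4 * (B (e i.castSucc) + B (Complex.I • e i.castSucc))) := by
  set d : Fin (m + 1) → ℝ := fun i => (sesq (χ.comp a z) (e i) (e i)).re
      + 1 / 4 * (B (e i) + B (Complex.I • e i)) with hd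
  obtain ⟨hlΓ, hlψ⟩ := hu.equation_coord hz hρ
  have hG := (g.isPosForm hz).toIsHermForm
  have hU := isHermForm_gForm χ hu.isC2 hz
  have hlam := isEigenTuple_lamG g χ hu.isC2 hz
  set d₀ : Fin (m + 1) → ℝ := fun i => (HermitianMetric.gForm χ u a z (e i) (e i)).re with hd₀
  have hd₀Γ : d₀ ∈ Γ := hΓ.isMonoCone.diag_mem (S := ⊤) hG hU (by simp) hlam hlΓ he
    fun _ => trivial
  have hfd₀ : θ ≤ f d₀ := ((hψ _).trans hlψ.ge).trans
    (hf.le_diag (S := ⊤) hG hU (by simp) hΓ.symmetric hlam hlΓ he fun _ => trivial)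
  have hle : ∀ i, d₀ i ≤ d i := fun i => by
    simp only [hd₀, hd, HermitianMetric.gForm, Complex.add_re, complexHessian, leviPart_self_re]
    linarith [hB (e i), hB (Complex.I • e i)]
  have hdΓ : d ∈ Γ := hΓ.isMonoCone.mono hd₀Γ hle
  have h1 := hμ _ (init_mem_gammaInfty (hε d hdΓ hR (hfd₀.trans (hf.mono hΓ hd₀Γ hle))))
  simp only [mul_sub, Finset.sum_sub_distrib] at h1
  rw [← Finset.sum_mul, hμ1, one_mul] at h1
  linarith

end comparison

/-! ### The normal derivative estimate from the barrier -/

open ComplexManifoldWithBoundary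

section bound

variable {m : ℕ} {M : Type*} [TopologicalSpace M] {X : ComplexManifoldWithBoundary (m + 1) M}
  {g : HermitianMetric X} {χ : RealForm11 X} {Γ : Set (Fin (m + 1) → ℝ)}
  {f : (Fin (m + 1) → ℝ) → ℝ} {ψ φ u : M → ℝ}

/-- The trace of a Hermitian form on the vectors `T` with weights `μ`. -/
def weightedTrace (μ : Fin m → ℝ) (Θ : CSpace (m + 1) → CSpace (m + 1) → ℂ)
    (T : Fin m → CSpace (m + 1)) : ℝ :=
  ∑ α, μ α * (Θ (T α) (T α)).re

/-- The Levi form of the defining function of the boundary. -/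
def ComplexManifoldWithBoundary.rhoLevi (X : ComplexManifoldWithBoundary (m + 1) M) (a : Fin X.N)
    (z ξ ζ : CSpace (m + 1)) : ℂ :=
  leviPart (fun v w => fderiv ℝ (fderiv ℝ (X.rho a)) z v w) ξ ζ

/-- The data on which the barrier at `z₀` is built, with bounds by `C` in the ball of radius `r`:
a unitary frame `T, N` with `T` tangent to the level sets of the defining function, and weights
`μ` which are positive on `Γ_∞`, such that the weighted trace `tr` on `T` satisfies
`tr (√-1 ∂∂̄ρ) ≤ -c` and `tr (χ + √-1 ∂∂̄φ + β₁ √-1 ∂∂̄ρ) ≤ 0` at `z₀`. -/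
structure IsBarrierData (g : HermitianMetric X) (χ : RealForm11 X) (Γ : Set (Fin (m + 1) → ℝ))
    (φ u : M → ℝ) (a : Fin X.N) (z₀ : CSpace (m + 1)) (T : Fin m → CSpace (m + 1) → CSpace (m + 1))
    (N : CSpace (m + 1) → CSpace (m + 1)) (μ : Fin m → ℝ) (β₁ r c C : ℝ) : Prop where
  boundary : z₀ ∈ X.coordBoundary a
  ball : Metric.closedBall z₀ r ⊆ X.ambient a
  tangent : ∀ z ∈ (X.chart a).target, dist z z₀ ≤ r → ∀ α, T α z ∈ X.holSub a z
  unitary : ∀ z ∈ (X.chart a).target, dist z z₀ ≤ r → IsUnitaryFam (sesq (g.comp a z))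
    (Fin.snoc (fun α => T α z) (N z) : Fin (m + 1) → CSpace (m + 1))
  norm_sq_le : ∀ z ∈ (X.chart a).target, dist z z₀ ≤ r → ∀ v,
    (sesq (g.comp a z) v v).re = 1 → ‖v‖ ^ 2 ≤ C
  abs_le : ∀ z ∈ (X.chart a).target, dist z z₀ ≤ r →
    |X.coord φ a z| ≤ C ∧ |X.coord u a z| ≤ C ∧ X.rho a z ≤ C
  chi_le : ∀ z ∈ (X.chart a).target, dist z z₀ ≤ r → ∀ ξ,
    |(sesq (χ.comp a z) ξ ξ).re| ≤ C * ‖ξ‖ ^ 2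
  hess_le : ∀ z ∈ (X.chart a).target, dist z z₀ ≤ r → ∀ ξ,
    |realHessian (X.coord φ a) (X.chart a).target z ξ ξ| ≤ C * ‖ξ‖ ^ 2
  fderiv_rho_le : ∀ z ∈ (X.chart a).target, dist z z₀ ≤ r → ∀ ξ,
    |fderiv ℝ (X.rho a) z ξ| ≤ C * ‖ξ‖
  hess_rho_le : ∀ z ∈ (X.chart a).target, dist z z₀ ≤ r → ∀ ξ,
    |fderiv ℝ (fderiv ℝ (X.rho a)) z ξ ξ| ≤ C * ‖ξ‖ ^ 2
  weight_nonneg : ∀ i, 0 ≤ μ i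
  weight_sum : ∑ i, μ i = 1
  weight_pos : ∀ l ∈ gammaInfty Γ, 0 < ∑ i, μ i * l i
  taylor : ∃ p : CSpace (m + 1) →L[ℝ] ℝ, ‖p‖ ≤ C ∧
    ∀ z ∈ (X.chart a).target, dist z z₀ ≤ r →
      |weightedTrace μ (HermitianMetric.gForm χ φ a z) (fun α => T α z)
        - weightedTrace μ (HermitianMetric.gForm χ φ a z₀) (fun α => T α z₀) - p (z - z₀)|
      ≤ C * ‖z - z₀‖ ^ 2
  taylor_rho : ∃ p : CSpace (m + 1) →L[ℝ] ℝ, ‖p‖ ≤ C ∧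
    ∀ z ∈ (X.chart a).target, dist z z₀ ≤ r →
      |weightedTrace μ (X.rhoLevi a z) (fun α => T α z)
        - weightedTrace μ (X.rhoLevi a z₀) (fun α => T α z₀) - p (z - z₀)|
      ≤ C * ‖z - z₀‖ ^ 2
  trace_rho_le : weightedTrace μ (X.rhoLevi a z₀) (fun α => T α z₀) ≤ -c
  abs_beta_le : |β₁| ≤ C
  trace_le : weightedTrace μ (HermitianMetric.gForm χ φ a z₀) (fun α => T α z₀)
    + β₁ * weightedTrace μ (X.rhoLevi a z₀) (fun α => T α z₀) ≤ 0

theorem hasJet2_rho (X : ComplexManifoldWithBoundary (m + 1) M) {a : Fin X.N}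
    {z : CSpace (m + 1)} (hz : z ∈ X.ambient a) (ξ : CSpace (m + 1)) :
    HasJet2 (fun s : ℝ => X.rho a (z + s • ξ)) (fderiv ℝ (X.rho a) z ξ)
      (fderiv ℝ (fderiv ℝ (X.rho a)) z ξ ξ) := by
  refine hasJet2_line ?_ ?_ ξ
  · filter_upwards [(X.isOpen_ambient a).mem_nhds hz] with y hy
    exact (X.regular a).hasFDerivAt hy
  · exact ((((X.regular a).contDiffAt hz).fderiv_right (m := 3) (by norm_num)).differentiableAt
      (by simp)).hasFDerivAt

/-- Two functions which agree at a boundary point and are ordered near it have ordered derivatives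
in the inner directions. -/
theorem fderivWithin_le_of_le {a : Fin X.N} {z₀ : CSpace (m + 1)} (hz₀ : z₀ ∈ X.coordBoundary a)
    {h w : CSpace (m + 1) → ℝ} {w' : CSpace (m + 1) →L[ℝ] ℝ}
    (hh : DifferentiableWithinAt ℝ h (X.chart a).target z₀)
    (hw : HasFDerivWithinAt w w' (X.chart a).target z₀) (h0 : w z₀ = h z₀) {s : ℝ} (hs0 : 0 < s)
    (hle : ∀ z ∈ (X.chart a).target, dist z z₀ ≤ s → h z ≤ w z) {v : CSpace (m + 1)}
    (hv : 0 < fderiv ℝ (X.rho a) z₀ v) :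
    fderivWithin ℝ h (X.chart a).target z₀ v ≤ w' v := by
  have hz := hz₀.1
  have hder := hw.sub hh.hasFDerivWithinAt
  have hray := (X.regular a).eventually_ray_pos (X.mem_target.1 hz).1 hz₀.2 hv
  have hnear : ∀ᶠ t in 𝓝[>] (0 : ℝ), dist (z₀ + t • v) z₀ < s :=
    (IsRegularDomain.tendsto_ray z₀ v).eventually (Metric.ball_mem_nhds z₀ hs0)
  have hline : HasDerivWithinAt (fun t : ℝ => z₀ + t • v) v (Ioi 0) 0 := by
    simpa using (((hasDerivAt_id (0 : ℝ)).smul_const v).const_add z₀).hasDerivWithinAt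
  obtain ⟨δ, hδ, hIoo⟩ := mem_nhdsGT_iff_exists_Ioo_subset.1 (hray.and hnear)
  have hδ0 : (0 : ℝ) < δ := hδ
  have hmaps : MapsTo (fun t : ℝ => z₀ + t • v) (Ioo 0 δ) (X.chart a).target := fun t ht =>
    X.mem_target.2 ⟨(hIoo ht).1.1, (hIoo ht).1.2.le⟩
  have hder' : HasFDerivWithinAt (w - h) (w' - fderivWithin ℝ h (X.chart a).target z₀)
      (X.chart a).target (z₀ + (0 : ℝ) • v) := by
    rw [zero_smul, add_zero]; exact hder
  have h3 := (hasDerivWithinAt_iff_tendsto_slope' (by simp)).1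
    (hder'.comp_hasDerivWithinAt 0 (hline.mono Ioo_subset_Ioi_self) hmaps)
  have : (𝓝[Ioo 0 δ] (0 : ℝ)).NeBot := by
    rw [nhdsWithin_Ioo_eq_nhdsGT hδ0]; infer_instance
  have h4 := ge_of_tendsto (b := (0 : ℝ)) h3 (by
    filter_upwards [self_mem_nhdsWithin] with t ht
    simp only [slope, vsub_eq_sub, sub_zero, Function.comp, zero_smul, add_zero, h0, sub_self,
      smul_eq_mul, Pi.sub_apply]
    refine mul_nonneg (inv_nonneg.2 ht.1.le) ?_
    have := hle _ (hmaps ht) (hIoo ht).2.le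
    linarith)
  simp only [sub_apply] at h4
  linarith

theorem sum_weight_le {μ : Fin m → ℝ} (h0 : ∀ i, 0 ≤ μ i) (h1 : ∑ i, μ i = 1) {t : Fin m → ℝ}
    {D : ℝ} (ht : ∀ i, t i ≤ D) : ∑ i, μ i * t i ≤ D := by
  calc ∑ i, μ i * t i ≤ ∑ i, μ i * D :=
        Finset.sum_le_sum fun i _ => mul_le_mul_of_nonneg_left (ht i) (h0 i)
    _ = D := by rw [← Finset.sum_mul, h1, one_mul]

theorem sum_barrier_terms (μ p r t k : Fin m → ℝ) (b A d τ ε : ℝ) :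
    ∑ i, μ i * (p i + b * r i + A * (2 * d * (r i + τ * t i) + 2 * τ ^ 2 * k i) + ε * t i)
      = ∑ i, μ i * p i + b * ∑ i, μ i * r i
        + A * (2 * d * (∑ i, μ i * r i + τ * ∑ i, μ i * t i) + 2 * τ ^ 2 * ∑ i, μ i * k i)
        + ε * ∑ i, μ i * t i := by
  simp only [Finset.mul_sum, ← Finset.sum_add_distrib]
  exact Finset.sum_congr rfl fun i _ => by ring

/-- The Hessian of the barrier does not dominate that of `u` at interior points: otherwise the
weighted trace of `χ + √-1 ∂∂̄w` would exceed `ε₀`, but the trace estimate bounds it by `ε₀`. -/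
theorem IsBarrierData.not_hessian_le (hΓ : IsSymmetricCone Γ) (hf : IsStructuralFunction Γ f)
    {θ r c C : ℝ} (hc : 0 < c) (hC : 1 ≤ C) {Λ τ A ε ε₀ CB : ℝ} (hτ : τ = c / (4 * C))
    (hΛ0 : 0 ≤ Λ) (hA0 : 0 ≤ A) (hA1 : C + C * C + 2 * C * Λ ≤ A * (c * τ / 2))
    (hCB : CB = C + (C + 1 + Λ) * C + 2 * Λ * C
        + A * (2 * (C + τ) * (C + 2 * τ) + 2 * (C + 2 * τ) ^ 2) + 2)
    (hε0 : 0 < ε) (hε1 : ε ≤ 1) (hεε : ε * (C + C ^ 2) ≤ ε₀)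
    (hsub : ∀ l ∈ Γ, (∀ i, |l i| ≤ (C + CB) * C) → θ ≤ f l → (fun i => l i - ε₀) ∈ Γ)
    {a : Fin X.N} {z₀ : CSpace (m + 1)}
    {T : Fin m → CSpace (m + 1) → CSpace (m + 1)} {N : CSpace (m + 1) → CSpace (m + 1)}
    {μ : Fin m → ℝ} {β₁ : ℝ} (hψ : ∀ p, θ ≤ ψ p)
    (hu : IsAdmissibleSolution g χ Γ f ψ φ u) (hd : IsBarrierData g χ Γ φ u a z₀ T N μ β₁ r c C)
    {p q l : CSpace (m + 1) →L[ℝ] ℝ} (hqC : ‖q‖ ≤ C) (hlΛ : ‖l‖ ≤ Λ)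
    {z : CSpace (m + 1)} (hz : z ∈ (X.chart a).target) (hzr : dist z z₀ ≤ r)
    (hx1 : ‖z - z₀‖ ≤ 1) (hxc : ‖z - z₀‖ ≤ c / (8 * C)) (hρ : 0 < X.rho a z)
    (hp : |weightedTrace μ (HermitianMetric.gForm χ φ a z) (fun α => T α z)
        - weightedTrace μ (HermitianMetric.gForm χ φ a z₀) (fun α => T α z₀) - p (z - z₀)|
      ≤ C * ‖z - z₀‖ ^ 2)
    (hq : |weightedTrace μ (X.rhoLevi a z) (fun α => T α z)
        - weightedTrace μ (X.rhoLevi a z₀) (fun α => T α z₀) - q (z - z₀)|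
      ≤ C * ‖z - z₀‖ ^ 2)
    (hl : l (z - z₀) * weightedTrace μ (X.rhoLevi a z₀) (fun α => T α z₀)
      = -p (z - z₀) - β₁ * q (z - z₀)) :
    ¬∀ ξ, realHessian (X.coord u a) (X.chart a).target z ξ ξ
      ≤ barrierHess (X.rho a z) (z - z₀) ξ (β₁ - ε) l A τ ε
        (realHessian (X.coord φ a) (X.chart a).target z ξ ξ) (fderiv ℝ (X.rho a) z ξ)
        (fderiv ℝ (fderiv ℝ (X.rho a)) z ξ ξ) := by
  intro hle
  have hC0 : 0 < C := by linarith
  have hτ0 : 0 < τ := by rw [hτ]; positivity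
  have hCB0 : 0 ≤ CB := by rw [hCB]; positivity
  obtain ⟨b1, b2, b3⟩ := hd.abs_le z hz hzr
  set B : CSpace (m + 1) → ℝ := fun ξ => barrierHess (X.rho a z) (z - z₀) ξ (β₁ - ε) l A τ ε
      (realHessian (X.coord φ a) (X.chart a).target z ξ ξ) (fderiv ℝ (X.rho a) z ξ)
      (fderiv ℝ (fderiv ℝ (X.rho a)) z ξ ξ) with hB
  have hβε : |β₁ - ε| ≤ C + 1 := by
    refine (abs_sub _ _).trans ?_
    rw [abs_of_pos hε0]
    linarith [hd.abs_beta_le]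
  have hBb : ∀ ξ, |B ξ| ≤ CB * ‖ξ‖ ^ 2 := fun ξ => by
    rw [hCB]
    exact abs_barrierHess_le hC0.le hA0 hτ0.le hε0.le hε1 hx1 hρ.le b3 hβε hlΛ
      (hd.hess_le z hz hzr ξ) (hd.fderiv_rho_le z hz hzr ξ) (hd.hess_rho_le z hz hzr ξ)
  have hun := hd.unitary z hz hzr
  have hnorm : ∀ i, ‖(Fin.snoc (fun α => T α z) (N z) : Fin (m + 1) → CSpace (m + 1)) i‖ ^ 2 ≤ C :=
    fun i => hd.norm_sq_le z hz hzr _ (by rw [hun i i]; simp)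
  have hlt := lt_trace_of_hessian_le hΓ hf hψ hu hz hρ (B := B) hle hun (R := (C + CB) * C) hsub
    (fun i => by
      set e := (Fin.snoc (fun α => T α z) (N z) : Fin (m + 1) → CSpace (m + 1)) i with he
      have h1 := hBb e
      have h2 := hBb (Complex.I • e)
      rw [norm_smul, Complex.norm_I, one_mul] at h2
      have h3 := hd.chi_le z hz hzr e
      have h4 : |1 / 4 * (B e + B (Complex.I • e))| ≤ CB * ‖e‖ ^ 2 := by
        rw [abs_mul]
        have := abs_add_le (B e) (B (Complex.I • e))
        have : 0 ≤ CB * ‖e‖ ^ 2 := by positivity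
        norm_num [abs_of_pos]
        linarith
      calc _ ≤ C * ‖e‖ ^ 2 + CB * ‖e‖ ^ 2 := (abs_add_le _ _).trans (add_le_add h3 h4)
        _ = (C + CB) * ‖e‖ ^ 2 := by ring
        _ ≤ (C + CB) * C := mul_le_mul_of_nonneg_left (hnorm i) (by positivity))
    hd.weight_sum hd.weight_pos
  simp only [Fin.snoc_castSucc] at hlt
  have hTn : ∀ α, ‖T α z‖ ^ 2 ≤ C := fun α => by simpa using hnorm α.castSucc
  have hT0 : ∀ α, fderiv ℝ (X.rho a) z (T α z) = 0 ∧
      fderiv ℝ (X.rho a) z (Complex.I • T α z) = 0 := fun α => by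
    have h : T α z ∈ (X.holSub a z : Set (CSpace (m + 1))) := hd.tangent z hz hzr α
    rw [coe_holSub] at h
    exact h
  have hterm : ∀ α, (sesq (χ.comp a z) (T α z) (T α z)).re
      + 1 / 4 * (B (T α z) + B (Complex.I • T α z))
      = (HermitianMetric.gForm χ φ a z (T α z) (T α z)).re
        + (β₁ - ε + l (z - z₀)) * (X.rhoLevi a z (T α z) (T α z)).re
        + A * (2 * (X.rho a z + τ * ‖z - z₀‖ ^ 2)
            * ((X.rhoLevi a z (T α z) (T α z)).re + τ * ‖T α z‖ ^ 2)
          + 2 * τ ^ 2 * ‖(inner ℂ (T α z) (z - z₀) : ℂ)‖ ^ 2) + ε * ‖T α z‖ ^ 2 := fun α => by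
    simp only [hB, (hT0 α).1, (hT0 α).2]
    rw [barrierHess_add_I, HermitianMetric.gForm, Complex.add_re, complexHessian,
      leviPart_self_re, rhoLevi, leviPart_self_re]
    ring
  simp only [hterm] at hlt
  rw [sum_barrier_terms] at hlt
  have hwsum : ∀ (t : Fin m → ℝ) (D : ℝ), (∀ α, t α ≤ D) → ∑ α, μ α * t α ≤ D :=
    fun t D => sum_weight_le hd.weight_nonneg hd.weight_sum
  have hRb : ∀ α, |(X.rhoLevi a z (T α z) (T α z)).re| ≤ C ^ 2 := fun α => by
    rw [rhoLevi, leviPart_self_re, abs_mul]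
    have h1 := hd.hess_rho_le z hz hzr (T α z)
    have h2 := hd.hess_rho_le z hz hzr (Complex.I • T α z)
    rw [norm_smul, Complex.norm_I, one_mul] at h2
    have h3 := abs_add_le (fderiv ℝ (fderiv ℝ (X.rho a)) z (T α z) (T α z))
      (fderiv ℝ (fderiv ℝ (X.rho a)) z (Complex.I • T α z) (Complex.I • T α z))
    have h4 := mul_le_mul_of_nonneg_left (hTn α) hC0.le
    norm_num [abs_of_pos]
    nlinarith
  have hRabs : |weightedTrace μ (X.rhoLevi a z) (fun α => T α z)| ≤ C ^ 2 := by
    refine _root_.abs_le.2 ⟨?_, hwsum _ _ fun α => (_root_.abs_le.1 (hRb α)).2⟩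
    have := hwsum (fun α => -(X.rhoLevi a z (T α z) (T α z)).re) (C ^ 2) fun α => by
      linarith [(_root_.abs_le.1 (hRb α)).1]
    simp only [mul_neg, Finset.sum_neg_distrib] at this
    simp only [weightedTrace]
    linarith
  have hinner : ∀ α, ‖(inner ℂ (T α z) (z - z₀) : ℂ)‖ ^ 2 ≤ C * ‖z - z₀‖ ^ 2 := fun α => by
    have h1 := norm_inner_le_norm (𝕜 := ℂ) (T α z) (z - z₀)
    calc ‖(inner ℂ (T α z) (z - z₀) : ℂ)‖ ^ 2 ≤ (‖T α z‖ * ‖z - z₀‖) ^ 2 := by gcongr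
      _ = ‖T α z‖ ^ 2 * ‖z - z₀‖ ^ 2 := by ring
      _ ≤ C * ‖z - z₀‖ ^ 2 := by gcongr; exact hTn α
  have htrace := barrier_trace_le hc hC (norm_nonneg _) hx1 hxc hp hq
    ((q.le_opNorm _).trans (by gcongr)) ((l.le_opNorm _).trans (by gcongr)) hl hd.abs_beta_le
    hd.trace_le hd.trace_rho_le hRabs (hwsum _ _ hTn) (hwsum _ _ hinner) hρ.le hτ hA0 hA1 hε0.le
  simp only [weightedTrace] at htrace
  linarith

/-- The barrier lies above the solution, which improves the upper bound of the normal derivative by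
a definite amount. -/
theorem exists_fderivWithin_le (hΓ : IsSymmetricCone Γ) (hf : IsStructuralFunction Γ f) {θ : ℝ}
    (hθ : supBoundary Γ f < (θ : EReal)) {r c C : ℝ} (hr : 0 < r) (hc : 0 < c) (hC : 1 ≤ C) :
    ∃ ε > 0, ∀ (ψ φ u : M → ℝ) (a : Fin X.N) (z₀ : CSpace (m + 1))
      (T : Fin m → CSpace (m + 1) → CSpace (m + 1)) (N : CSpace (m + 1) → CSpace (m + 1))
      (μ : Fin m → ℝ) (β₁ : ℝ), (∀ p, θ ≤ ψ p) → X.IsCk 2 φ →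
      IsAdmissibleSolution g χ Γ f ψ φ u → IsBarrierData g χ Γ φ u a z₀ T N μ β₁ r c C →
      ∀ v, 0 < fderiv ℝ (X.rho a) z₀ v →
        fderivWithin ℝ (X.coord u a) (X.chart a).target z₀ v
          ≤ fderivWithin ℝ (X.coord φ a) (X.chart a).target z₀ v
            + (β₁ - ε) * fderiv ℝ (X.rho a) z₀ v := by
  have hC0 : 0 < C := by linarith
  -- `Λ` bounds the linear term `l`, and `A` is large for the trace estimate and on the sphere of
  -- radius `s`; `ε` comes last, as it depends on the bound `CB` of the Hessian of the barrier.
  set Λ := (C + C * C) / c with hΛ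
  have hΛ0 : 0 ≤ Λ := by positivity
  set τ := c / (4 * C) with hτ
  have hτ0 : 0 < τ := by positivity
  set s := min (min r 1) (c / (8 * C)) with hs
  have hs0 : 0 < s := lt_min (lt_min hr one_pos) (by positivity)
  have hsr : s ≤ r := (min_le_left _ _).trans (min_le_left _ _)
  have hs1 : s ≤ 1 := (min_le_left _ _).trans (min_le_right _ _)
  have hsc : s ≤ c / (8 * C) := min_le_right _ _
  set A := (C + C * C + 2 * C * Λ) / (c * τ / 2) + (2 * C + (C + 1 + Λ) * C) / (τ ^ 2 * s ^ 4)
    with hA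
  have hA0 : 0 ≤ A := by positivity
  have hA1 : C + C * C + 2 * C * Λ ≤ A * (c * τ / 2) := by
    rw [← div_le_iff₀ (by positivity), hA]
    exact le_add_of_nonneg_right (by positivity)
  have hA2 : 2 * C + (C + 1 + Λ) * C ≤ A * (τ ^ 2 * s ^ 4) := by
    rw [← div_le_iff₀ (by positivity), hA]
    exact le_add_of_nonneg_left (by positivity)
  set CB := C + (C + 1 + Λ) * C + 2 * Λ * C
        + A * (2 * (C + τ) * (C + 2 * τ) + 2 * (C + 2 * τ) ^ 2) + 2 with hCB
  have hCB0 : 0 ≤ CB := by positivity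
  obtain ⟨ε₀, hε₀, hsub⟩ := exists_sub_mem_of_le hΓ hθ ((C + CB) * C)
  set ε := min 1 (ε₀ / (C + C ^ 2)) with hε
  have hε0 : 0 < ε := lt_min one_pos (by positivity)
  have hε1 : ε ≤ 1 := min_le_left _ _
  have hεε : ε * (C + C ^ 2) ≤ ε₀ := by
    rw [← le_div_iff₀ (by positivity)]
    exact min_le_right _ _
  refine ⟨ε, hε0, fun ψ φ u a z₀ T N μ β₁ hψ hφ hu hd v hv => ?_⟩
  obtain ⟨p, hpC, hp⟩ := hd.taylor
  obtain ⟨q, hqC, hq⟩ := hd.taylor_rho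
  set P₀ := weightedTrace μ (HermitianMetric.gForm χ φ a z₀) (fun α => T α z₀) with hP₀
  set R₀ := weightedTrace μ (X.rhoLevi a z₀) (fun α => T α z₀) with hR₀
  have hR₀c := hd.trace_rho_le
  have hR₀n : R₀ ≠ 0 := by linarith [hd.trace_rho_le] |> fun h : R₀ < 0 => h.ne
  -- The linear term of the barrier removes the first order terms of the trace.
  set l : CSpace (m + 1) →L[ℝ] ℝ := (-R₀⁻¹) • (p + β₁ • q) with hl
  have hlΛ : ‖l‖ ≤ Λ := by
    rw [hl, norm_smul, hΛ, norm_neg, norm_inv, Real.norm_eq_abs, div_eq_inv_mul]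
    have h1 : ‖p + β₁ • q‖ ≤ C + C * C := by
      refine (norm_add_le _ _).trans (add_le_add hpC ?_)
      rw [norm_smul, Real.norm_eq_abs]
      exact mul_le_mul hd.abs_beta_le hqC (norm_nonneg _) hC0.le
    have h2 : |R₀|⁻¹ ≤ c⁻¹ := by
      refine inv_anti₀ hc ?_
      rw [abs_of_neg (by linarith)]
      linarith
    gcongr
  set w := barrier (X.coord φ a) (X.rho a) z₀ (β₁ - ε) l A τ ε with hw
  have hz₀ := hd.boundary.1
  have hcoordφ := hφ.differentiableWithinAt hz₀
  have hub : ∀ z ∈ (X.chart a).target, X.rho a z = 0 → X.coord u a z = X.coord φ a z :=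
    fun z hz h => hu.boundary_value _ ((X.symm_mem_boundary_iff hz).2 h)
  have hwle := le_of_forall_not_hessian_le (w := w) hu.isC2 hz₀ hs0
    ((Metric.closedBall_subset_closedBall hsr).trans hd.ball) ?_ ?_ ?_ ?_
  · -- The barrier touches `u` at `z₀` from above.
    have h0 : w z₀ = X.coord u a z₀ := by
      rw [hub z₀ hz₀ hd.boundary.2]
      simp [hw, barrier, hd.boundary.2]
    have h1 := fderivWithin_le_of_le hd.boundary
      (hu.isC2.differentiableWithinAt hz₀).differentiableWithinAt
      (hasFDerivWithinAt_barrier hcoordφ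
        ((X.regular a).hasFDerivAt (X.mem_target.1 hz₀).1).hasFDerivWithinAt hd.boundary.2
        (β₁ - ε) l A τ ε) h0 hs0 hwle hv
    simpa only [add_apply, smul_apply, smul_eq_mul] using h1
  · have h1 : ContinuousOn (X.coord φ a) ((X.chart a).target ∩ Metric.closedBall z₀ s) :=
      (hφ a).continuousOn.mono inter_subset_left
    have h2 : ContinuousOn (X.rho a) ((X.chart a).target ∩ Metric.closedBall z₀ s) := fun z hz =>
      ((X.regular a).continuousAt (X.mem_target.1 hz.1).1).continuousWithinAt
    have h3 : Continuous fun z : CSpace (m + 1) => ‖z - z₀‖ ^ 2 := by fun_prop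
    have h4 : Continuous fun z : CSpace (m + 1) => (β₁ - ε) + l (z - z₀) := by fun_prop
    have h5 := h2.add (h3.continuousOn.const_mul τ)
    exact ((h1.add (h4.continuousOn.mul h2)).add ((h5.mul h5).const_mul A)).add
      (h3.continuousOn.const_mul ε)
  · -- On the boundary `u = φ`, and the other terms of the barrier are nonnegative.
    intro z hz hzs hρ
    rw [hub z hz hρ, hw, barrier, hρ]
    have : 0 ≤ A * ((0 + τ * ‖z - z₀‖ ^ 2) * (0 + τ * ‖z - z₀‖ ^ 2)) :=
      mul_nonneg hA0 (mul_self_nonneg _)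
    have : 0 ≤ ε * ‖z - z₀‖ ^ 2 := by positivity
    linarith
  · -- On the sphere the term with the large factor `A` dominates.
    intro z hz hzs
    obtain ⟨b1, b2, b3⟩ := hd.abs_le z hz (hzs.le.trans hsr)
    have hρ := (X.mem_target.1 hz).2
    have hx : ‖z - z₀‖ = s := by rw [← dist_eq_norm, hzs]
    have hlx : |l (z - z₀)| ≤ Λ := by
      refine (l.le_opNorm _).trans ?_
      rw [hx]
      exact (mul_le_mul hlΛ hs1 hs0.le hΛ0).trans (mul_one Λ).le
    rw [hw, barrier, hx]
    have e1 : A * (τ ^ 2 * s ^ 4) ≤ A * ((X.rho a z + τ * s ^ 2) * (X.rho a z + τ * s ^ 2)) := by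
      refine mul_le_mul_of_nonneg_left ?_ hA0
      have h1 : 0 ≤ τ * s ^ 2 := by positivity
      nlinarith
    have e2 : -((C + 1 + Λ) * C) ≤ (β₁ - ε + l (z - z₀)) * X.rho a z := by
      have h1 : |β₁ - ε + l (z - z₀)| ≤ C + 1 + Λ := by
        refine (abs_add_le _ _).trans (add_le_add ?_ hlx)
        refine (abs_sub _ _).trans ?_
        rw [abs_of_pos hε0]
        linarith [hd.abs_beta_le]
      have h2 : |(β₁ - ε + l (z - z₀)) * X.rho a z| ≤ (C + 1 + Λ) * C := by
        rw [abs_mul, abs_of_nonneg hρ]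
        exact mul_le_mul h1 b3 hρ (by positivity)
      exact (abs_le.1 h2).1
    have e3 : 0 ≤ ε * s ^ 2 := by positivity
    linarith [(abs_le.1 b1).1, (abs_le.1 b2).2]
  · -- In the interior the Hessian of the barrier cannot dominate that of `u`.
    intro z hz hzs hρ
    have hzr : dist z z₀ ≤ r := hzs.le.trans hsr
    have hzamb := (X.mem_target.1 hz).1
    have hxs : ‖z - z₀‖ ≤ s := by rw [← dist_eq_norm]; exact hzs.le
    refine ⟨_, fun ξ => hasJet2_barrier (hasJet2_coord hφ hz hρ ξ) (hasJet2_rho X hzamb ξ)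
      (β₁ - ε) l A τ ε, hd.not_hessian_le hΓ hf hc hC hτ hΛ0 hA0 hA1 hCB hε0 hε1 hεε hsub hψ hu hqC
      hlΛ hz hzr (hxs.trans hs1) (hxs.trans hsc) hρ (hp z hz hzr) (hq z hz hzr) ?_⟩
    rw [hl]
    simp only [smul_apply, add_apply, smul_eq_mul]
    field_simp
    ring

end bound

/-! ### Traces on the complex tangent space of the boundary -/

open ComplexManifoldWithBoundary

section trace

variable {m : ℕ} {M : Type*} [TopologicalSpace M] {X : ComplexManifoldWithBoundary (m + 1) M}
  {g : HermitianMetric X} {χ : RealForm11 X} {Γ : Set (Fin (m + 1) → ℝ)}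
  {f : (Fin (m + 1) → ℝ) → ℝ} {ψ φ u usub : M → ℝ}

/-- In tangential directions, the Hessian of a function vanishing on the boundary is proportional
to the Hessian of the defining function. -/
theorem realHessian_mul_fderiv_rho {h : M → ℝ} (hh : X.IsCk 2 h) (h0 : ∀ p ∈ X.boundary, h p = 0)
    {a : Fin X.N} {z N : CSpace (m + 1)} (hz : z ∈ X.coordBoundary a)
    (hN : fderiv ℝ (X.rho a) z N ≠ 0) {v w : CSpace (m + 1)}
    (hv : v ∈ X.boundaryTangent a z) (hw : w ∈ X.boundaryTangent a z) :
    realHessian (X.coord h a) (X.chart a).target z v w * fderiv ℝ (X.rho a) z N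
      = fderivWithin ℝ (X.coord h a) (X.chart a).target z N
        * fderiv ℝ (fderiv ℝ (X.rho a)) z v w := by
  have hsub : X.coordBoundary a ⊆ (X.chart a).target := fun y hy => hy.1
  have hzc : v ∈ tangentConeAt ℝ (X.coordBoundary a) z := by
    rw [X.coordBoundary_eq]
    exact (X.regular a).mem_tangentCone_bdry (X.mem_target.1 hz.1).1 hz.2 hv
  have hzamb := (X.mem_target.1 hz.1).1
  have hDρ : HasFDerivWithinAt (fderiv ℝ (X.rho a)) (fderiv ℝ (fderiv ℝ (X.rho a)) z)
      (X.coordBoundary a) z :=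
    ((((X.regular a).contDiffAt hzamb).fderiv_right (m := 3) (by norm_num)).differentiableAt
      (by simp)).hasFDerivAt.hasFDerivWithinAt
  set H := fderivWithin ℝ (X.coord h a) (X.chart a).target with hH
  have hHd := (hh.differentiableWithinAt_fderivWithin hz.1).mono hsub
  have hHw : ∀ x, HasFDerivWithinAt (fun y => H y x)
      ((fderivWithin ℝ H (X.chart a).target z).flip x) (X.coordBoundary a) z := fun x => by
    refine (hHd.clm_apply (hasFDerivWithinAt_const x z _)).congr_fderiv ?_
    ext; simp [hH]
  have hρw : ∀ x, HasFDerivWithinAt (fun y => fderiv ℝ (X.rho a) y x)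
      ((fderiv ℝ (fderiv ℝ (X.rho a)) z).flip x) (X.coordBoundary a) z := fun x => by
    refine (hDρ.clm_apply (hasFDerivWithinAt_const x z _)).congr_fderiv ?_
    ext; simp
  have h1 := (hHw w).mul (hρw N)
  have h2 := (hHw N).mul (hρw w)
  have hev : (fun y => H y w * fderiv ℝ (X.rho a) y N) =ᶠ[𝓝[X.coordBoundary a] z]
      fun y => H y N * fderiv ℝ (X.rho a) y w := by
    filter_upwards [(hρw N).continuousWithinAt.eventually_ne hN, self_mem_nhdsWithin] with y hy hyb
    rw [hH, fderivWithin_coord_of_boundary hh h0 hyb hy w]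
    field_simp
  have h3 := (h2.congr_of_eventuallyEq hev (hev.self_of_nhdsWithin hz)).unique_on h1 hzc
  have hw' : fderiv ℝ (X.rho a) z w = 0 := hw
  have hHw0 : H z w = 0 := by
    rw [hH, fderivWithin_coord_of_boundary hh h0 hz hN w, hw', mul_zero]
  simp only [add_apply, smul_apply, ContinuousLinearMap.flip_apply, hw', hHw0, smul_eq_mul,
    zero_mul, zero_add, add_zero] at h3
  rw [realHessian]
  linarith

/-- The restrictions to `T^{1,0}_{∂M}` of the forms `𝔤[v₁]` and `𝔤[v₂]` of two functions with the
same boundary values differ by a multiple of the Levi form of the boundary. -/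
theorem gForm_eq_add_rhoLevi {v₁ v₂ : M → ℝ} (h₁ : X.IsCk 2 v₁) (h₂ : X.IsCk 2 v₂)
    (h : ∀ p ∈ X.boundary, v₁ p = v₂ p) {a : Fin X.N} {z N : CSpace (m + 1)}
    (hz : z ∈ X.coordBoundary a) {β : ℝ} (hN : fderiv ℝ (X.rho a) z N ≠ 0)
    (hβ : fderivWithin ℝ (X.coord (fun p => v₁ p - v₂ p) a) (X.chart a).target z N
      = β * fderiv ℝ (X.rho a) z N) {ξ : CSpace (m + 1)} (hξ : ξ ∈ X.holSub a z) :
    (HermitianMetric.gForm χ v₁ a z ξ ξ).re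
      = (HermitianMetric.gForm χ v₂ a z ξ ξ).re + β * (X.rhoLevi a z ξ ξ).re := by
  have hξ' : ξ ∈ (X.holSub a z : Set (CSpace (m + 1))) := hξ
  rw [coe_holSub] at hξ'
  have h0 : ∀ p ∈ X.boundary, v₁ p - v₂ p = 0 := fun p hp => by rw [h p hp, sub_self]
  have e : ∀ v ∈ X.boundaryTangent a z,
      realHessian (X.coord (fun p => v₁ p - v₂ p) a) (X.chart a).target z v v
        = β * fderiv ℝ (fderiv ℝ (X.rho a)) z v v := fun v hv => by
    have := realHessian_mul_fderiv_rho (h₁.sub h₂) h0 hz hN hv hv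
    rw [hβ] at this
    refine mul_right_cancel₀ hN (this.trans ?_)
    ring
  have h3 : X.complexHessian v₁ a z ξ ξ
      = X.complexHessian v₂ a z ξ ξ + X.complexHessian (fun p => v₁ p - v₂ p) a z ξ ξ := by
    rw [complexHessian_sub h₁ h₂ hz.1]; ring
  have h4 : (X.complexHessian (fun p => v₁ p - v₂ p) a z ξ ξ).re
      = β * (X.rhoLevi a z ξ ξ).re := by
    rw [complexHessian, leviPart_self_re, rhoLevi, leviPart_self_re, e _ hξ'.1, e _ hξ'.2]
    ring
  rw [HermitianMetric.gForm, HermitianMetric.gForm, h3, Complex.add_re, Complex.add_re,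
    Complex.add_re, h4]
  ring

theorem weightedTrace_eq_add_rhoLevi {v₁ v₂ : M → ℝ} (h₁ : X.IsCk 2 v₁) (h₂ : X.IsCk 2 v₂)
    (h : ∀ p ∈ X.boundary, v₁ p = v₂ p) {a : Fin X.N} {z N : CSpace (m + 1)}
    (hz : z ∈ X.coordBoundary a) {β : ℝ} (hN : fderiv ℝ (X.rho a) z N ≠ 0)
    (hβ : fderivWithin ℝ (X.coord (fun p => v₁ p - v₂ p) a) (X.chart a).target z N
      = β * fderiv ℝ (X.rho a) z N) (μ : Fin m → ℝ) {e : Fin m → CSpace (m + 1)}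
    (he : ∀ α, e α ∈ X.holSub a z) :
    weightedTrace μ (HermitianMetric.gForm χ v₁ a z) e
      = weightedTrace μ (HermitianMetric.gForm χ v₂ a z) e
        + β * weightedTrace μ (X.rhoLevi a z) e := by
  simp only [weightedTrace, Finset.mul_sum, ← Finset.sum_add_distrib]
  refine Finset.sum_congr rfl fun α _ => ?_
  rw [gForm_eq_add_rhoLevi h₁ h₂ h hz hN hβ (he α)]
  ring

/-- The diagonal entries of `𝔤[u̲]` in a unitary frame lie in the superlevel set of `f`, so that
their weighted traces are bounded below. -/
theorem lt_weightedTrace_subsolution (hΓ : IsSymmetricCone Γ) (hf : IsStructuralFunction Γ f)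
    {θ : ℝ} (hψ : ∀ p, θ ≤ ψ p) (hs : IsAdmissibleSubsolution g χ Γ f ψ φ usub) {a : Fin X.N}
    {z : CSpace (m + 1)} (hz : z ∈ (X.chart a).target) {R ε : ℝ}
    (hε : ∀ l ∈ Γ, (∀ i, |l i| ≤ R) → θ ≤ f l → (fun i => l i - ε) ∈ Γ)
    {e : Fin (m + 1) → CSpace (m + 1)} (he : IsUnitaryFam (sesq (g.comp a z)) e)
    (hR : ∀ i, |(HermitianMetric.gForm χ usub a z (e i) (e i)).re| ≤ R)
    {μ : Fin m → ℝ} (hμ1 : ∑ i, μ i = 1) (hμ : ∀ l ∈ gammaInfty Γ, 0 < ∑ i, μ i * l i) :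
    ε < weightedTrace μ (HermitianMetric.gForm χ usub a z) fun α => e α.castSucc := by
  obtain ⟨hlΓ, hlψ⟩ := hs.inequality_coord hz
  have hG := (g.isPosForm hz).toIsHermForm
  have hL := isHermForm_gForm χ hs.isC2 hz
  have hlam := isEigenTuple_lamG g χ hs.isC2 hz
  have hdΓ := hΓ.isMonoCone.diag_mem (S := ⊤) hG hL (by simp) hlam hlΓ he fun _ => trivial
  have hfd := ((hψ _).trans hlψ).trans
    (hf.le_diag (S := ⊤) hG hL (by simp) hΓ.symmetric hlam hlΓ he fun _ => trivial)
  have h1 := hμ _ (init_mem_gammaInfty (hε _ hdΓ hR hfd))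
  simp only [mul_sub, Finset.sum_sub_distrib] at h1
  rw [← Finset.sum_mul, hμ1, one_mul] at h1
  simp only [weightedTrace]
  linarith

end trace

section frame

variable {n k : ℕ} {G : CSpace n → CSpace n → ℂ}

/-- The coefficients of a unitary family in a unitary basis form a matrix with orthonormal rows. -/
theorem IsUnitaryFam.coeff_sum {S : Submodule ℂ (CSpace n)} (hG : IsHermForm G)
    {e e' : Fin k → CSpace n} (he : IsUnitaryFam G e) (he' : IsUnitaryFam G e')
    (heS : ∀ α, e α ∈ S) (he'S : ∀ α, e' α ∈ S) (hk : Module.finrank ℂ S = k) (α β : Fin k) :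
    ∑ γ, G (e α) (e' γ) * (starRingEnd ℂ) (G (e β) (e' γ)) = if α = β then 1 else 0 := by
  rw [← he α β]
  conv_rhs => rw [he'.expand hG he'S hk (heS α), he'.expand hG he'S hk (heS β)]
  rw [IsUnitaryFam.herm_eq_sum hG]
  refine Finset.sum_congr rfl fun γ _ => ?_
  rw [Finset.sum_eq_single γ]
  · rw [he' γ γ, if_pos rfl, mul_one]
  · intro δ _ hδ
    rw [he' γ δ, if_neg (Ne.symm hδ), mul_zero]
  · simp

theorem norm_le_one_of_row_sum {c : Fin k → Fin k → ℂ}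
    (hc : ∀ α β, ∑ γ, c α γ * (starRingEnd ℂ) (c β γ) = if α = β then 1 else 0) (α β : Fin k) :
    ‖c α β‖ ≤ 1 := by
  have h := congrArg Complex.re (hc α α)
  simp only [Complex.mul_conj, if_true, Complex.one_re, Complex.re_sum, Complex.ofReal_re,
    Complex.normSq_eq_norm_sq] at h
  have h1 := Finset.single_le_sum (f := fun γ => ‖c α γ‖ ^ 2) (fun _ _ => sq_nonneg _)
    (Finset.mem_univ β)
  rw [h] at h1
  exact (sq_le_one_iff₀ (norm_nonneg _)).1 h1

/-- A unitary change of the first vectors of a unitary frame. -/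
theorem IsUnitaryFam.snoc_sum (hG : IsHermForm G) {e : Fin k → CSpace n} {N : CSpace n}
    (he : IsUnitaryFam G (Fin.snoc e N : Fin (k + 1) → CSpace n)) {c : Fin k → Fin k → ℂ}
    (hc : ∀ α β, ∑ γ, c α γ * (starRingEnd ℂ) (c β γ) = if α = β then 1 else 0) :
    IsUnitaryFam G (Fin.snoc (fun α => ∑ β, c α β • e β) N : Fin (k + 1) → CSpace n) := by
  have he0 : IsUnitaryFam G e := fun α β => by
    have := he α.castSucc β.castSucc
    simpa using this
  have hNe : ∀ β, G N (e β) = 0 := fun β => by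
    have := he (Fin.last k) β.castSucc
    simpa [(Fin.castSucc_lt_last β).ne'] using this
  have hNN : G N N = 1 := by
    have := he (Fin.last k) (Fin.last k)
    simpa using this
  refine isUnitaryFam_snoc hG (fun α β => ?_) hNN fun α => ?_
  · rw [IsUnitaryFam.herm_eq_sum hG, ← hc α β]
    refine Finset.sum_congr rfl fun γ _ => ?_
    rw [Finset.sum_eq_single γ]
    · rw [he0 γ γ, if_pos rfl, mul_one]
    · intro δ _ hδ
      rw [he0 γ δ, if_neg (Ne.symm hδ), mul_zero]
    · simp
  · rw [hG.sum_right]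
    exact Finset.sum_eq_zero fun β _ => by rw [hG.smul_right, hNe, mul_zero]

end frame

section taylor

variable {n : ℕ} {ι : Type*} {V : Set (CSpace n)} {q : CSpace n} {P : ι → Prop}
  {z : ι → CSpace n} {T : ι → CSpace n → CSpace n}

theorem UniformTaylor.mul {F G : ι → CSpace n → ℂ} (hF : UniformTaylor V q P z F)
    (hG : UniformTaylor V q P z G) : UniformTaylor V q P z fun i y => F i y * G i y :=
  hF.bilin hG (ContinuousLinearMap.mul ℝ ℂ)

theorem UniformTaylor.csmul {F : ι → CSpace n → ℂ} (hF : UniformTaylor V q P z F)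
    (hT : UniformTaylor V q P z T) : UniformTaylor V q P z fun i y => F i y • T i y :=
  hF.bilin hT (ContinuousLinearMap.lsmul ℝ ℂ)

theorem UniformTaylor.sesq {Θ : CSpace n → Matrix (Fin n) (Fin n) ℂ}
    (hΘ : ∀ j k, UniformTaylor V q P z fun _ y => Θ y j k) (hT : UniformTaylor V q P z T) :
    UniformTaylor V q P z fun i y => (sesq (Θ y) (T i y) (T i y)).re := by
  have hc : ∀ j, UniformTaylor V q P z fun i y => T i y j := fun j =>
    hT.clm ((EuclideanSpace.proj (𝕜 := ℂ) j).restrictScalars ℝ)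
  have hc' : ∀ j, UniformTaylor V q P z fun i y => (starRingEnd ℂ) (T i y j) := fun j =>
    (hc j).clm Complex.conjCLE.toContinuousLinearMap
  exact (UniformTaylor.sum Finset.univ fun j _ => UniformTaylor.sum Finset.univ fun k _ =>
    ((hΘ j k).mul (hc j)).mul (hc' k)).clm Complex.reCLM

theorem UniformTaylor.leviPart {F : ι → CSpace n → CSpace n →L[ℝ] CSpace n →L[ℝ] ℝ}
    (hF : UniformTaylor V q P z F) (hT : UniformTaylor V q P z T) :
    UniformTaylor V q P z fun i y =>
      (leviPart (fun v w => F i y v w) (T i y) (T i y)).re := by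
  have hI : UniformTaylor V q P z fun i y => Complex.I • T i y :=
    (UniformTaylor.const (fun _ => Complex.I) (C := 1) (by simp)).csmul hT
  have h := ((hF.apply hT).apply hT).add ((hF.apply hI).apply hI)
  have h2 := h.clm ((1 / 4 : ℝ) • ContinuousLinearMap.id ℝ ℝ)
  simpa only [leviPart_self_re, smul_apply, ContinuousLinearMap.id_apply, smul_eq_mul] using h2

end taylor

/-! ### The estimate near a boundary point -/

open ComplexManifoldWithBoundary

section expansion

variable {m : ℕ} {M : Type*} [TopologicalSpace M] {X : ComplexManifoldWithBoundary (m + 1) M}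

set_option maxSynthPendingDepth 3 in
theorem norm_fderivWithin_iterate {E : Type*} [NormedAddCommGroup E] [NormedSpace ℝ E] {F : E → ℝ}
    {V : Set E} (hu : UniqueDiffOn ℝ V) {y : E} (hy : y ∈ V) :
    ‖fderivWithin ℝ (fderivWithin ℝ F V) V y‖ = ‖iteratedFDerivWithin ℝ 2 F V y‖ ∧
    ‖fderivWithin ℝ (fderivWithin ℝ (fderivWithin ℝ F V) V) V y‖
      = ‖iteratedFDerivWithin ℝ 3 F V y‖ ∧
    ‖fderivWithin ℝ (fderivWithin ℝ (fderivWithin ℝ (fderivWithin ℝ F V) V) V) V y‖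
      = ‖iteratedFDerivWithin ℝ 4 F V y‖ := by
  refine ⟨?_, ?_, ?_⟩
  · rw [← norm_iteratedFDerivWithin_one _ (hu y hy), norm_iteratedFDerivWithin_fderivWithin hu hy]
  · rw [← norm_iteratedFDerivWithin_one _ (hu y hy), norm_iteratedFDerivWithin_fderivWithin hu hy,
      norm_iteratedFDerivWithin_fderivWithin hu hy]
  · refine (norm_iteratedFDerivWithin_one _ (hu y hy)).symm.trans ?_
    refine (norm_iteratedFDerivWithin_fderivWithin hu hy).trans ?_
    rw [norm_iteratedFDerivWithin_fderivWithin hu hy, norm_iteratedFDerivWithin_fderivWithin hu hy]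

set_option maxSynthPendingDepth 3 in
/-- The Hessians of functions which are bounded in `C⁴` have uniform second order expansions. -/
theorem uniformTaylor_hessian [T2Space M] (K : ℝ) {a : Fin X.N} {q : CSpace (m + 1)}
    (hq : q ∈ X.coordBoundary a) {ι : Type*} {P : ι → Prop} {z : ι → CSpace (m + 1)}
    {φ : ι → M → ℝ} (hz : ∀ i, P i → z i ∈ (X.chart a).target)
    (hφ : ∀ i, P i → X.IsCk 4 (φ i) ∧ X.CkNormLE 4 (φ i) K) :
    UniformTaylor (X.chart a).target q P z fun i =>
      fderivWithin ℝ (fderivWithin ℝ (X.coord (φ i) a) (X.chart a).target) (X.chart a).target := by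
  obtain ⟨C, hC⟩ := exists_bound_of_CkNormLE (X := X) 4 K hq.1
  have hu := X.uniqueDiffOn_target a
  set V := (X.chart a).target with hV
  have hVd : V = IsRegularDomain.dom (X.rho a) (X.ambient a) := X.target_eq_dom a
  have key := UniformTaylor.of_eventually (ι := ι) (P := P) (z := z) (C := C)
    (F := fun i => fderivWithin ℝ (fderivWithin ℝ (X.coord (φ i) a) V) V)
    (F' := fun i => fderivWithin ℝ (fderivWithin ℝ (fderivWithin ℝ (X.coord (φ i) a) V) V) V)
    (F'' := fun i => fderivWithin ℝ
      (fderivWithin ℝ (fderivWithin ℝ (fderivWithin ℝ (X.coord (φ i) a) V) V) V) V)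
    (X.regular a) (X.mem_target.1 hq.1).1 hq.2 (by rw [← hVd]; exact hz) (by
      rw [← hVd]
      filter_upwards [hC, self_mem_nhdsWithin] with y hy hyV i hi
      obtain ⟨hk, hn⟩ := hφ i hi
      have h0 : ContDiffOn ℝ 4 (X.coord (φ i) a) V := hk a
      have h1 := h0.fderivWithin (m := 3) hu (by norm_num)
      have h2 := h1.fderivWithin (m := 2) hu (by norm_num)
      have h3 := h2.fderivWithin (m := 1) hu (by norm_num)
      refine ⟨(h2.differentiableOn (by simp) y hyV).hasFDerivWithinAt,
        (h3.differentiableOn (by simp) y hyV).hasFDerivWithinAt, ?_, ?_, ?_⟩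
      · exact (norm_fderivWithin_iterate hu hyV).1.trans_le (hy _ hk hn 2 (by norm_num))
      · exact (norm_fderivWithin_iterate hu hyV).2.1.trans_le (hy _ hk hn 3 (by norm_num))
      · exact (norm_fderivWithin_iterate hu hyV).2.2.trans_le (hy _ hk hn 4 (by norm_num)))
  rwa [← hVd] at key

theorem UniformTaylor.weightedTrace {ι : Type*} {V : Set (CSpace (m + 1))} {q : CSpace (m + 1)}
    {P : ι → Prop} {z : ι → CSpace (m + 1)} {μ : ι → Fin m → ℝ}
    {Θ : ι → CSpace (m + 1) → CSpace (m + 1) → CSpace (m + 1) → ℂ}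
    {T : ι → Fin m → CSpace (m + 1) → CSpace (m + 1)} (hμ : ∀ i, P i → ∀ α, |μ i α| ≤ 1)
    (h : ∀ α, UniformTaylor V q P z fun i y => (Θ i y (T i α y) (T i α y)).re) :
    UniformTaylor V q P z fun i y => weightedTrace (μ i) (Θ i y) fun α => T i α y :=
  UniformTaylor.sum Finset.univ fun α _ =>
    (UniformTaylor.const (fun i => μ i α) (C := 1) fun i hi => hμ i hi α).bilin (h α)
      (ContinuousLinearMap.mul ℝ ℝ)

/-- Combinations, with bounded coefficients which may depend on the index but not on the point, of
fixed vector fields. -/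
theorem UniformTaylor.combination {ι : Type*} {V : Set (CSpace (m + 1))} {q : CSpace (m + 1)}
    {P : ι → Prop} {z : ι → CSpace (m + 1)} {c : ι → Fin m → ℂ}
    {E : Fin m → CSpace (m + 1) → CSpace (m + 1)} (hc : ∀ i, P i → ∀ β, ‖c i β‖ ≤ 1)
    (hE : ∀ β, UniformTaylor V q P z fun _ => E β) :
    UniformTaylor V q P z fun i y => ∑ β, c i β • E β y := by
  refine UniformTaylor.sum (F := fun β i y => c i β • E β y) Finset.univ fun β _ => ?_
  have h := UniformTaylor.const (V := V) (q := q) (P := P) (z := z) (fun i => c i β) (C := 1)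
    fun i hi => hc i hi β
  exact UniformTaylor.csmul (F := fun i _ => c i β) (T := fun _ => E β) h (hE β)

set_option maxSynthPendingDepth 3 in
/-- Uniform expansions of the traces of `χ + √-1 ∂∂̄φ` and of the Levi form of the boundary on
combinations with constant coefficients of the vector fields `E`. -/
theorem exists_weightedTrace_taylor [T2Space M] (χ : RealForm11 X) (K : ℝ) {a : Fin X.N}
    {q : CSpace (m + 1)} (hq : q ∈ X.coordBoundary a)
    {E : Fin m → CSpace (m + 1) → CSpace (m + 1)}
    (hE : ∀ α, ContDiffWithinAt ℝ 2 (E α) (X.chart a).target q) :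
    ∃ C : ℝ, ∃ r : ℝ, 0 < r ∧ ∀ (φ : M → ℝ) (z : CSpace (m + 1)) (c : Fin m → Fin m → ℂ)
      (μ : Fin m → ℝ),
      X.IsCk 4 φ → X.CkNormLE 4 φ K → z ∈ (X.chart a).target → (∀ α β, ‖c α β‖ ≤ 1) →
      (∀ α, |μ α| ≤ 1) → dist z q < r →
      (∃ p : CSpace (m + 1) →L[ℝ] ℝ, ‖p‖ ≤ C ∧ ∀ y ∈ (X.chart a).target, dist y z ≤ r →
        |weightedTrace μ (HermitianMetric.gForm χ φ a y) (fun α => ∑ β, c α β • E β y)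
          - weightedTrace μ (HermitianMetric.gForm χ φ a z) (fun α => ∑ β, c α β • E β z)
          - p (y - z)| ≤ C * ‖y - z‖ ^ 2) ∧
      (∃ p : CSpace (m + 1) →L[ℝ] ℝ, ‖p‖ ≤ C ∧ ∀ y ∈ (X.chart a).target, dist y z ≤ r →
        |weightedTrace μ (X.rhoLevi a y) (fun α => ∑ β, c α β • E β y)
          - weightedTrace μ (X.rhoLevi a z) (fun α => ∑ β, c α β • E β z)
          - p (y - z)| ≤ C * ‖y - z‖ ^ 2) := by
  set V := (X.chart a).target with hV
  have hVd : V = IsRegularDomain.dom (X.rho a) (X.ambient a) := X.target_eq_dom a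
  let P : (M → ℝ) × CSpace (m + 1) × (Fin m → Fin m → ℂ) × (Fin m → ℝ) → Prop := fun i =>
    X.IsCk 4 i.1 ∧ X.CkNormLE 4 i.1 K ∧ i.2.1 ∈ V ∧ (∀ α β, ‖i.2.2.1 α β‖ ≤ 1) ∧
      ∀ α, |i.2.2.2 α| ≤ 1
  have hzV : ∀ i, P i → i.2.1 ∈ V := fun i hi => hi.2.2.1
  have fixed : ∀ {W : Type} [NormedAddCommGroup W] [NormedSpace ℝ W] {F : CSpace (m + 1) → W},
      ContDiffWithinAt ℝ 2 F V q → UniformTaylor V q P (fun i => i.2.1) fun _ => F := by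
    intro W _ _ F hF
    rw [hVd] at hF hzV ⊢
    exact UniformTaylor.of_contDiffWithinAt (X.regular a) (X.mem_target.1 hq.1).1 hq.2 hzV hF
  have hT : ∀ α, UniformTaylor V q P (fun i => i.2.1) fun i y => ∑ β, i.2.2.1 α β • E β y :=
    fun α => UniformTaylor.combination (fun i hi => hi.2.2.2.1 α) fun β => fixed (hE β)
  have hχ : ∀ j k, UniformTaylor V q P (fun i => i.2.1) fun _ y => χ.comp a y j k := fun j k =>
    fixed ((χ.smooth a j k q hq.1).of_le two_le_infty)
  have hφ := uniformTaylor_hessian (P := P) (z := fun i => i.2.1) (φ := fun i => i.1) K hq hzV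
    fun i hi => ⟨hi.1, hi.2.1⟩
  have hρ : UniformTaylor V q P (fun i => i.2.1) fun _ => fderiv ℝ (fderiv ℝ (X.rho a)) :=
    fixed ((((((X.regular a).contDiffAt (X.mem_target.1 hq.1).1).fderiv_right (m := 3)
      (by norm_num)).fderiv_right (m := 2) (by norm_num))).contDiffWithinAt)
  have h1 := UniformTaylor.weightedTrace (V := V) (q := q) (P := P) (z := fun i => i.2.1)
    (μ := fun i => i.2.2.2) (Θ := fun i y => HermitianMetric.gForm χ i.1 a y)
    (T := fun i α y => ∑ β, i.2.2.1 α β • E β y) (fun i hi => hi.2.2.2.2) fun α => by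
      simp only [HermitianMetric.gForm, Complex.add_re]
      exact (UniformTaylor.sesq hχ (hT α)).add (hφ.leviPart (hT α))
  have h2 := UniformTaylor.weightedTrace (V := V) (q := q) (P := P) (z := fun i => i.2.1)
    (μ := fun i => i.2.2.2) (Θ := fun _ y => X.rhoLevi a y)
    (T := fun i α y => ∑ β, i.2.2.1 α β • E β y) (fun i hi => hi.2.2.2.2) fun α =>
      hρ.leviPart (hT α)
  obtain ⟨C₁, -, r₁, hr₁, -, h1⟩ := h1
  obtain ⟨C₂, -, r₂, hr₂, -, h2⟩ := h2
  refine ⟨max C₁ C₂, min r₁ r₂, lt_min hr₁ hr₂, fun φ z c μ hk hn hz hc hμ hd => ?_⟩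
  obtain ⟨p₁, -, hp₁, e₁⟩ := h1 (φ, z, c, μ) ⟨hk, hn, hz, hc, hμ⟩ (hd.trans_le (min_le_left _ _))
  obtain ⟨p₂, -, hp₂, e₂⟩ := h2 (φ, z, c, μ) ⟨hk, hn, hz, hc, hμ⟩ (hd.trans_le (min_le_right _ _))
  refine ⟨⟨p₁, hp₁.trans (le_max_left _ _), fun y hy hyd => ?_⟩,
    ⟨p₂, hp₂.trans (le_max_right _ _), fun y hy hyd => ?_⟩⟩
  · exact (e₁ y hy (hyd.trans (min_le_left _ _))).trans
      (mul_le_mul_of_nonneg_right (le_max_left _ _) (sq_nonneg _))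
  · exact (e₂ y hy (hyd.trans (min_le_right _ _))).trans
      (mul_le_mul_of_nonneg_right (le_max_right _ _) (sq_nonneg _))

end expansion

open ComplexManifoldWithBoundary

section bounds

variable {m : ℕ} {M : Type*} [TopologicalSpace M] {X : ComplexManifoldWithBoundary (m + 1) M}

/-- The vectors `E α z` and `N z` are the values at `z` of an adapted unitary frame, and `C` bounds
at `z` the data of the manifold and all functions whose `C⁴` or `C²` norm is at most `K`. -/
structure HasFrameBounds (g : HermitianMetric X) (χ : RealForm11 X) (K : ℝ) (a : Fin X.N)
    (E : Fin m → CSpace (m + 1) → CSpace (m + 1)) (N : CSpace (m + 1) → CSpace (m + 1)) (C : ℝ)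
    (z : CSpace (m + 1)) : Prop where
  tangent : ∀ α, E α z ∈ X.holSub a z
  unitary : IsUnitaryFam (sesq (g.comp a z))
    (Fin.snoc (fun α => E α z) (N z) : Fin (m + 1) → CSpace (m + 1))
  le_fderiv : C⁻¹ ≤ fderiv ℝ (X.rho a) z (N z)
  norm_sq_le : ∀ v, (sesq (g.comp a z) v v).re = 1 → ‖v‖ ^ 2 ≤ C
  rho_le : X.rho a z ≤ C
  chi_le : ∀ ξ, |(sesq (χ.comp a z) ξ ξ).re| ≤ C * ‖ξ‖ ^ 2
  fderiv_rho_le : ∀ ξ, |fderiv ℝ (X.rho a) z ξ| ≤ C * ‖ξ‖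
  hess_rho_le : ∀ ξ, |fderiv ℝ (fderiv ℝ (X.rho a)) z ξ ξ| ≤ C * ‖ξ‖ ^ 2
  four_le : ∀ v, X.IsCk 4 v → X.CkNormLE 4 v K → ∀ j ≤ 4,
    ‖iteratedFDerivWithin ℝ j (X.coord v a) (X.chart a).target z‖ ≤ C
  two_le : ∀ v, X.IsCk 2 v → X.CkNormLE 2 v K → ∀ j ≤ 2,
    ‖iteratedFDerivWithin ℝ j (X.coord v a) (X.chart a).target z‖ ≤ C

theorem abs_fderivWithin_le {F : CSpace (m + 1) → ℝ} {V : Set (CSpace (m + 1))}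
    (hV : UniqueDiffOn ℝ V) {z : CSpace (m + 1)} (hz : z ∈ V) {C : ℝ}
    (h : ‖iteratedFDerivWithin ℝ 1 F V z‖ ≤ C) (ξ : CSpace (m + 1)) :
    |fderivWithin ℝ F V z ξ| ≤ C * ‖ξ‖ := by
  rw [norm_iteratedFDerivWithin_one _ (hV z hz)] at h
  exact ((fderivWithin ℝ F V z).le_opNorm ξ).trans (by gcongr)

theorem abs_le_of_norm_iteratedFDerivWithin_zero {F : CSpace (m + 1) → ℝ}
    {V : Set (CSpace (m + 1))} {z : CSpace (m + 1)} {C : ℝ}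
    (h : ‖iteratedFDerivWithin ℝ 0 F V z‖ ≤ C) : |F z| ≤ C := by
  rwa [norm_iteratedFDerivWithin_zero] at h

set_option maxSynthPendingDepth 3 in
theorem eventually_hasFrameBounds [T2Space M] (g : HermitianMetric X) (χ : RealForm11 X) (K : ℝ)
    {a : Fin X.N} {q : CSpace (m + 1)} (hq : q ∈ X.coordBoundary a) :
    ∃ (E : Fin m → CSpace (m + 1) → CSpace (m + 1)) (N : CSpace (m + 1) → CSpace (m + 1)),
      (∀ α, ContDiffWithinAt ℝ 2 (E α) (X.chart a).target q) ∧
      ∃ C : ℝ, 1 ≤ C ∧ |K| ≤ C ∧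
        ∀ᶠ z in 𝓝[(X.chart a).target] q, HasFrameBounds g χ K a E N C z := by
  obtain ⟨E, N, hE, hN, hev⟩ := exists_adapted_frame g hq
  have hqamb := (X.mem_target.1 hq.1).1
  obtain ⟨c₁, hc₁, h₁⟩ := g.eventually_le_riem hq.1
  obtain ⟨C₂, hC₂, h₂⟩ := eventually_norm_sesq_le fun i j =>
    (χ.smooth a i j).continuousOn q hq.1
  obtain ⟨C₃, h₃⟩ := exists_bound_of_CkNormLE (X := X) 4 K hq.1
  obtain ⟨C₄, h₄⟩ := exists_bound_of_CkNormLE (X := X) 2 K hq.1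
  have hD1 : ContinuousAt (fderiv ℝ (X.rho a)) q := (X.regular a).continuousAt_fderiv hqamb
  have hD2 : ContinuousAt (fderiv ℝ (fderiv ℝ (X.rho a))) q :=
    (((((X.regular a).contDiffAt hqamb).fderiv_right (m := 3) (by norm_num)).fderiv_right
      (m := 2) (by norm_num))).continuousAt
  have h₅ : ∀ᶠ z in 𝓝[(X.chart a).target] q,
      ‖fderiv ℝ (X.rho a) z‖ < ‖fderiv ℝ (X.rho a) q‖ + 1 :=
    (hD1.norm.eventually_lt_const (lt_add_one _)).filter_mono nhdsWithin_le_nhds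
  have h₆ : ∀ᶠ z in 𝓝[(X.chart a).target] q,
      ‖fderiv ℝ (fderiv ℝ (X.rho a)) z‖ < ‖fderiv ℝ (fderiv ℝ (X.rho a)) q‖ + 1 :=
    (hD2.norm.eventually_lt_const (lt_add_one _)).filter_mono nhdsWithin_le_nhds
  have h₇ : ∀ᶠ z in 𝓝[(X.chart a).target] q, X.rho a z < 1 := by
    have h := (X.regular a).continuousAt hqamb
    refine (h.eventually_lt_const ?_).filter_mono nhdsWithin_le_nhds
    rw [hq.2]; exact one_pos
  set d := fderiv ℝ (X.rho a) q (N q) with hd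
  have hd0 : 0 < d := (hev.self_of_nhdsWithin hq.1).2.2.2
  have h₈ : ∀ᶠ z in 𝓝[(X.chart a).target] q, d / 2 < fderiv ℝ (X.rho a) z (N z) := by
    have h : ContinuousWithinAt (fun z => fderiv ℝ (X.rho a) z (N z)) (X.chart a).target q :=
      hD1.continuousWithinAt.clm_apply hN.continuousWithinAt
    exact h.eventually_const_lt (half_lt_self hd0)
  set C := 1 + |K| + c₁⁻¹ + C₂ + |C₃| + |C₄| + (‖fderiv ℝ (X.rho a) q‖ + 1)
    + (‖fderiv ℝ (fderiv ℝ (X.rho a)) q‖ + 1) + (d / 2)⁻¹ with hC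
  have p₁ : 0 < c₁⁻¹ := by positivity
  have p₂ : 0 < (d / 2)⁻¹ := by positivity
  have p₃ := abs_nonneg K
  have p₄ := abs_nonneg C₃
  have p₅ := abs_nonneg C₄
  have p₆ := norm_nonneg (fderiv ℝ (X.rho a) q)
  have p₇ := norm_nonneg (fderiv ℝ (fderiv ℝ (X.rho a)) q)
  have p₈ := le_abs_self C₃
  have p₉ := le_abs_self C₄
  refine ⟨E, N, hE, C, by linarith, by linarith, ?_⟩
  filter_upwards [hev, h₁, h₂, h₃, h₄, h₅, h₆, h₇, h₈] with z hz e₁ e₂ e₃ e₄ e₅ e₆ e₇ e₈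
  refine ⟨hz.1, hz.2.1, ?_, fun v hv => ?_, by linarith, fun ξ => ?_, fun ξ => ?_,
    fun ξ => ?_, fun v hv hvK j hj => (e₃ v hv hvK j hj).trans (by linarith),
    fun v hv hvK j hj => (e₄ v hv hvK j hj).trans (by linarith)⟩
  · refine le_trans ?_ e₈.le
    exact inv_le_of_inv_le₀ (by positivity) (by linarith)
  · have h := e₁ v
    rw [HermitianMetric.riem, hv] at h
    have h' : ‖v‖ ^ 2 ≤ c₁⁻¹ := by
      rw [← mul_le_mul_iff_right₀ hc₁, mul_inv_cancel₀ hc₁.ne']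
      exact h
    linarith
  · refine (Complex.abs_re_le_norm _).trans ((e₂ ξ ξ).trans ?_)
    rw [mul_assoc, ← sq]
    exact mul_le_mul_of_nonneg_right (by linarith) (sq_nonneg _)
  · refine ((fderiv ℝ (X.rho a) z).le_opNorm ξ).trans ?_
    exact mul_le_mul_of_nonneg_right (by linarith) (norm_nonneg _)
  · refine ((fderiv ℝ (fderiv ℝ (X.rho a)) z).le_opNorm₂ ξ ξ).trans ?_
    rw [mul_assoc, ← sq]
    exact mul_le_mul_of_nonneg_right (by linarith) (sq_nonneg _)

end bounds

open ComplexManifoldWithBoundary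

section bound

variable {m : ℕ} {M : Type*} [TopologicalSpace M] {X : ComplexManifoldWithBoundary (m + 1) M}
  {g : HermitianMetric X} {χ : RealForm11 X} {Γ : Set (Fin (m + 1) → ℝ)}
  {f : (Fin (m + 1) → ℝ) → ℝ}

theorem fderivWithin_coord_sub {u v : M → ℝ} (hu : X.IsCk 2 u) (hv : X.IsCk 2 v) {a : Fin X.N}
    {z : CSpace (m + 1)} (hz : z ∈ (X.chart a).target) (w : CSpace (m + 1)) :
    fderivWithin ℝ (X.coord (fun p => u p - v p) a) (X.chart a).target z w
      = fderivWithin ℝ (X.coord u a) (X.chart a).target z w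
        - fderivWithin ℝ (X.coord v a) (X.chart a).target z w := by
  have h := ((hu.differentiableWithinAt hz).sub (hv.differentiableWithinAt hz)).fderivWithin
    (X.uniqueDiffOn_target a z hz)
  have h2 : X.coord (fun p => u p - v p) a = X.coord u a - X.coord v a := rfl
  rw [h2, h, sub_apply]

set_option maxHeartbeats 1600000 in
/-- Near a boundary point, `1 - t₀` is bounded below if `A_{t₀}` has left `Γ_∞`. On `T^{1,0}_{∂M}`
one has `A_t = t 𝔤[u̲] + β₀ √-1 ∂∂̄ρ`, where `d(u - u̲) = β₀ dρ`. A weighted trace which is nonpositive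
on `A_{t₀}` is bounded below by a positive constant on `𝔤[u̲]`, so that it is negative on `√-1 ∂∂̄ρ`,
and the barrier built from it gives `ε t₀ ≤ β₀ (1 - t₀)`. -/
theorem exists_local_bound [T2Space M] (hΓ : IsSymmetricCone Γ) (hΓ₁ : IsTypeOne Γ)
    (hf : IsStructuralFunction Γ f) {θ : ℝ} (hθ : supBoundary Γ f < (θ : EReal)) (K : ℝ)
    {a : Fin X.N} {q : CSpace (m + 1)} (hq : q ∈ X.coordBoundary a) :
    ∃ B : ℝ, ∃ r : ℝ, 0 < r ∧ ∀ z ∈ X.coordBoundary a, dist z q < r →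
      ∀ φ ψ u usub : M → ℝ, (∀ p, θ ≤ ψ p) → X.IsCk 4 φ → X.CkNormLE 4 φ K →
      IsAdmissibleSolution g χ Γ f ψ φ u → IsAdmissibleSubsolution g χ Γ f ψ φ usub →
      (∀ p, |u p| ≤ K) → g.BoundaryGradLE u K → X.CkNormLE 2 usub K →
      ∀ t₀ : ℝ, 1 / 2 ≤ t₀ → t₀ < 1 →
        eigenTuple m (sesq (g.comp a z)) (fun x y => HermitianMetric.gForm χ u a z x y
          + ((-(1 - t₀) : ℝ) : ℂ) * HermitianMetric.gForm χ usub a z x y) (X.holTangent a z)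
          ∉ gammaInfty Γ →
        (1 - t₀)⁻¹ ≤ B := by
  obtain ⟨E, N, hE, C₀, hC₀, hKC, hev⟩ := eventually_hasFrameBounds g χ K hq
  obtain ⟨C₁, r₁, hr₁, htay⟩ := exists_weightedTrace_taylor χ K hq hE
  obtain ⟨r₂, hr₂, hball⟩ := Metric.mem_nhdsWithin_iff.1 hev
  obtain ⟨r₃, hr₃, hamb⟩ := Metric.isOpen_iff.1 (X.isOpen_ambient a) q (X.mem_target.1 hq.1).1
  set r := min r₁ (min (r₂ / 2) (r₃ / 2)) with hr
  have hr0 : 0 < r := lt_min hr₁ (lt_min (by positivity) (by positivity))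
  have hrr₁ : r ≤ r₁ := min_le_left _ _
  have hrr₂ : r ≤ r₂ / 2 := (min_le_right _ _).trans (min_le_left _ _)
  have hrr₃ : r ≤ r₃ / 2 := (min_le_right _ _).trans (min_le_right _ _)
  have hC₀0 : 0 < C₀ := by linarith
  obtain ⟨ε₁, hε₁, hsub⟩ := exists_sub_mem_of_le hΓ hθ (2 * C₀ ^ 2)
  -- Both normal derivatives `β₀` and `βₛ` below are bounded by `b`.
  set b := 2 * C₀ ^ 3 with hb
  have hb0 : 0 < b := by positivity
  set C := C₀ + |C₁| + 3 * b with hC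
  have hC₁ := abs_nonneg C₁
  have hCC₀ : C₀ ≤ C := by linarith
  have hCC₁ : C₁ ≤ C := by linarith [le_abs_self C₁]
  obtain ⟨ε, hε, hbar⟩ := exists_fderivWithin_le (X := X) (g := g) (χ := χ) hΓ hf hθ hr0
    (c := ε₁ / (2 * b)) (by positivity) (hC₀.trans hCC₀)
  refine ⟨2 * b / ε, r, hr0, fun z hz hzq φ ψ u usub hψ hφ hφK hu hs huK hgu hsK t₀ ht ht1 hnot =>
    ?_⟩
  have hnear : ∀ y ∈ (X.chart a).target, dist y z ≤ r → HasFrameBounds g χ K a E N C₀ y :=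
    fun y hy hyz => hball ⟨by
      rw [Metric.mem_ball]; linarith [dist_triangle y z q], hy⟩
  have hFz := hnear z hz.1 (by rw [dist_self]; exact hr0.le)
  have hz1 := hz.1
  have hVu := X.uniqueDiffOn_target a
  have hφ2 : X.IsCk 2 φ := fun b => (hφ b).of_le (by norm_num)
  have hG := (g.isPosForm hz1).toIsHermForm
  have hD : 0 < fderiv ℝ (X.rho a) z (N z) := (inv_pos.2 hC₀0).trans_le hFz.le_fderiv
  have hk : Module.finrank ℂ (X.holSub a z) = m := finrank_holSub fun h => by simp [h] at hD
  -- An eigenframe of `A_{t₀}`, and weights which are nonpositive on its eigenvalues.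
  rw [← coe_holSub] at hnot
  obtain ⟨e, heS, heU, heA⟩ := isEigenTuple_eigenTuple (g.isPosForm hz1)
    ((isHermForm_gForm χ hu.isC2 hz1).add
      ((isHermForm_gForm χ hs.isC2 hz1).real_mul (-(1 - t₀)))) hk
  obtain ⟨μ, hμ0, hμ1, hμle, hμpos⟩ := (isMonoCone_gammaInfty hΓ hΓ₁).exists_weights hnot
  have hEU : IsUnitaryFam (sesq (g.comp a z)) fun α => E α z := fun α β => by
    have := hFz.unitary α.castSucc β.castSucc
    simpa using this
  set c : Fin m → Fin m → ℂ := fun α β => sesq (g.comp a z) (e α) (E β z) with hc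
  have hcsum : ∀ α β, ∑ γ, c α γ * (starRingEnd ℂ) (c β γ) = if α = β then 1 else 0 :=
    IsUnitaryFam.coeff_sum hG heU hEU heS hFz.tangent hk
  have hc1 := norm_le_one_of_row_sum hcsum
  have hTz : ∀ α, ∑ β, c α β • E β z = e α := fun α =>
    (IsUnitaryFam.expand hG hEU hFz.tangent hk (heS α)).symm
  have hμabs : ∀ α, |μ α| ≤ 1 := fun α => by
    rw [abs_of_nonneg (hμ0 α), ← hμ1]
    exact Finset.single_le_sum (fun i _ => hμ0 i) (Finset.mem_univ α)
  have hNN : (sesq (g.comp a z) (N z) (N z)).re = 1 := by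
    have := hFz.unitary (Fin.last m) (Fin.last m)
    simp only [Fin.snoc_last, if_true] at this
    rw [this, Complex.one_re]
  have hNn : ‖N z‖ ≤ C₀ := by
    have h1 := hFz.norm_sq_le _ hNN
    nlinarith [norm_nonneg (N z)]
  set D := fderiv ℝ (X.rho a) z (N z) with hDdef
  set Du := fderivWithin ℝ (X.coord u a) (X.chart a).target z (N z) with hDu
  set Ds := fderivWithin ℝ (X.coord usub a) (X.chart a).target z (N z) with hDs
  set Dφ := fderivWithin ℝ (X.coord φ a) (X.chart a).target z (N z) with hDφ
  have hDub : |Du| ≤ C₀ := (hgu a z hz _ hNN).trans ((le_abs_self K).trans hKC)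
  have hDsb : |Ds| ≤ C₀ ^ 2 :=
    (abs_fderivWithin_le hVu hz1 (hFz.two_le _ hs.isC2 hsK 1 (by norm_num)) _).trans (by
      rw [sq]; gcongr)
  have hDφb : |Dφ| ≤ C₀ ^ 2 :=
    (abs_fderivWithin_le hVu hz1 (hFz.four_le _ hφ hφK 1 (by norm_num)) _).trans (by
      rw [sq]; gcongr)
  have hdiv : ∀ x : ℝ, |x| ≤ 2 * C₀ ^ 2 → |x / D| ≤ b := fun x hx => by
    rw [abs_div, abs_of_pos hD, div_le_iff₀ hD]
    have h1 : 1 ≤ C₀ * D := by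
      have := mul_le_mul_of_nonneg_left hFz.le_fderiv hC₀0.le
      rwa [mul_inv_cancel₀ hC₀0.ne'] at this
    calc |x| ≤ 2 * C₀ ^ 2 * 1 := by linarith
      _ ≤ 2 * C₀ ^ 2 * (C₀ * D) := by gcongr
      _ = b * D := by rw [hb]; ring
  -- `d(u - u̲) = β₀ dρ` and `d(u̲ - φ) = βₛ dρ` at `z`.
  set β₀ := (Du - Ds) / D with hβ₀
  set βₛ := (Ds - Dφ) / D with hβₛ
  have hβ₀D : Du - Ds = β₀ * D := (div_mul_cancel₀ _ hD.ne').symm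
  have hβₛD : Ds - Dφ = βₛ * D := (div_mul_cancel₀ _ hD.ne').symm
  have hβ₀b : |β₀| ≤ b := hdiv _ (by
    refine (abs_sub _ _).trans ?_
    nlinarith)
  have hβₛb : |βₛ| ≤ b := hdiv _ (by
    refine (abs_sub _ _).trans ?_
    linarith)
  have hβ₀0 : 0 ≤ β₀ := by
    have := fderivWithin_sub_nonneg hΓ hf hθ hψ hu hs hz hD
    rw [fderivWithin_coord_sub hu.isC2 hs.isC2 hz1] at this
    exact div_nonneg this hD.le
  -- On `T^{1,0}_{∂M}` the three forms differ by multiples of the Levi form of `ρ`.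
  have htr₁ := weightedTrace_eq_add_rhoLevi (χ := χ) hu.isC2 hs.isC2
    (fun p hp => by rw [hu.boundary_value p hp, hs.boundary_value p hp]) hz hD.ne' (β := β₀)
    (by rw [fderivWithin_coord_sub hu.isC2 hs.isC2 hz1]; exact hβ₀D) μ heS
  have htr₂ := weightedTrace_eq_add_rhoLevi (χ := χ) hs.isC2 hφ2 hs.boundary_value hz hD.ne'
    (β := βₛ) (by rw [fderivWithin_coord_sub hs.isC2 hφ2 hz1]; exact hβₛD) μ heS
  set trU := weightedTrace μ (HermitianMetric.gForm χ u a z) e with htrU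
  set trL := weightedTrace μ (HermitianMetric.gForm χ usub a z) e with htrL
  set P₀ := weightedTrace μ (HermitianMetric.gForm χ φ a z) e with hP₀
  set R₀ := weightedTrace μ (X.rhoLevi a z) e with hR₀
  have hA : trU - (1 - t₀) * trL ≤ 0 := by
    refine le_trans (le_of_eq ?_) hμle
    simp only [htrU, htrL, weightedTrace, Finset.mul_sum, ← Finset.sum_sub_distrib]
    refine Finset.sum_congr rfl fun α _ => ?_
    have h1 := congrArg Complex.re (heA α α)
    simp only [if_true, Complex.add_re, Complex.re_ofReal_mul, Complex.ofReal_re] at h1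
    rw [← h1]
    ring
  have hunit := hFz.unitary.snoc_sum hG hcsum
  simp only [hTz] at hunit
  have hL : ε₁ < trL := by
    have h := lt_weightedTrace_subsolution hΓ hf hψ hs hz1 hsub hunit (fun i => ?_) hμ1 hμpos
    · simpa only [Fin.snoc_castSucc] using h
    · have h1 := hFz.norm_sq_le _ (by rw [hunit i i]; simp)
      rw [HermitianMetric.gForm, Complex.add_re]
      have h2 := hFz.chi_le ((Fin.snoc e (N z) : Fin (m + 1) → CSpace (m + 1)) i)
      have h3 := (abs_complexHessian_le usub hz1
        ((Fin.snoc e (N z) : Fin (m + 1) → CSpace (m + 1)) i)).trans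
        (mul_le_mul_of_nonneg_right (hFz.two_le _ hs.isC2 hsK 2 le_rfl) (sq_nonneg _))
      have h4 := mul_le_mul_of_nonneg_left h1 hC₀0.le
      refine (abs_add_le _ _).trans ?_
      nlinarith
  have hβR : t₀ * trL + β₀ * R₀ ≤ 0 := by rw [htr₁] at hA; linarith
  have hR₀c : R₀ ≤ -(ε₁ / (2 * b)) := by
    have h1 : ε₁ / 2 ≤ β₀ * (-R₀) := by nlinarith
    have h2 : 0 ≤ -R₀ := by
      by_contra! h
      nlinarith
    have h3 : β₀ * (-R₀) ≤ b * (-R₀) :=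
      mul_le_mul_of_nonneg_right ((le_abs_self _).trans hβ₀b) h2
    have h4 : ε₁ / (2 * b) ≤ -R₀ := by
      rw [div_le_iff₀ (by positivity)]
      linarith
    linarith
  have ht0 : 0 < t₀ := by linarith
  -- With this choice, `t₀ (P₀ + β₁ R₀)` is the trace of `A_{t₀}`.
  set β₁ := βₛ + β₀ / t₀ with hβ₁
  have hβ₁C : |β₁| ≤ C := by
    have h1 : |β₀ / t₀| ≤ 2 * b := by
      rw [abs_div, abs_of_pos ht0, div_le_iff₀ ht0]
      nlinarith
    have h2 := abs_add_le βₛ (β₀ / t₀)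
    rw [← hβ₁] at h2
    linarith
  have hPR : P₀ + β₁ * R₀ ≤ 0 := by
    have h1 : t₀ * (P₀ + β₁ * R₀) = t₀ * trL + β₀ * R₀ := by
      rw [htr₂, hβ₁]; field_simp; ring
    rw [← h1] at hβR
    by_contra! h
    nlinarith [mul_pos ht0 h]
  obtain ⟨⟨p, hp, hpT⟩, ⟨p', hp', hpT'⟩⟩ := htay φ z c μ hφ hφK hz1 hc1 hμabs (hzq.trans_le hrr₁)
  simp only [hTz] at hpT hpT'
  have hsq : ∀ ξ : CSpace (m + 1), C₀ * ‖ξ‖ ^ 2 ≤ C * ‖ξ‖ ^ 2 := fun ξ =>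
    mul_le_mul_of_nonneg_right hCC₀ (sq_nonneg _)
  have hdata : IsBarrierData g χ Γ φ u a z (fun α y => ∑ β, c α β • E β y) N μ β₁ r
      (ε₁ / (2 * b)) C :=
    { boundary := hz
      ball := fun y hy => hamb (by
        rw [Metric.mem_closedBall] at hy
        rw [Metric.mem_ball]
        linarith [dist_triangle y z q])
      tangent := fun y hy hyz α => Submodule.sum_mem _ fun β _ =>
        Submodule.smul_mem _ _ ((hnear y hy hyz).tangent β)
      unitary := fun y hy hyz =>
        (hnear y hy hyz).unitary.snoc_sum (g.isPosForm hy).toIsHermForm hcsum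
      norm_sq_le := fun y hy hyz v hv => ((hnear y hy hyz).norm_sq_le v hv).trans hCC₀
      abs_le := fun y hy hyz => ⟨(abs_le_of_norm_iteratedFDerivWithin_zero
          ((hnear y hy hyz).four_le φ hφ hφK 0 (by norm_num))).trans hCC₀,
        (huK _).trans ((le_abs_self K).trans (hKC.trans hCC₀)),
        (hnear y hy hyz).rho_le.trans hCC₀⟩
      chi_le := fun y hy hyz ξ => ((hnear y hy hyz).chi_le ξ).trans (hsq ξ)
      hess_le := fun y hy hyz ξ => by
        refine (abs_realHessian_le _ hVu hy ξ ξ).trans ?_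
        rw [mul_assoc, ← sq]
        exact mul_le_mul_of_nonneg_right
          (((hnear y hy hyz).four_le φ hφ hφK 2 (by norm_num)).trans hCC₀) (sq_nonneg _)
      fderiv_rho_le := fun y hy hyz ξ => ((hnear y hy hyz).fderiv_rho_le ξ).trans
        (mul_le_mul_of_nonneg_right hCC₀ (norm_nonneg _))
      hess_rho_le := fun y hy hyz ξ => ((hnear y hy hyz).hess_rho_le ξ).trans (hsq ξ)
      weight_nonneg := hμ0
      weight_sum := hμ1
      weight_pos := hμpos
      taylor := ⟨p, hp.trans hCC₁, fun y hy hyz => by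
        simp only [hTz]
        exact (hpT y hy (hyz.trans hrr₁)).trans (mul_le_mul_of_nonneg_right hCC₁ (sq_nonneg _))⟩
      taylor_rho := ⟨p', hp'.trans hCC₁, fun y hy hyz => by
        simp only [hTz]
        exact (hpT' y hy (hyz.trans hrr₁)).trans (mul_le_mul_of_nonneg_right hCC₁ (sq_nonneg _))⟩
      trace_rho_le := by simp only [hTz]; exact hR₀c
      abs_beta_le := hβ₁C
      trace_le := by simp only [hTz]; exact hPR }
  have hfin := hbar ψ φ u a z _ N μ β₁ hψ hφ2 hu hdata (N z) hD
  have h1 : βₛ + β₀ ≤ β₁ - ε := by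
    refine le_of_mul_le_mul_right ?_ hD
    have h2 : Du ≤ Dφ + (β₁ - ε) * D := hfin
    linarith
  have h2 : ε * t₀ ≤ β₀ * (1 - t₀) := by
    have h3 : ε ≤ β₀ / t₀ - β₀ := by rw [hβ₁] at h1; linarith
    have h4 := mul_le_mul_of_nonneg_right h3 ht0.le
    rw [sub_mul, div_mul_cancel₀ _ ht0.ne'] at h4
    linarith
  have h3 : β₀ * (1 - t₀) ≤ b * (1 - t₀) :=
    mul_le_mul_of_nonneg_right ((le_abs_self _).trans hβ₀b) (by linarith)
  rw [inv_le_comm₀ (by linarith) (by positivity), inv_div, div_le_iff₀ (by positivity)]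
  nlinarith

end bound

/-! ### Eigenvalues on the boundary and compactness -/

open ComplexManifoldWithBoundary

section boundary

variable {m : ℕ} {M : Type*} [TopologicalSpace M] {X : ComplexManifoldWithBoundary (m + 1) M}
  {g : HermitianMetric X} {χ : RealForm11 X} {Γ : Set (Fin (m + 1) → ℝ)}
  {f : (Fin (m + 1) → ℝ) → ℝ} {ψ φ u usub : M → ℝ}

theorem finrank_holSub_of_boundary {a : Fin X.N} {z : CSpace (m + 1)} (hz : z ∈ X.coordBoundary a) :
    Module.finrank ℂ (X.holSub a z) = m :=
  finrank_holSub (X.rho_regular a z (X.mem_target.1 hz.1).1 hz.2)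

theorem eigenTuple_subsolution_mem (hΓ : IsSymmetricCone Γ)
    (hs : IsAdmissibleSubsolution g χ Γ f ψ φ usub) {a : Fin X.N} {z : CSpace (m + 1)}
    (hz : z ∈ X.coordBoundary a) :
    eigenTuple m (sesq (g.comp a z)) (HermitianMetric.gForm χ usub a z)
      (X.holSub a z : Set (CSpace (m + 1))) ∈ gammaInfty Γ := by
  have hG := g.isPosForm hz.1
  have hL := isHermForm_gForm χ hs.isC2 hz.1
  obtain ⟨e, -, heU, heL⟩ := isEigenTuple_eigenTuple hG hL (finrank_holSub_of_boundary hz)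
  obtain ⟨N, -, hN⟩ := exists_unitary_snoc (S := ⊤) hG heU (by simp)
  have h := init_mem_gammaInfty (hΓ.isMonoCone.diag_mem (S := ⊤) hG.toIsHermForm hL (by simp)
    (isEigenTuple_lamG g χ hs.isC2 hz.1) (hs.inequality_coord hz.1).1 hN fun _ => trivial)
  convert h using 2 with α
  have h1 := congrArg Complex.re (heL α α)
  rw [Fin.snoc_castSucc, h1]
  simp

/-- The diagonal entries of `𝔤[v]` in a continuous frame are continuous. -/
theorem continuousWithinAt_gForm (χ : RealForm11 X) {v : M → ℝ} (hv : X.IsCk 2 v) {a : Fin X.N}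
    {z : CSpace (m + 1)} (hz : z ∈ (X.chart a).target) {T : CSpace (m + 1) → CSpace (m + 1)}
    (hT : ContDiffWithinAt ℝ 0 T (X.chart a).target z) :
    ContinuousWithinAt (fun y => (HermitianMetric.gForm χ v a y (T y) (T y)).re)
      (X.chart a).target z := by
  have hTc := hT.continuousWithinAt
  have h1 : ContinuousWithinAt (fun y => (sesq (χ.comp a y) (T y) (T y)).re) (X.chart a).target z :=
    (contDiffWithinAt_re (contDiffWithinAt_sesq
      (fun i j => (χ.smooth a i j z hz).of_le (by simp)) hT hT)).continuousWithinAt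
  have h2 : ContinuousWithinAt (fderivWithin ℝ (fderivWithin ℝ (X.coord v a) (X.chart a).target)
      (X.chart a).target) (X.chart a).target z :=
    ((((hv a).fderivWithin (m := 1) (X.uniqueDiffOn_target a) (by norm_num)).fderivWithin (m := 0)
      (X.uniqueDiffOn_target a) (by norm_num)).continuousOn) z hz
  have hI : ContinuousWithinAt (fun y => Complex.I • T y) (X.chart a).target z :=
    hTc.const_smul Complex.I
  have h3 := ((h2.clm_apply hTc).clm_apply hTc).add ((h2.clm_apply hI).clm_apply hI)
  refine (h1.add (h3.const_mul (1 / 4))).congr (fun y _ => ?_) ?_ <;>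
  simp only [HermitianMetric.gForm, Complex.add_re, complexHessian, leviPart_self_re] <;> rfl

/-- On the boundary, the restriction of `𝔤[u]` to the complex tangent space has eigenvalues in
`Γ_∞`: the limits of interior diagonal entries stay in `Γ`, since they lie in a bounded part of a
superlevel set of `f`. -/
theorem eigenTuple_solution_mem (hΓ : IsSymmetricCone Γ) (hf : IsStructuralFunction Γ f) {θ : ℝ}
    (hθ : supBoundary Γ f < (θ : EReal)) (hψ : ∀ p, θ ≤ ψ p)
    (hu : IsAdmissibleSolution g χ Γ f ψ φ u) {a : Fin X.N} {z : CSpace (m + 1)}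
    (hz : z ∈ X.coordBoundary a) :
    eigenTuple m (sesq (g.comp a z)) (HermitianMetric.gForm χ u a z)
      (X.holSub a z : Set (CSpace (m + 1))) ∈ gammaInfty Γ := by
  have hG := g.isPosForm hz.1
  have hk := finrank_holSub_of_boundary hz
  obtain ⟨e, heS, heU, heL⟩ := isEigenTuple_eigenTuple hG (isHermForm_gForm χ hu.isC2 hz.1) hk
  obtain ⟨E, N, hE, hN, hev⟩ := exists_adapted_frame g hz
  obtain ⟨hEz, hUz, -, hNz⟩ := hev.self_of_nhdsWithin hz.1
  have hEU : IsUnitaryFam (sesq (g.comp a z)) fun α => E α z := fun α β => by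
    have := hUz α.castSucc β.castSucc
    simpa using this
  set c : Fin m → Fin m → ℂ := fun α β => sesq (g.comp a z) (e α) (E β z) with hc
  have hcsum : ∀ α β, ∑ γ, c α γ * (starRingEnd ℂ) (c β γ) = if α = β then 1 else 0 :=
    IsUnitaryFam.coeff_sum hG.toIsHermForm heU hEU heS hEz hk
  have hTz : ∀ α, ∑ β, c α β • E β z = e α := fun α =>
    (IsUnitaryFam.expand hG.toIsHermForm hEU hEz hk (heS α)).symm
  set F : Fin (m + 1) → CSpace (m + 1) → CSpace (m + 1) := fun i y =>
    (Fin.snoc (fun α => ∑ β, c α β • E β y) (N y) : Fin (m + 1) → CSpace (m + 1)) i with hF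
  have hFc : ∀ i, ContDiffWithinAt ℝ 0 (F i) (X.chart a).target z := by
    refine Fin.lastCases ?_ fun α => ?_
    · simpa only [hF, Fin.snoc_last] using hN.of_le (by simp)
    · simp only [hF, Fin.snoc_castSucc]
      exact ContDiffWithinAt.sum fun β _ => contDiffWithinAt_csmul
        contDiffWithinAt_const ((hE β).of_le (by simp))
  set d : CSpace (m + 1) → Fin (m + 1) → ℝ := fun y i =>
    (HermitianMetric.gForm χ u a y (F i y) (F i y)).re with hd
  have hdc : ContinuousWithinAt d (X.chart a).target z :=
    continuousWithinAt_pi.2 fun i => continuousWithinAt_gForm χ hu.isC2 hz.1 (hFc i)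
  set R := ‖d z‖ + 1 with hR
  obtain ⟨ε, hε, hsub⟩ := exists_sub_mem_of_le hΓ hθ R
  have hray : Tendsto (fun t : ℝ => z + t • N z) (𝓝[>] 0) (𝓝[(X.chart a).target] z) := by
    refine tendsto_nhdsWithin_iff.2 ⟨IsRegularDomain.tendsto_ray z (N z), ?_⟩
    filter_upwards [(X.regular a).eventually_ray_pos (X.mem_target.1 hz.1).1 hz.2 hNz] with t ht
    exact X.mem_target.2 ⟨ht.1, ht.2.le⟩
  have hlim : Tendsto (fun t : ℝ => fun i => d (z + t • N z) i - ε) (𝓝[>] 0)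
      (𝓝 fun i => d z i - ε) :=
    tendsto_pi_nhds.2 fun i => ((tendsto_pi_nhds.1 (hdc.tendsto.comp hray)) i).sub_const ε
  have hcl : (fun i => d z i - ε) ∈ closure Γ := by
    refine isClosed_closure.mem_of_tendsto hlim ?_
    have hb : ∀ᶠ y in 𝓝[(X.chart a).target] z, ‖d y‖ < R :=
      hdc.norm.eventually_lt_const (lt_add_one _)
    filter_upwards [(X.regular a).eventually_ray_pos (X.mem_target.1 hz.1).1 hz.2 hNz,
      hray.eventually hev, hray.eventually hb] with t ht hfr hbd
    set y := z + t • N z with hy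
    have hyt : y ∈ (X.chart a).target := X.mem_target.2 ⟨ht.1, ht.2.le⟩
    have hGy := (g.isPosForm hyt).toIsHermForm
    have hUy := isHermForm_gForm χ hu.isC2 hyt
    have hlam := isEigenTuple_lamG g χ hu.isC2 hyt
    obtain ⟨hlΓ, hlψ⟩ := hu.equation_coord hyt ht.2
    have hFu : IsUnitaryFam (sesq (g.comp a y)) fun i => F i y := hfr.2.1.snoc_sum hGy hcsum
    refine subset_closure (hsub (d y) ?_ (fun i => ?_) ?_)
    · exact hΓ.isMonoCone.diag_mem (S := ⊤) hGy hUy (by simp) hlam hlΓ hFu fun _ => trivial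
    · exact (norm_le_pi_norm (d y) i).trans hbd.le
    · exact ((hψ _).trans hlψ.ge).trans
        (hf.le_diag (S := ⊤) hGy hUy (by simp) hΓ.symmetric hlam hlΓ hFu fun _ => trivial)
  have hdz := (hΓ.isMonoCone.mem_closure_iff.1 hcl) ε hε
  simp only [sub_add_cancel] at hdz
  have h := init_mem_gammaInfty hdz
  convert h using 2 with α
  have h1 := congrArg Complex.re (heL α α)
  simp only [hd, hF, Fin.snoc_castSucc, hTz]
  rw [h1]
  simp

theorem isClosed_boundary (X : ComplexManifoldWithBoundary (m + 1) M) : IsClosed X.boundary := by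
  rw [← isOpen_compl_iff, isOpen_iff_mem_nhds]
  intro p hp
  obtain ⟨a, ha⟩ := X.core_cover p
  have hpa := X.core_subset a ha
  have hne : X.rho a (X.chart a p) ≠ 0 := fun h => hp ((X.mem_boundary_iff hpa).2 h)
  have hc : ContinuousAt (fun x => X.rho a (X.chart a x)) p := by
    refine ContinuousAt.comp (f := X.chart a) ?_
      ((X.continuousOn_chart a).continuousAt ((X.isOpen_source a).mem_nhds hpa))
    exact (X.regular a).continuousAt (X.mem_target.1 ((X.chart a).map_source hpa)).1
  filter_upwards [hc.eventually_ne hne, (X.isOpen_source a).mem_nhds hpa] with x hx hxa hxb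
  exact hx ((X.mem_boundary_iff hxa).1 hxb)

/-- The bound of `(1 - t₀)⁻¹` is uniform over the boundary. -/
theorem exists_bound [T2Space M] (hΓ : IsSymmetricCone Γ) (hΓ₁ : IsTypeOne Γ)
    (hf : IsStructuralFunction Γ f) {θ : ℝ} (hθ : supBoundary Γ f < (θ : EReal)) (K : ℝ) :
    ∃ B : ℝ, ∀ p ∈ X.boundary, ∀ φ ψ u usub : M → ℝ, (∀ p, θ ≤ ψ p) → X.IsCk 4 φ →
      X.CkNormLE 4 φ K → IsAdmissibleSolution g χ Γ f ψ φ u →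
      IsAdmissibleSubsolution g χ Γ f ψ φ usub → (∀ p, |u p| ≤ K) → g.BoundaryGradLE u K →
      X.CkNormLE 2 usub K → ∀ a, p ∈ (X.chart a).source →
      ∀ t₀ : ℝ, 1 / 2 ≤ t₀ → t₀ < 1 →
        eigenTuple m (sesq (g.comp a (X.chart a p)))
          (fun x y => HermitianMetric.gForm χ u a (X.chart a p) x y
            + ((-(1 - t₀) : ℝ) : ℂ) * HermitianMetric.gForm χ usub a (X.chart a p) x y)
          (X.holTangent a (X.chart a p)) ∉ gammaInfty Γ →
        (1 - t₀)⁻¹ ≤ B := by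
  have := X.compactSpace
  refine (isClosed_boundary X).isCompact.induction_on
    (p := fun s => ∃ B : ℝ, ∀ p ∈ s, ∀ φ ψ u usub : M → ℝ, (∀ p, θ ≤ ψ p) → X.IsCk 4 φ →
      X.CkNormLE 4 φ K → IsAdmissibleSolution g χ Γ f ψ φ u →
      IsAdmissibleSubsolution g χ Γ f ψ φ usub → (∀ p, |u p| ≤ K) → g.BoundaryGradLE u K →
      X.CkNormLE 2 usub K → ∀ a, p ∈ (X.chart a).source →
      ∀ t₀ : ℝ, 1 / 2 ≤ t₀ → t₀ < 1 →
        eigenTuple m (sesq (g.comp a (X.chart a p)))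
          (fun x y => HermitianMetric.gForm χ u a (X.chart a p) x y
            + ((-(1 - t₀) : ℝ) : ℂ) * HermitianMetric.gForm χ usub a (X.chart a p) x y)
          (X.holTangent a (X.chart a p)) ∉ gammaInfty Γ →
        (1 - t₀)⁻¹ ≤ B) ⟨0, by simp⟩ ?_ ?_ ?_
  · rintro s t hst ⟨B, hB⟩
    exact ⟨B, fun p hp => hB p (hst hp)⟩
  · rintro s t ⟨B, hB⟩ ⟨B', hB'⟩
    refine ⟨max B B', fun p hp φ ψ u usub h1 h2 h3 h4 h5 h6 h7 h8 a ha t₀ ht ht1 hn => ?_⟩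
    rcases hp with hp | hp
    · exact (hB p hp φ ψ u usub h1 h2 h3 h4 h5 h6 h7 h8 a ha t₀ ht ht1 hn).trans (le_max_left _ _)
    · exact (hB' p hp φ ψ u usub h1 h2 h3 h4 h5 h6 h7 h8 a ha t₀ ht ht1 hn).trans
        (le_max_right _ _)
  · intro p hp
    obtain ⟨b, hb⟩ := X.core_cover p
    have hpb := X.core_subset b hb
    have hq : X.chart b p ∈ X.coordBoundary b :=
      ⟨(X.chart b).map_source hpb, (X.mem_boundary_iff hpb).1 hp⟩
    obtain ⟨B, r, hr, hB⟩ := exists_local_bound (g := g) (χ := χ) hΓ hΓ₁ hf hθ K hq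
    refine ⟨X.boundary ∩ {x | x ∈ (X.chart b).source ∧ dist (X.chart b x) (X.chart b p) < r},
      inter_mem self_mem_nhdsWithin (mem_nhdsWithin_of_mem_nhds ?_), B, ?_⟩
    · have hc := (X.continuousOn_chart b).continuousAt ((X.isOpen_source b).mem_nhds hpb)
      exact inter_mem ((X.isOpen_source b).mem_nhds hpb)
        (hc.preimage_mem_nhds (Metric.ball_mem_nhds _ hr))
    · rintro x ⟨hxb, hxs, hxr⟩ φ ψ u usub h1 h2 h3 h4 h5 h6 h7 h8 a ha t₀ ht ht1 hn
      refine hB (X.chart b x) ⟨(X.chart b).map_source hxs, (X.mem_boundary_iff hxs).1 hxb⟩ hxr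
        φ ψ u usub h1 h2 h3 h4 h5 h6 h7 h8 t₀ ht ht1 ?_
      rwa [eigenTuple_transition g χ h4.isC2 h5.isC2 (X.chart_mem_overlap ha hxs)
        ((X.mem_boundary_iff ha).1 hxb), X.transition_chart ha] at hn

end boundary

end

theorem lemma3p1 {m : ℕ} (hm : 1 ≤ m) {M : Type*} [TopologicalSpace M] [T2Space M]
    (X : ComplexManifoldWithBoundary (m + 1) M) (g : HermitianMetric X) (χ : RealForm11 X)
    (Γ : Set (Fin (m + 1) → ℝ)) (f : (Fin (m + 1) → ℝ) → ℝ)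
    (hΓ : IsSymmetricCone Γ) (hΓ₁ : IsTypeOne Γ) (hf : IsStructuralFunction Γ f) (K : ℝ) :
    ∃ C : ℝ, 0 < C ∧ ∀ φ ψ u usub : M → ℝ,
      X.IsCk 4 φ → X.CkNormLE 4 φ K →
      Continuous ψ → (∀ p, |ψ p| ≤ K) →
      0 < nondegeneracy Γ f ψ → (nondegeneracy Γ f ψ)⁻¹ ≤ (K : EReal) →
      IsAdmissibleSolution g χ Γ f ψ φ u →
      IsAdmissibleSubsolution g χ Γ f ψ φ usub →
      (∀ p, |u p| ≤ K) → g.BoundaryGradLE u K → X.CkNormLE 2 usub K →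
      ∀ p₀ ∈ X.boundary, ∀ a, p₀ ∈ (X.chart a).source →
      ∀ ν, g.IsUnitInnerNormal a (X.chart a p₀) ν →
      ∀ η : ℝ, η = fderivWithin ℝ (X.coord (fun p => u p - usub p) a) (X.chart a).target
          (X.chart a p₀) ν →
        ∃ t₀ : ℝ, IsFirstHit g χ Γ usub η a (X.chart a p₀) t₀ ∧ t₀ < 1 ∧
          (1 - t₀)⁻¹ ≤ C := by
  by_cases hex : X.boundary.Nonempty ∧ ∃ ψ : M → ℝ, 0 < nondegeneracy Γ f ψ
  swap
  · exact ⟨1, one_pos, fun φ ψ _ _ _ _ _ _ hψ _ _ _ _ _ _ p₀ hp₀ =>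
      absurd ⟨⟨p₀, hp₀⟩, ψ, hψ⟩ hex⟩
  obtain ⟨⟨p, hp⟩, hψex⟩ := hex
  have : Nonempty M := ⟨p⟩
  -- `θ` is a common lower bound, above `sup_{∂Γ} f`, of all right-hand sides `ψ`.
  obtain ⟨θ, hθ, hθψ⟩ := exists_threshold hψex K
  obtain ⟨B, hB⟩ := exists_bound (X := X) (g := g) (χ := χ) hΓ hΓ₁ hf hθ K
  refine ⟨max B 2, lt_max_of_lt_right two_pos, fun φ ψ u usub hφ hφK _ hψK hδ hδK hu hs huK hgu hsK
    p₀ hp₀ a ha ν hν η hη => ?_⟩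
  have hψθ := hθψ ψ hψK hδ hδK
  have hz : X.chart a p₀ ∈ X.coordBoundary a :=
    ⟨(X.chart a).map_source ha, (X.mem_boundary_iff ha).1 hp₀⟩
  obtain ⟨t₀, hgr, ht1, hn⟩ := exists_first_hit (isMonoCone_gammaInfty hΓ hΓ₁) (g.isPosForm hz.1)
    (isHermForm_gForm χ hu.isC2 hz.1) (isHermForm_gForm χ hs.isC2 hz.1)
    (finrank_holSub_of_boundary hz) (eigenTuple_solution_mem hΓ hf hθ hψθ hu hz)
    (eigenTuple_subsolution_mem hΓ hs hz)
  rw [X.coe_holSub] at hn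
  refine ⟨t₀, ?_, ht1, ?_⟩
  · have hset : {t : ℝ | t ≤ 1 ∧ g.lamA χ usub η t a (X.chart a p₀) ∈ frontier (gammaInfty Γ)}
        = {t : ℝ | t ≤ 1 ∧ eigenTuple m (sesq (g.comp a (X.chart a p₀)))
          (fun x y => HermitianMetric.gForm χ u a (X.chart a p₀) x y
            + ((-(1 - t) : ℝ) : ℂ) * HermitianMetric.gForm χ usub a (X.chart a p₀) x y)
          (X.holSub a (X.chart a p₀) : Set (CSpace (m + 1))) ∈ frontier (gammaInfty Γ)} := by
      ext t
      rw [mem_ofPred_eq, mem_ofPred_eq, hη, lamA_eq g χ hu.isC2 hs.isC2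
        (fun p hp => by rw [hu.boundary_value p hp, hs.boundary_value p hp]) hz hν t, X.coe_holSub]
    rw [IsFirstHit, hset]
    exact hgr
  · rcases le_or_gt (1 / 2) t₀ with ht | ht
    · exact (hB p₀ hp₀ φ ψ u usub hψθ hφ hφK hu hs huK hgu hsK a ha t₀ ht ht1 hn).trans
        (le_max_left _ _)
    · refine le_trans ?_ (le_max_right _ _)
      rw [inv_le_comm₀ (by linarith) two_pos]
      linarith
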